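/- Let $k$ be an algebraically closed field of characteristic $0$, let $S$ be a smooth curve over $k$ (a smooth separated integral $k$-scheme of finite type of dimension one), let $W$ be a variety over $k$ (integral, separated, of finite type), and let $f\colon W\to S$ be a smooth dominant morphism. Let $T^\vee(W/S)=T^\vee(W)/f^{-1}T^\vee(S)$ be the total space of the relative cotangent bundle; its scheme-theoretic fiber over $s\in S(k)$ is the cotangent bundle $T^\vee(W_s)$ of the fiber $W_s=f^{-1}(s)$. For a reduced closed subscheme $X\subset W$ let $\mathrm{Sm}(X)$ be the locus where $X$ is smooth over $k$, and put $$\mathrm{Sm}(X/S)=\{x\in \mathrm{Sm}(X) \mid f|_X\colon X\to S \text{ is smooth at } x\},\qquad \mathrm{Sing}(X/S)=X\setminus \mathrm{Sm}(X/S).$$ The relative conormal variety of $X$ is the closure $$\Lambda_{X/S}=\overline{\{(x,\xi)\in T^\vee(W/S)\mid x\in \mathrm{Sm}(X/S),\ \xi\perp T_xX_{f(x)}\}}\subset T^\vee(W/S)$$ with its reduced structure, where $X_t = f^{-1}(t)\cap X$. Its specialization $\mathrm{sp}_s(\Lambda_{X/S})$ at $s\in S(k)$ is the cycle on $T^\vee(W_s)$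 underlying the scheme-theoretic fiber of $\Lambda_{X/S}\to S$ over $s$: the sum of the irreducible components of that fiber, each with the length of the local ring of the fiber at its generic point as coefficient. For a reduced closed subscheme $Y\subset W_s$ let $$\Lambda_Y=\overline{\{(x,\xi)\in T^\vee(W_s)\mid x\in \mathrm{Sm}(Y),\ \xi\perp T_xY\}}\subset T^\vee(W_s),$$ regarded as a reduced cycle (every irreducible component has coefficient $1$). Let $X\subset W$ be a reduced divisor, i.e. a reduced closed subscheme all of whose irreducible components have codimension $1$ in $W$, and suppose that $X$ is flat over $S$. Let $s\in S(k)$ and let $Z$ be an irreducible component of $\mathrm{Sing}(X/S)$ that is contained in the fiber $f^{-1}(s)$. Then $$\mathrm{sp}_s(\Lambda_{X/S})-\Lambda_{X_s}\ \geq\ \Lambda_Z ,$$ where $X_s$ is taken with its reduced structure in the term $\Lambda_{X_s}$, and where the inequality of cycles on $T^\vee(W_s)$ means that the difference of the two sides is effective or zero. -/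

import Mathlib

universe u

noncomputable section

namespace LagrangianSpecialization

open TensorProduct


section Derivations

variable (A A' B B' : Type u) [CommRing A] [CommRing A'] [CommRing B] [CommRing B']
  [Algebra A B] [Algebra A' B'] [Algebra A A'] [Algebra B B'] [Algebra A B']
  [IsScalarTower A B B'] [IsScalarTower A A' B']

lemma kaehler_isBaseChange [Algebra.FormallyUnramified A A'] [Algebra.FormallyEtale B B'] :
    IsBaseChange B' (KaehlerDifferential.map A A' B B') := by
  have h1 : IsBaseChange B' (KaehlerDifferential.map A A B B') :=
    KaehlerDifferential.isBaseChange_of_formallyEtale A B B'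
  have hbij : Function.Bijective (KaehlerDifferential.map A A' B' B') := by
    refine ⟨?_, KaehlerDifferential.map_surjective A A' B'⟩
    rw [injective_iff_map_eq_zero]
    intro x hx
    obtain ⟨y, rfl⟩ := (KaehlerDifferential.exact_mapBaseChange_map A A' B' x).mp hx
    rw [Subsingleton.elim y 0, map_zero]
  have h2 := h1.comp (IsBaseChange.ofEquiv (LinearEquiv.ofBijective _ hbij))
  convert! h2
  refine Derivation.liftKaehlerDifferential_unique _ _ ?_
  ext b
  simp

variable {A A' B B'} in
lemma derivation_ext_of_formallyEtale [Algebra.FormallyUnramified A A'] [Algebra.FormallyEtale B B']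
    {D E : Derivation A' B' B'} (h : ∀ b : B, D (algebraMap B B' b) = E (algebraMap B B' b)) :
    D = E := by
  have key : D.liftKaehlerDifferential = E.liftKaehlerDifferential := by
    refine (kaehler_isBaseChange A A' B B').algHom_ext _ _ fun x ↦ ?_
    have : ((D.liftKaehlerDifferential.restrictScalars B).comp
        (KaehlerDifferential.map A A' B B')) =
        ((E.liftKaehlerDifferential.restrictScalars B).comp
        (KaehlerDifferential.map A A' B B')) := by
      refine Derivation.liftKaehlerDifferential_unique _ _ ?_
      ext b
      simpa using h b
    exact congr($this x)
  rw [← D.liftKaehlerDifferential_comp, key, E.liftKaehlerDifferential_comp]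

/-- The extension of an `A`-derivation of `B` to an `A'`-derivation of `B'`, where `B'` is étale over
`B` and `A'` is unramified over `A`; it is characterized by `extendDerivation_algebraMap`. -/
def extendDerivation [Algebra.FormallyUnramified A A'] [Algebra.FormallyEtale B B'] :
    Derivation A B B →ₗ[B] Derivation A' B' B' :=
  ((KaehlerDifferential.linearMapEquivDerivation A' B' (M := B')).toLinearMap.restrictScalars B).comp
    (((kaehler_isBaseChange A A' B B').toDual).comp
      (KaehlerDifferential.linearMapEquivDerivation A B (M := B)).symm.toLinearMap)

lemma extendDerivation_algebraMap [Algebra.FormallyUnramified A A'] [Algebra.FormallyEtale B B']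
    (D : Derivation A B B) (b : B) :
    extendDerivation A A' B B' D (algebraMap B B' b) = algebraMap B B' (D b) := by
  have := (kaehler_isBaseChange A A' B B').toDual_comp_apply
    D.liftKaehlerDifferential (KaehlerDifferential.D A B b)
  simpa [extendDerivation] using this

lemma extendDerivation_isBaseChange [Algebra.FormallyUnramified A A'] [Algebra.FormallyEtale B B']
    [Module.Flat B B'] [Module.FinitePresentation B Ω[B⁄A]] :
    IsBaseChange B' (extendDerivation A A' B B') := by
  have h := Module.FinitePresentation.isBaseChange_map B Ω[B⁄A] B B'
  have hb := kaehler_isBaseChange A A' B B'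
  refine (IsBaseChange.iff_of_equiv_comm (KaehlerDifferential.linearMapEquivDerivation A B (M := B))
    ((LinearEquiv.arrowCongr hb.equiv (TensorProduct.AlgebraTensorModule.rid B B' B')).trans
      (KaehlerDifferential.linearMapEquivDerivation A' B' (M := B'))) ?_).mp h
  ext φ : 1
  refine derivation_ext_of_formallyEtale (A := A) (B := B) fun b ↦ ?_
  simp only [LinearMap.comp_apply, LinearEquiv.coe_coe]
  rw [extendDerivation_algebraMap]
  have h1 : hb.equiv.symm (KaehlerDifferential.D A' B' (algebraMap B B' b)) =
      1 ⊗ₜ KaehlerDifferential.D A B b := by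
    rw [← KaehlerDifferential.map_D A A' B B', hb.equiv_symm_apply]
  simp [LinearEquiv.arrowCongr_apply, h1, Algebra.smul_def]

end Derivations

section SymmetricAlgebra

variable {B : Type u} (B' : Type u) [CommRing B] [CommRing B'] [Algebra B B']
  {M M' : Type u} [AddCommGroup M] [Module B M] [AddCommGroup M'] [Module B M'] [Module B' M']
  [IsScalarTower B B' M']

/-- The homomorphism of symmetric algebras induced by a semilinear map of modules. -/
def symMap (φ : M →ₗ[B] M') : SymmetricAlgebra B M →+* SymmetricAlgebra B' M' :=
  (SymmetricAlgebra.lift (((SymmetricAlgebra.ι B' M').restrictScalars B).comp φ)).toRingHom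

@[simp]
lemma symMap_ι (φ : M →ₗ[B] M') (m : M) :
    symMap B' φ (SymmetricAlgebra.ι B M m) = SymmetricAlgebra.ι B' M' (φ m) := by
  simp [symMap]

@[simp]
lemma symMap_algebraMap (φ : M →ₗ[B] M') (b : B) :
    symMap B' φ (algebraMap B _ b) = algebraMap B' _ (algebraMap B B' b) := by
  simp [symMap, ← IsScalarTower.algebraMap_apply]

lemma symmetricAlgebra_hom_ext {R : Type*} [CommRing R] {g h : SymmetricAlgebra B M →+* R}
    (h1 : ∀ b, g (algebraMap B _ b) = h (algebraMap B _ b))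
    (h2 : ∀ m, g (SymmetricAlgebra.ι B M m) = h (SymmetricAlgebra.ι B M m)) : g = h := by
  refine RingHom.ext fun (x : SymmetricAlgebra B M) ↦ ?_
  induction x using SymmetricAlgebra.induction with
  | algebraMap r => exact h1 r
  | ι x => exact h2 x
  | mul a b ha hb => rw [map_mul, map_mul, ha, hb]
  | add a b ha hb => rw [map_add, map_add, ha, hb]

lemma symMap_exists_unique {φ : M →ₗ[B] M'} (hφ : IsBaseChange B' φ) {R : Type u} [CommRing R]
    (g : B' →+* R) (h : SymmetricAlgebra B M →+* R)
    (hgh : ∀ b, g (algebraMap B B' b) = h (algebraMap B _ b)) :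
    ∃ l : SymmetricAlgebra B' M' →+* R, l.comp (algebraMap B' _) = g ∧ l.comp (symMap B' φ) = h := by
  let : Algebra B' R := g.toAlgebra
  let : Algebra B R := (g.comp (algebraMap B B')).toAlgebra
  have : IsScalarTower B B' R := .of_algebraMap_eq fun _ ↦ rfl
  let h' : SymmetricAlgebra B M →ₐ[B] R := { h with commutes' := fun b ↦ (hgh b).symm }
  let m : M' →ₗ[B'] R := hφ.lift (h'.toLinearMap.comp (SymmetricAlgebra.ι B M))
  refine ⟨(SymmetricAlgebra.lift m).toRingHom, ?_, ?_⟩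
  · ext b
    exact (SymmetricAlgebra.lift m).commutes b
  · refine symmetricAlgebra_hom_ext ?_ ?_
    · intro b
      simp only [AlgHom.toRingHom_eq_coe, RingHom.comp_apply, symMap_algebraMap, RingHom.coe_coe,
        AlgHom.commutes]
      exact hgh b
    · intro x
      simp only [AlgHom.toRingHom_eq_coe, RingHom.comp_apply, symMap_ι, RingHom.coe_coe,
        SymmetricAlgebra.lift_ι_apply]
      exact hφ.lift_eq _ x

open CategoryTheory in
lemma symMap_isPushout {φ : M →ₗ[B] M'} (hφ : IsBaseChange B' φ) :
    IsPushout (CommRingCat.ofHom (algebraMap B B'))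
      (CommRingCat.ofHom (algebraMap B (SymmetricAlgebra B M)))
      (CommRingCat.ofHom (algebraMap B' (SymmetricAlgebra B' M')))
      (CommRingCat.ofHom (symMap B' φ)) := by
  have hex (s : Limits.PushoutCocone (CommRingCat.ofHom (algebraMap B B'))
      (CommRingCat.ofHom (algebraMap B (SymmetricAlgebra B M)))) :=
    symMap_exists_unique B' hφ s.inl.hom s.inr.hom fun b ↦ congr($(s.condition).hom b)
  refine ⟨⟨?_⟩, ⟨Limits.PushoutCocone.IsColimit.mk _
    (fun s ↦ CommRingCat.ofHom (hex s).choose) (fun s ↦ ?_) (fun s ↦ ?_) (fun s m h1 h2 ↦ ?_)⟩⟩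
  · ext b
    simp
  · ext b
    exact congr($((hex s).choose_spec.1) b)
  · ext b
    exact congr($((hex s).choose_spec.2) b)
  · have h1' (b : B') : m.hom (algebraMap B' _ b) = s.inl.hom b := congr($(h1).hom b)
    have h2' (b) : m.hom (symMap B' φ b) = s.inr.hom b := congr($(h2).hom b)
    have h3 (b : B') : (hex s).choose (algebraMap B' _ b) = s.inl.hom b :=
      congr($((hex s).choose_spec.1) b)
    have h4 (b) : (hex s).choose (symMap B' φ b) = s.inr.hom b :=
      congr($((hex s).choose_spec.2) b)
    refine CommRingCat.hom_ext (symmetricAlgebra_hom_ext (fun b ↦ ?_) (fun x ↦ ?_))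
    · exact (h1' b).trans (h3 b).symm
    · induction x using hφ.inductionOn with
      | zero => simp
      | tmul x =>
        have := (h2' (SymmetricAlgebra.ι B M x)).trans (h4 (SymmetricAlgebra.ι B M x)).symm
        simpa using this
      | smul b x hx =>
        rw [map_smul, Algebra.smul_def, map_mul, map_mul, hx, h1']
        exact congr($((h3 b).symm) * _)
      | add x y hx hy => rw [map_add, map_add, map_add, hx, hy]

end SymmetricAlgebra

open CategoryTheory Limits AlgebraicGeometry TopologicalSpace

section CotangentBundle

variable {W S : Scheme.{u}} {f : W ⟶ S}

/-- A chart of `f : W ⟶ S`: an affine open of `W` mapping into an affine open of `S`. -/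
structure Chart (f : W ⟶ S) where
  /-- The affine open of the base. -/
  base : S.affineOpens
  /-- The affine open of the total space. -/
  total : W.affineOpens
  le : total.1 ≤ f ⁻¹ᵁ base.1

namespace Chart

/-- The coordinate ring of the base of a chart. -/
def A (c : Chart f) : Type u := Γ(S, c.base.1)

/-- The coordinate ring of the total space of a chart. -/
def B (c : Chart f) : Type u := Γ(W, c.total.1)

instance (c : Chart f) : CommRing c.A := inferInstanceAs (CommRing Γ(S, c.base.1))

instance (c : Chart f) : CommRing c.B := inferInstanceAs (CommRing Γ(W, c.total.1))

instance (c : Chart f) : Algebra c.A c.B := (f.appLE c.base.1 c.total.1 c.le).hom.toAlgebra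

instance : Preorder (Chart f) where
  le c d := c.base.1 ≤ d.base.1 ∧ c.total.1 ≤ d.total.1
  le_refl c := ⟨le_rfl, le_rfl⟩
  le_trans _ _ _ h h' := ⟨h.1.trans h'.1, h.2.trans h'.2⟩

/-- Restriction of functions on the base. -/
def resA {c d : Chart f} (h : c ≤ d) : d.A →+* c.A := (S.presheaf.map (homOfLE h.1).op).hom

/-- Restriction of functions on the total space. -/
def resB {c d : Chart f} (h : c ≤ d) : d.B →+* c.B := (W.presheaf.map (homOfLE h.2).op).hom

lemma resB_comp {c d : Chart f} (h : c ≤ d) :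
    (resB h).comp (algebraMap d.A d.B) = (algebraMap c.A c.B).comp (resA h) := by
  change (f.appLE _ _ _ ≫ W.presheaf.map _).hom = (S.presheaf.map _ ≫ f.appLE _ _ _).hom
  rw [Scheme.Hom.appLE_map, Scheme.Hom.map_appLE]

lemma etale_resA {c d : Chart f} (h : c ≤ d) : (resA h).Etale := by
  have := Scheme.Hom.etale_appLE (𝟙 S) d.base.2 c.base.2 h.1
  simpa [Scheme.Hom.appLE] using! this

lemma etale_resB {c d : Chart f} (h : c ≤ d) : (resB h).Etale := by
  have := Scheme.Hom.etale_appLE (𝟙 W) d.total.2 c.total.2 h.2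
  simpa [Scheme.Hom.appLE] using! this

/-- The relative vector fields on a chart: sections of the relative tangent sheaf. -/
abbrev Der (c : Chart f) : Type u := Derivation c.A c.B c.B

/-- The functions on the relative cotangent bundle over a chart: the symmetric algebra on the
relative vector fields, which are the fiberwise linear functions. -/
abbrev Sym (c : Chart f) : Type u := SymmetricAlgebra c.B c.Der

/-- Restriction of functions on the relative cotangent bundle; see `resSym_algebraMap` and
`resSym_ι`. -/
def resSym {c d : Chart f} (h : c ≤ d) : d.Sym →+* c.Sym :=
  letI : Algebra d.A c.A := (resA h).toAlgebra
  letI : Algebra d.B c.B := (resB h).toAlgebra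
  letI : Algebra d.A c.B := ((resB h).comp (algebraMap d.A d.B)).toAlgebra
  haveI : IsScalarTower d.A d.B c.B := .of_algebraMap_eq fun _ ↦ rfl
  haveI : IsScalarTower d.A c.A c.B := .of_algebraMap_eq fun x ↦ congr($(resB_comp h) x)
  haveI : Algebra.Etale d.A c.A := etale_resA h
  haveI : Algebra.Etale d.B c.B := etale_resB h
  symMap c.B (extendDerivation d.A c.A d.B c.B)

lemma resSym_algebraMap {c d : Chart f} (h : c ≤ d) (b : d.B) :
    resSym h (algebraMap d.B d.Sym b) = algebraMap c.B c.Sym (resB h b) := by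
  let : Algebra d.B c.B := (resB h).toAlgebra
  exact symMap_algebraMap ..

lemma resSym_ι {c d : Chart f} (h : c ≤ d) (D : d.Der) (E : c.Der)
    (hDE : ∀ b, E (resB h b) = resB h (D b)) :
    resSym h (SymmetricAlgebra.ι d.B d.Der D) = SymmetricAlgebra.ι c.B c.Der E := by
  let : Algebra d.A c.A := (resA h).toAlgebra
  let : Algebra d.B c.B := (resB h).toAlgebra
  let : Algebra d.A c.B := ((resB h).comp (algebraMap d.A d.B)).toAlgebra
  have : IsScalarTower d.A d.B c.B := .of_algebraMap_eq fun _ ↦ rfl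
  have : IsScalarTower d.A c.A c.B := .of_algebraMap_eq fun x ↦ congr($(resB_comp h) x)
  have : Algebra.Etale d.A c.A := etale_resA h
  have : Algebra.Etale d.B c.B := etale_resB h
  refine (symMap_ι ..).trans (congrArg _ ?_)
  refine derivation_ext_of_formallyEtale (A := d.A) (B := d.B) fun b ↦ ?_
  rw [extendDerivation_algebraMap]
  exact (hDE b).symm

lemma exists_der_extend {c d : Chart f} (h : c ≤ d) (D : d.Der) :
    ∃ E : c.Der, ∀ b, E (resB h b) = resB h (D b) := by
  let : Algebra d.A c.A := (resA h).toAlgebra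
  let : Algebra d.B c.B := (resB h).toAlgebra
  let : Algebra d.A c.B := ((resB h).comp (algebraMap d.A d.B)).toAlgebra
  have : IsScalarTower d.A d.B c.B := .of_algebraMap_eq fun _ ↦ rfl
  have : IsScalarTower d.A c.A c.B := .of_algebraMap_eq fun x ↦ congr($(resB_comp h) x)
  have : Algebra.Etale d.A c.A := etale_resA h
  have : Algebra.Etale d.B c.B := etale_resB h
  exact ⟨extendDerivation d.A c.A d.B c.B D, fun b ↦ extendDerivation_algebraMap _ _ _ _ D b⟩

lemma isPushout_resSym [LocallyOfFinitePresentation f] {c d : Chart f} (h : c ≤ d) :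
    IsPushout (CommRingCat.ofHom (resB h))
      (CommRingCat.ofHom (algebraMap d.B d.Sym)) (CommRingCat.ofHom (algebraMap c.B c.Sym))
      (CommRingCat.ofHom (resSym h)) := by
  let : Algebra d.A c.A := (resA h).toAlgebra
  let : Algebra d.B c.B := (resB h).toAlgebra
  let : Algebra d.A c.B := ((resB h).comp (algebraMap d.A d.B)).toAlgebra
  have : IsScalarTower d.A d.B c.B := .of_algebraMap_eq fun _ ↦ rfl
  have : IsScalarTower d.A c.A c.B := .of_algebraMap_eq fun x ↦ congr($(resB_comp h) x)
  have : Algebra.Etale d.A c.A := etale_resA h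
  have : Algebra.Etale d.B c.B := etale_resB h
  have : Algebra.FinitePresentation d.A d.B :=
    f.finitePresentation_appLE d.base.2 d.total.2 d.le
  exact symMap_isPushout c.B (extendDerivation_isBaseChange d.A c.A d.B c.B)

lemma resB_refl (c : Chart f) (b : c.B) : resB (le_refl c) b = b :=
  congr($(W.presheaf.map_id (.op c.total.1)).hom b)

lemma resB_trans {c d e : Chart f} (h : c ≤ d) (h' : d ≤ e) (b : e.B) :
    resB (h.trans h') b = resB h (resB h' b) := by
  change _ = (W.presheaf.map _ ≫ W.presheaf.map _).hom b
  rw [← Functor.map_comp]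
  rfl

lemma resSym_refl (c : Chart f) : resSym (le_refl c) = RingHom.id c.Sym := by
  refine symmetricAlgebra_hom_ext (fun b ↦ ?_) fun D ↦ ?_
  · rw [resSym_algebraMap, resB_refl]; rfl
  · rw [resSym_ι (le_refl c) D D fun b ↦ by rw [resB_refl, resB_refl]]; rfl

lemma resSym_trans {c d e : Chart f} (h : c ≤ d) (h' : d ≤ e) :
    resSym (h.trans h') = (resSym h).comp (resSym h') := by
  refine symmetricAlgebra_hom_ext (fun b ↦ ?_) fun D ↦ ?_
  · rw [RingHom.comp_apply, resSym_algebraMap, resSym_algebraMap, resSym_algebraMap, resB_trans]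
  · obtain ⟨E, hE⟩ := exists_der_extend h' D
    obtain ⟨F, hF⟩ := exists_der_extend h E
    rw [RingHom.comp_apply, resSym_ι h' D E hE, resSym_ι h E F hF]
    exact resSym_ι _ D F fun b ↦ by rw [resB_trans h h', hF, hE, resB_trans h h']

lemma exists_mem_le (x : W) (c d : Chart f) (hc : x ∈ c.total.1) (hd : x ∈ d.total.1) :
    ∃ e : Chart f, e ≤ c ∧ e ≤ d ∧ x ∈ e.total.1 := by
  obtain ⟨V, hV, hxV, hVle⟩ := Opens.isBasis_iff_nbhd.mp S.isBasis_affineOpens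
    (show f x ∈ c.base.1 ⊓ d.base.1 from ⟨c.le hc, d.le hd⟩)
  obtain ⟨U, hU, hxU, hUle⟩ := Opens.isBasis_iff_nbhd.mp W.isBasis_affineOpens
    (show x ∈ c.total.1 ⊓ d.total.1 ⊓ f ⁻¹ᵁ V from ⟨⟨hc, hd⟩, hxV⟩)
  exact ⟨⟨⟨V, hV⟩, ⟨U, hU⟩, hUle.trans inf_le_right⟩,
    ⟨hVle.trans inf_le_left, hUle.trans (inf_le_left.trans inf_le_left)⟩,
    ⟨hVle.trans inf_le_right, hUle.trans (inf_le_left.trans inf_le_right)⟩, hxU⟩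

lemma exists_mem (f : W ⟶ S) (x : W) : ∃ e : Chart f, x ∈ e.total.1 := by
  obtain ⟨V, hV, hxV, -⟩ := Opens.isBasis_iff_nbhd.mp S.isBasis_affineOpens
    (show f x ∈ (⊤ : S.Opens) from trivial)
  obtain ⟨U, hU, hxU, hUle⟩ := Opens.isBasis_iff_nbhd.mp W.isBasis_affineOpens
    (show x ∈ f ⁻¹ᵁ V from hxV)
  exact ⟨⟨⟨V, hV⟩, ⟨U, hU⟩, hUle⟩, hxU⟩

/-- The open cover of `W` by the charts of `f`. -/
@[simps] abbrev cover (f : W ⟶ S) : W.OpenCover where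
  I₀ := Chart f
  X c := c.total.1
  f c := c.total.1.ι
  mem₀ := by
    rw [Scheme.presieve₀_mem_precoverage_iff]
    refine ⟨fun x ↦ ?_, inferInstance⟩
    obtain ⟨c, hc⟩ := exists_mem f x
    exact ⟨c, ⟨x, hc⟩, rfl⟩

instance : (cover f).LocallyDirected where
  trans h := W.homOfLE h.le.2
  directed {c d} x := by
    have hcd : (pullback.fst c.total.1.ι d.total.1.ι ≫ c.total.1.ι) x =
        (pullback.snd c.total.1.ι d.total.1.ι ≫ d.total.1.ι) x := by
      rw [pullback.condition]
    obtain ⟨e, hec, hed, hae⟩ := exists_mem_le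
      ((pullback.fst c.total.1.ι d.total.1.ι ≫ c.total.1.ι) x) c d
      (pullback.fst c.total.1.ι d.total.1.ι x).2
      (hcd ▸ (pullback.snd c.total.1.ι d.total.1.ι x).2)
    refine ⟨e, homOfLE hec, homOfLE hed, ⟨_, hae⟩, ?_⟩
    apply (pullback.fst c.total.1.ι d.total.1.ι ≫ c.total.1.ι).isOpenEmbedding.injective
    change (pullback.lift (W.homOfLE hec.2) (W.homOfLE hed.2) _ ≫
      pullback.fst c.total.1.ι d.total.1.ι ≫ c.total.1.ι) _ = _
    rw [pullback.lift_fst_assoc, Scheme.homOfLE_ι]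
    rfl

/-- The total space of a chart as the spectrum of its coordinate ring. -/
def isoSpec (c : Chart f) : c.total.1.toScheme ≅ Spec (.of c.B) := IsAffineOpen.isoSpec c.total.2

lemma isoSpec_hom_naturality {c d : Chart f} (h : c ≤ d) :
    c.isoSpec.hom ≫ Spec.map (CommRingCat.ofHom (resB h)) = W.homOfLE h.2 ≫ d.isoSpec.hom := by
  have h1 : c.isoSpec.hom = c.total.1.toSpecΓ := IsAffineOpen.isoSpec_hom c.total.2
  have h2 : d.isoSpec.hom = d.total.1.toSpecΓ := IsAffineOpen.isoSpec_hom d.total.2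
  rw [h1, h2]
  exact Scheme.Opens.toSpecΓ_SpecMap_presheaf_map ..

lemma isoSpec_inv_naturality {c d : Chart f} (h : c ≤ d) :
    Spec.map (CommRingCat.ofHom (resB h)) ≫ d.isoSpec.inv = c.isoSpec.inv ≫ W.homOfLE h.2 := by
  rw [Iso.eq_inv_comp, ← Category.assoc, Iso.comp_inv_eq, isoSpec_hom_naturality]


/-- The relative cotangent bundles of the charts form a gluing datum over `W`. -/
def gluingData (f : W ⟶ S) [LocallyOfFinitePresentation f] : (cover f).RelativeGluingData where
  functor :=
    { obj c := Spec (.of c.Sym)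
      map h := Spec.map (CommRingCat.ofHom (resSym h.le))
      map_id c := by rw [resSym_refl]; exact Spec.map_id _
      map_comp h h' := by
        rw [← Spec.map_comp, ← CommRingCat.ofHom_comp, ← resSym_trans] }
  natTrans :=
    { app c := Spec.map (CommRingCat.ofHom (algebraMap c.B c.Sym)) ≫ c.isoSpec.inv
      naturality c d h := by
        change Spec.map _ ≫ Spec.map _ ≫ _ = (Spec.map _ ≫ _) ≫ W.homOfLE h.le.2
        rw [Category.assoc, ← isoSpec_inv_naturality h.le, ← Spec.map_comp_assoc,
          ← Spec.map_comp_assoc]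
        congr 2
        ext b
        exact resSym_algebraMap h.le b }
  equifibered c d h := by
    have h1 := isPullback_SpecMap_of_isPushout _ _ _ _ (isPushout_resSym h.le)
    have h2 : IsPullback c.isoSpec.inv (Spec.map (CommRingCat.ofHom (resB h.le)))
        (W.homOfLE h.le.2) d.isoSpec.inv :=
      IsPullback.of_horiz_isIso ⟨(isoSpec_inv_naturality h.le).symm⟩
    exact (h1.paste_horiz h2).flip

end Chart

end CotangentBundle

section
variable {W S : Scheme.{u}}

lemma finiteType_symmetricAlgebra {R M : Type u} [CommRing R] [AddCommGroup M] [Module R M]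
    [Module.Finite R M] : Algebra.FiniteType R (SymmetricAlgebra R M) := by
  obtain ⟨t, ht⟩ := Module.Finite.fg_top (R := R) (M := M)
  classical
  refine ⟨t.image (SymmetricAlgebra.ι R M), ?_⟩
  rw [eq_top_iff]
  rintro x -
  induction x using SymmetricAlgebra.induction with
  | algebraMap r => exact Subalgebra.algebraMap_mem _ r
  | mul a b ha hb => exact mul_mem ha hb
  | add a b ha hb => exact add_mem ha hb
  | ι x =>
    have hx : x ∈ Submodule.span R (t : Set M) := ht ▸ Submodule.mem_top
    induction hx using Submodule.span_induction with
    | mem y hy => exact Algebra.subset_adjoin (by simpa using ⟨y, hy, rfl⟩)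
    | zero => rw [map_zero]; exact zero_mem _
    | add y z _ _ hy hz => rw [map_add]; exact add_mem hy hz
    | smul r y _ hy => rw [map_smul]; exact Subalgebra.smul_mem _ hy r

lemma Chart.finite_der {f : W ⟶ S} [Smooth f] (c : Chart f) : Module.Finite c.B c.Der := by
  have h : (algebraMap c.A c.B).Smooth := f.smooth_appLE c.base.2 c.total.2 c.le
  have : Algebra.Smooth c.A c.B := h
  exact .equiv (KaehlerDifferential.linearMapEquivDerivation c.A c.B (M := c.B))

/-- The relative cotangent bundle `T^∨(W/S)`. -/
def cotangentBundle (f : W ⟶ S) [Smooth f] : Scheme.{u} := (Chart.gluingData f).glued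

/-- The projection of the relative cotangent bundle to `W`. -/
def cotangentProj (f : W ⟶ S) [Smooth f] : cotangentBundle f ⟶ W := (Chart.gluingData f).toBase

/-- The relative cotangent bundle of a chart, as an open subscheme of the whole one. -/
def cotangentChart (f : W ⟶ S) [Smooth f] (c : Chart f) : Spec (.of c.Sym) ⟶ cotangentBundle f :=
  (Chart.gluingData f).cover.f c

lemma cotangentChart_proj (f : W ⟶ S) [Smooth f] (c : Chart f) :
    cotangentChart f c ≫ cotangentProj f =
      Spec.map (CommRingCat.ofHom (algebraMap c.B c.Sym)) ≫ c.isoSpec.inv ≫ c.total.1.ι :=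
  ((Chart.gluingData f).ι_toBase c).trans (Category.assoc _ _ _)

instance (f : W ⟶ S) [Smooth f] : LocallyOfFiniteType (cotangentProj f) := by
  have : IsZariskiLocalAtSource @LocallyOfFiniteType.{u} :=
    HasRingHomProperty.instIsZariskiLocalAtSource (Q := RingHom.FiniteType)
  refine (IsZariskiLocalAtSource.iff_of_openCover (P := @LocallyOfFiniteType)
    (Chart.gluingData f).cover).mpr fun (c : Chart f) ↦ ?_
  have h := cotangentChart_proj f c
  change LocallyOfFiniteType (cotangentChart f c ≫ cotangentProj f)
  have := c.finite_der
  have : Algebra.FiniteType c.B c.Sym := finiteType_symmetricAlgebra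
  have : LocallyOfFiniteType (Spec.map (CommRingCat.ofHom (algebraMap c.B c.Sym))) :=
    HasRingHomProperty.Spec_iff.mpr ((RingHom.finiteType_algebraMap).mpr this)
  rw [h]
  infer_instance

end

section Cycles

variable {Y : Scheme.{u}}

/-- The multiplicity of `Y` along `closure {y}`: the length of the local ring of `Y` at `y` if `y` is
the generic point of an irreducible component of `Y`, and zero otherwise. -/
def componentMultiplicity (Y : Scheme.{u}) (y : Y) : ℤ :=
  open scoped Classical in
  if closure {y} ∈ irreducibleComponents Y then
    ((Module.length (Y.presheaf.stalk y) (Y.presheaf.stalk y)).toNat : ℤ) else 0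

lemma finite_generic_inter [IsLocallyNoetherian Y] {U : Y.Opens} (hU : IsAffineOpen U) :
    ((U : Set Y) ∩ {y | closure {y} ∈ irreducibleComponents Y}).Finite := by
  have : IsNoetherianRing Γ(Y, U) := IsLocallyNoetherian.component_noetherian ⟨U, hU⟩
  have : NoetherianSpace U := noetherianSpace_of_isAffineOpen U hU
  have hfin := NoetherianSpace.finite_irreducibleComponents (α := U)
  refine Set.Finite.of_finite_image (f := fun y ↦ ((↑) : U → Y) ⁻¹' (closure {y}))
    (hfin.subset ?_) ?_
  · rintro _ ⟨y, ⟨hyU, hy⟩, rfl⟩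
    exact preimage_mem_irreducibleComponents hy U.2.isOpenEmbedding_subtypeVal
      ⟨y, subset_closure rfl, ⟨y, hyU⟩, rfl⟩
  · rintro y ⟨hyU, hy⟩ z ⟨hzU, hz⟩ (h : ((↑) : U → Y) ⁻¹' (closure {y}) = (↑) ⁻¹' (closure {z}))
    have h1 : y ∈ closure {z} := by
      have : (⟨y, hyU⟩ : U) ∈ ((↑) : U → Y) ⁻¹' (closure {z}) := by
        rw [← h]; exact subset_closure rfl
      exact this
    have h2 : z ∈ closure {y} := by
      have : (⟨z, hzU⟩ : U) ∈ ((↑) : U → Y) ⁻¹' (closure {y}) := by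
        rw [h]; exact subset_closure rfl
      exact this
    exact ((specializes_iff_mem_closure.mpr h2).antisymm (specializes_iff_mem_closure.mpr h1)).eq

/-- The cycle on `Y` of the closed subscheme defined by an ideal sheaf: the sum of its irreducible
components with their multiplicities. -/
def closedSubschemeCycle [IsLocallyNoetherian Y] (I : Y.IdealSheafData) : AlgebraicCycle Y ℤ where
  toFun := Function.extend I.subschemeι (componentMultiplicity I.subscheme) 0
  supportWithinDomain' := Set.subset_univ _
  supportLocallyFiniteWithinDomain' z _ := by
    obtain ⟨U, hU, hzU, -⟩ := Opens.isBasis_iff_nbhd.mp Y.isBasis_affineOpens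
      (show z ∈ (⊤ : Y.Opens) from trivial)
    have : IsLocallyNoetherian I.subscheme :=
      LocallyOfFiniteType.isLocallyNoetherian I.subschemeι
    refine ⟨U, U.2.mem_nhds hzU, ((finite_generic_inter
      (hU.preimage I.subschemeι)).image I.subschemeι).subset ?_⟩
    rintro y ⟨hyU, hy⟩
    by_cases hx : ∃ x, I.subschemeι x = y
    · obtain ⟨x, rfl⟩ := hx
      rw [Function.mem_support, I.subschemeι.isEmbedding.injective.extend_apply] at hy
      refine ⟨x, ⟨hyU, ?_⟩, rfl⟩
      by_contra h
      exact hy (if_neg h)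
    · exact (hy (Function.extend_apply' _ _ _ hx)).elim

end Cycles

section Conormal

variable {W S : Scheme.{u}}

/-- The points of `W` lying on the closed subset `Y` at which `Y`, with its reduced scheme
structure, is smooth over `V` along `g : W ⟶ V`. -/
def smoothPoints {V : Scheme.{u}} (Y : Closeds W) (g : W ⟶ V) : Set W :=
  {x | ∃ y : (Scheme.IdealSheafData.vanishingIdeal Y).subscheme,
    (Scheme.IdealSheafData.vanishingIdeal Y).subschemeι y = x ∧
    ∃ U : (Scheme.IdealSheafData.vanishingIdeal Y).subscheme.Opens, y ∈ U ∧
      Smooth (U.ι ≫ (Scheme.IdealSheafData.vanishingIdeal Y).subschemeι ≫ g)}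

/-- The smooth locus `Sm(X/S)` for `f : W ⟶ S` and `p : S ⟶ K`: the points of `Sm(X)`
(smoothness over `K`) at which `X` is smooth over `S`. -/
def relSmoothLocus {K : Scheme.{u}} (p : S ⟶ K) (f : W ⟶ S) (X : Closeds W) : Set W :=
  smoothPoints X (f ≫ p) ∩ smoothPoints X f

/-- The relative singular locus `Sing(X/S)`, the complement of `Sm(X/S)` in `X`. -/
def relSingularLocus {K : Scheme.{u}} (p : S ⟶ K) (f : W ⟶ S) (X : Closeds W) : Set W :=
  (X : Set W) \ relSmoothLocus p f X

/-- A closed subset, all of whose irreducible components have codimension one. -/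
def IsReducedDivisor (X : Closeds W) : Prop :=
  ∀ x : W, Maximal (fun B : Closeds W ↦ IsIrreducible (B : Set W) ∧ B ≤ X)
    (Closeds.closure {x}) → ringKrullDim (W.presheaf.stalk x) = 1

/-- The reduced fiber `X_s` of `X` over a closed point `s`, as a closed subset of `W`. -/
def closedFiber (f : W ⟶ S) (X : Closeds W) {s : S} (hs : IsClosed {s}) : Closeds W :=
  X ⊓ ⟨f ⁻¹' {s}, hs.preimage f.continuous⟩

variable (f : W ⟶ S) [Smooth f]

/-- The points `(x, ξ)` of the relative cotangent bundle with `x ∈ A` and `ξ` orthogonal to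
`T_x Y ∩ T_x (W/S)`. Here `ξ` is orthogonal to a relative vector field `D` if the function `D` on
the cotangent bundle vanishes at `(x, ξ)`, and `D` is tangent to `Y` at `x` if `D g` vanishes at `x`
for all `g` in the ideal of `Y`. -/
def conormalPoints (Y : Closeds W) (A : Set W) : Set (cotangentBundle f) :=
  {ξ | cotangentProj f ξ ∈ A ∧ ∃ (c : Chart f) (q : Spec (.of c.Sym)), cotangentChart f c q = ξ ∧
    ∀ D : c.Der,
      (∀ g : c.B, g ∈ (Scheme.IdealSheafData.vanishingIdeal Y).ideal c.total →
        algebraMap c.B c.Sym (D g) ∈ q.asIdeal) →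
      SymmetricAlgebra.ι c.B c.Der D ∈ q.asIdeal}

/-- The relative conormal variety `Λ_{X/S}` in the relative cotangent bundle. -/
def relConormal {K : Scheme.{u}} (p : S ⟶ K) (X : Closeds W) : Closeds (cotangentBundle f) :=
  Closeds.closure (conormalPoints f X (relSmoothLocus p f X))

/-- The fiber over `s` of the relative cotangent bundle, which is the cotangent bundle of the
fiber `W_s`. -/
abbrev cotangentFiber (s : S) : Scheme.{u} := (cotangentProj f ≫ f).fiber s

instance (s : S) : IsLocallyNoetherian (cotangentFiber f s) :=
  have : LocallyOfFiniteType ((cotangentProj f ≫ f).fiberToSpecResidueField s) :=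
    inferInstanceAs (LocallyOfFiniteType (pullback.snd _ _))
  LocallyOfFiniteType.isLocallyNoetherian
    ((cotangentProj f ≫ f).fiberToSpecResidueField s)

/-- The cycle `sp_s(Λ)` of the scheme-theoretic fiber over `s` of the closed subset `Λ`, taken with
its reduced structure. -/
def specialization (s : S) (Λ : Closeds (cotangentBundle f)) :
    AlgebraicCycle (cotangentFiber f s) ℤ :=
  closedSubschemeCycle
    ((Scheme.IdealSheafData.vanishingIdeal Λ).comap ((cotangentProj f ≫ f).fiberι s))

/-- The conormal variety `Λ_Y` of a closed subset `Y` of the fiber `W_s`: the closure in the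
cotangent bundle of `W_s` of the conormal vectors at the points where `Y` is smooth over `K`. -/
def conormalVariety {K : Scheme.{u}} (p : S ⟶ K) (s : S) (Y : Closeds W) :
    Closeds (cotangentFiber f s) :=
  Closeds.closure ((cotangentProj f ≫ f).fiberι s ⁻¹'
    conormalPoints f Y (smoothPoints Y (f ≫ p)))

/-- The cycle of the conormal variety `Λ_Y` with its reduced structure. -/
def conormalCycle {K : Scheme.{u}} (p : S ⟶ K) (s : S) (Y : Closeds W) :
    AlgebraicCycle (cotangentFiber f s) ℤ :=
  closedSubschemeCycle (Scheme.IdealSheafData.vanishingIdeal (conormalVariety f p s Y))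

end Conormal

end LagrangianSpecialization

end

open CategoryTheory AlgebraicGeometry TopologicalSpace LagrangianSpecialization

/-! Conormal cycles of reduced closed sets have coefficients 0 or 1, so the inequality can be tested
at one point `e` of the cotangent fiber at a time (`conormalCycle_le`). The specialization must have
coefficient at least 1 at the generic points of the components of Λ_Z and of Λ_{X_s}, and at least 2
where two of these points coincide.

Let Y be Z or X_s. Near a smooth point of Y there are étale coordinates t, z_i, w_j on W such that t
is a parameter of S at s, Y = {t = z = 0} and X = {F = 0} (`exists_adapted_coordinates`,
`AdaptedChart.exists_mem`). The last point uses that local rings of a smooth variety are factorial,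
which is proved on the way. The relative cotangent bundle becomes an affine space over the chart. In
it Λ_{X/S} is the closure of the pairs (x, λ∇F(x)), where ∇ is the gradient in the directions z and
w (`polyChart_mem_relConormal_iff`), and Λ_Y is given by t = z = 0 and ξ_w = 0.

Containment of Λ_Y in Λ_{X/S} (`conormalIdeal_le_genericConormal`). Fix constants c. The polar
locus, where F = 0 and ∇_zF is proportional to c, is cut out by as many equations as there are z_i,
which is one less than the codimension of Y in W. Hence Y is not a component of it, and the polar
locus contains a subvariety V(x) in which Y is a divisor. On V(x) rescale the gradient to u∇F = (c,
v). In characteristic zero the function field of V(x) has a derivation δ_j that kills t, is dual to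
w_j and maps functions vanishing along Y to functions vanishing along Y
(`exists_logarithmic_derivation`). Applying δ_j to F = 0 yields v_j = -δ_j(∑ c_i z_i), so v vanishes
along Y (`exists_evaluation`). Thus (c, 0) is a limit of conormal vectors of X, and such vectors
fill out Λ_Y.

Λ_Y is locally a component of the fiber of Λ_{X/S} over s by a count of heights
(`eq_genericConormal`).

Multiplicity two (`not_forall_exists_mul_mem`). If the generic points coincide, Z is locally a
component of X_s, there is a single coordinate z, and F and ∇F vanish along Z. Suppose the fiber of
Λ_{X/S} were reduced at the point in question. Then X would have one branch V(x) there, and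
evaluating the equations at (c, v) would make z and v divisible by t over a ring integral over the
local ring; by Nakayama z would be divisible by t on X itself. So r z - t a would be a multiple of F
for some unit r near Z, and differentiating with respect to z gives a contradiction. -/

section

open IsLocalRing

namespace LagrangianSpecialization

/-! ### Regular local rings: quotients by a parameter and absence of zero divisors. -/

section Regular

/-- The class of `x` is a nonzero vector of the cotangent space. Lifts of a basis of the quotient by
this vector complete `x` to a minimal system of generators, by Nakayama. -/
lemma exists_span_insert_eq_maximalIdeal {R : Type u} [CommRing R] [IsLocalRing R]
    [IsNoetherianRing R] {x : R} (hx : x ∈ maximalIdeal R) (hx2 : x ∉ maximalIdeal R ^ 2) :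
    ∃ (n : ℕ) (T : Fin n → R), n + 1 = (maximalIdeal R).spanFinrank ∧
      Ideal.span (insert x (Set.range T)) = maximalIdeal R := by
  let V := CotangentSpace R
  let v : V := (maximalIdeal R).toCotangent ⟨x, hx⟩
  have hv : v ≠ 0 := by
    rw [Ne, Ideal.toCotangent_eq_zero]; exact hx2
  let Q := V ⧸ Submodule.span (ResidueField R) {v}
  let b := Module.finBasis (ResidueField R) Q
  have hsurj : ∀ q : Q, ∃ m : maximalIdeal R,
      Submodule.Quotient.mk ((maximalIdeal R).toCotangent m) = q := fun q ↦ by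
    obtain ⟨w, rfl⟩ := Submodule.Quotient.mk_surjective _ q
    obtain ⟨m, rfl⟩ := (maximalIdeal R).toCotangent_surjective w
    exact ⟨m, rfl⟩
  choose T hT using fun i ↦ hsurj (b i)
  refine ⟨_, fun i ↦ (T i : R), ?_, ?_⟩
  · have h1 := Submodule.finrank_quotient_add_finrank (Submodule.span (ResidueField R) {v})
    rw [finrank_span_singleton hv] at h1
    rw [spanFinrank_maximalIdeal_eq_finrank_cotangentSpace, ← h1]
  · have hle : Ideal.span (insert x (Set.range fun i ↦ (T i : R))) ≤ maximalIdeal R := by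
      rw [Ideal.span_le]
      rintro y (rfl | ⟨i, rfl⟩)
      · exact hx
      · exact (T i).2
    refine le_antisymm hle ?_
    refine Submodule.le_of_le_smul_of_le_jacobson_bot (I := maximalIdeal R)
      (IsNoetherian.noetherian _) (jacobson_eq_maximalIdeal ⊥ bot_ne_top).ge ?_
    intro y hy
    have h1 : Submodule.Quotient.mk ((maximalIdeal R).toCotangent ⟨y, hy⟩) ∈
        Submodule.span (ResidueField R) (Set.range b) := by rw [b.span_eq]; trivial
    rw [Submodule.mem_span_range_iff_exists_fun] at h1
    obtain ⟨c, hc⟩ := h1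
    choose c' hc' using fun i ↦ residue_surjective (c i)
    have h2 : (maximalIdeal R).toCotangent ⟨y, hy⟩ - ∑ i, c i • (maximalIdeal R).toCotangent (T i) ∈
        Submodule.span (ResidueField R) {v} := by
      rw [← Submodule.Quotient.mk_eq_zero, Submodule.Quotient.mk_sub, ← hc, sub_eq_zero,
        ← Submodule.mkQ_apply, map_sum]
      refine Finset.sum_congr rfl fun i _ ↦ ?_
      rw [map_smul, Submodule.mkQ_apply, hT]
    obtain ⟨a, ha⟩ := Submodule.mem_span_singleton.mp h2
    obtain ⟨a', rfl⟩ := residue_surjective a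
    have hsm : ∀ (r : R) (w : V), residue R r • w = r • w := fun r w ↦
      algebraMap_smul (ResidueField R) r w
    have h3 : (maximalIdeal R).toCotangent
        (⟨y, hy⟩ - ∑ i, c' i • T i - a' • ⟨x, hx⟩) = 0 := by
      rw [map_sub, map_sub, map_sum, map_smul]
      simp only [map_smul]
      rw [← hsm a', ha, sub_eq_zero]
      congr 1
      refine Finset.sum_congr rfl fun i _ ↦ ?_
      rw [← hc' i, hsm]
    rw [Ideal.toCotangent_eq_zero] at h3
    have h4 : y = (∑ i, c' i * (T i : R) + a' * x) +
        ((⟨y, hy⟩ - ∑ i, c' i • T i - a' • ⟨x, hx⟩ : maximalIdeal R) : R) := by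
      simp
    rw [h4]
    refine Submodule.add_mem_sup (add_mem (sum_mem fun i _ ↦ ?_) ?_) ?_
    · exact Ideal.mul_mem_left _ _ (Ideal.subset_span (Or.inr ⟨i, rfl⟩))
    · exact Ideal.mul_mem_left _ _ (Ideal.subset_span (Or.inl rfl))
    · rwa [smul_eq_mul, ← pow_two]

/-- Killing a member of a minimal generating system lowers the embedding dimension by one, while the
Krull dimension drops by at most one. Regularity of `R` leaves no slack between the two. -/
lemma isRegularLocalRing_quotient {R : Type u} [CommRing R] [IsRegularLocalRing R] {x : R}
    (hx : x ∈ maximalIdeal R) (hx2 : x ∉ maximalIdeal R ^ 2) :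
    IsRegularLocalRing (R ⧸ Ideal.span {x}) ∧
      ringKrullDim (R ⧸ Ideal.span {x}) + 1 = ringKrullDim R := by
  have hne : Ideal.span {x} ≠ ⊤ := fun h ↦
    (maximalIdeal.isMaximal R).ne_top (top_unique (h ▸ (Ideal.span_singleton_le_iff_mem _).mpr hx))
  have : Nontrivial (R ⧸ Ideal.span {x}) := Ideal.Quotient.nontrivial_iff.mpr hne
  have : IsLocalRing (R ⧸ Ideal.span {x}) := .of_surjective' _ Ideal.Quotient.mk_surjective
  obtain ⟨n, T, hn, hT⟩ := exists_span_insert_eq_maximalIdeal hx hx2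
  have hreg := IsRegularLocalRing.spanFinrank_maximalIdeal (R := R)
  rw [← hn] at hreg
  have hmap : maximalIdeal (R ⧸ Ideal.span {x}) =
      Ideal.span (Set.range fun i ↦ Ideal.Quotient.mk (Ideal.span {x}) (T i)) := by
    have h1 := map_maximalIdeal_of_surjective _ (Ideal.Quotient.mk_surjective (I := Ideal.span {x}))
    rw [← h1, ← hT, Ideal.map_span, Set.image_insert_eq, ← Set.range_comp]
    refine le_antisymm (Ideal.span_le.mpr ?_) (Ideal.span_mono (Set.subset_insert _ _))
    rintro y (rfl | hy)
    · have : Ideal.Quotient.mk (Ideal.span {x}) x = 0 :=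
        Ideal.Quotient.eq_zero_iff_mem.mpr (Ideal.mem_span_singleton_self x)
      rw [this]; exact zero_mem _
    · exact Ideal.subset_span hy
  have hle : (maximalIdeal (R ⧸ Ideal.span {x})).spanFinrank ≤ n := by
    rw [hmap]
    refine (Submodule.spanFinrank_span_le_ncard_of_finite (Set.finite_range _)).trans ?_
    rw [← Set.image_univ]
    refine (Set.ncard_image_le Set.finite_univ).trans ?_
    simp [Set.ncard_univ]
  have hdim : ringKrullDim R ≤ ringKrullDim (R ⧸ Ideal.span {x}) + 1 := by
    rw [← maximalIdeal_height_eq_ringKrullDim]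
    exact Ideal.height_le_ringKrullDim_quotient_add_one hx
  have hdim' := ringKrullDim_le_spanFinrank_maximalIdeal (R ⧸ Ideal.span {x})
  obtain ⟨e, he⟩ : ∃ e : ℕ, ringKrullDim (R ⧸ Ideal.span {x}) = e := by
    have := ringKrullDim_lt_top (R := R ⧸ Ideal.span {x})
    have h0 := ringKrullDim_nonneg_of_nontrivial (R := R ⧸ Ideal.span {x})
    generalize ringKrullDim (R ⧸ Ideal.span {x}) = a at *
    cases a with
    | bot => simp at h0
    | coe a => cases a with
      | top => simp at this
      | coe a => exact ⟨a, rfl⟩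
  rw [he, ← hreg] at hdim
  rw [he] at hdim'
  have h1 : n + 1 ≤ e + 1 := by exact_mod_cast hdim
  have h2 : e ≤ (maximalIdeal (R ⧸ Ideal.span {x})).spanFinrank := by exact_mod_cast hdim'
  have hen : e = n := by omega
  refine ⟨.of_spanFinrank_maximalIdeal_le _ ?_, ?_⟩
  · rw [he]; exact_mod_cast (hle.trans hen.ge)
  · rw [he, ← hreg, hen]; rfl

lemma eq_zero_of_forall_eq_mul {R : Type u} [CommRing R] [IsLocalRing R] [IsNoetherianRing R]
    {x : R} (hx : x ∈ maximalIdeal R) (I : Ideal R) (h : ∀ y ∈ I, ∃ z ∈ I, y = x * z) : I = ⊥ := by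
  refine Submodule.eq_bot_of_le_smul_of_le_jacobson_bot (Ideal.span {x}) I
    (IsNoetherian.noetherian _) ?_ ?_
  · intro y hy
    obtain ⟨z, hz, rfl⟩ := h y hy
    exact Submodule.smul_mem_smul (Ideal.mem_span_singleton_self x) hz
  · rw [jacobson_eq_maximalIdeal ⊥ bot_ne_top]
    exact (Ideal.span_singleton_le_iff_mem _).mpr hx

lemma isField_of_isRegularLocalRing {R : Type u} [CommRing R] [IsRegularLocalRing R]
    (h : ringKrullDim R ≤ 0) : IsField R := by
  rw [isField_iff_maximalIdeal_eq]
  have h1 := IsRegularLocalRing.spanFinrank_maximalIdeal (R := R)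
  rw [← h1] at h
  have h2 : (maximalIdeal R).spanFinrank = 0 := by
    have : (maximalIdeal R).spanFinrank ≤ 0 := by exact_mod_cast h
    omega
  exact (Submodule.spanFinrank_eq_zero_iff_eq_bot (IsNoetherian.noetherian _)).mp h2

/-- Prime avoidance supplies `x ∈ 𝔪` outside `𝔪²` and outside every minimal prime. By induction
`R/x` is a domain, so `(x)` is prime and contains a minimal prime `q`. As `x ∉ q`, every element of
`q` is `x` times an element of `q`, whence `q = 0` by Nakayama. -/
lemma isDomain_of_isRegularLocalRing (n : ℕ) (R : Type u) [CommRing R] [IsRegularLocalRing R]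
    (hn : ringKrullDim R ≤ n) : IsDomain R := by
  induction n generalizing R with
  | zero =>
    exact (isField_of_isRegularLocalRing (by simpa using hn)).isDomain
  | succ n ih =>
    by_cases hf : IsField R
    · exact hf.isDomain
    have hfin := minimalPrimes.finite_of_isNoetherianRing R
    have hm2 : ¬ maximalIdeal R ≤ maximalIdeal R ^ 2 := fun h ↦ hf <| by
      rw [isField_iff_maximalIdeal_eq]
      refine Submodule.eq_bot_of_le_smul_of_le_jacobson_bot (maximalIdeal R) _
        (IsNoetherian.noetherian _) (by rwa [smul_eq_mul, ← pow_two])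
        (jacobson_eq_maximalIdeal ⊥ bot_ne_top).ge
    by_cases hmin : maximalIdeal R ∈ minimalPrimes R
    · refine (hf (isField_of_isRegularLocalRing ?_)).elim
      rw [← maximalIdeal_height_eq_ringKrullDim]
      have : (maximalIdeal R).height = 0 := by
        exact Ideal.height_eq_zero_iff.mpr hmin
      rw [this]; rfl
    have key : ∃ x ∈ maximalIdeal R, x ∉ maximalIdeal R ^ 2 ∧ ∀ q ∈ minimalPrimes R, x ∉ q := by
      by_contra! hcon
      classical
      -- Prime avoidance tolerates two ideals that are not prime; `𝔪²` is named in both exceptional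
      -- slots.
      have := (Ideal.subset_union_prime (s := insert (maximalIdeal R ^ 2) hfin.toFinset)
        (f := id) (maximalIdeal R ^ 2) (maximalIdeal R ^ 2) (I := maximalIdeal R) ?_).mp ?_
      · obtain ⟨q, hq, hle⟩ := this
        rcases Finset.mem_insert.mp hq with rfl | hq
        · exact hm2 hle
        · rw [Set.Finite.mem_toFinset] at hq
          have : q.IsPrime := hq.1.1
          exact hmin ((le_antisymm hle (le_maximalIdeal this.ne_top)) ▸ hq)
      · intro q hq h1 _
        rcases Finset.mem_insert.mp hq with h | hq
        · exact (h1 h).elim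
        · rw [Set.Finite.mem_toFinset] at hq
          exact hq.1.1
      · intro x hx
        by_cases hx2 : x ∈ maximalIdeal R ^ 2
        · exact Set.mem_biUnion (Finset.mem_coe.mpr (Finset.mem_insert_self _ _)) hx2
        · obtain ⟨q, hq, hxq⟩ := hcon x hx hx2
          exact Set.mem_biUnion (x := q) (Finset.mem_coe.mpr (Finset.mem_insert_of_mem (by simpa using hq))) hxq
    obtain ⟨x, hx, hx2, hxq⟩ := key
    obtain ⟨hreg, hdim⟩ := isRegularLocalRing_quotient hx hx2
    have hdom : IsDomain (R ⧸ Ideal.span {x}) := by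
      refine ih _ ?_
      rw [← hdim] at hn
      push_cast at hn
      exact (ENat.WithBot.add_le_add_one_right_iff).mp hn
    have hprime : (Ideal.span {x}).IsPrime := (Ideal.Quotient.isDomain_iff_prime _).mp hdom
    obtain ⟨q, hq, hqle⟩ := Ideal.exists_minimalPrimes_le (I := (⊥ : Ideal R)) (J := Ideal.span {x})
      bot_le
    have hqp : q.IsPrime := hq.1.1
    have hq0 : q = ⊥ := eq_zero_of_forall_eq_mul hx q fun y hy ↦ by
      obtain ⟨z, rfl⟩ := Ideal.mem_span_singleton.mp (hqle hy)
      exact ⟨z, (hqp.mem_or_mem hy).resolve_left (hxq q hq), rfl⟩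
    rw [hq0] at hqp
    exact IsDomain.of_bot_isPrime R

end Regular

end LagrangianSpecialization

namespace LagrangianSpecialization

/-! ### Free syzygies over regular local rings. -/

section Syzygies

/-- Every `n`-th syzygy of the module `M` is free. -/
def HasFreeSyzygies (R : Type u) [CommRing R] :
    ℕ → ∀ (M : Type u) [AddCommGroup M] [Module R M], Prop
  | 0, M, _, _ => Module.Free R M
  | n + 1, M, _, _ => ∀ (r : ℕ) (φ : (Fin r → R) →ₗ[R] M), Function.Surjective φ →
      HasFreeSyzygies R n (LinearMap.ker φ)

/-- Here `S = R/x` and `N = M/xM` with `x` regular on `R` and on `M`. A first syzygy of `M` reduces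
modulo `x` to a first syzygy of `N`, since `M` has no `x`-torsion. At the end of the induction, a
basis modulo `x` lifts to a basis by Nakayama. -/
lemma HasFreeSyzygies.of_quotient {R S : Type u} [CommRing R] [IsLocalRing R] [IsNoetherianRing R]
    [CommRing S] [Algebra R S] (hs : Function.Surjective (algebraMap R S)) {x : R}
    (hx : x ∈ maximalIdeal R) (hxr : ∀ r, x * r = 0 → r = 0)
    (hker : ∀ r : R, algebraMap R S r = 0 ↔ ∃ r', r = x * r') (n : ℕ)
    (M N : Type u) [AddCommGroup M] [Module R M] [Module.Finite R M]
    [AddCommGroup N] [Module R N] [Module S N] [IsScalarTower R S N]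
    (π : M →ₗ[R] N) (hπ : Function.Surjective π) (hπk : ∀ m, π m = 0 ↔ ∃ m', m = x • m')
    (hreg : ∀ m : M, x • m = 0 → m = 0)
    (h : HasFreeSyzygies S n N) : HasFreeSyzygies R n M := by
  have : IsNoetherian R M := inferInstance
  induction n generalizing M N with
  | zero =>
    have hfree : Module.Free S N := h
    have hfin : Module.Finite R N := .of_surjective π hπ
    have hfin' : Module.Finite S N := .of_restrictScalars_finite R S N
    rcases subsingleton_or_nontrivial S with hS | hS
    · have h1 : algebraMap R S 1 = 0 := Subsingleton.elim _ _
      obtain ⟨r, hr⟩ := (hker 1).mp h1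
      exact ((maximalIdeal.isMaximal R).ne_top ((Ideal.eq_top_iff_one _).mpr
        (hr ▸ Ideal.mul_mem_right _ _ hx))).elim
    let b := Module.finBasis S N
    choose e he using fun i ↦ hπ (b i)
    let φ : (Fin (Module.finrank S N) → R) →ₗ[R] M := Fintype.linearCombination R e
    have hφπ : ∀ v, π (φ v) = ∑ i, algebraMap R S (v i) • b i := fun v ↦ by
      simp [φ, Fintype.linearCombination_apply, he]
    have hsurj : Function.Surjective φ := by
      rw [← LinearMap.range_eq_top, ← top_le_iff]
      refine Submodule.le_of_le_smul_of_le_jacobson_bot (I := maximalIdeal R)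
        (IsNoetherian.noetherian _) (jacobson_eq_maximalIdeal ⊥ bot_ne_top).ge ?_
      intro m _
      have h1 := b.sum_repr (π m)
      choose v hv using fun i ↦ hs (b.repr (π m) i)
      have h2 : π (m - φ v) = 0 := by
        rw [map_sub, hφπ]; simp only [hv]; rw [h1, sub_self]
      obtain ⟨m', hm'⟩ := (hπk _).mp h2
      rw [← add_sub_cancel (φ v) m, hm']
      exact Submodule.add_mem_sup ⟨v, rfl⟩ (Submodule.smul_mem_smul hx trivial)
    have hinj : LinearMap.ker φ = ⊥ := by
      refine Submodule.eq_bot_of_le_smul_of_le_jacobson_bot (maximalIdeal R) _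
        (IsNoetherian.noetherian _) ?_ (jacobson_eq_maximalIdeal ⊥ bot_ne_top).ge
      intro v hv
      have h1 : ∑ i, algebraMap R S (v i) • b i = 0 := by
        rw [← hφπ, LinearMap.mem_ker.mp hv, map_zero]
      have h2 := Fintype.linearIndependent_iff.mp b.linearIndependent _ h1
      choose v' hv' using fun i ↦ (hker (v i)).mp (h2 i)
      have h3 : v = x • v' := by ext i; exact hv' i
      rw [h3]
      refine Submodule.smul_mem_smul hx ?_
      refine LinearMap.mem_ker.mpr (hreg _ ?_)
      rw [← map_smul, ← h3]; exact LinearMap.mem_ker.mp hv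
    exact Module.Free.of_equiv (LinearEquiv.ofBijective φ ⟨LinearMap.ker_eq_bot.mp hinj, hsurj⟩)
  | succ n ih =>
    intro r φ hφ
    let φ' : (Fin r → S) →ₗ[S] N :=
      Fintype.linearCombination S (fun i ↦ π (φ (Pi.single i 1)))
    let red : (Fin r → R) →ₗ[R] (Fin r → S) := (Algebra.linearMap R S).compLeft (Fin r)
    have hred : ∀ v i, red v i = algebraMap R S (v i) := fun _ _ ↦ rfl
    have hcomm : ∀ v, φ' (red v) = π (φ v) := fun v ↦ by
      conv_rhs => rw [← Finset.univ_sum_single v]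
      rw [map_sum, map_sum, Fintype.linearCombination_apply]
      refine Finset.sum_congr rfl fun i _ ↦ ?_
      rw [hred, algebraMap_smul, ← map_smul, ← map_smul, ← Pi.single_smul, smul_eq_mul, mul_one]
    have hredsurj : Function.Surjective red := fun v ↦ by
      choose w hw using fun i ↦ hs (v i)
      exact ⟨w, funext hw⟩
    have hφ' : Function.Surjective φ' := fun y ↦ by
      obtain ⟨m, rfl⟩ := hπ y
      obtain ⟨v, rfl⟩ := hφ m
      exact ⟨red v, hcomm v⟩
    have hredk : ∀ v, red v = 0 ↔ ∃ v', v = x • v' := fun v ↦ by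
      constructor
      · intro hv
        choose v' hv' using fun i ↦ (hker (v i)).mp (congrFun hv i)
        exact ⟨v', funext hv'⟩
      · rintro ⟨v', rfl⟩
        ext i
        exact (hker _).mpr ⟨v' i, rfl⟩
    let ρ : LinearMap.ker φ →ₗ[R] LinearMap.ker φ' :=
      LinearMap.codRestrict ((LinearMap.ker φ').restrictScalars R) (red.comp (LinearMap.ker φ).subtype)
        fun v ↦ by
          change φ' (red v) = 0
          rw [hcomm, LinearMap.mem_ker.mp v.2, map_zero]
    have hρ : ∀ v, (ρ v : Fin r → S) = red v := fun _ ↦ rfl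
    refine ih (LinearMap.ker φ) (LinearMap.ker φ') ρ ?_ ?_ ?_ (h r φ' hφ') inferInstance
    · rintro ⟨v, hv⟩
      obtain ⟨v, rfl⟩ := hredsurj v
      rw [LinearMap.mem_ker, hcomm, hπk] at hv
      obtain ⟨m', hm'⟩ := hv
      obtain ⟨v', rfl⟩ := hφ m'
      refine ⟨⟨v - x • v', ?_⟩, ?_⟩
      · rw [LinearMap.mem_ker, map_sub, map_smul, hm', sub_self]
      · refine Subtype.ext ?_
        rw [hρ]
        change red (v - x • v') = red v
        rw [map_sub, (hredk _).mpr ⟨v', rfl⟩, sub_zero]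
    · intro v
      rw [← Subtype.coe_inj, hρ]
      change red v = 0 ↔ _
      rw [hredk]
      constructor
      · rintro ⟨v', hv'⟩
        refine ⟨⟨v', LinearMap.mem_ker.mpr (hreg _ ?_)⟩, Subtype.ext hv'⟩
        rw [← map_smul, ← hv']; exact LinearMap.mem_ker.mp v.2
      · rintro ⟨v', rfl⟩
        exact ⟨v', rfl⟩
    · intro v hv
      refine Subtype.ext (funext fun i ↦ hxr _ ?_)
      exact congrFun (congrArg Subtype.val hv) i

/-- `M` itself may have `x`-torsion, but its first syzygy `K` lies in a free module over a domain
and has none. The induction hypothesis is therefore applied to `K/xK` over the regular ring `R/x`,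
which accounts for the shift from `n` to `n + 1`. -/
theorem hasFreeSyzygies_of_isRegularLocalRing (n : ℕ) (R : Type u) [CommRing R]
    [IsRegularLocalRing R] (hn : ringKrullDim R = n) (M : Type u) [AddCommGroup M] [Module R M]
    [Module.Finite R M] : HasFreeSyzygies R n M := by
  induction n generalizing R M with
  | zero =>
    let := (isField_of_isRegularLocalRing hn.le).toField
    exact (inferInstance : Module.Free R M)
  | succ n ih =>
    intro r φ hφ
    have hdom := isDomain_of_isRegularLocalRing (n + 1) R hn.le
    have hm2 : ∃ x ∈ maximalIdeal R, x ∉ maximalIdeal R ^ 2 := by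
      by_contra! h
      have : IsField R := by
        rw [isField_iff_maximalIdeal_eq]
        refine Submodule.eq_bot_of_le_smul_of_le_jacobson_bot (maximalIdeal R) _
          (IsNoetherian.noetherian _) (by rw [smul_eq_mul, ← pow_two]; exact h)
          (jacobson_eq_maximalIdeal ⊥ bot_ne_top).ge
      have h0 := ringKrullDim_eq_zero_of_isField this
      rw [hn] at h0
      exact absurd h0 (by exact_mod_cast Nat.succ_ne_zero n)
    obtain ⟨x, hx, hx2⟩ := hm2
    have hx0 : x ≠ 0 := fun h ↦ hx2 (h ▸ zero_mem _)
    obtain ⟨hreg, hdim⟩ := isRegularLocalRing_quotient hx hx2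
    have hdim' : ringKrullDim (R ⧸ Ideal.span {x}) = n := by
      rw [hn] at hdim; push_cast at hdim
      exact (ENat.WithBot.add_one_cancel).mp hdim
    let K := LinearMap.ker φ
    let N := K ⧸ (Ideal.span {x} • (⊤ : Submodule R K))
    have hxN : ∀ m : K, m ∈ Ideal.span {x} • (⊤ : Submodule R K) ↔ ∃ m', m = x • m' := fun m ↦ by
      rw [Submodule.ideal_span_singleton_smul, Submodule.mem_smul_pointwise_iff_exists]
      exact ⟨fun ⟨y, _, hy⟩ ↦ ⟨y, hy.symm⟩, fun ⟨y, hy⟩ ↦ ⟨y, trivial, hy.symm⟩⟩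
    have : Module.Finite (R ⧸ Ideal.span {x}) N := .of_restrictScalars_finite R _ _
    refine HasFreeSyzygies.of_quotient (S := R ⧸ Ideal.span {x}) Ideal.Quotient.mk_surjective hx
      (fun r hr ↦ (mul_eq_zero.mp hr).resolve_left hx0) (fun r ↦ ?_) n K N
      (Submodule.mkQ _) (Submodule.mkQ_surjective _) (fun m ↦ ?_) (fun m hm ↦ ?_) (ih _ hdim' N)
    · rw [Ideal.Quotient.algebraMap_eq, Ideal.Quotient.eq_zero_iff_mem, Ideal.mem_span_singleton]
      rfl
    · rw [Submodule.mkQ_apply, Submodule.Quotient.mk_eq_zero]; exact hxN m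
    · exact (smul_eq_zero.mp hm).resolve_left hx0

end Syzygies

end LagrangianSpecialization

namespace LagrangianSpecialization

/-! ### Factoriality of regular local rings. -/

section Factorial

/-- A localized presentation of `M` splits because `M'` is projective. Its kernel is a localized
syzygy, stably free by induction, and a complement of a stably free module in a free module of
finite rank is stably free. -/
lemma HasFreeSyzygies.isStablyFree {R T : Type u} [CommRing R] [CommRing T] [Algebra R T]
    (S : Submonoid R) [IsLocalization S T] [IsNoetherianRing R] (n : ℕ)
    (M M' : Type u) [AddCommGroup M] [Module R M] [Module.Finite R M]
    [AddCommGroup M'] [Module R M'] [Module T M'] [IsScalarTower R T M']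
    (f : M →ₗ[R] M') [IsLocalizedModule S f] [Module.Projective T M']
    (h : HasFreeSyzygies R n M) : Module.IsStablyFree T M' := by
  induction n generalizing M M' with
  | zero =>
    have : Module.Free R M := h
    have : Module.Free T M' := Module.free_of_isLocalizedModule (Rₛ := T) S f
    infer_instance
  | succ n ih =>
    obtain ⟨r, φ, hφ⟩ := Module.Finite.exists_fin' R M
    let g : (Fin r → R) →ₗ[R] (Fin r → T) := (Algebra.linearMap R T).compLeft (Fin r)
    have hg : IsLocalizedModule S g :=
      IsLocalizedModule.pi S fun _ : Fin r ↦ Algebra.linearMap R T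
    let φ' : (Fin r → T) →ₗ[T] M' := IsLocalizedModule.mapExtendScalars S g f T φ
    have hφ' : Function.Surjective φ' := IsLocalizedModule.map_surjective S g f φ hφ
    let e : LinearMap.ker (IsLocalizedModule.map S g f φ) ≃ₗ[R] LinearMap.ker φ' :=
      { toFun x := ⟨x.1, x.2⟩
        invFun x := ⟨x.1, x.2⟩
        map_add' _ _ := rfl
        map_smul' _ _ := rfl
        left_inv _ := rfl
        right_inv _ := rfl }
    obtain ⟨s, hs⟩ := Module.projective_lifting_property φ' LinearMap.id hφ'
    have hs' : ∀ m, φ' (s m) = m := fun m ↦ congr($hs m)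
    let Φ : (M' × LinearMap.ker φ') ≃ₗ[T] (Fin r → T) := LinearEquiv.ofBijective
      (s.coprod (LinearMap.ker φ').subtype) <| by
        constructor
        · rw [← LinearMap.ker_eq_bot, LinearMap.ker_eq_bot']
          rintro ⟨m, v⟩ hv
          have h1 : s m + v = 0 := hv
          have h2 := congrArg φ' h1
          rw [map_add, hs', LinearMap.mem_ker.mp v.2, add_zero, map_zero] at h2
          subst h2
          rw [map_zero, zero_add] at h1
          rw [Prod.mk_eq_zero]
          exact ⟨rfl, Subtype.ext h1⟩
        · intro v
          refine ⟨(φ' v, ⟨v - s (φ' v), ?_⟩), ?_⟩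
          · rw [LinearMap.mem_ker, map_sub, hs', sub_self]
          · simp
    have : Module.Projective T (LinearMap.ker φ') := by
      have hp : Module.Projective T (Fin r → T) := Module.Projective.of_free
      have : Module.Projective T (M' × LinearMap.ker φ') := .of_equiv Φ.symm
      exact .of_split (LinearMap.inr T M' _) (LinearMap.snd T M' _) rfl
    have : IsLocalizedModule S (LinearMap.toKerIsLocalized S g f φ) :=
      LinearMap.toKerLocalized_isLocalizedModule T S g f φ
    have : IsLocalizedModule S (e.toLinearMap ∘ₗ LinearMap.toKerIsLocalized S g f φ) :=
      IsLocalizedModule.of_linearEquiv S _ e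
    have hK := ih (LinearMap.ker φ) (LinearMap.ker φ')
      (e.toLinearMap ∘ₗ LinearMap.toKerIsLocalized S g f φ) (h r φ hφ)
    obtain ⟨P, _, _, _, _, hP⟩ := hK.exist_free_prod
    have : Module.Finite T (LinearMap.ker φ') := by
      have : Module.Finite T (M' × LinearMap.ker φ') := .equiv Φ.symm
      exact .of_surjective (LinearMap.snd T M' (LinearMap.ker φ')) LinearMap.snd_surjective
    have : Module.Free T (M' × (LinearMap.ker φ' × P)) :=
      .of_equiv ((Φ.symm.prodCongr (LinearEquiv.refl T P)).trans (LinearEquiv.prodAssoc T _ _ _))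
    exact .of_free_prod T M' (LinearMap.ker φ' × P)

open TensorProduct in
-- A functional θ on an ideal of a domain satisfies x θ(y) = y θ(x). For a dual basis (ψ_i, a_i)
-- this forces ∑ ψ_i(a_i) = 1, and the contraction `I* ⊗ I → T` has inverse `t ↦ t e` with e = ∑ ψ_i
-- ⊗ a_i.
lemma invertible_of_projective_ideal {T : Type u} [CommRing T] [IsDomain T] (I : Ideal T)
    (hI : I ≠ ⊥) [Module.Finite T I] [Module.Projective T I] : Module.Invertible T I := by
  obtain ⟨n, φ, hφ⟩ := Module.Finite.exists_fin' T I
  obtain ⟨s, hs⟩ := Module.projective_lifting_property φ LinearMap.id hφ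
  let a : Fin n → I := fun i ↦ φ (Pi.single i 1)
  let ψ : Fin n → Module.Dual T I := fun i ↦ LinearMap.proj i ∘ₗ s
  have hψ : ∀ x : I, ∑ i, ψ i x • a i = x := fun x ↦ by
    conv_rhs => rw [← LinearMap.id_apply (R := T) x, ← hs, LinearMap.comp_apply,
      ← Finset.univ_sum_single (s x), map_sum]
    refine Finset.sum_congr rfl fun i _ ↦ ?_
    rw [← map_smul, ← Pi.single_smul, smul_eq_mul, mul_one]
    rfl
  have hswap : ∀ (θ : Module.Dual T I) (x y : I), (x : T) * θ y = (y : T) * θ x := fun θ x y ↦ by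
    rw [← smul_eq_mul, ← smul_eq_mul, ← map_smul, ← map_smul]
    congr 1
    exact Subtype.ext (mul_comm _ _)
  have hone : ∑ i, ψ i (a i) = 1 := by
    obtain ⟨x, hx, hx0⟩ := Submodule.exists_mem_ne_zero_of_ne_bot hI
    refine mul_left_cancel₀ hx0 ?_
    rw [Finset.mul_sum, mul_one]
    have := congrArg Subtype.val (hψ ⟨x, hx⟩)
    simp only [AddSubmonoidClass.coe_finsetSum, SetLike.val_smul, smul_eq_mul] at this
    conv_rhs => rw [← this]
    refine Finset.sum_congr rfl fun i _ ↦ ?_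
    rw [hswap (ψ i) ⟨x, hx⟩ (a i), mul_comm]
  let e : Module.Dual T I ⊗[T] I := ∑ i, ψ i ⊗ₜ a i
  have he : contractLeft T I e = 1 := by
    simp only [e, map_sum, contractLeft_apply]; exact hone
  have hmain : ∀ w, w = contractLeft T I w • e := fun w ↦ by
    induction w with
    | zero => simp
    | add x y hx hy => rw [map_add, add_smul, ← hx, ← hy]
    | tmul θ x =>
      rw [contractLeft_apply]
      have h1 : ∀ i, ψ i (a i) • θ = θ (a i) • ψ i := fun i ↦ by
        ext y
        rw [LinearMap.smul_apply, LinearMap.smul_apply, smul_eq_mul, smul_eq_mul]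
        have h0 : (a i : T) = 0 ∨ (a i : T) ≠ 0 := em _
        rcases h0 with h0 | h0
        · have : a i = 0 := Subtype.ext h0
          simp [this]
        · refine mul_left_cancel₀ h0 ?_
          have e1 := hswap θ (a i) y
          have e2 := hswap (ψ i) (a i) y
          linear_combination (ψ i (a i)) * e1 - θ (a i) * e2
      calc θ ⊗ₜ[T] x = (∑ i, ψ i (a i)) • (θ ⊗ₜ[T] x) := by rw [hone, one_smul]
        _ = ∑ i, ψ i ⊗ₜ[T] (θ x • a i) := by
          rw [Finset.sum_smul]
          refine Finset.sum_congr rfl fun i _ ↦ ?_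
          rw [TensorProduct.smul_tmul', h1, ← TensorProduct.smul_tmul', ← TensorProduct.tmul_smul]
          congr 1
          refine Subtype.ext ?_
          simp only [SetLike.val_smul, smul_eq_mul]
          rw [mul_comm, hswap θ x (a i), mul_comm]
        _ = θ x • e := by
          rw [Finset.smul_sum]
          exact Finset.sum_congr rfl fun i _ ↦ (TensorProduct.tmul_smul _ _ _)
  refine ⟨⟨?_, fun t ↦ ⟨t • e, by rw [map_smul, he, smul_eq_mul, mul_one]⟩⟩⟩
  intro v w h
  rw [hmain v, hmain w, h]

lemma isRegularRing_of_isLocalization {R T : Type u} [CommRing R] [CommRing T] [Algebra R T]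
    (S : Submonoid R) [IsLocalization S T] [IsRegularRing R] : IsRegularRing T := by
  have := IsLocalization.isNoetherianRing S T inferInstance
  rw [isRegularRing_iff]
  intro Q hQ
  have := IsLocalization.isLocalization_isLocalization_atPrime_isLocalization S
    (Localization.AtPrime Q) Q
  have : (Q.comap (algebraMap R T)).IsPrime := inferInstance
  exact IsRegularLocalRing.of_ringEquiv (IsLocalization.algEquiv
    (Q.comap (algebraMap R T)).primeCompl (Localization.AtPrime (Q.comap (algebraMap R T)))
    (Localization.AtPrime Q)).toRingEquiv

/-- It suffices that height one primes are principal. For a prime element `x ∈ 𝔪 \ 𝔪²`, Nagata's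
criterion reduces this to the extension of the prime to `R[1/x]`. That ideal is locally principal by
induction on the dimension, hence projective and invertible. It is also stably free, since syzygies
over `R` are free. A stably free invertible module is free. -/
theorem uniqueFactorizationMonoid_of_isRegularLocalRing (n : ℕ) (R : Type u) [CommRing R]
    [IsDomain R] [IsRegularLocalRing R] [IsRegularRing R] (hn : ringKrullDim R ≤ n) :
    UniqueFactorizationMonoid R := by
  induction n generalizing R with
  | zero =>
    let := (isField_of_isRegularLocalRing (by simpa using hn)).toField
    infer_instance
  | succ n ih =>
    by_cases hf : IsField R
    · let := hf.toField
      infer_instance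
    have hm2 : ∃ x ∈ maximalIdeal R, x ∉ maximalIdeal R ^ 2 := by
      by_contra! h
      refine hf ?_
      rw [isField_iff_maximalIdeal_eq]
      exact Submodule.eq_bot_of_le_smul_of_le_jacobson_bot (maximalIdeal R) _
          (IsNoetherian.noetherian _) (by rw [smul_eq_mul, ← pow_two]; exact h)
          (jacobson_eq_maximalIdeal ⊥ bot_ne_top).ge
    obtain ⟨x, hx, hx2⟩ := hm2
    have hx0 : x ≠ 0 := fun h ↦ hx2 (h ▸ zero_mem _)
    obtain ⟨hreg, hdim⟩ := isRegularLocalRing_quotient hx hx2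
    have hdim1 : ringKrullDim (R ⧸ Ideal.span {x}) ≤ n := by
      rw [← hdim] at hn
      push_cast at hn
      exact (ENat.WithBot.add_le_add_one_right_iff).mp hn
    have hxp : Prime x := by
      have := isDomain_of_isRegularLocalRing n _ hdim1
      rw [← Ideal.span_singleton_prime hx0]
      exact (Ideal.Quotient.isDomain_iff_prime _).mp this
    refine UniqueFactorizationMonoid.of_forall_isPrincipal_of_height_eq_one fun p hp hph ↦ ?_
    by_cases hxmem : x ∈ p
    · exact ⟨x, Ideal.eq_span_singleton_of_height_eq_one hph hxmem hxp⟩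
    refine Ideal.isPrincipal_of_isPrincipal_localizationAway_of_prime hxp hxmem ?_
    let T := Localization.Away x
    have : IsDomain T := IsLocalization.Away.isDomain T hx0
    have : IsNoetherianRing T := IsLocalization.isNoetherianRing (.powers x) T inferInstance
    let I : Ideal T := p.map (algebraMap R T)
    have hinj : Function.Injective (algebraMap R T) :=
      IsLocalization.injective T (powers_le_nonZeroDivisors_of_noZeroDivisors hx0)
    have hI0 : I ≠ ⊥ := by
      rw [Ne, Ideal.map_eq_bot_iff_of_injective hinj]
      exact Ideal.ne_bot_of_height_eq_one hph
    have hloc : ∀ (P : Ideal T) [P.IsMaximal],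
        (I.map (algebraMap T (Localization.AtPrime P))).IsPrincipal := fun P _ ↦ by
      let L := Localization.AtPrime P
      let q : Ideal R := P.comap (algebraMap R T)
      have hqL : IsLocalization.AtPrime L q :=
        IsLocalization.isLocalization_isLocalization_atPrime_isLocalization (.powers x) L P
      have hqprime : q.IsPrime := inferInstance
      have : IsRegularRing L := isRegularRing_of_isLocalization q.primeCompl
      have : IsRegularLocalRing L := .of_isRegularRing_of_isLocalRing L
      have hxq : x ∉ q := fun h ↦ by
        have hu : IsUnit (algebraMap R T x) := IsLocalization.Away.algebraMap_isUnit x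
        exact (inferInstance : P.IsMaximal).ne_top (Ideal.eq_top_of_isUnit_mem _ h hu)
      -- After `x` is inverted no prime contracts to `𝔪`, so all local rings have smaller dimension.
      have hlt : q < maximalIdeal R :=
        lt_of_le_of_ne (le_maximalIdeal hqprime.ne_top) fun h ↦ hxq (h ▸ hx)
      have hdimL : ringKrullDim L ≤ n := by
        rw [IsLocalization.AtPrime.ringKrullDim_eq_height q L]
        have h1 := Ideal.height_add_one_le_of_lt_of_isPrime hlt
        have h2 : ((maximalIdeal R).height : WithBot ℕ∞) ≤ ((n + 1 : ℕ) : WithBot ℕ∞) := by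
          rw [maximalIdeal_height_eq_ringKrullDim]; exact hn
        have h3 : (maximalIdeal R).height ≤ ((n + 1 : ℕ) : ℕ∞) := by exact_mod_cast h2
        have h4 : q.height + 1 ≤ (n : ℕ∞) + 1 := by
          refine h1.trans (h3.trans ?_); push_cast; exact le_rfl
        have h5 : q.height ≤ (n : ℕ∞) := (ENat.add_le_add_iff_right ENat.one_ne_top).mp h4
        exact_mod_cast h5
      have : IsDomain L := IsLocalization.isDomain_of_atPrime L q
      have hufd : UniqueFactorizationMonoid L := ih L hdimL
      have hmap : I.map (algebraMap T L) = p.map (algebraMap R L) := by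
        rw [Ideal.map_map, ← IsScalarTower.algebraMap_eq]
      rw [hmap]
      by_cases hpq : p ≤ q
      · have hd : Disjoint (q.primeCompl : Set R) (p : Set R) :=
          Set.disjoint_left.mpr fun y hy hyp ↦ hy (hpq hyp)
        have := IsLocalization.isPrime_of_isPrime_disjoint q.primeCompl L p hp hd
        refine UniqueFactorizationMonoid.isPrincipal_of_height_eq_one ?_
        rw [← IsLocalization.height_under q.primeCompl,
          IsLocalization.under_map_of_isPrime_disjoint q.primeCompl L hp hd, hph]
      · obtain ⟨y, hy, hyq⟩ := Set.not_subset.mp hpq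
        have : p.map (algebraMap R L) = ⊤ := Ideal.eq_top_of_isUnit_mem _
          (Ideal.mem_map_of_mem _ hy) (IsLocalization.map_units L (⟨y, hyq⟩ : q.primeCompl))
        rw [this]
        exact ⟨1, by simp⟩
    have : Module.FinitePresentation T I := Module.finitePresentation_of_finite T I
    have hproj : Module.Projective T I := by
      refine Module.projective_of_localization_maximal' (fun P _ ↦ Localization.AtPrime P)
        (fun P _ ↦ I.map (algebraMap T (Localization.AtPrime P)))
        (fun P _ ↦ Algebra.idealMap (Localization.AtPrime P) I) fun P _ ↦ ?_
      obtain ⟨g, hg⟩ := hloc P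
      have : IsDomain (Localization.AtPrime P) :=
        IsLocalization.isDomain_of_atPrime (Localization.AtPrime P) P
      rw [hg]
      by_cases hg0 : g = 0
      · subst hg0
        rw [Submodule.span_zero_singleton]
        exact .of_free
      · exact .of_equiv (LinearEquiv.toSpanNonzeroSingleton _ _ g hg0)
    obtain ⟨m, hm⟩ : ∃ m : ℕ, ringKrullDim R = m :=
      ⟨_, (IsRegularLocalRing.spanFinrank_maximalIdeal (R := R)).symm⟩
    have hst : Module.IsStablyFree T I :=
      (hasFreeSyzygies_of_isRegularLocalRing m R hm p).isStablyFree (.powers x) m p I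
        (Algebra.idealMap T p)
    have hinv := invertible_of_projective_ideal I hI0
    have hfree := Module.free_of_isStablyFree_of_invertible T I
    obtain ⟨e⟩ := Module.Invertible.free_iff_linearEquiv.mp hfree
    refine ⟨e.symm 1, le_antisymm (fun y hy ↦ ?_) ?_⟩
    · rw [Submodule.mem_span_singleton]
      refine ⟨e ⟨y, hy⟩, ?_⟩
      rw [← SetLike.val_smul, ← map_smul, smul_eq_mul, mul_one, e.symm_apply_apply]
    · exact (Submodule.span_singleton_le_iff_mem _ _).mpr (e.symm 1).2

end Factorial

end LagrangianSpecialization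

namespace LagrangianSpecialization

/-! ### Smooth algebras over regular rings are regular. -/

section Regular

/-- Unramifiedness makes the maximal ideal downstairs generate the one upstairs, so the number of
generators does not grow. Flatness gives going down, so the height does not drop. -/
theorem isRegularRing_of_etale (P S : Type u) [CommRing P] [CommRing S] [Algebra P S]
    [Algebra.Etale P S] [IsRegularRing P] : IsRegularRing S := by
  have : IsNoetherianRing S := Algebra.FiniteType.isNoetherianRing P S
  have : Module.Flat P S := Algebra.Smooth.flat P S
  rw [isRegularRing_iff]
  intro q _
  let p : Ideal P := q.under P
  have : q.LiesOver p := ⟨rfl⟩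
  let := Localization.AtPrime.algebraOfLiesOver p q
  have hmax := ((Algebra.isUnramifiedAt_iff_map_eq P p q).mp inferInstance).2
  rw [IsScalarTower.algebraMap_eq P (Localization.AtPrime p), ← Ideal.map_map,
    Localization.AtPrime.map_eq_maximalIdeal] at hmax
  refine .of_spanFinrank_maximalIdeal_le _ ?_
  rw [← hmax]
  have h1 := Ideal.spanFinrank_map_le_of_fg
    (algebraMap (Localization.AtPrime p) (Localization.AtPrime q))
    (IsNoetherian.noetherian (maximalIdeal (Localization.AtPrime p)))
  have h2 : p.height ≤ q.height := by
    rw [Ideal.height_eq_height_add_of_liesOver_of_hasGoingDown p q]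
    exact le_self_add
  have h3 : ((maximalIdeal (Localization.AtPrime p)).spanFinrank : WithBot ℕ∞) =
      ringKrullDim (Localization.AtPrime p) := IsRegularLocalRing.spanFinrank_maximalIdeal (R := Localization.AtPrime p)
  rw [IsLocalization.AtPrime.ringKrullDim_eq_height p (Localization.AtPrime p)] at h3
  rw [IsLocalization.AtPrime.ringKrullDim_eq_height q (Localization.AtPrime q)]
  refine le_trans (b := ((p.height : ℕ∞) : WithBot ℕ∞)) ?_ (by exact_mod_cast h2)
  rw [← h3]
  exact_mod_cast h1

theorem isRegularRing_of_smooth (P S : Type u) [CommRing P] [CommRing S] [Algebra P S]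
    [Algebra.Smooth P S] [IsRegularRing P] : IsRegularRing S := by
  have : IsNoetherianRing S := Algebra.FiniteType.isNoetherianRing P S
  rw [isRegularRing_iff]
  intro q _
  obtain ⟨g, hg, hstd⟩ := Algebra.IsSmoothAt.exists_notMem_isStandardSmooth P q
  obtain ⟨n, φ, hφ, het⟩ := RingHom.IsStandardSmooth.exists_etale_mvPolynomial
    (f := algebraMap P (Localization.Away g)) (by simpa [RingHom.isStandardSmooth_algebraMap])
  algebraize [φ]
  have : IsRegularRing (Localization.Away g) :=
    isRegularRing_of_etale (MvPolynomial (Fin n) P) (Localization.Away g)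
  have hd : Disjoint (Submonoid.powers g : Set S) (q : Set S) := by
    rw [Set.disjoint_left]
    rintro _ ⟨m, rfl⟩ hm
    exact hg (Ideal.IsPrime.mem_of_pow_mem inferInstance m hm)
  let Q := q.map (algebraMap S (Localization.Away g))
  have hQ : Q.IsPrime := IsLocalization.isPrime_of_isPrime_disjoint (.powers g) _ _ ‹_› hd
  have hQq : Q.comap (algebraMap S _) = q :=
    IsLocalization.under_map_of_isPrime_disjoint (.powers g) _ ‹_› hd
  have := IsLocalization.isLocalization_isLocalization_atPrime_isLocalization (.powers g)
    (Localization.AtPrime Q) Q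
  simp only [hQq] at this
  exact IsRegularLocalRing.of_ringEquiv
    (IsLocalization.algEquiv q.primeCompl (Localization.AtPrime Q)
      (Localization.AtPrime q)).toRingEquiv

theorem uniqueFactorizationMonoid_localization_of_smooth {k B : Type u} [Field k] [CommRing B] [IsDomain B] [Algebra k B]
    [Algebra.Smooth k B] (p : Ideal B) [p.IsPrime] :
    UniqueFactorizationMonoid (Localization.AtPrime p) := by
  have : IsRegularRing B := isRegularRing_of_smooth k B
  have : IsRegularRing (Localization.AtPrime p) := isRegularRing_of_isLocalization p.primeCompl
  have : IsDomain (Localization.AtPrime p) := IsLocalization.isDomain_of_atPrime _ p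
  obtain ⟨m, hm⟩ : ∃ m : ℕ, ringKrullDim (Localization.AtPrime p) = m :=
      ⟨_, (IsRegularLocalRing.spanFinrank_maximalIdeal (R := Localization.AtPrime p)).symm⟩
  exact uniqueFactorizationMonoid_of_isRegularLocalRing m _ hm.le

end Regular

end LagrangianSpecialization

namespace LagrangianSpecialization

/-! ### Derivations and divisorial valuations in characteristic zero. -/

section LogarithmicDerivation

open Polynomial

/-- The localization of `D` at the center of `V` is a discrete valuation ring with uniformizer ϖ; it
already contains all of `V`, which is the first claim. If `c` has order `i` and `τ` has order `j`,
then `c ^ j` and `τ ^ i` are both associated to ϖ^(ij), which is the second. -/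
lemma exists_eq_div_of_isDedekindDomain {D K : Type*} [CommRing D] [IsDedekindDomain D] [Field K]
    [Algebra D K] [IsFractionRing D K] (V : ValuationSubring K)
    (hD : ∀ d, algebraMap D K d ∈ V) {τ : D} (hτ0 : τ ≠ 0) (hτ : V.valuation (algebraMap D K τ) < 1) :
    (∀ a ∈ V, ∃ c s : D, V.valuation (algebraMap D K s) = 1 ∧
      a * algebraMap D K s = algebraMap D K c) ∧
    ∀ c : D, c ≠ 0 → ∃ (i j : ℕ) (s s' : D), j ≠ 0 ∧ V.valuation (algebraMap D K s) = 1 ∧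
      V.valuation (algebraMap D K s') = 1 ∧ s * c ^ j = s' * τ ^ i := by
  let φ : D →+* V := (algebraMap D K).codRestrict V.toSubring hD
  let n : Ideal D := (maximalIdeal V).comap φ
  have hle (d : D) : V.valuation (algebraMap D K d) ≤ 1 := (V.valuation_le_one_iff _).mpr (hD d)
  have hmem (d : D) : d ∈ n ↔ V.valuation (algebraMap D K d) < 1 := by
    rw [Ideal.mem_comap, ← V.mem_nonunits_iff, ← V.coe_mem_nonunits_iff]; rfl
  have hnmem (d : D) : d ∉ n ↔ V.valuation (algebraMap D K d) = 1 := by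
    rw [hmem, not_lt]; exact ⟨fun h ↦ le_antisymm (hle d) h, fun h ↦ h.ge⟩
  have hn : n.IsPrime := inferInstance
  have hn0 : n ≠ ⊥ := fun h ↦ hτ0 <| by
    have : τ ∈ n := (hmem τ).mpr hτ
    rwa [h, Ideal.mem_bot] at this
  let L := Localization.AtPrime n
  have : IsDiscreteValuationRing L :=
    IsLocalization.AtPrime.isDiscreteValuationRing_of_dedekind_domain D hn0 L
  have hinj : Function.Injective (algebraMap D L) :=
    IsLocalization.injective L n.primeCompl_le_nonZeroDivisors
  have hdvd (x y : D) (h : algebraMap D L x ∣ algebraMap D L y) :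
      ∃ c s : D, s ∉ n ∧ y * s = x * c := by
    obtain ⟨z, hz⟩ := h
    obtain ⟨c, s, rfl⟩ := IsLocalization.exists_mk'_eq n.primeCompl z
    refine ⟨c, s, s.2, hinj ?_⟩
    rw [map_mul, map_mul, hz, mul_assoc, IsLocalization.mk'_spec]
  have hDK : Function.Injective (algebraMap D K) := IsFractionRing.injective D K
  refine ⟨fun a ha ↦ ?_, fun c hc ↦ ?_⟩
  · obtain ⟨x, y, hy, rfl⟩ := IsFractionRing.div_surjective (A := D) a
    have hy0 : algebraMap D K y ≠ 0 := by
      rw [Ne, map_eq_zero_iff _ hDK]; exact nonZeroDivisors.ne_zero hy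
    rcases ValuationRing.dvd_total (algebraMap D L x) (algebraMap D L y) with h | h
    · obtain ⟨c, s, hs, hcs⟩ := hdvd _ _ h
      have hcs' := congrArg (algebraMap D K) hcs
      rw [map_mul, map_mul] at hcs'
      have hs0 : algebraMap D K s ≠ 0 := by
        rw [Ne, map_eq_zero_iff _ hDK]; rintro rfl; exact hs n.zero_mem
      refine ⟨s, c, ?_, ?_⟩
      · refine le_antisymm (hle c) ?_
        have h1 : algebraMap D K x / algebraMap D K y * algebraMap D K c = algebraMap D K s := by
          rw [div_mul_eq_mul_div, ← hcs', mul_div_cancel_left₀ _ hy0]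
        rw [← (hnmem s).mp hs, ← h1, map_mul]
        exact mul_le_of_le_one_left' ((V.valuation_le_one_iff _).mpr ha)
      · rw [div_mul_eq_mul_div, ← hcs', mul_div_cancel_left₀ _ hy0]
    · obtain ⟨c, s, hs, hcs⟩ := hdvd _ _ h
      have hcs' := congrArg (algebraMap D K) hcs
      rw [map_mul, map_mul] at hcs'
      refine ⟨c, s, (hnmem s).mp hs, ?_⟩
      rw [div_mul_eq_mul_div, hcs', mul_div_cancel_left₀ _ hy0]
  · obtain ⟨ϖ, hϖ⟩ := IsDiscreteValuationRing.exists_irreducible L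
    have hc' : algebraMap D L c ≠ 0 := by rwa [Ne, map_eq_zero_iff _ hinj]
    have hτ' : algebraMap D L τ ≠ 0 := by rwa [Ne, map_eq_zero_iff _ hinj]
    obtain ⟨i, hi⟩ := IsDiscreteValuationRing.associated_pow_irreducible hc' hϖ
    obtain ⟨j, hj⟩ := IsDiscreteValuationRing.associated_pow_irreducible hτ' hϖ
    have hj0 : j ≠ 0 := by
      rintro rfl
      rw [pow_zero, associated_one_iff_isUnit, IsLocalization.AtPrime.isUnit_to_map_iff L n] at hj
      exact hj ((hmem τ).mpr hτ)
    have hass : Associated (algebraMap D L (c ^ j)) (algebraMap D L (τ ^ i)) := by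
      rw [map_pow, map_pow]
      refine (hi.pow_pow (n := j)).trans ?_
      rw [← pow_mul, mul_comm, pow_mul]
      exact (hj.pow_pow (n := i)).symm
    obtain ⟨s', s, hs, hss⟩ := hdvd _ _ hass.symm.dvd
    obtain ⟨a, b, hb, hab⟩ := hdvd _ _ hass.dvd
    have hs' : s' ∉ n := fun h ↦ by
      have hc0 : c ^ j ≠ 0 := pow_ne_zero _ hc
      have : s * b = s' * a := mul_left_cancel₀ hc0 <| by
        linear_combination b * hss + s' * hab
      exact (hn.mul_notMem hs hb) (this ▸ n.mul_mem_right _ h)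
    exact ⟨i, j, s, s', hj0, (hnmem s).mp hs, (hnmem s').mp hs', by linear_combination hss⟩

/-- Up to a unit `u`, a positive power of a nonzero element `a` of the maximal ideal is a power of
the parameter τ = X, which δ kills. Differentiating a^j = u τ^i gives δ a = a δ u / (j u), so it is
enough that δ maps `V` to `V`. For this, Nakayama is applied to a finitely generated module that
contains δ(V): the residues of the integral closure of `E[X]` are separable over `E`, and this
controls the derivatives modulo the maximal ideal. -/
theorem derivation_mem_valuationSubring {E K : Type*} [Field E] [CharZero E] [Field K] [Algebra E K]
    [Algebra E[X] K] [IsScalarTower E E[X] K] [FaithfulSMul E[X] K] [Algebra.IsAlgebraic E[X] K]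
    [Algebra.EssFiniteType E K] (V : ValuationSubring K) (hE : ∀ e, algebraMap E K e ∈ V)
    (hX : V.valuation (algebraMap E[X] K X) < 1) (δ : Derivation ℤ K K)
    (hδX : δ (algebraMap E[X] K X) = 0)
    (hδE : ∀ e, δ (algebraMap E K e) ∈ V) :
    ∀ a, V.valuation a < 1 → V.valuation (δ a) < 1 := by
  let F := FractionRing E[X]
  let : Algebra F K := FractionRing.liftAlgebra E[X] K
  have : IsScalarTower E[X] F K := FractionRing.isScalarTower_liftAlgebra E[X] K
  have : IsScalarTower E F K := .to₁₃₄ E E[X] F K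
  have : Algebra.EssFiniteType F K := .of_comp E F K
  have : Algebra.IsAlgebraic F K := IsFractionRing.comap_isAlgebraic_iff (A := E[X]).mp inferInstance
  have : FiniteDimensional F K := Algebra.finite_of_essFiniteType_of_isAlgebraic
  have : CharZero F := charZero_of_injective_algebraMap (algebraMap E F).injective
  let D := integralClosure E[X] K
  have : IsDedekindDomain D := integralClosure.isDedekindDomain E[X] F K
  have : Module.Finite E[X] D := IsIntegralClosure.finite E[X] F K D
  have : IsFractionRing D K := IsIntegralClosure.isFractionRing_of_finite_extension E[X] F K D
  set τ : K := algebraMap E[X] K X with hτ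
  have hle {x : K} : x ∈ V ↔ V.valuation x ≤ 1 := (V.valuation_le_one_iff x).symm
  have hP (p : E[X]) : algebraMap E[X] K p ∈ V ∧ δ (algebraMap E[X] K p) ∈ V := by
    have hC (e : E) : algebraMap E[X] K (C e) = algebraMap E K e :=
      (IsScalarTower.algebraMap_apply E E[X] K e).symm
    have hXn (n : ℕ) : δ (τ ^ n) = 0 := by rw [Derivation.leibniz_pow, hδX]; simp
    have hτV : τ ∈ V := hle.mpr hX.le
    induction p using Polynomial.induction_on' with
    | add p q hp hq =>
      rw [map_add, map_add]
      exact ⟨add_mem hp.1 hq.1, add_mem hp.2 hq.2⟩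
    | monomial n e =>
      rw [← C_mul_X_pow_eq_monomial, map_mul, map_pow, hC, ← hτ, Derivation.leibniz, hXn, smul_zero,
        zero_add, smul_eq_mul]
      exact ⟨mul_mem (hE e) (pow_mem hτV n), mul_mem (pow_mem hτV n) (hδE e)⟩
  have hD (d : D) : (d : K) ∈ V := by
    let φ : E[X] →+* V := (algebraMap E[X] K).codRestrict V.toSubring fun p ↦ (hP p).1
    have : IsIntegral V (d : K) := IsIntegral.map_of_comp_eq (a := (d : K)) φ (RingHom.id K)
      rfl d.2
    obtain ⟨y, hy⟩ := IsIntegrallyClosed.isIntegral_iff.mp this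
    exact hy ▸ y.2
  have hτ0 : τ ≠ 0 := by
    rw [hτ, Ne, map_eq_zero_iff _ (FaithfulSMul.algebraMap_injective E[X] K)]; exact X_ne_zero
  let τ' : D := algebraMap E[X] D X
  have hτ'0 : τ' ≠ 0 := fun h ↦ hτ0 (congrArg Subtype.val h)
  obtain ⟨hfrac, hpow⟩ := exists_eq_div_of_isDedekindDomain V hD hτ'0 hX
  have hne {x : K} (hx : V.valuation x = 1) : x ≠ 0 := by rintro rfl; simp at hx
  have hEunit (e : E) (he : e ≠ 0) : V.valuation (algebraMap E K e) = 1 := by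
    refine le_antisymm (hle.mp (hE e)) ?_
    have := hle.mp (hE e⁻¹)
    rw [map_inv₀, map_inv₀] at this
    refine (inv_le_one₀ ?_).mp this
    rw [zero_lt_iff, Ne, map_eq_zero, map_eq_zero]
    exact he
  have hlog (a : K) (ha : V.valuation a < 1) : ∃ r u : K, V.valuation r < 1 ∧ u ∈ V ∧
      δ a = r * δ u ∧ V.valuation r = V.valuation a := by
    by_cases ha0 : a = 0
    · exact ⟨0, 0, by simp, zero_mem V, by simp [ha0], by simp [ha0]⟩
    obtain ⟨c, s, hs, hc⟩ := hfrac a (hle.mpr ha.le)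
    have hc0 : c ≠ 0 := by
      rintro rfl
      rw [map_zero, mul_eq_zero] at hc
      exact hc.elim ha0 (hne hs)
    obtain ⟨i, j, s₁, s₂, hj, h₁, h₂, h⟩ := hpow c hc0
    have h' := congrArg (algebraMap D K) h
    rw [map_mul, map_mul, map_pow, map_pow, ← hc] at h'
    have hτ'' : algebraMap D K τ' = τ := rfl
    rw [hτ''] at h'
    set σ := algebraMap D K s
    set σ₁ := algebraMap D K s₁
    set σ₂ := algebraMap D K s₂
    let u : K := σ₂ / (σ₁ * σ ^ j)
    have hu : V.valuation u = 1 := by simp [u, hs, h₁, h₂]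
    have hau : a ^ j = u * τ ^ i := by
      have := hne hs; have := hne h₁
      simp only [u]
      field_simp
      linear_combination h'
    -- Characteristic zero enters here: the exponent is a nonzero constant, hence a unit of `V`.
    have hj1 : V.valuation (j : K) = 1 := by
      rw [← map_natCast (algebraMap E K)]
      exact hEunit _ (by exact_mod_cast hj)
    refine ⟨a / (j * u), u, ?_, hle.mpr hu.le, ?_, ?_⟩
    · simpa [hu, hj1] using ha
    · have h3 := congrArg δ hau
      rw [Derivation.leibniz, Derivation.leibniz_pow, Derivation.leibniz_pow, hδX] at h3
      simp only [smul_zero, nsmul_eq_mul, smul_eq_mul, zero_add, mul_zero] at h3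
      have hju : (j : K) * u ≠ 0 := mul_ne_zero (hne hj1) (hne hu)
      rw [div_mul_eq_mul_div, eq_div_iff hju]
      refine mul_right_cancel₀ (pow_ne_zero i hτ0) ?_
      have h4 : a ^ j = a ^ (j - 1) * a := by rw [← pow_succ, Nat.sub_add_cancel (by omega)]
      calc δ a * (j * u) * τ ^ i = j * (u * τ ^ i) * δ a := by ring
        _ = a * (j * (a ^ (j - 1) * δ a)) := by rw [← hau, h4]; ring
        _ = a * δ u * τ ^ i := by rw [h3]; ring
    · simp [hu, hj1]
  obtain ⟨T, hT⟩ := Module.Finite.fg_top (R := E[X]) (M := D)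
  -- A finitely generated substitute for `V + δ(V)`; the aim is to show that it equals `V`.
  let M : Submodule V K := Submodule.span V (insert 1 ((fun d : D ↦ δ (d : K)) '' T))
  have h1M : (1 : K) ∈ M := Submodule.subset_span (Set.mem_insert _ _)
  have hVM {a : K} (ha : a ∈ V) : a ∈ M := by
    simpa [Algebra.smul_def] using M.smul_mem (⟨a, ha⟩ : V) h1M
  have hsmul {a b : K} (ha : a ∈ V) (hb : b ∈ M) : a * b ∈ M := M.smul_mem (⟨a, ha⟩ : V) hb
  have hδD (d : D) : δ (d : K) ∈ M := by
    have hd : d ∈ Submodule.span E[X] (T : Set D) := hT ▸ Submodule.mem_top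
    induction hd using Submodule.span_induction with
    | mem x hx => exact Submodule.subset_span (Set.mem_insert_of_mem _ ⟨x, hx, rfl⟩)
    | zero => simp
    | add x y _ _ hx hy =>
      rw [AddMemClass.coe_add, map_add]; exact add_mem hx hy
    | smul p x _ hx =>
      have : ((p • x : D) : K) = algebraMap E[X] K p * x := Algebra.smul_def p (x : K)
      rw [this, Derivation.leibniz, smul_eq_mul, smul_eq_mul]
      exact add_mem (hsmul (hP p).1 hx) (hVM (mul_mem (hD x) (hP p).2))
  have hδV {a : K} (ha : a ∈ V) : δ a ∈ M := by
    obtain ⟨c, s, hs, hc⟩ := hfrac a ha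
    have h3 := congrArg δ hc
    rw [Derivation.leibniz, smul_eq_mul, smul_eq_mul] at h3
    have hs0 := hne hs
    have h4 : δ a = (algebraMap D K s)⁻¹ * (δ (algebraMap D K c) - a * δ (algebraMap D K s)) := by
      rw [← h3]; field_simp; ring
    rw [h4]
    refine hsmul (hle.mpr (by rw [map_inv₀, hs, inv_one])) (sub_mem (hδD c) (hsmul ha (hδD s)))
  have hmul {r b : K} (hr : V.valuation r < 1) (hb : b ∈ M) : r * b ∈ maximalIdeal V • M := by
    obtain ⟨hrV, hr'⟩ := V.mem_nonunits_iff_exists_mem_maximalIdeal.mp (V.mem_nonunits_iff.mpr hr)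
    exact Submodule.smul_mem_smul hr' hb
  have hδm {a : K} (ha : V.valuation a < 1) : δ a ∈ maximalIdeal V • M := by
    obtain ⟨r, u, hr, hu, h, -⟩ := hlog a ha
    rw [h]
    exact hmul hr (hδV hu)
  -- Let `P` be the minimal polynomial over `E` of the residue of `d`. Then P(d) lies in the maximal
  -- ideal and P'(d) is a unit. The chain rule expresses P'(d) δ d by δ(P(d)), which lies in `𝔪 M`,
  -- and by derivatives of the coefficients, which lie in `V`.
  have hle1 : M ≤ 1 ⊔ maximalIdeal V • M := by
    let N : Submodule V K := 1 ⊔ maximalIdeal V • M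
    have h1N {a : K} (ha : a ∈ V) : a ∈ N :=
      Submodule.mem_sup_left (Submodule.mem_one.mpr ⟨⟨a, ha⟩, rfl⟩)
    let φ : E →+* V := (algebraMap E K).codRestrict V.toSubring hE
    let : Algebra E V := φ.toAlgebra
    have : IsScalarTower E V K := .of_algebraMap_eq fun _ ↦ rfl
    refine Submodule.span_le.mpr (Set.insert_subset (h1N (one_mem V)) ?_)
    rintro _ ⟨d, -, rfl⟩
    let d' : V := ⟨d, hD d⟩
    have hint : IsIntegral E (residue V d') := by
      obtain ⟨f, hf, hfd⟩ := d.2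
      -- `X` becomes zero in the residue field, so an integral equation over `E[X]` specializes at
      -- `X = 0` to one over `E`.
      refine ⟨f.map (evalRingHom 0), hf.map _, ?_⟩
      let ψ : E[X] →+* V := (algebraMap E[X] K).codRestrict V.toSubring fun p ↦ (hP p).1
      have h5 : eval₂ ψ d' f = 0 := by
        refine Subtype.val_injective (?_ : V.subtype _ = V.subtype 0)
        rw [hom_eval₂, map_zero]
        exact hfd
      have h6 := congrArg (residue V) h5
      rw [hom_eval₂, map_zero] at h6
      rw [eval₂_map, ← h6]
      congr 1
      refine Polynomial.ringHom_ext (fun e ↦ ?_) ?_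
      · rw [RingHom.comp_apply, RingHom.comp_apply, coe_evalRingHom, eval_C,
          IsScalarTower.algebraMap_apply E V (ResidueField V)]
        congr 1
        refine Subtype.ext ?_
        exact IsScalarTower.algebraMap_apply E E[X] K e
      · rw [RingHom.comp_apply, RingHom.comp_apply, coe_evalRingHom, eval_X, map_zero, eq_comm,
          residue_eq_zero_iff]
        exact V.coe_mem_nonunits_iff.mp (V.mem_nonunits_iff.mpr hX)
    let P := minpoly E (residue V d')
    have hsep : P.Separable := (minpoly.irreducible hint).separable
    have hres (Q : E[X]) : residue V (aeval d' Q) = aeval (residue V d') Q := by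
      rw [← IsLocalRing.ResidueField.algebraMap_eq, aeval_algebraMap_apply]
    have hcoe (Q : E[X]) : ((aeval d' Q : V) : K) = aeval (d : K) Q :=
      (aeval_algebraMap_apply K d' Q).symm
    have hP0 : V.valuation (aeval (d : K) P) < 1 := by
      rw [← hcoe, ← V.mem_nonunits_iff, V.coe_mem_nonunits_iff, ← residue_eq_zero_iff, hres]
      exact minpoly.aeval E _
    have hP1 : V.valuation (aeval (d : K) (derivative P)) = 1 := by
      refine le_antisymm (hle.mp (hcoe _ ▸ (aeval d' _ : V).2)) ?_
      rw [← not_lt, ← hcoe, ← V.mem_nonunits_iff, V.coe_mem_nonunits_iff, ← residue_eq_zero_iff,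
        hres]
      exact hsep.aeval_derivative_ne_zero (minpoly.aeval E _)
    have hchain (Q : E[X]) : δ (aeval (d : K) Q) - aeval (d : K) (derivative Q) * δ d ∈ V := by
      induction Q using Polynomial.induction_on' with
      | add p q hp hq =>
        simp only [map_add, add_mul]
        convert! add_mem hp hq using 1
        ring
      | monomial n e =>
        rw [derivative_monomial, ← C_mul_X_pow_eq_monomial, ← C_mul_X_pow_eq_monomial]
        simp only [map_mul, map_pow, aeval_X, aeval_C, Derivation.leibniz, Derivation.leibniz_pow,
          smul_eq_mul, nsmul_eq_mul, map_natCast]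
        convert! mul_mem (pow_mem (hD d) n) (hδE e) using 1
        ring
    have hδd : δ (d : K) = (aeval (d : K) (derivative P))⁻¹ *
        (δ (aeval (d : K) P) - (δ (aeval (d : K) P) - aeval (d : K) (derivative P) * δ d)) := by
      have := hne hP1
      field_simp; ring
    have hinv : (aeval (d : K) (derivative P))⁻¹ ∈ V := hle.mpr (by simp [hP1])
    change δ (d : K) ∈ N
    rw [hδd]
    exact N.smul_mem (⟨_, hinv⟩ : V)
      (sub_mem (Submodule.mem_sup_right (hδm hP0)) (h1N (hchain P)))
  have hM1 : M ≤ 1 := Submodule.le_of_le_smul_of_le_jacobson_bot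
    (Submodule.fg_span ((T.finite_toSet.image _).insert _)) (jacobson_eq_maximalIdeal ⊥ bot_ne_top).ge
    hle1
  intro a ha
  obtain ⟨r, u, hr, hu, h, -⟩ := hlog a ha
  obtain ⟨y, hy⟩ := Submodule.mem_one.mp (hM1 (hδV hu))
  rw [h, map_mul]
  have : V.valuation (δ u) ≤ 1 := hle.mp (hy ▸ y.2)
  exact mul_lt_one_of_lt_of_le hr this

end LogarithmicDerivation

end LagrangianSpecialization

namespace LagrangianSpecialization

/-! ### Algebraic independence of the coordinates of a divisor and its parameter. -/

section Transcendence

open Polynomial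

/-- A prime of `R` in the same fiber over `C` as `P` contains τ, hence some minimal prime over τ.
Away from the other components of V(τ) that minimal prime is `P`, and quasi-finiteness of `R/P` then
leaves only `P` itself. So `C → R` is quasi-finite at `P`, and Zariski's main theorem writes every
element of `R` as a fraction of integral ones. -/
lemma isAlgebraic_of_mem_minimalPrimes_span_singleton {C R : Type u} [CommRing C] [IsDomain C]
    [CommRing R] [IsDomain R] [IsNoetherianRing R] [Algebra C R] [Algebra.FiniteType C R]
    (P : Ideal R) [P.IsPrime] (τ : C) (hP : P ∈ (Ideal.span {algebraMap C R τ}).minimalPrimes)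
    [Algebra.QuasiFinite C (R ⧸ P)] : Algebra.IsAlgebraic C R := by
  let q : PrimeSpectrum R := ⟨P, inferInstance⟩
  have hτP : algebraMap C R τ ∈ P := (Ideal.span_singleton_le_iff_mem _).mp hP.1.2
  have : Algebra.QuasiFiniteAt C P := by
    refine (Algebra.quasiFiniteAt_iff_isOpen_singleton_fiber q).mpr ?_
    have hfin := Ideal.finite_minimalPrimes_of_isNoetherianRing R (Ideal.span {algebraMap C R τ})
    refine isOpen_induced_iff.mpr
      ⟨⋂ Q ∈ (Ideal.span {algebraMap C R τ}).minimalPrimes \ {P},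
        (PrimeSpectrum.zeroLocus (Q : Set R))ᶜ, ?_, ?_⟩
    · exact (hfin.subset Set.sdiff_subset).isOpen_biInter fun Q _ ↦
        (PrimeSpectrum.isClosed_zeroLocus _).isOpen_compl
    · ext ⟨y, hy⟩
      simp only [Set.mem_preimage, Set.mem_iInter, Set.mem_compl_iff, PrimeSpectrum.mem_zeroLocus,
        SetLike.coe_subset_coe, Set.mem_singleton_iff]
      constructor
      · intro h
        have hy' : y.asIdeal.comap (algebraMap C R) = P.comap (algebraMap C R) :=
          congrArg PrimeSpectrum.asIdeal hy
        have hτy : algebraMap C R τ ∈ y.asIdeal := by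
          rw [← Ideal.mem_comap, hy', Ideal.mem_comap]; exact hτP
        obtain ⟨Q, hQ, hQy⟩ := Ideal.exists_minimalPrimes_le
          ((Ideal.span_singleton_le_iff_mem _).mpr hτy)
        have hQP : Q = P := by
          by_contra hne
          exact h Q ⟨hQ, hne⟩ hQy
        rw [hQP] at hQy
        have h1 : (⊥ : Ideal (R ⧸ P)) = y.asIdeal.map (Ideal.Quotient.mk P) := by
          have hc : (y.asIdeal.map (Ideal.Quotient.mk P)).comap (Ideal.Quotient.mk P) =
              y.asIdeal := by
            rw [Ideal.comap_map_of_surjective _ Ideal.Quotient.mk_surjective,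
              ← RingHom.ker_eq_comap_bot, Ideal.mk_ker, sup_eq_left.mpr hQy]
          have : (y.asIdeal.map (Ideal.Quotient.mk P)).IsPrime :=
            Ideal.map_isPrime_of_surjective Ideal.Quotient.mk_surjective (by rwa [Ideal.mk_ker])
          refine Algebra.QuasiFinite.eq_of_le_of_under_eq (R := C) _ _ bot_le ?_
          ext c
          rw [Ideal.mem_comap, Ideal.mem_comap, Ideal.mem_bot,
            IsScalarTower.algebraMap_apply C R (R ⧸ P), Ideal.Quotient.algebraMap_eq,
            Ideal.Quotient.eq_zero_iff_mem, ← Ideal.mem_comap (f := Ideal.Quotient.mk P), hc,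
            ← Ideal.mem_comap (f := algebraMap C R), ← Ideal.mem_comap (f := algebraMap C R), hy']
        ext r
        have h2 : r ∈ P ↔ r ∈ y.asIdeal := by
          refine ⟨fun h ↦ hQy h, fun h ↦ ?_⟩
          have := Ideal.mem_map_of_mem (Ideal.Quotient.mk P) h
          rwa [← h1, Ideal.mem_bot, Ideal.Quotient.eq_zero_iff_mem] at this
        exact h2.symm
      · intro h Q ⟨hQ, hne⟩ hle
        obtain rfl : y = q := congrArg Subtype.val h
        exact hne (le_antisymm hle (hP.2 hQ.1 hle))
  obtain ⟨r, hr, hri, H⟩ := Algebra.zariskisMainProperty_iff.mp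
    (Algebra.ZariskisMainProperty.of_finiteType (R := C) P)
  have hr0 : r ≠ 0 := fun h ↦ hr (h ▸ P.zero_mem)
  refine ⟨fun x ↦ ?_⟩
  obtain ⟨m, hm⟩ := H x
  have : Nontrivial C := inferInstance
  exact IsAlgebraic.of_mul (mem_nonZeroDivisors_of_ne_zero (pow_ne_zero m hr0))
    (hri.pow m).isAlgebraic hm.isAlgebraic

/-- If `x < p` are primes with nothing in between, and `B / p` is étale over a polynomial ring `C`,
then `C` and an element `τ ∈ p \ x` are algebraically independent in `B / x`. -/
lemma faithfulSMul_and_isAlgebraic_polynomial {C R : Type u} [CommRing C] [IsDomain C]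
    [IsNoetherianRing C] [CommRing R] [IsDomain R] [Algebra C R] [Algebra.FiniteType C R]
    [Algebra C[X] R] [IsScalarTower C C[X] R]
    (P : Ideal R) [P.IsPrime] (hP : ∀ Q : Ideal R, Q.IsPrime → Q ≤ P → Q = ⊥ ∨ Q = P)
    [Algebra.QuasiFinite C (R ⧸ P)] [FaithfulSMul C (R ⧸ P)]
    (hτ : algebraMap C[X] R X ∈ P) (hτ0 : algebraMap C[X] R X ≠ 0) :
    FaithfulSMul C[X] R ∧ Algebra.IsAlgebraic C[X] R := by
  have : IsNoetherianRing R := Algebra.FiniteType.isNoetherianRing C R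
  have : Algebra.FiniteType C[X] R := .of_restrictScalars_finiteType C C[X] R
  have : Algebra.QuasiFinite C[X] (R ⧸ P) := .of_restrictScalars C C[X] (R ⧸ P)
  constructor
  · rw [faithfulSMul_iff_algebraMap_injective, injective_iff_map_eq_zero]
    intro f hf
    -- Modulo `P` a relation f(τ) = 0 reduces to its constant term, which vanishes because `C`
    -- embeds in `R/P`. Dividing by τ and repeating shows that `f` is divisible by every power of
    -- `X`.
    have key (n : ℕ) : ∀ f : C[X], algebraMap C[X] R f = 0 → X ^ n ∣ f := by
      induction n with
      | zero => exact fun f _ ↦ by simp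
      | succ n ih =>
        intro f hf
        have h0 : f.coeff 0 = 0 := by
          refine FaithfulSMul.algebraMap_injective C (R ⧸ P) ?_
          rw [map_zero, IsScalarTower.algebraMap_apply C R, Ideal.Quotient.algebraMap_eq,
            Ideal.Quotient.eq_zero_iff_mem]
          rw [← X_mul_divX_add f, map_add, map_mul, ← algebraMap_eq,
            ← IsScalarTower.algebraMap_apply] at hf
          rw [eq_neg_of_add_eq_zero_right hf]
          exact neg_mem (P.mul_mem_right _ hτ)
        have hfX : f = X * f.divX := by
          conv_lhs => rw [← X_mul_divX_add f, h0, map_zero, add_zero]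
        have h1 : algebraMap C[X] R f.divX = 0 := by
          rw [hfX, map_mul] at hf
          exact (mul_eq_zero.mp hf).resolve_left hτ0
        rw [hfX, pow_succ']
        exact mul_dvd_mul_left _ (ih _ h1)
    by_contra hf0
    have := X_pow_dvd_iff.mp (key (f.natDegree + 1) f hf) f.natDegree (Nat.lt_succ_self _)
    exact hf0 (leadingCoeff_eq_zero.mp this)
  · refine isAlgebraic_of_mem_minimalPrimes_span_singleton P (X : C[X])
      ⟨⟨inferInstance, (Ideal.span_singleton_le_iff_mem _).mpr hτ⟩, fun Q hQ hle ↦ ?_⟩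
    have hτQ := (Ideal.span_singleton_le_iff_mem _).mp hQ.2
    rcases hP Q hQ.1 hle with rfl | rfl
    · exact (hτ0 hτQ).elim
    · exact le_rfl

end Transcendence

end LagrangianSpecialization

namespace LagrangianSpecialization

/-! ### Logarithmic derivations dual to the coordinates of a divisor. -/

section LogarithmicDerivation

open Polynomial

lemma exists_derivation_polynomial (k : Type u) [Field k] {σ : Type} [DecidableEq σ] (j : σ) :
    ∃ d : Derivation k (MvPolynomial σ k)[X] (MvPolynomial σ k)[X],
      d X = 0 ∧ ∀ i, d (C (MvPolynomial.X i)) = if i = j then 1 else 0 := by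
  let e := MvPolynomial.optionEquivLeft k σ
  let d := MvPolynomial.pderiv (R := k) (some j)
  refine ⟨Derivation.mk' (e.toLinearMap ∘ₗ (d : _ →ₗ[k] _) ∘ₗ e.symm.toLinearMap) fun a b ↦ ?_,
    ?_, fun i ↦ ?_⟩
  · simp only [LinearMap.comp_apply, AlgEquiv.toLinearMap_apply, map_mul, Derivation.coeFn_coe,
      Derivation.leibniz, smul_eq_mul, map_add, AlgEquiv.apply_symm_apply]
  · have : e.symm X = MvPolynomial.X none := by
      rw [AlgEquiv.symm_apply_eq, MvPolynomial.optionEquivLeft_X_none]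
    change e (d (e.symm X)) = 0
    rw [this, MvPolynomial.pderiv_X_of_ne (by simp), map_zero]
  · have : e.symm (C (MvPolynomial.X i)) = MvPolynomial.X (some i) := by
      rw [AlgEquiv.symm_apply_eq, MvPolynomial.optionEquivLeft_X_some]
    change e (d (e.symm (C (MvPolynomial.X i)))) = _
    rw [this, MvPolynomial.pderiv_X]
    split_ifs with h <;> simp [h]

/-- With w_i the variables of the polynomial ring, `K` is algebraic over k(w, τ). In characteristic
zero it is formally étale over it, so the partial derivative along w_j with τ fixed extends to `K`.
A valuation ring centered at `P` contains E = k(w), and this puts it within reach of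
`derivation_mem_valuationSubring`. -/
theorem exists_logarithmic_derivation {k : Type u} [Field k] [CharZero k] {σ : Type} [DecidableEq σ]
    [Finite σ] {R : Type u} [CommRing R] [IsDomain R] [Algebra k R] [Algebra (MvPolynomial σ k) R]
    [IsScalarTower k (MvPolynomial σ k) R] [Algebra.FiniteType (MvPolynomial σ k) R]
    (P : Ideal R) [P.IsPrime] (hP : ∀ Q : Ideal R, Q.IsPrime → Q ≤ P → Q = ⊥ ∨ Q = P)
    [Algebra.QuasiFinite (MvPolynomial σ k) (R ⧸ P)] [FaithfulSMul (MvPolynomial σ k) (R ⧸ P)]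
    (τ : R) (hτ : τ ∈ P) (hτ0 : τ ≠ 0) (K : Type u) [Field K] [Algebra R K] [IsFractionRing R K]
    [Algebra k K] [IsScalarTower k R K] (j : σ) :
    ∃ δ : Derivation k K K, δ (algebraMap R K τ) = 0 ∧
      (∀ i, δ (algebraMap R K (algebraMap _ R (MvPolynomial.X i : MvPolynomial σ k))) =
        if i = j then 1 else 0) ∧
      ∀ V : ValuationSubring K, (∀ r, algebraMap R K r ∈ V) →
        (∀ r ∈ P, V.valuation (algebraMap R K r) < 1) →
        (∀ r ∉ P, V.valuation (algebraMap R K r) = 1) →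
        ∀ a, V.valuation a < 1 → V.valuation (δ a) < 1 := by
  let C := MvPolynomial σ k
  let E := FractionRing C
  let : Algebra C[X] R := (aeval τ : C[X] →ₐ[C] R).toRingHom.toAlgebra
  have : IsScalarTower C C[X] R := .of_algebraMap_eq fun c ↦ (aeval_C τ c).symm
  have : IsScalarTower k C[X] R := .to₁₃₄ k C C[X] R
  have hX : algebraMap C[X] R X = τ := aeval_X τ
  obtain ⟨h1, h2⟩ := faithfulSMul_and_isAlgebraic_polynomial (C := C) P hP (hX ▸ hτ) (hX ▸ hτ0)
  let : Algebra C[X] K := ((algebraMap R K).comp (algebraMap C[X] R)).toAlgebra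
  have : IsScalarTower C[X] R K := .of_algebraMap_eq fun _ ↦ rfl
  have : IsScalarTower k C[X] K := .of_algebraMap_eq fun c ↦ by
    rw [IsScalarTower.algebraMap_apply k R K, IsScalarTower.algebraMap_apply k C[X] R]; rfl
  have : FaithfulSMul C[X] K := by
    rw [faithfulSMul_iff_algebraMap_injective]
    exact (IsFractionRing.injective R K).comp (FaithfulSMul.algebraMap_injective C[X] R)
  have : Algebra.IsAlgebraic C[X] K := by
    have : Algebra.IsAlgebraic R K := IsLocalization.isAlgebraic K (nonZeroDivisors R)
    exact .trans C[X] R K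
  let F := FractionRing C[X]
  let : Algebra F K := FractionRing.liftAlgebra C[X] K
  have : IsScalarTower C[X] F K := FractionRing.isScalarTower_liftAlgebra C[X] K
  have : CharZero F := charZero_of_injective_algebraMap
    ((algebraMap C[X] F).comp (algebraMap k C[X])).injective
  have : Algebra.IsAlgebraic F K := IsFractionRing.comap_isAlgebraic_iff (A := C[X]).mp inferInstance
  have : Algebra.FormallyEtale F K := .of_isSeparable F K
  have : Algebra.FormallyEtale C[X] F := .of_isLocalization (nonZeroDivisors C[X])
  have : Algebra.FormallyEtale C[X] K := .comp C[X] F K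
  obtain ⟨d, hdX, hdi⟩ := exists_derivation_polynomial k j
  let δ := extendDerivation k k C[X] K d
  have hδ (f : C[X]) : δ (algebraMap C[X] K f) = algebraMap C[X] K (d f) :=
    extendDerivation_algebraMap k k C[X] K d f
  have hτK : algebraMap R K τ = algebraMap C[X] K X := by rw [← hX]; rfl
  have hCK (c : C) : algebraMap R K (algebraMap C R c) = algebraMap C[X] K (Polynomial.C c) := by
    rw [IsScalarTower.algebraMap_apply C C[X] R]; rfl
  have hδτ : δ (algebraMap R K τ) = 0 := by rw [hτK, hδ, hdX, map_zero]
  refine ⟨δ, hδτ, fun i ↦ ?_, fun V hV hV1 hV2 ↦ ?_⟩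
  · rw [hCK, hδ, hdi]; split_ifs <;> simp
  let : Algebra C K := ((algebraMap R K).comp (algebraMap C R)).toAlgebra
  have : IsScalarTower C R K := .of_algebraMap_eq fun _ ↦ rfl
  have : IsScalarTower C C[X] K := .of_algebraMap_eq fun c ↦ hCK c
  have : FaithfulSMul C K := by
    rw [faithfulSMul_iff_algebraMap_injective, IsScalarTower.algebraMap_eq C C[X] K]
    exact (FaithfulSMul.algebraMap_injective C[X] K).comp C_injective
  let : Algebra E K := FractionRing.liftAlgebra C K
  have : IsScalarTower C E K := FractionRing.isScalarTower_liftAlgebra C K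
  have : CharZero E := charZero_of_injective_algebraMap
    ((algebraMap C E).comp (algebraMap k C)).injective
  let : Algebra E[X] K := (aeval (algebraMap R K τ) : E[X] →ₐ[E] K).toRingHom.toAlgebra
  have : IsScalarTower E E[X] K := .of_algebraMap_eq fun c ↦ (aeval_C _ c).symm
  have hEX : algebraMap E[X] K X = algebraMap R K τ := aeval_X _
  have hmap (f : C[X]) : algebraMap E[X] K (f.map (algebraMap C E)) = algebraMap C[X] K f := by
    change aeval (algebraMap R K τ) (f.map (algebraMap C E)) = algebraMap R K (aeval τ f)
    rw [aeval_map_algebraMap, aeval_algebraMap_apply]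
  let : Algebra C[X] E[X] := (mapRingHom (algebraMap C E)).toAlgebra
  have : IsScalarTower C[X] E[X] K := .of_algebraMap_eq fun f ↦ (hmap f).symm
  have : FaithfulSMul E[X] K := by
    have h3 : Transcendental E (algebraMap R K τ) := by
      rw [Transcendental, ← IsFractionRing.isAlgebraic_iff C E K]
      refine transcendental_iff_injective.mpr fun f g hfg ↦ ?_
      rw [← aeval_map_algebraMap E _ f, ← aeval_map_algebraMap E _ g] at hfg
      exact FaithfulSMul.algebraMap_injective C[X] K ((hmap f).symm.trans (hfg.trans (hmap g)))
    rw [faithfulSMul_iff_algebraMap_injective]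
    exact transcendental_iff_injective.mp h3
  have : FaithfulSMul C[X] E[X] := by
    rw [faithfulSMul_iff_algebraMap_injective]
    exact map_injective _ (IsFractionRing.injective C E)
  have : Algebra.IsAlgebraic E[X] K :=
    .extendScalars (FaithfulSMul.algebraMap_injective C[X] E[X])
  have : Algebra.EssFiniteType E K := by
    have : Algebra.EssFiniteType R K := .of_isLocalization K (nonZeroDivisors R)
    have : Algebra.EssFiniteType C K := .comp C R K
    exact .of_comp C E K
  -- The w_i are independent on V(P), so nonzero polynomials in them are units at `P`.
  have hVC (c : C) (hc : c ≠ 0) : V.valuation (algebraMap C K c) = 1 := by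
    refine hV2 _ fun h ↦ hc (FaithfulSMul.algebraMap_injective C (R ⧸ P) ?_)
    rw [map_zero]
    exact Ideal.Quotient.eq_zero_iff_mem.mpr h
  have hVE (e : E) : algebraMap E K e ∈ V ∧ δ (algebraMap E K e) ∈ V := by
    obtain ⟨a, b, hb, rfl⟩ := IsFractionRing.div_surjective (A := C) e
    have hb0 : b ≠ 0 := nonZeroDivisors.ne_zero hb
    have hbV := hVC b hb0
    have hb1 : (algebraMap C K b)⁻¹ ∈ V := by
      rw [← V.valuation_le_one_iff, map_inv₀, hbV, inv_one]
    have hCV (c : C) : algebraMap C K c ∈ V := hV _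
    have hδC (c : C) : δ (algebraMap C K c) ∈ V := by
      rw [IsScalarTower.algebraMap_apply C C[X] K, hδ]
      exact hV _
    rw [map_div₀, ← IsScalarTower.algebraMap_apply, ← IsScalarTower.algebraMap_apply,
      div_eq_mul_inv, Derivation.leibniz, Derivation.leibniz_inv]
    refine ⟨mul_mem (hCV a) hb1, add_mem (mul_mem (hCV a) ?_) (mul_mem hb1 (hδC a))⟩
    rw [smul_eq_mul, neg_mul]
    exact neg_mem (mul_mem (pow_mem hb1 2) (hδC b))
  exact derivation_mem_valuationSubring (E := E) V (fun e ↦ (hVE e).1)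
    (by rw [hEX]; exact hV1 τ hτ) (δ.restrictScalars ℤ) (by rw [hEX]; exact hδτ) fun e ↦ (hVE e).2

end LogarithmicDerivation

end LagrangianSpecialization

namespace LagrangianSpecialization

/-! ### Étale coordinates and the chain rule. -/

section Coordinates

open MvPolynomial

variable {k : Type u} [Field k] {n : Type} {B : Type u} [CommRing B] [Algebra k B]
  [Algebra (MvPolynomial n k) B] [IsScalarTower k (MvPolynomial n k) B]

variable (k B) in
/-- The coordinate functions of an étale algebra over affine space. -/
noncomputable def coord (i : n) : B := algebraMap (MvPolynomial n k) B (X i)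

lemma derivation_ext_of_coord [Algebra.FormallyUnramified (MvPolynomial n k) B] {M : Type*}
    [AddCommGroup M] [Module k M] [Module B M] [IsScalarTower k B M] {d e : Derivation k B M}
    (h : ∀ i : n, d (coord k B i) = e (coord k B i)) : d = e := by
  let := Module.compHom M (algebraMap (MvPolynomial n k) B)
  have : IsScalarTower (MvPolynomial n k) B M := ⟨fun a b m ↦ by
    rw [Algebra.smul_def, mul_smul]; rfl⟩
  have : IsScalarTower k (MvPolynomial n k) M := ⟨fun a b m ↦ by
    rw [← algebraMap_smul B (a • b), ← algebraMap_smul B b, Algebra.smul_def, map_mul,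
      ← IsScalarTower.algebraMap_apply, mul_smul, algebraMap_smul]⟩
  have hP : d.compAlgebraMap (MvPolynomial n k) = e.compAlgebraMap (MvPolynomial n k) :=
    MvPolynomial.derivation_ext h
  let D : Derivation (MvPolynomial n k) B M :=
    Derivation.mk' { toFun b := d b - e b
                     map_add' a b := by rw [map_add, map_add]; abel
                     map_smul' a b := by
                      have h1 : d (algebraMap _ B a) = e (algebraMap _ B a) := congr($hP a)
                      rw [Algebra.smul_def, Derivation.leibniz, Derivation.leibniz, h1,
                        add_sub_add_right_eq_sub, ← smul_sub, algebraMap_smul, RingHom.id_apply] }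
      fun a b ↦ by
        change d (a * b) - e (a * b) = a • (d b - e b) + b • (d a - e a)
        rw [Derivation.leibniz, Derivation.leibniz, smul_sub, smul_sub]; abel
  have hD : D = 0 := by
    rw [← D.liftKaehlerDifferential_comp, Subsingleton.elim D.liftKaehlerDifferential 0]
    ext; simp
  ext b
  exact sub_eq_zero.mp congr($hD b)

variable [DecidableEq n] [Algebra.Etale (MvPolynomial n k) B]

variable (k B) in
/-- The partial derivatives of an étale algebra over affine space. -/
noncomputable def partialDer (i : n) : Derivation k B B :=
  extendDerivation k k (MvPolynomial n k) B (pderiv i)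

lemma partialDer_coord (i j : n) : partialDer k B i (coord k B j) = if j = i then 1 else 0 := by
  rw [partialDer, coord, extendDerivation_algebraMap, pderiv_X]
  split_ifs with h <;> simp [h]

lemma derivation_apply_eq_sum [Fintype n] {M : Type*} [AddCommGroup M] [Module k M] [Module B M]
    [IsScalarTower k B M] (d : Derivation k B M) (b : B) :
    d b = ∑ i : n, partialDer k B i b • d (coord k B i) := by
  let e : Derivation k B M :=
    ∑ i : n, ((LinearMap.toSpanSingleton B M (d (coord k B i))).compDer (partialDer k B i))
  have he (b : B) : e b = ∑ i : n, partialDer k B i b • d (coord k B i) := by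
    have := congrFun (map_sum (Derivation.coeFnAddMonoidHom (R := k) (A := B) (M := M))
      (fun i : n ↦ (LinearMap.toSpanSingleton B M (d (coord k B i))).compDer (partialDer k B i))
      Finset.univ) b
    rw [Finset.sum_apply] at this
    exact this
  rw [← he]
  congr 1
  refine derivation_ext_of_coord (n := n) fun i ↦ ?_
  rw [he]
  simp [partialDer_coord]

end Coordinates

/-! ### The codimension of a coordinate subspace. -/

section Height

open MvPolynomial

lemma card_le_height_of_strictMono {α R : Type*} [DecidableEq α] [CommRing R]
    (J : Finset α → Ideal R) (hJ : ∀ s, (J s).IsPrime) (hlt : ∀ s, ∀ a ∉ s, J s < J (insert a s))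
    (s : Finset α) : (s.card : ℕ∞) ≤ (J s).height := by
  induction s using Finset.induction_on with
  | empty => simp
  | insert a s ha ih =>
    rw [Finset.card_insert_of_notMem ha]
    have := Ideal.height_add_one_le_of_lt_of_isPrime (hlt s a ha)
    push_cast
    exact (add_le_add_left ih 1).trans this

variable {k : Type u} [Field k] {ι σ : Type}

variable (k ι σ) in
/-- The ideal of the linear subspace of affine space on which the coordinates `none` and `inl i`
vanish, as a kernel. -/
noncomputable def killHom : MvPolynomial (Option (ι ⊕ σ)) k →ₐ[k] MvPolynomial σ k :=
  aeval fun i ↦ i.elim 0 (Sum.elim 0 X)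

lemma killHom_rename (f : MvPolynomial σ k) :
    killHom k ι σ (rename (fun j ↦ some (Sum.inr j)) f) = f := by
  rw [killHom, aeval_rename]
  exact aeval_X_left_apply f

/-- Setting the coordinates `none` and `inl i` to zero one after the other produces a strict chain
of kernels, all of them prime. -/
lemma card_le_height_ker_killHom [Fintype ι] :
    ((Fintype.card ι + 1 : ℕ) : ℕ∞) ≤ (RingHom.ker (killHom k ι σ)).height := by
  classical
  let P := MvPolynomial (Option (ι ⊕ σ)) k
  let φ (s : Finset (Option ι)) : P →ₐ[k] P := aeval fun i ↦
    if i ∈ s.image (Option.map Sum.inl) then 0 else X i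
  have h := card_le_height_of_strictMono (fun s ↦ RingHom.ker (φ s)) (fun s ↦ RingHom.ker_isPrime _)
    (fun s a ha ↦ ?_) Finset.univ
  · have : RingHom.ker (φ Finset.univ) = RingHom.ker (killHom k ι σ) := by
      have h1 : φ Finset.univ = (rename fun j ↦ some (Sum.inr j)).comp (killHom k ι σ) := by
        refine MvPolynomial.algHom_ext fun i ↦ ?_
        rcases i with _ | i | j
        · simp [φ, killHom]
        · simp [φ, killHom]
        · simp [φ, killHom]
      have hinj : Function.Injective (rename (R := k) fun j : σ ↦ some (Sum.inr (α := ι) j)) :=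
        rename_injective _ ((Option.some_injective _).comp Sum.inr_injective)
      ext f
      rw [RingHom.mem_ker, RingHom.mem_ker, h1, AlgHom.comp_apply, map_eq_zero_iff _ hinj]
    rw [this] at h
    simpa using h
  · have hmem (s : Finset (Option ι)) (b : Option ι) :
        b.map (Sum.inl (β := σ)) ∈ s.image (Option.map Sum.inl) ↔ b ∈ s := by
      rw [Finset.mem_image]
      exact ⟨fun ⟨c, hc, h⟩ ↦ Option.map_injective Sum.inl_injective h ▸ hc, fun h ↦ ⟨b, h, rfl⟩⟩
    have hcomp : φ (insert a s) = (φ (insert a s)).comp (φ s) := by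
      refine MvPolynomial.algHom_ext fun i ↦ ?_
      by_cases hi : i ∈ s.image (Option.map Sum.inl)
      · have : i ∈ (insert a s).image (Option.map (Sum.inl (β := σ))) :=
          Finset.image_subset_image (Finset.subset_insert a s) hi
        simp only [AlgHom.comp_apply, φ, aeval_X, if_pos hi, if_pos this, map_zero]
      · have : φ s (X i) = X i := (aeval_X _ _).trans (if_neg hi)
        rw [AlgHom.comp_apply, this]
    refine lt_of_le_of_ne (fun f hf ↦ ?_) fun h ↦ ?_
    · rw [RingHom.mem_ker, hcomp, AlgHom.comp_apply, RingHom.mem_ker.mp hf, map_zero]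
    · have h1 : (X (a.map Sum.inl) : P) ∈ RingHom.ker (φ (insert a s)) := by
        rw [RingHom.mem_ker, aeval_X, if_pos ((hmem _ _).mpr (Finset.mem_insert_self _ _))]
      rw [← h, RingHom.mem_ker, aeval_X, if_neg ((hmem s a).not.mpr ha)] at h1
      exact X_ne_zero _ h1

variable {B : Type u} [CommRing B] [Algebra (MvPolynomial (Option (ι ⊕ σ)) k) B]

/-- Going down yields a prime below `p` that lies over the kernel. It contains the extension of the
kernel, which is `p`, so the two primes coincide. -/
lemma comap_eq_ker_killHom [Algebra.HasGoingDown (MvPolynomial (Option (ι ⊕ σ)) k) B]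
    (p : Ideal B) [p.IsPrime]
    (hp : p = (RingHom.ker (killHom k ι σ)).map (algebraMap _ B)) :
    p.under (MvPolynomial (Option (ι ⊕ σ)) k) = RingHom.ker (killHom k ι σ) := by
  have hJ : (RingHom.ker (killHom k ι σ)).IsPrime := RingHom.ker_isPrime _
  have : p.LiesOver (p.under (MvPolynomial (Option (ι ⊕ σ)) k)) := ⟨rfl⟩
  obtain ⟨Q, hQ, _, hQJ⟩ := Ideal.exists_ideal_le_liesOver_of_le (p := RingHom.ker (killHom k ι σ))
    (q := p.under (MvPolynomial (Option (ι ⊕ σ)) k)) p (Ideal.map_le_iff_le_comap.mp hp.ge)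
  have : Q = p := le_antisymm hQ <| by
    conv_lhs => rw [hp]
    rw [Ideal.map_le_iff_le_comap]
    exact hQJ.over.le
  rw [← this]
  exact hQJ.over.symm

lemma card_le_height [Fintype ι] [Finite σ] [IsNoetherianRing B]
    [Algebra.HasGoingDown (MvPolynomial (Option (ι ⊕ σ)) k) B]
    (p : Ideal B) [p.IsPrime] (hp : p = (RingHom.ker (killHom k ι σ)).map (algebraMap _ B)) :
    ((Fintype.card ι + 1 : ℕ) : ℕ∞) ≤ p.height := by
  have hJ : (RingHom.ker (killHom k ι σ)).IsPrime := RingHom.ker_isPrime _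
  have : p.LiesOver (RingHom.ker (killHom k ι σ)) := ⟨(comap_eq_ker_killHom p hp).symm⟩
  rw [Ideal.height_eq_height_add_of_liesOver_of_hasGoingDown (RingHom.ker (killHom k ι σ)) p]
  exact card_le_height_ker_killHom.trans le_self_add

end Height

end LagrangianSpecialization

namespace LagrangianSpecialization

/-! ### Limits of rescaled gradients along a polar variety. -/

section Evaluation

open MvPolynomial

variable {k : Type u} [Field k] {ι σ : Type} {B : Type u} [CommRing B] [Algebra k B]
  [Algebra (MvPolynomial (Option (ι ⊕ σ)) k) B] [IsScalarTower k (MvPolynomial (Option (ι ⊕ σ)) k) B]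

/-- Write G for the gradient of `F`, with z_i and w_j the coordinates `inl i` and `inr j`. On V(x)
the polar equations allow a rescaling of G whose z-part is the constant vector `c`. A logarithmic
derivation δ_j, applied to F = 0 on V(x), gives 0 = ∑ G_i δ_j z_i + G_j because δ_j kills t and is
dual to the w's. After rescaling, v_j = -∑ c_i δ_j z_i = -δ_j(∑ c_i z_i). The sum ∑ c_i z_i lies in
`p`, and δ_j preserves the maximal ideal of every valuation centered at `p`. -/
theorem exists_evaluation [CharZero k] [Fintype ι] [DecidableEq ι] [Fintype σ] [DecidableEq σ]
    [Algebra.Etale (MvPolynomial (Option (ι ⊕ σ)) k) B] (p : Ideal B) [p.IsPrime]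
    (hp : p = (RingHom.ker (killHom k ι σ)).map (algebraMap _ B)) (x : Ideal B) [x.IsPrime]
    (hxp : x < p) (hmax : ∀ Q : Ideal B, Q.IsPrime → x ≤ Q → Q ≤ p → Q = x ∨ Q = p)
    (F : B) (hF : F ∈ x) (c : ι → k) (i₀ : ι) (hc : c i₀ ≠ 0)
    (hG : ∀ i, algebraMap k B (c i₀) * partialDer k B (some (Sum.inl (β := σ) i)) F -
      algebraMap k B (c i) * partialDer k B (some (Sum.inl (β := σ) i₀)) F ∈ x)
    (hsm : ∃ i : ι ⊕ σ, partialDer k B (some i) F ∉ x)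
    (K : Type u) [Field K] [Algebra B K] [Algebra (B ⧸ x) K] [IsScalarTower B (B ⧸ x) K]
    [IsFractionRing (B ⧸ x) K] :
    ∃ (v : σ → K) (u : K), u ≠ 0 ∧
      (∀ i, u * algebraMap B K (partialDer k B (some (Sum.inl (β := σ) i)) F) =
        algebraMap B K (algebraMap k B (c i))) ∧
      (∀ j, u * algebraMap B K (partialDer k B (some (Sum.inr (α := ι) j)) F) = v j) ∧
      ∀ V : ValuationSubring K, (∀ b, algebraMap B K b ∈ V) →
        (∀ b ∈ p, V.valuation (algebraMap B K b) < 1) →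
        (∀ b ∉ p, V.valuation (algebraMap B K b) = 1) → ∀ j, V.valuation (v j) < 1 := by
  let P := MvPolynomial (Option (ι ⊕ σ)) k
  let C := MvPolynomial σ k
  let R := B ⧸ x
  have hKx (b : B) : algebraMap B K b = 0 ↔ b ∈ x := by
    rw [IsScalarTower.algebraMap_apply B R K, map_eq_zero_iff _ (IsFractionRing.injective R K),
      Ideal.Quotient.algebraMap_eq, Ideal.Quotient.eq_zero_iff_mem]
  let : Algebra k K := ((algebraMap B K).comp (algebraMap k B)).toAlgebra
  have : IsScalarTower k B K := .of_algebraMap_eq fun _ ↦ rfl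
  have : IsScalarTower k R K := .of_algebraMap_eq fun c ↦ by
    rw [IsScalarTower.algebraMap_apply k B K, IsScalarTower.algebraMap_apply B R K]; rfl
  let ρ : C →ₐ[k] P := rename fun j ↦ some (Sum.inr j)
  let : Algebra C B := ((algebraMap P B).comp ρ.toRingHom).toAlgebra
  have : IsScalarTower k C B := .of_algebraMap_eq fun c ↦ by
    rw [IsScalarTower.algebraMap_apply k P B]
    exact congrArg (algebraMap P B) (ρ.commutes c).symm
  have : Algebra.FiniteType k B := .trans (S := P) inferInstance inferInstance
  have : Algebra.FiniteType C B := .of_restrictScalars_finiteType k C B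
  have : IsScalarTower k C R := .of_algebraMap_eq fun c ↦ by
    rw [IsScalarTower.algebraMap_apply k B R, IsScalarTower.algebraMap_apply k C B]; rfl
  have hCB (j : σ) : algebraMap C B (X j) = coord k B (some (Sum.inr j)) :=
    congrArg (algebraMap P B) (rename_X _ j)
  let Q : Ideal R := p.map (Ideal.Quotient.mk x)
  have hQ : Q.comap (Ideal.Quotient.mk x) = p := by
    rw [Ideal.comap_map_of_surjective _ Ideal.Quotient.mk_surjective,
      ← RingHom.ker_eq_comap_bot, Ideal.mk_ker, sup_eq_left.mpr hxp.le]
  have hmemQ (b : B) : Ideal.Quotient.mk x b ∈ Q ↔ b ∈ p := by rw [← Ideal.mem_comap, hQ]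
  have hQprime : Q.IsPrime := Ideal.map_isPrime_of_surjective Ideal.Quotient.mk_surjective
    (by rw [Ideal.mk_ker]; exact hxp.le)
  have hQmax : ∀ I : Ideal R, I.IsPrime → I ≤ Q → I = ⊥ ∨ I = Q := fun I hI hIQ ↦ by
    have h1 : x ≤ I.comap (Ideal.Quotient.mk x) := fun b hb ↦ by
      rw [Ideal.mem_comap, Ideal.Quotient.eq_zero_iff_mem.mpr hb]; exact I.zero_mem
    have h2 : (I.comap (Ideal.Quotient.mk x)).map (Ideal.Quotient.mk x) = I :=
      Ideal.map_comap_of_surjective _ Ideal.Quotient.mk_surjective I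
    rcases hmax (I.comap (Ideal.Quotient.mk x)) inferInstance h1
      ((Ideal.comap_mono hIQ).trans hQ.le) with h | h
    · left; rw [← h2, h, Ideal.map_quotient_self]
    · right; rw [← h2, h]
  have hunder := comap_eq_ker_killHom p hp
  have hpP (f : P) : algebraMap P B f ∈ p ↔ killHom k ι σ f = 0 := by
    rw [← RingHom.mem_ker, ← hunder]; rfl
  have : Algebra.QuasiFinite C (R ⧸ Q) := by
    let : Algebra P C := (killHom k ι σ).toRingHom.toAlgebra
    have : IsScalarTower P C (R ⧸ Q) := .of_algebraMap_eq fun f ↦ by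
      have h1 : f - ρ (killHom k ι σ f) ∈ RingHom.ker (killHom k ι σ) := by
        rw [RingHom.mem_ker, map_sub, killHom_rename, sub_self]
      have h2 : algebraMap P B f - algebraMap P B (ρ (killHom k ι σ f)) ∈ p := by
        rw [← map_sub, hpP]; exact h1
      exact (Ideal.Quotient.eq (I := Q)).mpr ((hmemQ _).mpr h2)
    have : Algebra.QuasiFinite P (R ⧸ Q) := .of_surjective_algHom
      (IsScalarTower.toAlgHom P B (R ⧸ Q))
      (Ideal.Quotient.mk_surjective.comp Ideal.Quotient.mk_surjective)
    exact .of_restrictScalars P C (R ⧸ Q)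
  have : FaithfulSMul C (R ⧸ Q) := by
    rw [faithfulSMul_iff_algebraMap_injective, injective_iff_map_eq_zero]
    intro f hf
    have h1 : algebraMap P B (ρ f) ∈ p := (hmemQ _).mp (Ideal.Quotient.eq_zero_iff_mem.mp hf)
    rwa [hpP, killHom_rename] at h1
  have ht : coord k B (none : Option (ι ⊕ σ)) ∈ p := (hpP _).mpr (by simp [killHom])
  have hz (i : ι) : coord k B (some (Sum.inl (β := σ) i)) ∈ p := (hpP _).mpr (by simp [killHom])
  -- If t vanishes on V(x), any element of `p` outside `x` can serve as parameter; in either case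
  -- δ_j kills t.
  obtain ⟨τ, hτp, hτx, hτt⟩ : ∃ τ ∈ p, τ ∉ x ∧
      (coord k B (none : Option (ι ⊕ σ)) = τ ∨ coord k B (none : Option (ι ⊕ σ)) ∈ x) := by
    by_cases h : coord k B (none : Option (ι ⊕ σ)) ∈ x
    · obtain ⟨b, hb, hbx⟩ := Set.exists_of_ssubset hxp
      exact ⟨b, hb, hbx, .inr h⟩
    · exact ⟨_, ht, h, .inl rfl⟩
  choose δ hδτ hδw hδV using exists_logarithmic_derivation (k := k) (σ := σ) Q hQmax
    (Ideal.Quotient.mk x τ) ((hmemQ τ).mpr hτp)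
    (fun h ↦ hτx (Ideal.Quotient.eq_zero_iff_mem.mp h)) K
  have hδt (j : σ) : δ j (algebraMap B K (coord k B (none : Option (ι ⊕ σ)))) = 0 := by
    rcases hτt with h | h
    · rw [h, IsScalarTower.algebraMap_apply B R K]; exact hδτ j
    · rw [(hKx _).mpr h, map_zero]
  have hδw' (j i : σ) : δ j (algebraMap B K (coord k B (some (Sum.inr i) : Option (ι ⊕ σ)))) =
      if i = j then 1 else 0 := by
    rw [← hδw j i, IsScalarTower.algebraMap_apply B R K, ← hCB]; rfl
  let c' (i : ι) : K := algebraMap B K (algebraMap k B (c i))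
  let G (i : ι ⊕ σ) : K := algebraMap B K (partialDer k B (some i) F)
  have hc' : c' i₀ ≠ 0 := by
    rw [Ne, hKx]
    exact fun h ↦ (inferInstance : x.IsPrime).ne_top
      (Ideal.eq_top_of_isUnit_mem _ h ((Ne.isUnit hc).map (algebraMap k B)))
  have hGc (i : ι) : c' i₀ * G (Sum.inl i) = c' i * G (Sum.inl i₀) := by
    have := (hKx _).mpr (hG i)
    rwa [map_sub, map_mul, map_mul, sub_eq_zero] at this
  have hchain (j : σ) : 0 = ∑ i, G (Sum.inl i) * δ j (algebraMap B K (coord k B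
      (some (Sum.inl (β := σ) i)))) + G (Sum.inr j) := by
    have := derivation_apply_eq_sum (n := Option (ι ⊕ σ)) ((δ j).compAlgebraMap B) F
    simp only [Derivation.compAlgebraMap_apply, Fintype.sum_option, Fintype.sum_sum_type, hδt,
      hδw', (hKx F).mpr hF, map_zero, zero_add, Algebra.smul_def, mul_ite, mul_one,
      mul_zero, Finset.sum_ite_eq', Finset.mem_univ, if_true] at this
    exact this
  let s (j : σ) : K := ∑ i, c' i * δ j (algebraMap B K (coord k B (some (Sum.inl (β := σ) i))))
  have hs (j : σ) : G (Sum.inr j) * c' i₀ = - (G (Sum.inl i₀) * s j) := by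
    have h1 := congrArg (c' i₀ * ·) (hchain j)
    simp only [mul_zero, mul_add, Finset.mul_sum, ← mul_assoc, hGc] at h1
    rw [mul_comm, eq_neg_iff_add_eq_zero, add_comm, h1, Finset.mul_sum]
    congr 1
    exact Finset.sum_congr rfl fun i _ ↦ by ring
  -- Otherwise the polar equations would annihilate the whole z-part of the gradient and the chain
  -- rule its w-part, against `hsm`.
  have hG0 : G (Sum.inl i₀) ≠ 0 := fun h0 ↦ by
    obtain ⟨i | j, hi⟩ := hsm
    · have h1 := hGc i
      rw [h0, mul_zero] at h1
      exact hi ((hKx _).mp ((mul_eq_zero.mp h1).resolve_left hc'))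
    · have h1 := hs j
      rw [h0, zero_mul, neg_zero] at h1
      exact hi ((hKx _).mp ((mul_eq_zero.mp h1).resolve_right hc'))
  refine ⟨fun j ↦ - s j, c' i₀ / G (Sum.inl i₀), div_ne_zero hc' hG0, fun i ↦ ?_, fun j ↦ ?_,
    fun V hV hV1 hV2 j ↦ ?_⟩
  · rw [div_mul_eq_mul_div, div_eq_iff hG0]; exact hGc i
  · rw [div_mul_eq_mul_div, div_eq_iff hG0, neg_mul, mul_comm (s j), ← hs, mul_comm]
  · rw [Valuation.map_neg]
    -- The c_i are constants, so they pass through δ_j.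
    have h1 : s j = δ j (algebraMap B K (∑ i, algebraMap k B (c i) * coord k B
        (some (Sum.inl (β := σ) i)))) := by
      rw [map_sum, map_sum]
      refine Finset.sum_congr rfl fun i _ ↦ ?_
      have h2 : algebraMap B K (algebraMap k B (c i)) = algebraMap k K (c i) := rfl
      rw [map_mul, Derivation.leibniz, h2, Derivation.map_algebraMap, smul_zero, add_zero]
      rfl
    rw [h1]
    refine hδV j V (fun r ↦ ?_) (fun r hr ↦ ?_) (fun r hr ↦ ?_) _
      (hV1 _ (sum_mem fun i _ ↦ p.mul_mem_left _ (hz i)))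
    · obtain ⟨b, rfl⟩ := Ideal.Quotient.mk_surjective r
      exact (IsScalarTower.algebraMap_apply B R K b) ▸ hV b
    · obtain ⟨b, rfl⟩ := Ideal.Quotient.mk_surjective r
      exact (IsScalarTower.algebraMap_apply B R K b) ▸ hV1 b ((hmemQ b).mp hr)
    · obtain ⟨b, rfl⟩ := Ideal.Quotient.mk_surjective r
      exact (IsScalarTower.algebraMap_apply B R K b) ▸ hV2 b ((hmemQ b).not.mp hr)

end Evaluation

end LagrangianSpecialization

namespace LagrangianSpecialization

/-! ### Valuation rings with prescribed center and integrality. -/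

section Domination

open Algebra Polynomial in
-- If `x` is not integral, then x⁻¹ and the maximal ideal of `R` generate a proper ideal of R[x⁻¹].
-- A valuation ring whose nonunits include this ideal is centered at the maximal ideal of `R` and
-- omits `x`.
lemma isIntegral_of_forall_valuationSubring {R K : Type*} [CommRing R] [IsLocalRing R] [Field K]
    [Algebra R K] {x : K} (h : ∀ V : ValuationSubring K, (∀ r, algebraMap R K r ∈ V) →
      (∀ r ∈ maximalIdeal R, algebraMap R K r ∈ V.nonunits) → x ∈ V) : IsIntegral R x := by
  by_contra hx
  obtain rfl | hx0 := eq_or_ne x 0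
  · exact hx isIntegral_zero
  let := invertibleOfNonzero (inv_ne_zero hx0)
  let B := R[x⁻¹]
  let xinv : B := ⟨x⁻¹, subset_adjoin rfl⟩
  let I : Ideal B := (maximalIdeal R).map (algebraMap R B) + .span {xinv}
  have hI : I ≠ ⊤ := fun eq ↦ hx <| by
    obtain ⟨p, hp, hpx⟩ := exists_aeval_invOf_eq_zero_of_idealMap_adjoin_sup_span_eq_top
      (x⁻¹) _ (maximalIdeal.isMaximal R).ne_top eq
    rw [invOf_eq_inv, inv_inv] at hpx
    have H : IsUnit p.leadingCoeff := of_not_not fun h ↦ by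
      have h1 := sub_mem ((mem_maximalIdeal _).mpr h) hp
      rw [sub_sub_cancel] at h1
      exact (Ideal.ne_top_iff_one _).mp (maximalIdeal.isMaximal R).ne_top h1
    refine ⟨.C H.unit⁻¹.1 * p, ?_, ?_⟩
    · rw [Polynomial.Monic, Polynomial.leadingCoeff_C_mul_of_isUnit H.unit⁻¹.isUnit]
      exact H.val_inv_mul
    · rw [← aeval_def, map_mul, hpx, mul_zero]
  obtain ⟨V, hV, hVI⟩ : ∃ V : ValuationSubring K, (∀ b : B, (b : K) ∈ V) ∧
      ∀ b ∈ I, (b : K) ∈ V.nonunits := by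
    obtain ⟨V, h1, h2⟩ := Ideal.image_subset_nonunits_valuationSubring (A := B.toSubring) I hI
    exact ⟨V, fun b ↦ h1 b.2, fun b hb ↦ h2 ⟨b, hb, rfl⟩⟩
  have hxI : xinv ∈ I := Ideal.mem_sup_right (Ideal.mem_span_singleton_self xinv)
  refine (V.inv_mem_nonunits_iff.mp (hVI _ hxI)).resolve_left hx0
    (h V (fun r ↦ hV (algebraMap R B r)) fun r hr ↦ ?_)
  exact hVI _ (Ideal.mem_sup_left (Ideal.mem_map_of_mem _ hr))

lemma exists_valuationSubring_of_prime {B K : Type*} [CommRing B] [Field K] [Algebra B K]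
    (p : Ideal B) [p.IsPrime] (hp : RingHom.ker (algebraMap B K) ≤ p) :
    ∃ V : ValuationSubring K, (∀ b, algebraMap B K b ∈ V) ∧
      (∀ b ∈ p, V.valuation (algebraMap B K b) < 1) ∧
      (∀ b ∉ p, V.valuation (algebraMap B K b) = 1) := by
  let A := (algebraMap B K).range
  let φ : B →+* A := (algebraMap B K).rangeRestrict
  have hφ : Function.Surjective φ := (algebraMap B K).rangeRestrict_surjective
  have hker : RingHom.ker φ ≤ p := fun b hb ↦ hp (congrArg Subtype.val (RingHom.mem_ker.mp hb))
  let P := p.map φ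
  have : P.IsPrime := Ideal.map_isPrime_of_surjective hφ hker
  have hmem (b : B) : φ b ∈ P ↔ b ∈ p := by
    rw [← Ideal.mem_comap, Ideal.comap_map_of_surjective _ hφ, ← RingHom.ker_eq_comap_bot,
      sup_eq_left.mpr hker]
  obtain ⟨V, hV⟩ := (LocalSubring.ofPrime A P).exists_le_valuationSubring
  have h1 (a : A) : (a : K) ∈ V := hV.1 (LocalSubring.le_ofPrime A P a.2)
  let a' (a : A) : (LocalSubring.ofPrime A P).toSubring := ⟨a, LocalSubring.le_ofPrime A P a.2⟩
  have hu (a : A) : IsUnit (a' a) ↔ a ∉ P :=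
    IsLocalization.AtPrime.isUnit_to_map_iff (LocalSubring.ofPrime A P).toSubring P a
  have := hV.2
  have hv (a : A) : V.valuation (a : K) = 1 ↔ a ∉ P := by
    rw [← hu, ← isUnit_map_iff (Subring.inclusion hV.1)]
    exact (V.valuation_eq_one_iff ⟨a, h1 a⟩).symm
  refine ⟨V, fun b ↦ h1 (φ b), fun b hb ↦ ?_, fun b hb ↦ ?_⟩
  · refine lt_of_le_of_ne ((V.valuation_le_one_iff _).mpr (h1 (φ b))) fun h ↦ ?_
    exact (hv (φ b)).mp h ((hmem b).mpr hb)
  · exact (hv (φ b)).mpr ((hmem b).not.mpr hb)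

end Domination

/-! ### The ideal of scaled gradient vectors. -/

section Conormal

open MvPolynomial

/-- The ideal of the closure of the set of points `(b, λ G(b))` with `b` in the vanishing locus
of `I`. -/
noncomputable def conormalIdeal {B : Type*} [CommRing B] {n : Type*} (G : n → B) (I : Ideal B) :
    Ideal (MvPolynomial n B) :=
  (I.map Polynomial.C).comap (aeval fun i ↦ Polynomial.C (G i) * Polynomial.X)

section

variable {B : Type*} [CommRing B] {n : Type*} (G : n → B)

lemma conormalIdeal_mono {I J : Ideal B} (h : I ≤ J) : conormalIdeal G I ≤ conormalIdeal G J :=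
  Ideal.comap_mono (Ideal.map_mono h)

instance (I : Ideal B) [I.IsPrime] : (conormalIdeal G I).IsPrime := by
  have : (I.map Polynomial.C).IsPrime := Ideal.isPrime_map_C_of_isPrime
  exact Ideal.comap_isPrime _ _

lemma C_mem_conormalIdeal {I : Ideal B} {b : B} : C b ∈ conormalIdeal G I ↔ b ∈ I := by
  rw [conormalIdeal, Ideal.mem_comap, aeval_C, Polynomial.algebraMap_eq, Ideal.mem_map_C_iff]
  constructor
  · intro h
    simpa using h 0
  · intro h m
    rw [Polynomial.coeff_C]
    split_ifs
    exacts [h, I.zero_mem]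

lemma mem_conormalIdeal_sInf {S : Set (Ideal B)} {g : MvPolynomial n B}
    (h : ∀ I ∈ S, g ∈ conormalIdeal G I) : g ∈ conormalIdeal G (sInf S) := by
  rw [conormalIdeal, Ideal.mem_comap, Ideal.mem_map_C_iff]
  intro m
  rw [Ideal.mem_sInf]
  intro I hI
  exact Ideal.mem_map_C_iff.mp (h I hI) m

/-- The ideal consists of the polynomials that vanish under the parametrization (b, λ) ↦ (b, λ G(b))
over V(I); here λ is specialized to `u`. -/
lemma eval_eq_zero_of_mem_conormalIdeal {I : Ideal B} {g : MvPolynomial n B}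
    (hg : g ∈ conormalIdeal G I) {K : Type*} [CommRing K] (φ : B →+* K) (hI : ∀ b ∈ I, φ b = 0)
    (u : K) : eval₂ φ (fun i ↦ u * φ (G i)) g = 0 := by
  have h1 : (aeval (fun i ↦ Polynomial.C (G i) * Polynomial.X) g : Polynomial B).map φ = 0 := by
    ext m
    rw [Polynomial.coeff_map, hI _ (Ideal.mem_map_C_iff.mp hg m), Polynomial.coeff_zero]
  have h2 := congrArg (Polynomial.eval u) h1
  rw [Polynomial.eval_zero, Polynomial.eval_map] at h2
  rw [← h2, ← Polynomial.coe_eval₂RingHom, aeval_def, hom_eval₂]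
  congr 1
  · ext b
    exact (Polynomial.eval₂_C φ u).symm
  · funext i
    rw [Polynomial.coe_eval₂RingHom, Polynomial.eval₂_mul, Polynomial.eval₂_C, Polynomial.eval₂_X,
      mul_comm]

end

end Conormal

end LagrangianSpecialization

namespace LagrangianSpecialization

/-! ### The determinant trick relative to a submodule. -/

section Nakayama

lemma exists_pow_add_smul_eq_zero {R M : Type*} [CommRing R] [AddCommGroup M] [Module R M]
    [Module.Finite R M] (I : Ideal R) (s : R) (h : ∀ m : M, s • m ∈ I • (⊤ : Submodule R M)) :
    ∃ n : ℕ, ∃ r ∈ I, ∀ m : M, (s ^ n + r) • m = 0 := by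
  obtain ⟨P, hP, -, hc, h0⟩ :=
    LinearMap.exists_monic_and_natDegree_eq_and_coeff_mem_pow_and_aeval_eq_zero R
    (LinearMap.lsmul R M s) I (by rintro _ ⟨m, rfl⟩; exact h m)
  have h1 : LinearMap.lsmul R M s = algebraMap R (Module.End R M) s := by ext; simp
  rw [h1, Polynomial.aeval_algebraMap_apply] at h0
  refine ⟨P.natDegree, P.eval s - s ^ P.natDegree, ?_, fun m ↦ ?_⟩
  · rw [Polynomial.eval_eq_sum_range, Finset.sum_range_succ, hP.coeff_natDegree, one_mul,
      add_sub_cancel_right]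
    refine sum_mem fun i hi ↦ I.mul_mem_right _ ?_
    exact Ideal.pow_le_self (Nat.sub_ne_zero_of_lt (Finset.mem_range.mp hi)) (hc i)
  · rw [add_sub_cancel]
    simpa using congr($h0 m)

/-- On the image of `N` modulo `L`, multiplication by `s` has values in `I` times this module. By
Cayley–Hamilton it satisfies a monic equation whose lower coefficients lie in `I`. It serves as
Nakayama's lemma near a prime that contains `I` but not `s`, without passing to the localization. -/
lemma exists_pow_add_mul_mem {R : Type*} [CommRing R] (N L I : Ideal R) (hN : N.FG) (s : R)
    (h : ∀ g ∈ N, s * g ∈ L ⊔ I * N) : ∃ n : ℕ, ∃ r ∈ I, ∀ g ∈ N, (s ^ n + r) * g ∈ L := by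
  have : Module.Finite R N := Module.Finite.iff_fg.mpr hN
  let π : N →ₗ[R] N ⧸ Submodule.comap N.subtype L := Submodule.mkQ _
  have hπ : Function.Surjective π := Submodule.mkQ_surjective _
  have hmk (g : N) : π g = 0 ↔ (g : R) ∈ L := Submodule.Quotient.mk_eq_zero _
  have hIN (g : R) (hg : g ∈ I * N) : ∃ y : N, (y : R) = g ∧ π y ∈
      I • (⊤ : Submodule R (N ⧸ Submodule.comap N.subtype L)) := by
    refine Submodule.mul_induction_on hg (fun a ha b hb ↦ ?_) fun x y hx hy ↦ ?_
    · exact ⟨a • ⟨b, hb⟩, rfl, by rw [map_smul]; exact Submodule.smul_mem_smul ha trivial⟩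
    · obtain ⟨x', rfl, hx⟩ := hx
      obtain ⟨y', rfl, hy⟩ := hy
      exact ⟨x' + y', rfl, by rw [map_add]; exact add_mem hx hy⟩
  obtain ⟨n, r, hr, hnr⟩ := exists_pow_add_smul_eq_zero
      (M := N ⧸ Submodule.comap N.subtype L) I s fun m ↦ by
    obtain ⟨g, rfl⟩ := hπ m
    obtain ⟨l, hl, y, hy, e⟩ := Submodule.mem_sup.mp (h g g.2)
    obtain ⟨y', rfl, hy'⟩ := hIN y hy
    have h1 : π (s • g - y') = 0 := by
      rw [hmk]
      change s * (g : R) - y' ∈ L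
      rwa [← e, add_sub_cancel_right]
    rw [map_sub, map_smul, sub_eq_zero] at h1
    rwa [h1]
  refine ⟨n, r, hr, fun g hg ↦ ?_⟩
  have := hnr (π ⟨g, hg⟩)
  rw [← map_smul, hmk] at this
  exact this

end Nakayama

/-! ### The conormal space of a coordinate subspace. -/

section GenericConormal

open MvPolynomial

variable {ι σ : Type} {B : Type u} [CommRing B]

variable (ι σ) in
/-- Reduction modulo `p` and restriction to the linear subspace where the coordinates `inr j`
vanish. -/
noncomputable def conormalHom (p : Ideal B) :
    MvPolynomial (ι ⊕ σ) B →+* MvPolynomial ι (B ⧸ p) :=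
  eval₂Hom (C.comp (Ideal.Quotient.mk p)) (Sum.elim X 0)

variable (ι σ) in
/-- The ideal of the conormal space of the zero locus of a prime `p`, in coordinates such that `p` is
generated by the coordinates `none` and `inl i`. -/
noncomputable abbrev genericConormal (p : Ideal B) : Ideal (MvPolynomial (ι ⊕ σ) B) :=
  RingHom.ker (conormalHom ι σ p)

lemma C_mem_genericConormal {p : Ideal B} {b : B} : C b ∈ genericConormal ι σ p ↔ b ∈ p := by
  rw [RingHom.mem_ker, conormalHom, coe_eval₂Hom, eval₂_C, RingHom.comp_apply,
    map_eq_zero_iff _ (C_injective _ _), Ideal.Quotient.eq_zero_iff_mem]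

lemma X_inr_mem_genericConormal (p : Ideal B) (j : σ) : X (Sum.inr j) ∈ genericConormal ι σ p := by
  rw [RingHom.mem_ker, conormalHom, coe_eval₂Hom, eval₂_X]; rfl

lemma sub_mem_of_forall_X_sub_mem {α R : Type*} [CommRing R]
    (φ : MvPolynomial α R →ₐ[R] MvPolynomial α R) (I : Ideal (MvPolynomial α R))
    (h : ∀ i, X i - φ (X i) ∈ I) (g : MvPolynomial α R) : g - φ g ∈ I := by
  have : Ideal.Quotient.mkₐ R I = (Ideal.Quotient.mkₐ R I).comp φ :=
    MvPolynomial.algHom_ext fun i ↦ (Ideal.Quotient.eq (I := I)).mpr (h i)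
  exact (Ideal.Quotient.eq (I := I)).mp congr($this g)

lemma conormalHom_rename (p : Ideal B) (g : MvPolynomial ι B) :
    conormalHom ι σ p (rename Sum.inl g) = map (Ideal.Quotient.mk p) g := by
  rw [conormalHom, coe_eval₂Hom, eval₂_rename, Sum.elim_comp_inl]
  induction g using MvPolynomial.induction_on with
  | C a => simp
  | add a b ha hb => rw [eval₂_add, ha, hb, map_add]
  | mul_X a i ha => rw [eval₂_mul, ha, eval₂_X, map_mul, map_X]

lemma genericConormal_eq (p : Ideal B) :
    genericConormal ι σ p = p.map C ⊔ Ideal.span (Set.range fun j : σ ↦ X (Sum.inr j)) := by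
  refine le_antisymm (fun g hg ↦ ?_) (sup_le ?_ ?_)
  · let φ : MvPolynomial (ι ⊕ σ) B →ₐ[B] MvPolynomial (ι ⊕ σ) B :=
      (rename Sum.inl).comp (aeval (Sum.elim X 0) : _ →ₐ[B] MvPolynomial ι B)
    have h1 := sub_mem_of_forall_X_sub_mem φ
      (Ideal.span (Set.range fun j : σ ↦ (X (Sum.inr j) : MvPolynomial (ι ⊕ σ) B))) (fun i ↦ by
        rcases i with i | j
        · simp [φ]
        · simpa [φ] using Ideal.subset_span (Set.mem_range_self j)) g
    have h3 : Ideal.span (Set.range fun j : σ ↦ X (Sum.inr j)) ≤ genericConormal ι σ p := by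
      rw [Ideal.span_le]; rintro _ ⟨j, rfl⟩; exact X_inr_mem_genericConormal p j
    have h2 : φ g ∈ genericConormal ι σ p := by
      simpa using sub_mem hg (h3 h1)
    rw [← sub_add_cancel g (φ g)]
    refine add_mem (Ideal.mem_sup_right h1) (Ideal.mem_sup_left ?_)
    rw [RingHom.mem_ker, AlgHom.comp_apply, conormalHom_rename] at h2
    have h5 : (aeval (Sum.elim X 0) g : MvPolynomial ι B) ∈ p.map C := by
      rw [mem_map_C_iff]
      intro m
      rw [← Ideal.Quotient.eq_zero_iff_mem, ← coeff_map, h2, coeff_zero]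
    have h6 := Ideal.mem_map_of_mem (rename (R := B) (Sum.inl (β := σ))).toRingHom h5
    rw [Ideal.map_map] at h6
    have h7 : (rename (R := B) (Sum.inl (β := σ))).toRingHom.comp (C (σ := ι)) = C := by ext; simp
    rw [h7] at h6
    exact h6
  · rw [Ideal.map_le_iff_le_comap]
    exact fun b hb ↦ C_mem_genericConormal.mpr hb
  · rw [Ideal.span_le]
    rintro _ ⟨j, rfl⟩
    exact X_inr_mem_genericConormal p j

lemma eval_conormalHom (p : Ideal B) (c : ι → B) (g : MvPolynomial (ι ⊕ σ) B) :
    eval (fun i ↦ Ideal.Quotient.mk p (c i)) (conormalHom ι σ p g) =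
      Ideal.Quotient.mk p (eval (Sum.elim c 0) g) := by
  induction g using MvPolynomial.induction_on with
  | C a => simp [conormalHom]
  | add a b ha hb => rw [map_add, map_add, ha, hb, map_add, map_add]
  | mul_X a i ha =>
    rw [map_mul, map_mul, ha, map_mul, map_mul]
    congr 1
    rcases i with i | i <;> simp [conormalHom]

lemma ker_killHom (k : Type*) [Field k] : RingHom.ker (killHom k ι σ) =
    Ideal.span (Set.range fun i : Option ι ↦ X (i.map Sum.inl)) := by
  refine le_antisymm (fun g hg ↦ ?_) ?_
  · have h1 := sub_mem_of_forall_X_sub_mem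
      ((rename fun j ↦ some (Sum.inr j)).comp (killHom k ι σ))
      (Ideal.span (Set.range fun i : Option ι ↦
          (X (i.map Sum.inl) : MvPolynomial (Option (ι ⊕ σ)) k))) (fun i ↦ by
        rcases i with _ | i | j
        · simp [killHom]
          exact Ideal.subset_span ⟨none, rfl⟩
        · simp [killHom]
          exact Ideal.subset_span ⟨some i, rfl⟩
        · simp [killHom]) g
    rwa [AlgHom.comp_apply, RingHom.mem_ker.mp hg, map_zero, sub_zero] at h1
  · rw [Ideal.span_le]
    rintro _ ⟨i | i, rfl⟩ <;> simp [killHom]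

end GenericConormal

end LagrangianSpecialization

namespace LagrangianSpecialization

/-! ### The conormal space of Y lies in the relative conormal variety of X. -/

section UpperBound

open MvPolynomial

variable {k : Type u} [Field k] {ι σ : Type} {B : Type u} [CommRing B] [Algebra k B]

/-- The field `k` is infinite, so a polynomial over the domain `B/p` that vanishes at all constant
vectors with nonzero entries is zero. This reduces statements about the conormal space to its
constant sections. -/
lemma mem_genericConormal_of_eval [CharZero k] [Finite ι] (p : Ideal B) [p.IsPrime]
    (g : MvPolynomial (ι ⊕ σ) B) (h : ∀ c : ι → k, (∀ i, c i ≠ 0) →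
    eval (fun i ↦ Ideal.Quotient.mk p (algebraMap k B (c i))) (conormalHom ι σ p g) = 0) :
    g ∈ genericConormal ι σ p := by
  have hinj : Function.Injective (algebraMap k (B ⧸ p)) := (algebraMap k (B ⧸ p)).injective
  rw [RingHom.mem_ker]
  refine MvPolynomial.funext_set (fun _ ↦ algebraMap k (B ⧸ p) '' {0}ᶜ)
    (fun _ ↦ (Set.infinite_image_iff hinj.injOn).mpr (Set.Finite.infinite_compl (Set.finite_singleton 0))) fun y hy ↦ ?_
  rw [map_zero]
  have hy' (i : ι) : ∃ c : k, c ≠ 0 ∧ algebraMap k (B ⧸ p) c = y i := hy i trivial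
  choose c hc hcy using hy'
  rw [← h c hc]
  congr 2
  funext i
  exact (hcy i).symm

variable [Algebra (MvPolynomial (Option (ι ⊕ σ)) k) B] [IsScalarTower k (MvPolynomial (Option (ι ⊕ σ)) k) B]

/-- The point (x, u∇F) = (x, (c, v)) over the function field of V(x) is a conormal vector, so `g`
vanishes at it. Modulo the maximal ideal of a valuation ring centered at `p` the vector `v` becomes
zero, and the point specializes to (c, 0) over `B/p`. -/
theorem eval_conormalHom_eq_zero [CharZero k] [Fintype ι] [DecidableEq ι] [Fintype σ]
    [DecidableEq σ] [Algebra.Etale (MvPolynomial (Option (ι ⊕ σ)) k) B] (p : Ideal B) [p.IsPrime]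
    (hp : p = (RingHom.ker (killHom k ι σ)).map (algebraMap _ B)) (x : Ideal B) [x.IsPrime]
    (hxp : x < p) (hmax : ∀ Q : Ideal B, Q.IsPrime → x ≤ Q → Q ≤ p → Q = x ∨ Q = p)
    (F : B) (hF : F ∈ x) (c : ι → k) (i₀ : ι) (hc : c i₀ ≠ 0)
    (hG : ∀ i, algebraMap k B (c i₀) * partialDer k B (some (Sum.inl (β := σ) i)) F -
      algebraMap k B (c i) * partialDer k B (some (Sum.inl (β := σ) i₀)) F ∈ x)
    (hsm : ∃ i : ι ⊕ σ, partialDer k B (some i) F ∉ x) (g : MvPolynomial (ι ⊕ σ) B)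
    (hg : g ∈ conormalIdeal (fun i : ι ⊕ σ ↦ partialDer k B (some i) F) x) :
    eval (fun i ↦ Ideal.Quotient.mk p (algebraMap k B (c i))) (conormalHom ι σ p g) = 0 := by
  let K := FractionRing (B ⧸ x)
  have hKx (b : B) : algebraMap B K b = 0 ↔ b ∈ x := by
    rw [IsScalarTower.algebraMap_apply B (B ⧸ x) K,
      map_eq_zero_iff _ (IsFractionRing.injective (B ⧸ x) K),
      Ideal.Quotient.algebraMap_eq, Ideal.Quotient.eq_zero_iff_mem]
  obtain ⟨v, u, -, h1, h2, hV⟩ := exists_evaluation p hp x hxp hmax F hF c i₀ hc hG hsm K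
  obtain ⟨V, hV1, hV2, hV3⟩ := exists_valuationSubring_of_prime (K := K) p fun b hb ↦
    hxp.le ((hKx b).mp hb)
  have hv := hV V hV1 hV2 hV3
  let φ : B →+* V := (algebraMap B K).codRestrict V.toSubring hV1
  let v' (j : σ) : V := ⟨v j, (V.valuation_le_one_iff _).mp (hv j).le⟩
  have h3 : eval₂ φ (Sum.elim (fun i ↦ φ (algebraMap k B (c i))) v') g = 0 := by
    apply V.subtype_injective
    rw [hom_eval₂, map_zero]
    have h4 := eval_eq_zero_of_mem_conormalIdeal _ hg (algebraMap B K) (fun b hb ↦ (hKx b).mpr hb) u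
    rw [← h4]
    congr 1
    funext i
    rcases i with i | j
    · exact (h1 i).symm
    · exact (h2 j).symm
  have h4 := congrArg (residue V) h3
  rw [hom_eval₂, map_zero] at h4
  have hres (b : B) : residue V (φ b) = 0 ↔ b ∈ p := by
    rw [residue_eq_zero_iff, V.valuation_lt_one_iff]
    exact ⟨fun h ↦ by_contra fun h' ↦ h.ne (hV3 b h'), fun h ↦ hV2 b h⟩
  rw [eval_conormalHom, Ideal.Quotient.eq_zero_iff_mem, ← hres, ← h4]
  have h5 := hom_eval₂ g (RingHom.id B) ((residue V).comp φ)
    (Sum.elim (fun i ↦ algebraMap k B (c i)) (0 : σ → B))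
  rw [RingHom.comp_id] at h5
  rw [← eval₂_id]
  refine h5.trans ?_
  congr 1
  funext i
  rcases i with i | j
  · rfl
  · have h6 : residue V (v' j) = 0 := by
      rw [residue_eq_zero_iff, V.valuation_lt_one_iff]
      exact hv j
    simp [h6]

lemma exists_maximal_prime_lt {B : Type*} [CommRing B] [IsNoetherianRing B] (I p : Ideal B)
    [p.IsPrime] (hI : I ≤ p) (hp : p ∉ I.minimalPrimes) :
    ∃ x : Ideal B, x.IsPrime ∧ I ≤ x ∧ x < p ∧
      ∀ Q : Ideal B, Q.IsPrime → x ≤ Q → Q ≤ p → Q = x ∨ Q = p := by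
  obtain ⟨x₀, hx₀, hxp₀⟩ := Ideal.exists_minimalPrimes_le hI
  obtain ⟨x, hx, hmax⟩ := set_has_maximal_iff_noetherian.mpr (inferInstanceAs (IsNoetherian B B))
    {x : Ideal B | x.IsPrime ∧ I ≤ x ∧ x < p}
    ⟨x₀, hx₀.1.1, hx₀.1.2, hxp₀.lt_of_ne fun h ↦ hp (h ▸ hx₀)⟩
  refine ⟨x, hx.1, hx.2.1, hx.2.2, fun Q hQ h1 h2 ↦ ?_⟩
  by_cases h : Q = p
  · exact .inr h
  · exact .inl (eq_of_le_of_not_lt h1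
      (hmax Q ⟨hQ, hx.2.1.trans h1, h2.lt_of_ne h⟩)).symm

/-- For constants `c` the polar locus is defined by `card ι` equations, all of them in `p`. Since
`p` has height at least `card ι + 1`, Krull's theorem shows that it is not minimal over them. So
there is a prime `x` immediately below `p` that contains the polar equations, and
`eval_conormalHom_eq_zero` applies along V(x). -/
theorem conormalIdeal_le_genericConormal [CharZero k] [Fintype ι] [DecidableEq ι] [Fintype σ]
    [DecidableEq σ] [Nonempty ι] [Algebra.Etale (MvPolynomial (Option (ι ⊕ σ)) k) B] (p : Ideal B)
    [p.IsPrime]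
    (hp : p = (RingHom.ker (killHom k ι σ)).map (algebraMap _ B)) (F : B) (hF : F ∈ p)
    (hD : (∀ i : ι, partialDer k B (some (Sum.inl (β := σ) i)) F ∈ p) ∨ Subsingleton ι)
    (hsm : ∀ x : Ideal B, x.IsPrime → F ∈ x → x < p →
      ∃ i : ι ⊕ σ, partialDer k B (some i) F ∉ x) :
    conormalIdeal (fun i : ι ⊕ σ ↦ partialDer k B (some i) F) (Ideal.span {F}) ≤
      genericConormal ι σ p := by
  classical
  have : Algebra.FiniteType k B := .trans (S := MvPolynomial (Option (ι ⊕ σ)) k) inferInstance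
    inferInstance
  have : IsNoetherianRing B := Algebra.FiniteType.isNoetherianRing k B
  have i₀ : ι := Classical.arbitrary ι
  refine fun g hg ↦ mem_genericConormal_of_eval (k := k) p g fun c hc ↦ ?_
  let G (i : ι) : B := algebraMap k B (c i₀) * partialDer k B (some (Sum.inl (β := σ) i)) F -
      algebraMap k B (c i) * partialDer k B (some (Sum.inl (β := σ) i₀)) F
  have hG0 : G i₀ = 0 := sub_self _
  -- The polar equation with index `i₀` is trivial, so `F` takes its place and the number of
  -- generators stays `card ι`.
  let T : Finset B := Finset.univ.image fun i ↦ if i = i₀ then F else G i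
  have hT : Ideal.span (T : Set B) ≤ p := by
    rw [Ideal.span_le]
    intro b hb
    obtain ⟨i, -, rfl⟩ := Finset.mem_image.mp hb
    split_ifs with h
    · exact hF
    -- The polar equations lie in `p` either because the z-derivatives of `F` do, or because with a
    -- single z-coordinate only the trivial one exists.
    · rcases hD with hD | hD
      · exact sub_mem (p.mul_mem_left _ (hD i)) (p.mul_mem_left _ (hD i₀))
      · exact (h (Subsingleton.elim _ _)).elim
  have hpT : p ∉ (Ideal.span (T : Set B)).minimalPrimes := fun h ↦ by
    have h1 := Ideal.height_le_card_of_mem_minimalPrimes_span_finset h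
    have h2 := (card_le_height p hp).trans h1
    have h3 : T.card ≤ Fintype.card ι := Finset.card_image_le
    have h4 : Fintype.card ι + 1 ≤ T.card := by exact_mod_cast h2
    omega
  obtain ⟨x, hx, hTx, hxp, hmax⟩ := exists_maximal_prime_lt _ p hT hpT
  have hTx' (i : ι) : (if i = i₀ then F else G i) ∈ x :=
    hTx (Ideal.subset_span (Finset.mem_coe.mpr (Finset.mem_image_of_mem _ (Finset.mem_univ i))))
  have hFx : F ∈ x := by simpa using hTx' i₀
  refine eval_conormalHom_eq_zero p hp x hxp hmax F hFx c i₀ (hc i₀) (fun i ↦ ?_)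
    (hsm x hx hFx hxp) g (conormalIdeal_mono _ (by rwa [Ideal.span_singleton_le_iff_mem]) hg)
  by_cases h : i = i₀
  · subst h
    change G i ∈ x
    rw [hG0]; exact x.zero_mem
  · simpa only [if_neg h] using hTx' i

end UpperBound

/-! ### Heights of conormal ideals and minimality of the conormal space of Y. -/

section Generization

open MvPolynomial

/-- Over the fraction field, impose the relations X_i = (G_i/G_{i₀}) X_{i₀} for one `i ≠ i₀` after
another; the kernels form a strict chain of `card n - 1` steps. The last kernel is the closure of
all scaled gradients. It lies strictly inside the conormal ideal of `x`, because it contains no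
nonzero element of `B`. -/
lemma card_le_height_conormalIdeal {B : Type*} [CommRing B] [IsDomain B] {n : Type*} [Fintype n]
    (G : n → B) (i₀ : n) (hG : G i₀ ≠ 0) (x : Ideal B) [x.IsPrime] (hx : x ≠ ⊥) :
    (Fintype.card n : ℕ∞) ≤ (conormalIdeal G x).height := by
  classical
  let K := FractionRing B
  let γ (i : n) : K := algebraMap B K (G i) / algebraMap B K (G i₀)
  have hinj := IsFractionRing.injective B K
  have h0 : algebraMap B K (G i₀) ≠ 0 := (map_ne_zero_iff _ hinj).mpr hG
  let α := {i : n // i ≠ i₀}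
  let ψ (s : Finset α) : MvPolynomial n K →ₐ[K] MvPolynomial n K := aeval fun i ↦
    if i ∈ s.image Subtype.val then C (γ i) * X i₀ else X i
  let φ (s : Finset α) : MvPolynomial n B →+* MvPolynomial n K :=
    (ψ s).toRingHom.comp (map (algebraMap B K))
  have hi₀ (s : Finset α) : i₀ ∉ s.image Subtype.val := fun h ↦ by
    obtain ⟨a, -, ha⟩ := Finset.mem_image.mp h
    exact a.2 ha
  have hψ₀ (s : Finset α) : ψ s (X i₀) = X i₀ := (aeval_X _ _).trans (if_neg (hi₀ s))
  have hψ (s : Finset α) (i : n) (hi : i ∈ s.image Subtype.val) : ψ s (X i) = C (γ i) * X i₀ :=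
    (aeval_X _ _).trans (if_pos hi)
  have hψ' (s : Finset α) (i : n) (hi : i ∉ s.image Subtype.val) : ψ s (X i) = X i :=
    (aeval_X _ _).trans (if_neg hi)
  have hφX (s : Finset α) (i : n) : φ s (X i) = ψ s (X i) := congrArg (ψ s) (map_X _ i)
  have hφC (s : Finset α) (b : B) : φ s (C b) = C (algebraMap B K b) := by
    change ψ s (map _ (C b)) = _
    rw [map_C]
    exact (ψ s).commutes _
  have key := card_le_height_of_strictMono (fun s ↦ RingHom.ker (φ s))
    (fun s ↦ RingHom.ker_isPrime _) (fun s a ha ↦ ?_) Finset.univ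
  · have hα : Fintype.card n = (Finset.univ : Finset α).card + 1 := by
      have h1 : 0 < Fintype.card n := Fintype.card_pos_iff.mpr ⟨i₀⟩
      rw [Finset.card_univ, Fintype.card_subtype_compl, Fintype.card_subtype_eq]
      omega
    have : (RingHom.ker (φ Finset.univ)).IsPrime := RingHom.ker_isPrime _
    have hlt : RingHom.ker (φ Finset.univ) < conormalIdeal G x := by
      obtain ⟨b, hb, hb0⟩ := Submodule.exists_mem_ne_zero_of_ne_bot hx
      refine SetLike.lt_iff_le_and_exists.mpr ⟨fun g hg ↦ ?_, C b, (C_mem_conormalIdeal G).mpr hb, ?_⟩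
      · have h1 : (aeval (fun i ↦ Polynomial.C (algebraMap B K (G i)) * Polynomial.X) :
            MvPolynomial n K →ₐ[K] Polynomial K) (map (algebraMap B K) g) = 0 := by
          let θ : MvPolynomial n K →ₐ[K] Polynomial K :=
            aeval fun _ ↦ Polynomial.C (algebraMap B K (G i₀)) * Polynomial.X
          have : (aeval (fun i ↦ Polynomial.C (algebraMap B K (G i)) * Polynomial.X) :
              MvPolynomial n K →ₐ[K] Polynomial K) = θ.comp (ψ Finset.univ) := by
            refine MvPolynomial.algHom_ext fun i ↦ ?_
            by_cases hi : i = i₀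
            · subst hi
              rw [AlgHom.comp_apply, hψ₀]
              simp [θ]
            · rw [AlgHom.comp_apply, hψ _ _ (Finset.mem_image.mpr ⟨⟨i, hi⟩, Finset.mem_univ _, rfl⟩),
                map_mul, aeval_X, aeval_X, aeval_C, Polynomial.algebraMap_eq, ← mul_assoc,
                ← Polynomial.C_mul, div_mul_cancel₀ _ h0]
          rw [this, AlgHom.comp_apply]
          exact (congrArg θ (RingHom.mem_ker.mp hg)).trans (map_zero θ)
        have h2 : (aeval (fun i ↦ Polynomial.C (G i) * Polynomial.X) g : Polynomial B) = 0 := by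
          apply Polynomial.map_injective _ hinj
          rw [Polynomial.map_zero, ← h1, aeval_map_algebraMap, aeval_def, ← Polynomial.coe_mapRingHom,
            hom_eval₂, aeval_def]
          congr 1
          · ext b; simp
          · funext i; simp
        rw [conormalIdeal, Ideal.mem_comap, h2]
        exact zero_mem _
      · rw [RingHom.mem_ker, hφC, map_eq_zero_iff _ (C_injective _ _), map_eq_zero_iff _ hinj]
        exact hb0
    rw [hα]
    push_cast
    exact (add_le_add_left key 1).trans (Ideal.height_add_one_le_of_lt_of_isPrime hlt)
  · have hmem (t : Finset α) (b : α) : (b : n) ∈ t.image Subtype.val ↔ b ∈ t := by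
      rw [Finset.mem_image]
      exact ⟨fun ⟨c, hc, h⟩ ↦ Subtype.ext h ▸ hc, fun h ↦ ⟨b, h, rfl⟩⟩
    have hcomp : ψ (insert a s) = (ψ (insert a s)).comp (ψ s) := by
      refine MvPolynomial.algHom_ext fun i ↦ ?_
      rw [AlgHom.comp_apply]
      by_cases hi : i ∈ s.image Subtype.val
      · rw [hψ s i hi, map_mul, hψ₀, hψ _ i (Finset.image_subset_image (Finset.subset_insert a s) hi)]
        congr 1
        exact ((ψ (insert a s)).commutes _).symm
      · rw [hψ' s i hi]
    refine lt_of_le_of_ne (fun f hf ↦ ?_) fun h ↦ ?_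
    · have h1 : ψ s (map (algebraMap B K) f) = 0 := hf
      change ψ (insert a s) (map (algebraMap B K) f) = 0
      rw [hcomp, AlgHom.comp_apply, h1, map_zero]
    · have h1 : C (G i₀) * X a.1 - C (G a.1) * X i₀ ∈ RingHom.ker (φ (insert a s)) := by
        rw [RingHom.mem_ker, map_sub, map_mul, map_mul, hφC, hφC, hφX, hφX, hψ₀,
          hψ _ _ ((hmem _ a).mpr (Finset.mem_insert_self _ _)), ← mul_assoc, ← C_mul,
          mul_div_cancel₀ _ h0, sub_self]
      rw [← h, RingHom.mem_ker, map_sub, map_mul, map_mul, hφC, hφC, hφX, hφX, hψ₀,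
        hψ' _ _ ((hmem s a).not.mpr ha)] at h1
      have h2 := congrArg (coeff (Finsupp.single a.1 1)) h1
      rw [coeff_sub, coeff_C_mul, coeff_C_mul, coeff_X, coeff_single_X, coeff_zero,
        if_pos rfl, if_neg (fun h ↦ a.2 h.2.symm), mul_zero, sub_zero, mul_one] at h2
      exact h0 h2

end Generization

end LagrangianSpecialization

namespace LagrangianSpecialization

section Generization

open MvPolynomial

variable {k : Type u} [Field k] {ι σ : Type} {B : Type u} [CommRing B]
  [Algebra (MvPolynomial (Option (ι ⊕ σ)) k) B]

lemma map_ker_killHom : (RingHom.ker (killHom k ι σ)).map (algebraMap _ B) =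
    Ideal.span (Set.range fun i : Option ι ↦ coord k B (i.map (Sum.inl (β := σ)))) := by
  rw [ker_killHom, Ideal.map_span, ← Set.range_comp]
  rfl

lemma genericConormal_eq_span (p : Ideal B)
    (hp : p = (RingHom.ker (killHom k ι σ)).map (algebraMap _ B)) :
    genericConormal ι σ p = Ideal.span (Set.range fun i : Option (ι ⊕ σ) ↦
      i.elim (C (coord k B (none : Option (ι ⊕ σ)))) (Sum.elim
        (fun i ↦ C (coord k B (some (Sum.inl (β := σ) i)))) fun j ↦ X (Sum.inr j))) := by
  rw [genericConormal_eq, hp, map_ker_killHom, Ideal.map_span, ← Set.range_comp]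
  refine le_antisymm (sup_le ?_ ?_) ?_
  · rw [Ideal.span_le]
    rintro _ ⟨_ | i, rfl⟩
    · exact Ideal.subset_span ⟨none, rfl⟩
    · exact Ideal.subset_span ⟨some (Sum.inl i), rfl⟩
  · rw [Ideal.span_le]
    rintro _ ⟨j, rfl⟩
    exact Ideal.subset_span ⟨some (Sum.inr j), rfl⟩
  · rw [Ideal.span_le]
    rintro _ ⟨_ | i | j, rfl⟩
    · exact Ideal.mem_sup_left (Ideal.subset_span ⟨none, rfl⟩)
    · exact Ideal.mem_sup_left (Ideal.subset_span ⟨some i, rfl⟩)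
    · exact Ideal.mem_sup_right (Ideal.subset_span ⟨j, rfl⟩)

/-- A radical ideal of a Noetherian ring is a finite intersection of primes, and an element in the
conormal ideals of all these primes is in the one of their intersection. A prime containing a finite
intersection contains one of its members. -/
lemma exists_conormalIdeal_le {B : Type*} [CommRing B] [IsNoetherianRing B] {n : Type*} (G : n → B)
    (I : Ideal B) (hI : I.IsRadical) (Q : Ideal (MvPolynomial n B)) [Q.IsPrime]
    (h : conormalIdeal G I ≤ Q) : ∃ x ∈ I.minimalPrimes, conormalIdeal G x ≤ Q := by
  have hfin := Ideal.finite_minimalPrimes_of_isNoetherianRing B I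
  have h1 : hfin.toFinset.inf (conormalIdeal G) ≤ Q := by
    refine le_trans (fun g hg ↦ ?_) h
    rw [← hI.radical, ← Ideal.sInf_minimalPrimes]
    refine mem_conormalIdeal_sInf G fun x hx ↦ ?_
    rw [Submodule.mem_finsetInf] at hg
    exact hg x (hfin.mem_toFinset.mpr hx)
  obtain ⟨x, hx, hxQ⟩ := (Ideal.IsPrime.inf_le' (inferInstance : Q.IsPrime)).mp h1
  exact ⟨x, hfin.mem_toFinset.mp hx, hxQ⟩

/-- Let n = `card (ι ⊕ σ)`. `Q` contains the conormal ideal of a component `x` of F = 0, of height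
at least n, and strictly so because t ∉ x. Hence `Q` has height at least n + 1. The conormal ideal
of Y is generated by n + 1 elements, so there is no room for a strict inclusion. -/
theorem eq_genericConormal [Algebra k B] [IsScalarTower k (MvPolynomial (Option (ι ⊕ σ)) k) B]
    [Fintype ι] [DecidableEq ι] [Fintype σ] [IsDomain B]
    [DecidableEq σ] [Algebra.Etale (MvPolynomial (Option (ι ⊕ σ)) k) B] (p : Ideal B)
    [p.IsPrime]
    (hp : p = (RingHom.ker (killHom k ι σ)).map (algebraMap _ B)) (F : B) (hF0 : F ≠ 0)
    (hsm : ∀ x : Ideal B, x.IsPrime → F ∈ x → x < p →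
      ∃ i : ι ⊕ σ, partialDer k B (some i) F ∉ x)
    (hFr : (Ideal.span {F}).IsRadical)
    (hFt : ∀ x ∈ (Ideal.span {F}).minimalPrimes, coord k B (none : Option (ι ⊕ σ)) ∉ x)
    (Q : Ideal (MvPolynomial (ι ⊕ σ) B)) [Q.IsPrime] (hQ : Q ≤ genericConormal ι σ p)
    (hLQ : conormalIdeal (fun i : ι ⊕ σ ↦ partialDer k B (some i) F) (Ideal.span {F}) ≤ Q)
    (htQ : C (coord k B (none : Option (ι ⊕ σ))) ∈ Q) : Q = genericConormal ι σ p := by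
  classical
  have : Algebra.FiniteType k B := .trans (S := MvPolynomial (Option (ι ⊕ σ)) k) inferInstance
    inferInstance
  have : IsNoetherianRing B := Algebra.FiniteType.isNoetherianRing k B
  have ht : coord k B (none : Option (ι ⊕ σ)) ∈ p := by
    rw [hp, map_ker_killHom]; exact Ideal.subset_span ⟨none, rfl⟩
  obtain ⟨x, hx, hxQ⟩ := exists_conormalIdeal_le _ _ hFr Q hLQ
  have hxprime : x.IsPrime := hx.1.1
  have hFx : F ∈ x := hx.1.2 (Ideal.mem_span_singleton_self F)
  have hxp : x < p := by
    refine lt_of_le_of_ne (fun b hb ↦ ?_) fun h ↦ hFt x hx (h ▸ ht)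
    exact C_mem_genericConormal.mp (hQ (hxQ ((C_mem_conormalIdeal _).mpr hb)))
  obtain ⟨i₀, hi₀⟩ := hsm x hxprime hFx hxp
  have h1 := card_le_height_conormalIdeal (fun i : ι ⊕ σ ↦ partialDer k B (some i) F) i₀
    (fun h ↦ hi₀ (by rw [h]; exact x.zero_mem)) x (fun h ↦ hF0 (by rwa [h] at hFx))
  have hlt : conormalIdeal (fun i : ι ⊕ σ ↦ partialDer k B (some i) F) x < Q :=
    lt_of_le_of_ne hxQ fun h ↦ hFt x hx ((C_mem_conormalIdeal _).mp (h ▸ htQ))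
  have h2 := Ideal.height_add_one_le_of_lt_of_isPrime hlt
  by_contra hne
  have : (genericConormal ι σ p).IsPrime := RingHom.ker_isPrime _
  have h3 := Ideal.height_add_one_le_of_lt_of_isPrime (lt_of_le_of_ne hQ hne)
  have h4 : (genericConormal ι σ p).height ≤ (Fintype.card (Option (ι ⊕ σ)) : ℕ∞) := by
    let T : Finset (MvPolynomial (ι ⊕ σ) B) := Finset.univ.image fun i : Option (ι ⊕ σ) ↦
      i.elim (C (coord k B (none : Option (ι ⊕ σ)))) (Sum.elim
        (fun i ↦ C (coord k B (some (Sum.inl (β := σ) i)))) fun j ↦ X (Sum.inr j))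
    have hT : genericConormal ι σ p = Ideal.span (T : Set (MvPolynomial (ι ⊕ σ) B)) := by
      rw [genericConormal_eq_span p hp, Finset.coe_image, Finset.coe_univ, Set.image_univ]
    have h5 : genericConormal ι σ p ∈ (Ideal.span (T : Set (MvPolynomial (ι ⊕ σ) B))).minimalPrimes := by
      rw [← hT, Ideal.minimalPrimes_eq_subsingleton_self]
      rfl
    refine (Ideal.height_le_card_of_mem_minimalPrimes_span_finset h5).trans ?_
    exact_mod_cast Finset.card_image_le
  have h6 : ((Fintype.card (ι ⊕ σ) + 1 + 1 : ℕ) : ℕ∞) ≤ (Fintype.card (ι ⊕ σ) + 1 : ℕ) := by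
    rw [Fintype.card_option] at h4
    refine le_trans ?_ h4
    push_cast
    exact (add_le_add_left ((add_le_add_left h1 1).trans h2) 1).trans h3
  have := Nat.cast_le.mp h6
  omega

end Generization

/-! ### Failure of reducedness where Y is a component of the fiber of X. -/

section Multiplicity

open MvPolynomial

/-- Let N_x be the conormal ideal of `x` and L that of `I`. As t ∉ x, the hypothesis gives s N_x ⊆ L
+ t N_x. The determinant trick then provides s^m + r outside `q` that carries N_x into L, hence into
N_y. So N_x ⊆ N_y, and comparing constants gives x ≤ y. Consequently only one branch of V(I) can be
involved where the fiber is reduced. -/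
lemma le_of_conormalIdeal {B : Type*} [CommRing B] [IsNoetherianRing B] {n : Type*} [Finite n]
    (G : n → B) (I : Ideal B) (t : B) (q : Ideal (MvPolynomial n B)) [q.IsPrime]
    (htq : C t ∈ q)
    (s : MvPolynomial n B) (hs : s ∉ q)
    (h : ∀ g ∈ q, s * g ∈ conormalIdeal G I ⊔ Ideal.span {C t}) (x y : Ideal B) [x.IsPrime]
    [y.IsPrime] (hIx : I ≤ x) (hIy : I ≤ y) (hxq : conormalIdeal G x ≤ q)
    (hyq : conormalIdeal G y ≤ q) (htx : t ∉ x) : x ≤ y := by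
  obtain ⟨m, r, hr, h1⟩ := exists_pow_add_mul_mem (conormalIdeal G x) (conormalIdeal G I)
    (Ideal.span {C t}) (IsNoetherian.noetherian _) s fun g hg ↦ by
      obtain ⟨l, hl, y, hy, e⟩ := Submodule.mem_sup.mp (h g (hxq hg))
      obtain ⟨b, rfl⟩ := Ideal.mem_span_singleton.mp hy
      rw [← e]
      refine add_mem (Ideal.mem_sup_left hl) (Ideal.mem_sup_right
        (Ideal.mul_mem_mul (Ideal.mem_span_singleton_self _) ?_))
      have h2 : C t * b ∈ conormalIdeal G x := by
        rw [eq_sub_of_add_eq' e]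
        exact sub_mem (Ideal.mul_mem_left _ _ hg) (conormalIdeal_mono G hIx hl)
      exact ((inferInstance : (conormalIdeal G x).IsPrime).mem_or_mem h2).resolve_left
        fun h3 ↦ htx ((C_mem_conormalIdeal G).mp h3)
  intro b hb
  have h2 := conormalIdeal_mono G hIy (h1 (C b) ((C_mem_conormalIdeal G).mpr hb))
  refine (C_mem_conormalIdeal G).mp
    (((inferInstance : (conormalIdeal G y).IsPrime).mem_or_mem h2).resolve_left fun h3 ↦ ?_)
  have h4 : r ∈ q := (Ideal.span_singleton_le_iff_mem _).mpr htq hr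
  have h5 : s ^ m ∈ q := by
    rw [eq_sub_of_add_eq (rfl : s ^ m + r = _)]
    exact sub_mem (hyq h3) h4
  exact hs (‹q.IsPrime›.mem_of_pow_mem _ h5)

lemma exists_mul_mem_of_unique_minimalPrime {B : Type*} [CommRing B] [IsNoetherianRing B]
    (I p x : Ideal B) [p.IsPrime] (hI : I.IsRadical)
    (hx : ∀ y ∈ I.minimalPrimes, y ≤ p → y = x) (b : B) (hb : b ∈ x) : ∃ s ∉ p, s * b ∈ I := by
  classical
  have hfin := (Ideal.finite_minimalPrimes_of_isNoetherianRing B I).subset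
    (Set.sdiff_subset (t := {x}))
  have h1 : ¬ hfin.toFinset.inf id ≤ p := fun h ↦ by
    obtain ⟨y, hy, hyp⟩ := (Ideal.IsPrime.inf_le' ‹p.IsPrime›).mp h
    obtain ⟨hy1, hy2⟩ := hfin.mem_toFinset.mp hy
    exact hy2 (hx y hy1 hyp)
  obtain ⟨s, hs, hsp⟩ := Set.not_subset.mp h1
  refine ⟨s, hsp, ?_⟩
  rw [← hI.radical, ← Ideal.sInf_minimalPrimes, Ideal.mem_sInf]
  intro y hy
  by_cases h : y = x
  · rw [h]; exact x.mul_mem_left _ hb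
  · exact y.mul_mem_right _ ((Submodule.mem_finsetInf).mp hs y (hfin.mem_toFinset.mpr ⟨hy, h⟩))

end Multiplicity

end LagrangianSpecialization

namespace LagrangianSpecialization

section Multiplicity

open MvPolynomial

/-- Expressions r + t a with a ∈ R[T] are closed under sums and products, so R[T] is the image of
`R` plus t R[T]. Its generators are integral, so R[T] is a finite module and Nakayama removes the
second summand. -/
lemma exists_eq_mul_algebraMap {R K : Type*} [CommRing R] [IsLocalRing R] [Field K] [Algebra R K]
    {T : Set K} (hfin : T.Finite) (hint : ∀ τ ∈ T, IsIntegral R τ) {t : R}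
    (ht : t ∈ maximalIdeal R)
    (hT : ∀ τ ∈ T, ∃ r : R, ∃ a ∈ Algebra.adjoin R T, τ = algebraMap R K r + algebraMap R K t * a)
    {a : K} (ha : a ∈ Algebra.adjoin R T) : ∃ r : R, a = algebraMap R K r := by
  let S := Algebra.adjoin R T
  have h1 : Subalgebra.toSubmodule S ≤ (1 : Submodule R K) ⊔
      maximalIdeal R • Subalgebra.toSubmodule S := by
    have h2 (a : K) (ha : a ∈ S) : ∃ r : R, ∃ b ∈ S, a = algebraMap R K r + algebraMap R K t * b := by
      induction ha using Algebra.adjoin_induction with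
      | mem x hx => exact hT x hx
      | algebraMap r => exact ⟨r, 0, zero_mem _, by simp⟩
      | add x y hx hy ihx ihy =>
        obtain ⟨r, b, hb, rfl⟩ := ihx
        obtain ⟨r', b', hb', rfl⟩ := ihy
        exact ⟨r + r', b + b', add_mem hb hb', by rw [map_add]; ring⟩
      | mul x y hx hy ihx ihy =>
        obtain ⟨r, b, hb, rfl⟩ := ihx
        obtain ⟨r', b', hb', rfl⟩ := ihy
        refine ⟨r * r', algebraMap R K r * b' + b * (algebraMap R K r' + algebraMap R K t * b'),
          add_mem (mul_mem (S.algebraMap_mem r) hb') (mul_mem hb hy), by rw [map_mul]; ring⟩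
    intro a ha
    obtain ⟨r, b, hb, rfl⟩ := h2 a ha
    refine add_mem (Submodule.mem_sup_left (Submodule.mem_one.mpr ⟨r, rfl⟩))
      (Submodule.mem_sup_right ?_)
    rw [← Algebra.smul_def]
    exact Submodule.smul_mem_smul ht hb
  have h3 := Submodule.le_of_le_smul_of_le_jacobson_bot
    (fg_adjoin_of_finite hfin hint) (IsLocalRing.maximalIdeal_le_jacobson _) h1 ha
  obtain ⟨r, hr⟩ := Submodule.mem_one.mp h3
  exact ⟨r, hr.symm⟩

lemma eval₂_mem_of_forall_mem {R B K : Type*} [CommRing R] [CommRing B] [Field K] [Algebra R K]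
    [Algebra B R] [Algebra B K] [IsScalarTower B R K] (S : Subalgebra R K) {n : Type*} (v : n → K)
    (hv : ∀ i, v i ∈ S) (g : MvPolynomial n B) : eval₂ (algebraMap B K) v g ∈ S := by
  induction g using MvPolynomial.induction_on with
  | C a => rw [eval₂_C, IsScalarTower.algebraMap_apply B R K]; exact S.algebraMap_mem _
  | add a b ha hb => rw [eval₂_add]; exact add_mem ha hb
  | mul_X a i ha => rw [eval₂_mul, eval₂_X]; exact mul_mem ha (hv i)

lemma exists_eval₂_eq_add_mul {R B K : Type*} [CommRing R] [CommRing B] [Field K] [Algebra R K]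
    [Algebra B R] [Algebra B K] [IsScalarTower B R K] (S : Subalgebra R K) {n : Type*} (v : n → K)
    (hvS : ∀ i, v i ∈ S) (w : n → B) (t : K)
    (hv : ∀ i, ∃ a ∈ S, v i = algebraMap B K (w i) + t * a) (g : MvPolynomial n B) :
    ∃ a ∈ S, eval₂ (algebraMap B K) v g = algebraMap B K (eval w g) + t * a := by
  induction g using MvPolynomial.induction_on with
  | C a => exact ⟨0, zero_mem _, by simp⟩
  | add a b ha hb =>
    obtain ⟨a', ha', ha⟩ := ha
    obtain ⟨b', hb', hb⟩ := hb
    exact ⟨a' + b', add_mem ha' hb', by rw [eval₂_add, ha, hb, map_add, map_add]; ring⟩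
  | mul_X a i ha =>
    obtain ⟨a', ha', ha⟩ := ha
    obtain ⟨b', hb', hb⟩ := hv i
    refine ⟨algebraMap B K (eval w a) * b' + a' * v i, add_mem (mul_mem ?_ hb')
      (mul_mem ha' (hvS i)), ?_⟩
    · rw [IsScalarTower.algebraMap_apply B R K]; exact S.algebraMap_mem _
    · rw [eval₂_mul, eval₂_X, ha, add_mul, map_mul, map_mul, eval_X]
      nth_rw 1 [hb]
      ring

variable {k : Type u} [Field k] {ι σ : Type} {B : Type u} [CommRing B]
  [Algebra (MvPolynomial (Option (ι ⊕ σ)) k) B]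

/-- The height of `p` is at least `card ι + 1` by the choice of coordinates and at most 2 by Krull.
-/
lemma subsingleton_of_mem_minimalPrimes [Fintype ι] [Finite σ] [IsNoetherianRing B]
    [Algebra.HasGoingDown (MvPolynomial (Option (ι ⊕ σ)) k) B]
    (p : Ideal B) [p.IsPrime] (hp : p = (RingHom.ker (killHom k ι σ)).map (algebraMap _ B))
    (F t : B) (hmin : p ∈ (Ideal.span {F, t}).minimalPrimes) : Subsingleton ι := by
  classical
  have h : p ∈ (Ideal.span (({F, t} : Finset B) : Set B)).minimalPrimes := by simpa using hmin
  have h1 := (card_le_height p hp).trans (Ideal.height_le_card_of_mem_minimalPrimes_span_finset h)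
  have h2 := Nat.cast_le.mp (h1.trans (Nat.cast_le.mpr Finset.card_le_two))
  exact Fintype.card_le_one_iff_subsingleton.mp (by omega)

lemma eq_or_eq_of_mem_minimalPrimes [IsDomain B] [IsNoetherianRing B]
    (p : Ideal B) [p.IsPrime] (F t : B) (hmin : p ∈ (Ideal.span {F, t}).minimalPrimes)
    (x : Ideal B) [x.IsPrime] (hx : x ≠ ⊥)
    (Q : Ideal B) (hQ : Q.IsPrime) (h1 : x ≤ Q) (h2 : Q ≤ p) : Q = x ∨ Q = p := by
  classical
  by_contra! h
  have h0 : p ∈ (Ideal.span (({F, t} : Finset B) : Set B)).minimalPrimes := by simpa using hmin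
  have h3 := Ideal.height_le_card_of_mem_minimalPrimes_span_finset h0
  have h4 := Ideal.height_add_one_le_of_lt_of_isPrime (bot_lt_iff_ne_bot.mpr hx)
  have h5 := Ideal.height_add_one_le_of_lt_of_isPrime (lt_of_le_of_ne h1 h.1.symm)
  have h6 := Ideal.height_add_one_le_of_lt_of_isPrime (lt_of_le_of_ne h2 h.2)
  have h7 : ((0 + 1 + 1 + 1 : ℕ) : ℕ∞) ≤ (2 : ℕ) := by
    refine le_trans ?_ (h3.trans (Nat.cast_le.mpr Finset.card_le_two))
    push_cast
    exact (add_le_add_left ((add_le_add_left ((add_le_add_left zero_le 1).trans h4) 1).trans h5)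
      1).trans h6
  have := Nat.cast_le.mp h7
  omega

end Multiplicity

end LagrangianSpecialization

namespace LagrangianSpecialization

section Multiplicity

open MvPolynomial

/-- The vectors `v` and `w` have the same residue in `U`, so s(v) has the residue of s(w), which is
nonzero. -/
lemma valuation_eval₂_eq_one {B K n : Type*} [CommRing B] [Field K] [Algebra B K]
    (U : ValuationSubring K) (p : Ideal B) (h1 : ∀ b, algebraMap B K b ∈ U)
    (h3 : ∀ b ∉ p, U.valuation (algebraMap B K b) = 1) (v : n → K) (w : n → B)
    (hvw : ∀ i, U.valuation (v i - algebraMap B K (w i)) < 1) (s : MvPolynomial n B)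
    (hs : eval w s ∉ p) : U.valuation (eval₂ (algebraMap B K) v s) = 1 := by
  let φ : B →+* U := (algebraMap B K).codRestrict U.toSubring h1
  have hvU (i) : v i ∈ U := by
    rw [← sub_add_cancel (v i) (algebraMap B K (w i))]
    exact add_mem ((U.valuation_le_one_iff _).mp (hvw i).le) (h1 _)
  let v' (i : n) : U := ⟨v i, hvU i⟩
  have h5 : eval₂ (algebraMap B K) v s = (eval₂ φ v' s : U) := by
    change _ = U.subtype _
    rw [hom_eval₂]
    rfl
  rw [h5, ← U.valuation_eq_one_iff]
  by_contra hnu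
  have h6 : residue U (eval₂ φ v' s) = 0 := (residue_eq_zero_iff _).mpr hnu
  rw [hom_eval₂] at h6
  have h7 : residue U (φ (eval w s)) = 0 := by
    have h8 := hom_eval₂ s (RingHom.id B) ((residue U).comp φ) w
    rw [RingHom.comp_id] at h8
    rw [← eval₂_id, ← h6]
    refine h8.trans ?_
    congr 1
    funext i
    rw [eq_comm, ← sub_eq_zero, RingHom.comp_apply, ← map_sub, residue_eq_zero_iff,
      U.valuation_lt_one_iff]
    exact hvw i
  rw [residue_eq_zero_iff, U.valuation_lt_one_iff] at h7
  exact h7.ne (h3 _ hs)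

section

variable {B R K : Type*} [CommRing B] [CommRing R] [IsLocalRing R] [Field K] [Algebra B R]
  [Algebra B K] [Algebra R K] [IsScalarTower B R K] (p : Ideal B) [p.IsPrime]
  [IsLocalization.AtPrime R p]

lemma isIntegral_of_forall_valuation_le_one {x : K}
    (h : ∀ U : ValuationSubring K, (∀ b, algebraMap B K b ∈ U) →
      (∀ b ∈ p, U.valuation (algebraMap B K b) < 1) →
      (∀ b ∉ p, U.valuation (algebraMap B K b) = 1) → U.valuation x ≤ 1) : IsIntegral R x := by
  refine isIntegral_of_forall_valuationSubring fun U hU hU' ↦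
    (U.valuation_le_one_iff _).mp (h U (fun b ↦ ?_) (fun b hb ↦ ?_) fun b hb ↦ ?_)
  · rw [IsScalarTower.algebraMap_apply B R K]; exact hU _
  · rw [IsScalarTower.algebraMap_apply B R K, ← U.mem_nonunits_iff]
    exact hU' _ ((IsLocalization.AtPrime.to_map_mem_maximal_iff R p b).mpr hb)
  · have h4 : IsUnit (algebraMap B R b) := IsLocalization.map_units R (⟨b, hb⟩ : p.primeCompl)
    have h5 : IsUnit ((algebraMap R K).codRestrict U.toSubring hU (algebraMap B R b)) :=
      h4.map _
    rw [IsScalarTower.algebraMap_apply B R K]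
    exact (U.valuation_eq_one_iff _).mp h5

lemma eval₂_ne_zero_of_valuation {n : Type*} (hp : RingHom.ker (algebraMap B K) ≤ p) (v : n → K)
    (w : n → B)
    (hvw : ∀ U : ValuationSubring K, (∀ b, algebraMap B K b ∈ U) →
      (∀ b ∈ p, U.valuation (algebraMap B K b) < 1) →
      (∀ b ∉ p, U.valuation (algebraMap B K b) = 1) →
      ∀ i, U.valuation (v i - algebraMap B K (w i)) < 1) (s : MvPolynomial n B)
    (hs : eval w s ∉ p) : eval₂ (algebraMap B K) v s ≠ 0 := by
  obtain ⟨U, hU1, hU2, hU3⟩ := exists_valuationSubring_of_prime (K := K) p hp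
  have h3 := valuation_eval₂_eq_one U p hU1 hU3 v w (hvw U hU1 hU2 hU3) s hs
  intro h0
  rw [h0, map_zero] at h3
  exact zero_ne_one h3

variable (R) in
-- Put y = s(v) and adjoin to `R` the differences v_i - w_i and y⁻¹. All these generators lie in
-- every valuation ring centered at `p`, hence are integral over `R`. By hypothesis the differences
-- are multiples of t in the enlarged ring, and y⁻¹ agrees modulo t with the inverse of the unit
-- s(w) of `R`. So `exists_eq_mul_algebraMap` shows that the enlarged ring is only the image of `R`,
-- and divisibility of `z` by t descends to `R`.
lemma exists_eq_mul_of_valuation {n : Type*} [Finite n] (hp : RingHom.ker (algebraMap B K) ≤ p)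
    (v : n → K) (w : n → B)
    (hvw : ∀ U : ValuationSubring K, (∀ b, algebraMap B K b ∈ U) →
      (∀ b ∈ p, U.valuation (algebraMap B K b) < 1) →
      (∀ b ∉ p, U.valuation (algebraMap B K b) = 1) →
      ∀ i, U.valuation (v i - algebraMap B K (w i)) < 1) (s : MvPolynomial n B)
    (hs : eval w s ∉ p) (t : B) (ht : t ∈ p)
    (hvt : ∀ i, ∃ g : MvPolynomial n B, eval₂ (algebraMap B K) v s * (v i - algebraMap B K (w i)) =
      algebraMap B K t * eval₂ (algebraMap B K) v g) (z : K)
    (hz : ∃ g : MvPolynomial n B, eval₂ (algebraMap B K) v s * z =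
      algebraMap B K t * eval₂ (algebraMap B K) v g) :
    ∃ r : R, z = algebraMap B K t * algebraMap R K r := by
  have hev0 := eval₂_ne_zero_of_valuation p hp v w hvw s hs
  set y := eval₂ (algebraMap B K) v s with hy
  let T : Set K := insert y⁻¹ (Set.range fun i ↦ v i - algebraMap B K (w i))
  have hyT : y⁻¹ ∈ Algebra.adjoin R T := Algebra.subset_adjoin (Set.mem_insert _ _)
  have hBT (b : B) : algebraMap B K b ∈ Algebra.adjoin R T := by
    rw [IsScalarTower.algebraMap_apply B R K]; exact Subalgebra.algebraMap_mem _ _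
  have hvT (i) : v i ∈ Algebra.adjoin R T := by
    rw [← sub_add_cancel (v i) (algebraMap B K (w i))]
    exact add_mem (Algebra.subset_adjoin (Set.mem_insert_of_mem _ ⟨i, rfl⟩)) (hBT _)
  have hmul (x : K) (hx : ∃ g : MvPolynomial n B, y * x =
      algebraMap B K t * eval₂ (algebraMap B K) v g) : ∃ a ∈ Algebra.adjoin R T,
      x = algebraMap B K t * a := by
    obtain ⟨g, hg⟩ := hx
    refine ⟨y⁻¹ * eval₂ (algebraMap B K) v g, mul_mem hyT (eval₂_mem_of_forall_mem _ v hvT g), ?_⟩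
    rw [mul_left_comm, ← hg, inv_mul_cancel_left₀ hev0]
  have htR : algebraMap R K (algebraMap B R t) = algebraMap B K t :=
    (IsScalarTower.algebraMap_apply B R K t).symm
  obtain ⟨a, ha, rfl⟩ := hmul z hz
  have hint : ∀ τ ∈ T, IsIntegral R τ := by
    rintro τ (rfl | ⟨j, rfl⟩)
    · refine isIntegral_of_forall_valuation_le_one p fun U h1 h2 h3 ↦ ?_
      rw [map_inv₀, valuation_eval₂_eq_one U p h1 h3 v w (hvw U h1 h2 h3) s hs, inv_one]
    · exact isIntegral_of_forall_valuation_le_one p fun U h1 h2 h3 ↦ (hvw U h1 h2 h3 j).le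
  have hT : ∀ τ ∈ T, ∃ r : R, ∃ a ∈ Algebra.adjoin R T,
      τ = algebraMap R K r + algebraMap R K (algebraMap B R t) * a := by
    rw [htR]
    rintro τ (rfl | ⟨j, rfl⟩)
    · obtain ⟨a, ha, h⟩ := exists_eval₂_eq_add_mul (R := R) (Algebra.adjoin R T) v hvT w
        (algebraMap B K t) (fun i ↦ by
          obtain ⟨a, ha, h⟩ := hmul _ (hvt i)
          exact ⟨a, ha, by rw [← h]; ring⟩) s
      obtain ⟨r₀, hr₀⟩ := IsLocalization.map_units R (⟨eval w s, hs⟩ : p.primeCompl)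
      have h' : y = algebraMap R K r₀ + algebraMap B K t * a := by
        rw [hr₀, ← IsScalarTower.algebraMap_apply B R K]; exact h
      have hr : algebraMap R K (↑r₀⁻¹) * algebraMap R K r₀ = 1 := by
        rw [← map_mul, Units.inv_mul, map_one]
      -- From y = r₀ + t a follows y⁻¹ = r₀⁻¹ - t r₀⁻¹ a y⁻¹.
      refine ⟨↑r₀⁻¹, algebraMap R K (↑r₀⁻¹) * (-a * y⁻¹), mul_mem
        (Subalgebra.algebraMap_mem _ _) (mul_mem (neg_mem ha) hyT), ?_⟩
      have h2 : algebraMap R K r₀ * y⁻¹ = 1 - algebraMap B K t * a * y⁻¹ := by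
        rw [eq_sub_of_add_eq h'.symm, sub_mul, mul_inv_cancel₀ hev0]
      calc y⁻¹ = algebraMap R K (↑r₀⁻¹) * (algebraMap R K r₀ * y⁻¹) := by
            rw [← mul_assoc, hr, one_mul]
        _ = _ := by rw [h2]; ring
    · obtain ⟨a, ha, h⟩ := hmul _ (hvt j)
      exact ⟨0, a, ha, by simpa using h⟩
  obtain ⟨r, rfl⟩ := exists_eq_mul_algebraMap (R := R) (T := T) ((Set.finite_range _).insert _) hint
    ((IsLocalization.AtPrime.to_map_mem_maximal_iff R p t).mpr ht) hT ha
  exact ⟨r, rfl⟩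

end

variable {k : Type u} [Field k] {ι σ : Type} {B : Type u} [CommRing B] [Algebra k B]
  [Algebra (MvPolynomial (Option (ι ⊕ σ)) k) B] [IsScalarTower k (MvPolynomial (Option (ι ⊕ σ)) k) B]

/-- Choose constants `c` for which s(c, 0) ∉ p and evaluate the relations `h` at the conormal vector
(c, v) over V(x), where the elements of the conormal ideal vanish. The relation for the coordinate z
makes s(c, v) z a multiple of t, and the relations for the covector coordinates `inr j` do the same
for the v_j. `exists_eq_mul_of_valuation` then divides z by t in the local ring. -/
theorem exists_mul_sub_mem [CharZero k] [Fintype ι] [DecidableEq ι] [Fintype σ] [DecidableEq σ]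
    [Subsingleton ι] (i₀ : ι)
    [Algebra.Etale (MvPolynomial (Option (ι ⊕ σ)) k) B] (p : Ideal B) [p.IsPrime]
    (hp : p = (RingHom.ker (killHom k ι σ)).map (algebraMap _ B)) (x : Ideal B) [x.IsPrime]
    (hxp : x < p) (hmax : ∀ Q : Ideal B, Q.IsPrime → x ≤ Q → Q ≤ p → Q = x ∨ Q = p)
    (F : B) (hF : F ∈ x) (hsm : ∃ i : ι ⊕ σ, partialDer k B (some i) F ∉ x)
    (t : B) (ht : t ∈ p) (s : MvPolynomial (ι ⊕ σ) B) (hs : s ∉ genericConormal ι σ p)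
    (h : ∀ g ∈ genericConormal ι σ p, s * g ∈
      conormalIdeal (fun i : ι ⊕ σ ↦ partialDer k B (some i) F) (Ideal.span {F}) ⊔
        Ideal.span {C t}) :
    ∃ r ∉ p, ∃ a : B, r * coord k B (some (Sum.inl (β := σ) i₀)) - t * a ∈ x := by
  classical
  have hz : coord k B (some (Sum.inl (β := σ) i₀)) ∈ p := by
    rw [hp, map_ker_killHom]; exact Ideal.subset_span ⟨some i₀, rfl⟩
  set z := coord k B (some (Sum.inl (β := σ) i₀)) with hzdef
  let K := FractionRing (B ⧸ x)
  let R := Localization.AtPrime p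
  have hKx (b : B) : algebraMap B K b = 0 ↔ b ∈ x := by
    rw [IsScalarTower.algebraMap_apply B (B ⧸ x) K,
      map_eq_zero_iff _ (IsFractionRing.injective (B ⧸ x) K),
      Ideal.Quotient.algebraMap_eq, Ideal.Quotient.eq_zero_iff_mem]
  have hunit (b : p.primeCompl) : IsUnit (algebraMap B K b) :=
    Ne.isUnit fun h ↦ b.2 (hxp.le ((hKx _).mp h))
  let : Algebra R K := (IsLocalization.lift (M := p.primeCompl) hunit).toAlgebra
  have : IsScalarTower B R K := .of_algebraMap_eq fun b ↦ (IsLocalization.lift_eq hunit b).symm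
  -- Such constants exist since `s` is nonzero on the conormal space of V(p).
  obtain ⟨c, hc, hcs⟩ : ∃ c : ι → k, (∀ i, c i ≠ 0) ∧
      eval (fun i ↦ Ideal.Quotient.mk p (algebraMap k B (c i))) (conormalHom ι σ p s) ≠ 0 := by
    by_contra! hcon
    exact hs (mem_genericConormal_of_eval (k := k) p s hcon)
  rw [eval_conormalHom, Ne, Ideal.Quotient.eq_zero_iff_mem] at hcs
  obtain ⟨v, u, hu, hu1, hu2, hV⟩ := exists_evaluation p hp x hxp hmax F hF c i₀ (hc i₀) (fun i ↦ by
    rw [Subsingleton.elim i i₀, sub_self]; exact x.zero_mem) hsm K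
  let w : ι ⊕ σ → B := Sum.elim (fun i ↦ algebraMap k B (c i)) 0
  let V : ι ⊕ σ → K := Sum.elim (fun i ↦ algebraMap B K (algebraMap k B (c i))) v
  let ev : MvPolynomial (ι ⊕ σ) B →+* K := eval₂Hom (algebraMap B K) V
  have hL (g) (hg : g ∈ conormalIdeal (fun i : ι ⊕ σ ↦ partialDer k B (some i) F)
      (Ideal.span {F})) : ev g = 0 := by
    have h4 := eval_eq_zero_of_mem_conormalIdeal _ hg (algebraMap B K) (fun b hb ↦ (hKx b).mpr
      ((Ideal.span_singleton_le_iff_mem x).mpr hF hb)) u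
    rw [← h4]
    change eval₂ (algebraMap B K) V g = _
    congr 1
    funext i
    rcases i with i | j
    · exact (hu1 i).symm
    · exact (hu2 j).symm
  have hev (g) (hg : g ∈ genericConormal ι σ p) : ∃ b, ev s * ev g = algebraMap B K t * ev b := by
    obtain ⟨l, hl, y, hy, e⟩ := Submodule.mem_sup.mp (h g hg)
    obtain ⟨b, rfl⟩ := Ideal.mem_span_singleton.mp hy
    refine ⟨b, ?_⟩
    rw [← map_mul, ← e, map_add, hL l hl, zero_add, map_mul]
    congr 1
    exact eval₂_C _ _ _
  have hp' : RingHom.ker (algebraMap B K) ≤ p := fun b hb ↦ hxp.le ((hKx b).mp hb)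
  obtain ⟨r, hza⟩ := exists_eq_mul_of_valuation R p hp' V w (fun U h1 h2 h3 i ↦ by
      rcases i with i | j
      · simp [V, w]
      · simpa [V, w] using hV U h1 h2 h3 j) s hcs t ht (fun i ↦ by
      rcases i with i | j
      · exact ⟨0, by simp [V, w]⟩
      · obtain ⟨b, hb⟩ := hev _ (X_inr_mem_genericConormal p j)
        refine ⟨b, ?_⟩
        change ev s * _ = _ * ev b
        rw [← hb]
        simp [V, w, ev]) (algebraMap B K z) (by
      obtain ⟨b, hb⟩ := hev _ (C_mem_genericConormal.mpr hz)
      refine ⟨b, ?_⟩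
      change ev s * _ = _ * ev b
      rw [← hb]
      simp [ev])
  obtain ⟨b, d, rfl⟩ := IsLocalization.exists_mk'_eq p.primeCompl r
  refine ⟨d, d.2, b, ?_⟩
  rw [← hKx, map_sub, map_mul, map_mul, hza, sub_eq_zero, mul_left_comm]
  congr 1
  rw [IsScalarTower.algebraMap_apply B R K, ← map_mul, mul_comm, IsLocalization.mk'_spec,
    ← IsScalarTower.algebraMap_apply B R K]

/-- If every equation of the conormal space of V(p) held locally on the fiber, F = 0 would have a
single branch V(x) through V(p), with z divisible by t on it. Clearing denominators, s'(r z - t a) =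
F b with s' and r outside `p`. In the z-derivative of this identity every term except s' r lies in
`p`, because F, its derivatives, z and t do. Hence s' r ∈ p, which is absurd. -/
theorem not_forall_exists_mul_mem [CharZero k] [Fintype ι] [DecidableEq ι] [Fintype σ]
    [DecidableEq σ] [Nonempty ι] [IsDomain B]
    [Algebra.Etale (MvPolynomial (Option (ι ⊕ σ)) k) B] (p : Ideal B) [p.IsPrime]
    (hp : p = (RingHom.ker (killHom k ι σ)).map (algebraMap _ B)) (F : B) (hF0 : F ≠ 0)
    (hD : ∀ i : ι ⊕ σ, partialDer k B (some i) F ∈ p)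
    (hmin : p ∈ (Ideal.span {F, coord k B (none : Option (ι ⊕ σ))}).minimalPrimes)
    (hsm : ∀ x : Ideal B, x.IsPrime → F ∈ x → x < p →
      ∃ i : ι ⊕ σ, partialDer k B (some i) F ∉ x)
    (hFr : (Ideal.span {F}).IsRadical)
    (hFt : ∀ x ∈ (Ideal.span {F}).minimalPrimes, coord k B (none : Option (ι ⊕ σ)) ∉ x) :
    ¬ ∀ g ∈ genericConormal ι σ p, ∃ s ∉ genericConormal ι σ p, s * g ∈
      conormalIdeal (fun i : ι ⊕ σ ↦ partialDer k B (some i) F) (Ideal.span {F}) ⊔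
        Ideal.span {C (coord k B (none : Option (ι ⊕ σ)))} := by
  classical
  intro H
  have : Algebra.FiniteType k B := .trans (S := MvPolynomial (Option (ι ⊕ σ)) k) inferInstance
    inferInstance
  have : IsNoetherianRing B := Algebra.FiniteType.isNoetherianRing k B
  have : Subsingleton ι := subsingleton_of_mem_minimalPrimes p hp _ _ hmin
  have i₀ : ι := Classical.arbitrary ι
  have hq : (genericConormal ι σ p).IsPrime := RingHom.ker_isPrime _
  have hFp : F ∈ p := hmin.1.2 (Ideal.subset_span (Set.mem_insert _ _))
  have ht : coord k B (none : Option (ι ⊕ σ)) ∈ p :=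
    hmin.1.2 (Ideal.subset_span (Set.mem_insert_of_mem _ rfl))
  -- The ideal is finitely generated, so one multiplier serves for all of its elements.
  obtain ⟨s, hs, hsq⟩ : ∃ s ∉ genericConormal ι σ p, ∀ g ∈ genericConormal ι σ p, s * g ∈
      conormalIdeal (fun i : ι ⊕ σ ↦ partialDer k B (some i) F) (Ideal.span {F}) ⊔
        Ideal.span {C (coord k B (none : Option (ι ⊕ σ)))} := by
    obtain ⟨T, hT⟩ := IsNoetherian.noetherian (genericConormal ι σ p)
    choose! σ' hσ hσ' using H
    refine ⟨∏ g ∈ T, σ' g, fun h ↦ ?_, fun g hg ↦ ?_⟩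
    · obtain ⟨g, hg, hg'⟩ := (hq.prod_mem_iff).mp h
      exact hσ g (hT ▸ Submodule.subset_span hg) hg'
    · rw [← hT] at hg
      induction hg using Submodule.span_induction with
      | mem g hg =>
        rw [← Finset.prod_erase_mul _ _ hg, mul_assoc]
        exact Ideal.mul_mem_left _ _ (hσ' g (hT ▸ Submodule.subset_span hg))
      | zero => rw [mul_zero]; exact zero_mem _
      | add a b _ _ ha hb => rw [mul_add]; exact add_mem ha hb
      | smul r a _ ha => rw [smul_eq_mul, mul_left_comm]; exact Ideal.mul_mem_left _ _ ha
  obtain ⟨x, hx, hxp'⟩ := Ideal.exists_minimalPrimes_le ((Ideal.span_singleton_le_iff_mem p).mpr hFp)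
  have hlt (y) (hy : y ∈ (Ideal.span {F}).minimalPrimes) (hyp : y ≤ p) : y < p :=
    lt_of_le_of_ne hyp fun h ↦ hFt y hy (h ▸ ht)
  have hmem (y) (hy : y ∈ (Ideal.span {F}).minimalPrimes) : F ∈ y :=
    hy.1.2 (Ideal.mem_span_singleton_self F)
  have hmax (y) (hy : y ∈ (Ideal.span {F}).minimalPrimes) (hyp : y ≤ p) (Q : Ideal B)
      (hQ : Q.IsPrime) (h1 : y ≤ Q) (h2 : Q ≤ p) : Q = y ∨ Q = p :=
    have := hy.1.1
    eq_or_eq_of_mem_minimalPrimes p F _ hmin y (fun h ↦ hF0 (by simpa [h] using hmem y hy))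
      Q hQ h1 h2
  have hle (y) (hy : y ∈ (Ideal.span {F}).minimalPrimes) (hyp : y ≤ p) :
      conormalIdeal (fun i : ι ⊕ σ ↦ partialDer k B (some i) F) y ≤ genericConormal ι σ p :=
    have := hy.1.1
    fun g hg ↦ mem_genericConormal_of_eval (k := k) p g fun c hc ↦
      eval_conormalHom_eq_zero p hp y (hlt y hy hyp) (hmax y hy hyp) F (hmem y hy) c i₀ (hc i₀)
        (fun i ↦ by rw [Subsingleton.elim i i₀, sub_self]; exact y.zero_mem)
        (hsm y hy.1.1 (hmem y hy) (hlt y hy hyp)) g hg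
  have hxprime : x.IsPrime := hx.1.1
  have huniq (y) (hy : y ∈ (Ideal.span {F}).minimalPrimes) (hyp : y ≤ p) : y = x := by
    have := hy.1.1
    have hxy : x ≤ y := le_of_conormalIdeal _ (Ideal.span {F}) _ _ (C_mem_genericConormal.mpr ht)
      s hs hsq x y hx.1.2 hy.1.2 (hle x hx hxp') (hle y hy hyp) (hFt x hx)
    exact (hy.2 ⟨hxprime, hx.1.2⟩ hxy).antisymm hxy
  obtain ⟨r, hr, a, hra⟩ := exists_mul_sub_mem i₀ p hp x (hlt x hx hxp') (hmax x hx hxp') F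
    (hmem x hx) (hsm x hxprime (hmem x hx) (hlt x hx hxp')) _ ht s hs hsq
  obtain ⟨s', hs', hm⟩ := exists_mul_mem_of_unique_minimalPrime (Ideal.span {F}) p x hFr huniq _ hra
  obtain ⟨b, hb⟩ := Ideal.mem_span_singleton.mp hm
  have hz : coord k B (some (Sum.inl (β := σ) i₀)) ∈ p := by
    rw [hp, map_ker_killHom]; exact Ideal.subset_span ⟨some i₀, rfl⟩
  have hder := congrArg (partialDer k B (some (Sum.inl (β := σ) i₀))) hb
  simp only [Derivation.leibniz, map_sub, partialDer_coord, smul_eq_mul] at hder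
  simp only [if_true, mul_one, reduceCtorEq, if_false, mul_zero, add_zero] at hder
  have h1 : s' * r ∈ p := by
    set z := coord k B (some (Sum.inl (β := σ) i₀))
    set t := coord k B (none : Option (ι ⊕ σ))
    set δ := partialDer k B (some (Sum.inl (β := σ) i₀))
    have h2 : s' * r = F * δ b + b * δ F - (s' * (z * δ r - t * δ a) + (r * z - t * a) * δ s') := by
      rw [← hder]; ring
    rw [h2]
    refine sub_mem (add_mem (p.mul_mem_right _ hFp) (p.mul_mem_left _ (hD _))) (add_mem
      (p.mul_mem_left _ (sub_mem (p.mul_mem_right _ hz) (p.mul_mem_right _ ht)))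
      (p.mul_mem_right _ (sub_mem (p.mul_mem_left _ hz) (p.mul_mem_right _ ht))))
  exact (‹p.IsPrime›.mem_or_mem h1).elim hs' hr

end Multiplicity

end LagrangianSpecialization

namespace LagrangianSpecialization

open TensorProduct

/-! ### The Jacobian criterion at the closed point of a local ring. -/

section Jacobian

variable {A R : Type u} [CommRing A] [CommRing R] [IsLocalRing R]

lemma one_tmul_ne_zero [IsNoetherianRing R] {F : R} (hF : F ≠ 0) :
    (1 : ResidueField R) ⊗ₜ[R] (⟨F, Ideal.mem_span_singleton_self F⟩ : Ideal.span {F}) ≠ 0 := by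
  intro h
  have h1 : Subsingleton (ResidueField R ⊗[R] Ideal.span {F}) := by
    refine subsingleton_of_forall_eq 0 fun x ↦ ?_
    induction x with
    | zero => rfl
    | add x y hx hy => rw [hx, hy, add_zero]
    | tmul a g =>
      obtain ⟨g, hg⟩ := g
      obtain ⟨b, rfl⟩ := Ideal.mem_span_singleton.mp hg
      have : (⟨F * b, hg⟩ : Ideal.span {F}) = b • ⟨F, Ideal.mem_span_singleton_self F⟩ :=
        Subtype.ext (mul_comm _ _)
      rw [this, ← mul_one a, ← smul_eq_mul, ← TensorProduct.smul_tmul', TensorProduct.tmul_smul, h,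
        smul_zero, smul_zero]
  rw [IsLocalRing.subsingleton_tensorProduct] at h1
  exact hF (congrArg Subtype.val (h1.elim ⟨F, Ideal.mem_span_singleton_self F⟩ 0))

variable [Algebra A R]

variable (A R) in
/-- The differential at the closed point of a local ring. -/
noncomputable def residueD : R →ₗ[A] ResidueField R ⊗[R] Ω[R⁄A] :=
  ((TensorProduct.mk R (ResidueField R) Ω[R⁄A] 1).restrictScalars A).comp
    (KaehlerDifferential.D A R).toLinearMap

lemma residueD_apply (x : R) : residueD A R x = 1 ⊗ₜ KaehlerDifferential.D A R x := rfl

variable [Algebra.FormallySmooth A R] [Module.Finite R Ω[R⁄A]]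

variable (A) in
-- Smoothness of the quotient amounts to left exactness of the conormal sequence after tensoring
-- with the residue field. It is phrased with an arbitrary linear map prescribed on the elements of
-- `I`, which is unique.
lemma formallySmooth_quotient_iff (I : Ideal R) (hI : I ≤ maximalIdeal R) (hfg : I.FG) :
    Algebra.FormallySmooth A (R ⧸ I) ↔ ∃ l : ResidueField R ⊗[R] I →ₗ[ResidueField R]
      ResidueField R ⊗[R] Ω[R⁄A], Function.Injective l ∧
        ∀ g : I, l (1 ⊗ₜ g) = residueD A R g := by
  have : Nontrivial (R ⧸ I) := Ideal.Quotient.nontrivial_iff.mpr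
    (ne_top_of_le_ne_top (maximalIdeal.isMaximal R).ne_top hI)
  have : IsLocalRing (R ⧸ I) := .of_surjective' (Ideal.Quotient.mk I) Ideal.Quotient.mk_surjective
  have hI0 (a : R) (ha : a ∈ I) : residue R a = 0 := (residue_eq_zero_iff _).mpr (hI ha)
  let : Algebra (R ⧸ I) (ResidueField R) := (Ideal.Quotient.lift I (residue R) hI0).toAlgebra
  have : IsScalarTower R (R ⧸ I) (ResidueField R) := .of_algebraMap_eq fun _ ↦ rfl
  have : Module.Free R Ω[R⁄A] := Module.free_of_flat_of_isLocalRing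
  have hker : RingHom.ker (algebraMap R (R ⧸ I)) = I := Ideal.mk_ker
  let e : RingHom.ker (algebraMap R (R ⧸ I)) ≃ₗ[R] I := LinearEquiv.ofEq _ _ hker
  have h₃ : maximalIdeal (R ⧸ I) ≤ RingHom.ker (algebraMap (R ⧸ I) (ResidueField R)) := by
    intro x hx
    obtain ⟨a, rfl⟩ := Ideal.Quotient.mk_surjective x
    rw [RingHom.mem_ker]
    change residue R a = 0
    rw [residue_eq_zero_iff, mem_maximalIdeal, mem_nonunits_iff]
    rw [mem_maximalIdeal, mem_nonunits_iff] at hx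
    exact fun h ↦ hx (h.map _)
  rw [Algebra.FormallySmooth.iff_injective_cotangentComplexBaseChange (R := A) (S := R ⧸ I) R
    (ResidueField R) Ideal.Quotient.mk_surjective (by rwa [hker]) h₃]
  have hl (g : I) : KaehlerDifferential.cotangentComplexBaseChange A (R ⧸ I) R (ResidueField R)
      (e.symm.baseChange R (ResidueField R) _ _ (1 ⊗ₜ g)) = residueD A R g := by
    rw [LinearEquiv.baseChange_tmul, KaehlerDifferential.cotangentComplexBaseChange_tmul, one_smul,
      KaehlerDifferential.kerToTensor_apply]
    rfl
  constructor
  · intro h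
    exact ⟨(KaehlerDifferential.cotangentComplexBaseChange A (R ⧸ I) R (ResidueField R)).comp
      (e.symm.baseChange R (ResidueField R) _ _).toLinearMap,
      h.comp (e.symm.baseChange R (ResidueField R) _ _).injective, hl⟩
  · rintro ⟨l, hl', h⟩
    have : l = (KaehlerDifferential.cotangentComplexBaseChange A (R ⧸ I) R (ResidueField R)).comp
        (e.symm.baseChange R (ResidueField R) _ _).toLinearMap := by
      refine TensorProduct.AlgebraTensorModule.ext fun a g ↦ ?_
      have : a ⊗ₜ[R] g = a • ((1 : ResidueField R) ⊗ₜ[R] g) := by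
        rw [TensorProduct.smul_tmul', smul_eq_mul, mul_one]
      rw [this, map_smul, map_smul, h]
      exact congrArg _ (hl g).symm
    rw [this] at hl'
    exact (Function.Injective.of_comp_iff' _ (e.symm.baseChange R (ResidueField R) _ _).bijective).mp
      hl'

lemma residueD_ne_zero_of_formallySmooth [IsNoetherianRing R] {F : R} (hF : F ≠ 0)
    (hFm : F ∈ maximalIdeal R) (h : Algebra.FormallySmooth A (R ⧸ Ideal.span {F})) :
    residueD A R F ≠ 0 := by
  obtain ⟨l, hl, hl'⟩ := (formallySmooth_quotient_iff A _
    ((Ideal.span_singleton_le_iff_mem _).mpr hFm) (IsNoetherian.noetherian _)).mp h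
  intro h0
  have h1 := hl' ⟨F, Ideal.mem_span_singleton_self F⟩
  rw [h0] at h1
  exact one_tmul_ne_zero hF (hl (h1.trans (map_zero l).symm))

/-- The functional on differentials induced by δ takes a unit value on dF, so dF survives in the
residue fiber; the conormal module there is spanned by the class of F. -/
lemma formallySmooth_of_isUnit_derivation [IsNoetherianRing R] {F : R} (hFm : F ∈ maximalIdeal R)
    (δ : Derivation A R R) (hδ : IsUnit (δ F)) :
    Algebra.FormallySmooth A (R ⧸ Ideal.span {F}) := by
  have hI := (Ideal.span_singleton_le_iff_mem (maximalIdeal R)).mpr hFm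
  let d : Ideal.span {F} →ₗ[R] ResidueField R ⊗[R] Ω[R⁄A] :=
    { toFun g := residueD A R g
      map_add' a b := map_add _ _ _
      map_smul' a b := by
        have hb : residue R b = 0 := (residue_eq_zero_iff _).mpr (hI b.2)
        change residueD A R (a * b) = _
        rw [residueD_apply, Derivation.leibniz, TensorProduct.tmul_add, TensorProduct.tmul_smul,
          TensorProduct.tmul_smul, ← algebraMap_smul (ResidueField R) (b : R)]
        change _ + residue R b • _ = _
        rw [hb, zero_smul, add_zero]
        rfl }
  refine (formallySmooth_quotient_iff A _ hI (IsNoetherian.noetherian _)).mpr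
    ⟨LinearMap.liftBaseChange (ResidueField R) d, ?_, fun g ↦ by
      rw [LinearMap.liftBaseChange_tmul, one_smul]; rfl⟩
  rw [injective_iff_map_eq_zero]
  intro x hx
  obtain ⟨a, rfl⟩ : ∃ a : ResidueField R,
      x = a ⊗ₜ (⟨F, Ideal.mem_span_singleton_self F⟩ : Ideal.span {F}) := by
    clear hx
    induction x with
    | zero => exact ⟨0, by rw [TensorProduct.zero_tmul]⟩
    | add x y hx hy =>
      obtain ⟨a, rfl⟩ := hx
      obtain ⟨b, rfl⟩ := hy
      exact ⟨a + b, by rw [TensorProduct.add_tmul]⟩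
    | tmul a g =>
      obtain ⟨g, hg⟩ := g
      obtain ⟨b, rfl⟩ := Ideal.mem_span_singleton.mp hg
      have : (⟨F * b, hg⟩ : Ideal.span {F}) = b • ⟨F, Ideal.mem_span_singleton_self F⟩ :=
        Subtype.ext (mul_comm _ _)
      exact ⟨b • a, by rw [this, TensorProduct.smul_tmul]⟩
  rw [LinearMap.liftBaseChange_tmul] at hx
  have h1 := congrArg ((LinearMap.lTensor (ResidueField R) δ.liftKaehlerDifferential)) hx
  have h2 : residue R (δ F) * a = 0 := by
    have h3 := congrArg (TensorProduct.rid R (ResidueField R)) h1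
    change TensorProduct.rid R _ (LinearMap.lTensor (ResidueField R) δ.liftKaehlerDifferential
      (a • (1 ⊗ₜ KaehlerDifferential.D A R F))) = _ at h3
    rw [TensorProduct.smul_tmul', LinearMap.lTensor_tmul, Derivation.liftKaehlerDifferential_comp_D,
      TensorProduct.rid_tmul, map_zero, map_zero, smul_eq_mul, mul_one, Algebra.smul_def] at h3
    exact h3
  have h3 : a = 0 := (mul_eq_zero.mp h2).resolve_left ((hδ.map (residue R)).ne_zero)
  rw [h3, TensorProduct.zero_tmul]

end Jacobian

section EtaleAt

variable {k R : Type u} [Field k] [CommRing R] [IsLocalRing R] [Algebra k R]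
  [Algebra.FormallySmooth k R] [Module.Finite R Ω[R⁄k]] {n : Type}
  [Algebra (MvPolynomial n k) R] [IsScalarTower k (MvPolynomial n k) R]

/-- By Nakayama the differentials of the coordinates form a basis of Ω over `R`, so the
differentials of the polynomial ring base change isomorphically. The Jacobi–Zariski sequence then
kills both the relative differentials and the first cotangent homology. -/
lemma formallyEtale_of_basis_residueD
    (hli : LinearIndependent (ResidueField R)
      fun i : n ↦ residueD k R (algebraMap (MvPolynomial n k) R (MvPolynomial.X i)))
    (hsp : Submodule.span (ResidueField R) (Set.range
      fun i : n ↦ residueD k R (algebraMap (MvPolynomial n k) R (MvPolynomial.X i))) = ⊤) :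
    Algebra.FormallyEtale (MvPolynomial n k) R := by
  let P := MvPolynomial n k
  have : Module.FinitePresentation R Ω[R⁄k] := Module.finitePresentation_of_projective R _
  obtain ⟨b, hb⟩ := Module.exists_basis_of_basis_baseChange (R := R)
    (fun i : n ↦ KaehlerDifferential.D k R (algebraMap P R (MvPolynomial.X i))) hli hsp
    (Module.Flat.rTensor_preserves_injective_linearMap _ Subtype.val_injective)
  let b' : Module.Basis n R (R ⊗[P] Ω[P⁄k]) := (KaehlerDifferential.mvPolynomialBasis k n).baseChange R
  have hmap : KaehlerDifferential.mapBaseChange k P R = (b'.equiv b (Equiv.refl n)).toLinearMap := by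
    refine b'.ext fun i ↦ ?_
    rw [LinearEquiv.coe_coe, Module.Basis.equiv_apply, Equiv.refl_apply, hb,
      Module.Basis.baseChange_apply, KaehlerDifferential.mvPolynomialBasis_apply,
      KaehlerDifferential.mapBaseChange_tmul, one_smul, KaehlerDifferential.map_D]
  have hbij : Function.Bijective (KaehlerDifferential.mapBaseChange k P R) := by
    rw [hmap]; exact (b'.equiv b (Equiv.refl n)).bijective
  have h1 : Subsingleton Ω[R⁄P] := by
    refine subsingleton_of_forall_eq 0 fun x ↦ ?_
    obtain ⟨y, rfl⟩ := KaehlerDifferential.map_surjective k P R x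
    obtain ⟨z, rfl⟩ := hbij.2 y
    exact (KaehlerDifferential.exact_mapBaseChange_map k P R _).mpr ⟨z, rfl⟩
  have h2 : Subsingleton (Algebra.H1Cotangent P R) := by
    refine subsingleton_of_forall_eq 0 fun x ↦ ?_
    have h3 : Algebra.H1Cotangent.δ k P R x = 0 := hbij.1 <| by
      rw [map_zero]
      exact (Algebra.H1Cotangent.exact_δ_mapBaseChange k P R _).mpr ⟨x, rfl⟩
    obtain ⟨y, rfl⟩ := (Algebra.H1Cotangent.exact_map_δ k P R x).mp h3
    rw [Subsingleton.elim y 0, map_zero]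
  exact ⟨h1, h2⟩

end EtaleAt

end LagrangianSpecialization

namespace LagrangianSpecialization

open TensorProduct

/-! ### Local coordinates adapted to a smooth subvariety. -/

section Coordinates

lemma exists_linearIndepOn_basis {K V α : Type*} [Field K] [AddCommGroup V] [Module K V]
    [Module.Finite K V] (h : α → V) (s : Set α) (hs : LinearIndepOn K h s)
    (hsp : Submodule.span K (Set.range h) = ⊤) :
    ∃ t : Set α, s ⊆ t ∧ t.Finite ∧ LinearIndepOn K h t ∧ Submodule.span K (h '' t) = ⊤ := by
  obtain ⟨t, -, hst, hsub, hli⟩ := exists_linearIndepOn_extension hs (Set.subset_univ s)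
  refine ⟨t, hst, ?_, hli, ?_⟩
  · have : LinearIndependent K fun i : t ↦ h i := hli
    have := this.finite
    exact Set.toFinite t
  · rw [eq_top_iff, ← hsp, ← Set.image_univ]
    exact Submodule.span_le.mpr hsub

variable {k : Type u} [Field k] {B : Type u} [CommRing B] [Algebra k B]

/-- Complete t to a basis of `I` modulo the maximal ideal by elements of `I`. These generate `I`
locally by Nakayama, and their differentials stay independent because V(I) is smooth. Then complete
the differentials to a basis by further functions from `B`. -/
theorem exists_coordinates (p : Ideal B) [p.IsPrime] {R : Type u} [CommRing R] [Algebra B R]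
    [IsLocalization.AtPrime R p] [IsLocalRing R] [Algebra k R] [IsScalarTower k B R]
    [IsNoetherianRing R] [Algebra.FormallySmooth k R] [Module.Finite R Ω[R⁄k]]
    (I : Ideal B) (hI : I ≤ p) (t : B) (ht : t ∈ I)
    (htD : residueD k R (algebraMap B R t) ≠ 0)
    (hsm : Algebra.FormallySmooth k (R ⧸ I.map (algebraMap B R))) :
    ∃ (d e : ℕ) (x : Option (Fin d ⊕ Fin e) → B), x none = t ∧
      I.map (algebraMap B R) = Ideal.span (Set.range fun i : Option (Fin d) ↦
        algebraMap B R (x (i.map Sum.inl))) ∧ (∀ i : Option (Fin d), x (i.map Sum.inl) ∈ I) ∧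
      LinearIndependent (ResidueField R) (fun i ↦ residueD k R (algebraMap B R (x i))) ∧
      Submodule.span (ResidueField R) (Set.range fun i ↦ residueD k R (algebraMap B R (x i))) = ⊤ := by
  classical
  let J := I.map (algebraMap B R)
  have hJ : J ≤ maximalIdeal R := by
    refine (Ideal.map_mono hI).trans (Ideal.map_le_iff_le_comap.mpr fun b hb ↦ ?_)
    exact (IsLocalization.AtPrime.to_map_mem_maximal_iff R p b).mpr hb
  obtain ⟨l, hl, hlD⟩ := (formallySmooth_quotient_iff k J hJ (IsNoetherian.noetherian _)).mp hsm
  let ψ (g : I) : J := ⟨algebraMap B R g, Ideal.mem_map_of_mem _ g.2⟩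
  let f (g : I) : ResidueField R ⊗[R] J := 1 ⊗ₜ ψ g
  let h (b : B) : ResidueField R ⊗[R] Ω[R⁄k] := residueD k R (algebraMap B R b)
  have hlf (g : I) : l (f g) = h g := hlD (ψ g)
  have hψ : Submodule.span R (Set.range ψ) = ⊤ := by
    rw [eq_top_iff]
    rintro ⟨x, hx⟩ -
    have h1 : x ∈ (Submodule.span R (Set.range ψ)).map J.subtype := by
      rw [Submodule.map_span, ← Set.range_comp]
      change x ∈ Ideal.span _ at hx
      refine Submodule.span_mono ?_ hx
      rintro _ ⟨b, hb, rfl⟩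
      exact ⟨⟨b, hb⟩, rfl⟩
    obtain ⟨y, hy, rfl⟩ := h1
    exact hy
  have tensor_span {M : Type u} [AddCommGroup M] [Module R M] {α : Type u} (v : α → M)
      (hv : Submodule.span R (Set.range v) = ⊤) :
      Submodule.span (ResidueField R) (Set.range fun a ↦ (1 : ResidueField R) ⊗ₜ[R] v a) = ⊤ := by
    have := Submodule.baseChange_span (A := ResidueField R) (R := R) (Set.range v)
    rw [hv, Submodule.baseChange_top, ← Set.range_comp] at this
    exact this.symm
  have hfsp : Submodule.span (ResidueField R) (Set.range f) = ⊤ := tensor_span ψ hψ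
  have hhsp : Submodule.span (ResidueField R) (Set.range h) = ⊤ := by
    refine tensor_span (fun b : B ↦ KaehlerDifferential.D k R (algebraMap B R b)) ?_
    rw [← KaehlerDifferential.span_range_map_derivation_of_isLocalization k B R p.primeCompl]
    congr 2
    funext b
    exact (KaehlerDifferential.map_D k k B R b).symm
  have hft : f ⟨t, ht⟩ ≠ 0 := fun h0 ↦ htD ((hlf ⟨t, ht⟩).symm.trans (by rw [h0, map_zero]))
  obtain ⟨s₁, hts₁, hfin₁, hli₁, hsp₁⟩ := exists_linearIndepOn_basis f {⟨t, ht⟩}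
    ((linearIndepOn_singleton_iff _).mpr hft) hfsp
  have hli₁' : LinearIndepOn (ResidueField R) h (Subtype.val '' s₁) := by
    have h1 : LinearIndepOn (ResidueField R) (l ∘ f) s₁ :=
      hli₁.map_injOn l hl.injOn
    have h2 : l ∘ f = h ∘ Subtype.val := funext hlf
    rw [h2] at h1
    exact h1.image_of_comp
  obtain ⟨s₂, hs₁₂, hfin₂, hli₂, hsp₂⟩ := exists_linearIndepOn_basis h _ hli₁' hhsp
  have hfin₁' := (hfin₁.image Subtype.val).subset (Set.sdiff_subset (t := {t}))
  have hfin₂' := hfin₂.subset (Set.sdiff_subset (t := Subtype.val '' s₁))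
  have : Finite (Subtype.val '' s₁ \ {t} : Set B) := hfin₁'
  have : Finite (s₂ \ Subtype.val '' s₁ : Set B) := hfin₂'
  let e₁ := (Finite.equivFin (Subtype.val '' s₁ \ {t} : Set B)).symm
  let e₂ := (Finite.equivFin (s₂ \ Subtype.val '' s₁ : Set B)).symm
  let x : Option (Fin _ ⊕ Fin _) → B := fun i ↦
    i.elim t (Sum.elim (fun i ↦ (e₁ i : B)) fun j ↦ (e₂ j : B))
  have hts : t ∈ Subtype.val '' s₁ := ⟨⟨t, ht⟩, hts₁ rfl, rfl⟩
  have hrange₁ : Set.range (fun i : Option (Fin _) ↦ x (i.map Sum.inl)) = Subtype.val '' s₁ := by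
    ext b
    constructor
    · rintro ⟨_ | i, rfl⟩
      exacts [hts, (e₁ i).2.1]
    · intro hb
      by_cases hbt : b = t
      · exact ⟨none, hbt.symm⟩
      · exact ⟨some (e₁.symm ⟨b, hb, hbt⟩), congrArg Subtype.val (e₁.apply_symm_apply _)⟩
  have hrange₂ : Set.range x = s₂ := by
    ext b
    constructor
    · rintro ⟨_ | i | j, rfl⟩
      exacts [hs₁₂ hts, hs₁₂ (e₁ i).2.1, (e₂ j).2.1]
    · intro hb
      by_cases hb1 : b ∈ Subtype.val '' s₁
      · rw [← hrange₁] at hb1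
        obtain ⟨i, rfl⟩ := hb1
        exact ⟨_, rfl⟩
      · exact ⟨some (Sum.inr (e₂.symm ⟨b, hb, hb1⟩)), congrArg Subtype.val (e₂.apply_symm_apply _)⟩
  have hinj : Function.Injective x := by
    have hmem {a b : B} (h : a = b) (ha : a ∈ Subtype.val '' s₁) : b ∈ Subtype.val '' s₁ := h ▸ ha
    rintro (_ | i | i) (_ | j | j) hij
    · rfl
    · exact ((e₁ j).2.2 hij.symm).elim
    · exact ((e₂ j).2.2 (hmem hij hts)).elim
    · exact ((e₁ i).2.2 hij).elim
    · rw [e₁.injective (Subtype.ext hij)]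
    · exact ((e₂ j).2.2 (hmem hij (e₁ i).2.1)).elim
    · exact ((e₂ i).2.2 (hmem hij.symm hts)).elim
    · exact ((e₂ i).2.2 (hmem hij.symm (e₁ j).2.1)).elim
    · rw [e₂.injective (Subtype.ext hij)]
  refine ⟨_, _, x, rfl, ?_, fun i ↦ ?_, ?_, ?_⟩
  · let bs : Module.Basis s₁ (ResidueField R) (ResidueField R ⊗[R] J) :=
      .mk (v := fun i : s₁ ↦ f i) hli₁ (by rw [← Set.image_eq_range, hsp₁])
    have hbs : ⇑bs = fun i : s₁ ↦ f i := Module.Basis.coe_mk _ _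
    have h1 := IsLocalRing.span_eq_top_of_tmul_eq_basis (fun i : s₁ ↦ ψ i) bs
      fun i ↦ (congrFun hbs i).symm
    have h2 := congrArg (Submodule.map J.subtype) h1
    rw [Submodule.map_span, Submodule.map_top, Submodule.range_subtype, ← Set.range_comp] at h2
    have h3 : Set.range (fun i : Option (Fin _) ↦ algebraMap B R (x (i.map Sum.inl))) =
        Set.range (J.subtype ∘ fun i : s₁ ↦ ψ i) := calc
      _ = algebraMap B R '' Set.range fun i : Option (Fin _) ↦ x (i.map Sum.inl) :=
        Set.range_comp _ _
      _ = algebraMap B R '' (Subtype.val '' s₁) := by rw [hrange₁]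
      _ = _ := by rw [← Set.image_comp, Set.image_eq_range]; rfl
    rw [h3]
    exact h2.symm
  · have h1 := hrange₁.subset ⟨i, rfl⟩
    obtain ⟨g, -, hg⟩ := h1
    have hg' : (g : B) = x (i.map Sum.inl) := hg
    exact hg' ▸ g.2
  · have h1 : LinearIndependent (ResidueField R) fun i : s₂ ↦ h i := hli₂
    have h2 (i) : x i ∈ s₂ := hrange₂.subset ⟨i, rfl⟩
    exact h1.comp (fun i ↦ ⟨x i, h2 i⟩) fun i j hij ↦ hinj (congrArg Subtype.val hij)
  · have h1 : (fun i ↦ residueD k R (algebraMap B R (x i))) = h ∘ x := rfl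
    rw [h1, Set.range_comp, hrange₂, hsp₂]

end Coordinates

end LagrangianSpecialization

namespace LagrangianSpecialization

/-! ### Spreading out equalities of ideals from a local ring to a basic open set. -/

section Spreading

variable {B : Type u} [CommRing B]

lemma exists_map_le_map_of_localization (p : Ideal B) [p.IsPrime] {R : Type*} [CommRing R]
    [Algebra B R] [IsLocalization.AtPrime R p] {I J : Ideal B} (hI : I.FG)
    (h : I.map (algebraMap B R) ≤ J.map (algebraMap B R)) :
    ∃ b ∉ p, ∀ g ∈ I, b * g ∈ J := by
  have key (g : B) (hg : g ∈ I) : ∃ s ∉ p, s * g ∈ J := by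
    obtain ⟨m, hm, hmg⟩ := (IsLocalization.algebraMap_mem_map_algebraMap_iff p.primeCompl R J g).mp
      (h (Ideal.mem_map_of_mem _ hg))
    exact ⟨m, hm, hmg⟩
  clear h
  induction I, hI using Submodule.fg_induction with
  | singleton x =>
    obtain ⟨s, hs, hsx⟩ := key x (Submodule.mem_span_singleton_self x)
    refine ⟨s, hs, fun g hg ↦ ?_⟩
    obtain ⟨a, rfl⟩ := Submodule.mem_span_singleton.mp hg
    rw [smul_eq_mul, mul_left_comm]
    exact J.mul_mem_left _ hsx
  | sup I₁ I₂ h₁ h₂ ih₁ ih₂ =>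
    obtain ⟨s₁, hs₁, H₁⟩ := ih₁ fun g hg ↦ key g (Submodule.mem_sup_left hg)
    obtain ⟨s₂, hs₂, H₂⟩ := ih₂ fun g hg ↦ key g (Submodule.mem_sup_right hg)
    refine ⟨s₁ * s₂, ‹p.IsPrime›.mul_notMem hs₁ hs₂, fun g hg ↦ ?_⟩
    obtain ⟨a, ha, b, hb, rfl⟩ := Submodule.mem_sup.mp hg
    rw [mul_add]
    refine J.add_mem ?_ ?_
    · rw [mul_right_comm]
      exact J.mul_mem_right _ (H₁ a ha)
    · rw [mul_assoc]
      exact J.mul_mem_left _ (H₂ b hb)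

lemma exists_map_eq_map_of_localization [IsNoetherianRing B] (p : Ideal B) [p.IsPrime]
    {R : Type*} [CommRing R] [Algebra B R] [IsLocalization.AtPrime R p] {I J : Ideal B}
    (h : I.map (algebraMap B R) = J.map (algebraMap B R)) :
    ∃ b ∉ p, ∀ (B' : Type u) [CommRing B'] [Algebra B B'], IsUnit (algebraMap B B' b) →
      I.map (algebraMap B B') = J.map (algebraMap B B') := by
  obtain ⟨b₁, hb₁, H₁⟩ := exists_map_le_map_of_localization p (IsNoetherian.noetherian I) h.le
  obtain ⟨b₂, hb₂, H₂⟩ := exists_map_le_map_of_localization p (IsNoetherian.noetherian J) h.ge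
  refine ⟨b₁ * b₂, ‹p.IsPrime›.mul_notMem hb₁ hb₂, fun B' _ _ hu ↦ ?_⟩
  have key {I J : Ideal B} {b : B} (hb : IsUnit (algebraMap B B' b)) (H : ∀ g ∈ I, b * g ∈ J) :
      I.map (algebraMap B B') ≤ J.map (algebraMap B B') := by
    refine Ideal.map_le_iff_le_comap.mpr fun g hg ↦ ?_
    have h1 := Ideal.mem_map_of_mem (algebraMap B B') (H g hg)
    rw [map_mul] at h1
    exact (Ideal.unit_mul_mem_iff_mem _ hb).mp h1
  rw [map_mul, IsUnit.mul_iff] at hu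
  exact le_antisymm (key hu.1 H₁) (key hu.2 H₂)

lemma isPrincipal_inf {R : Type*} [CommRing R] [IsDomain R] [UniqueFactorizationMonoid R]
    {I J : Ideal R} (hI : I.IsPrincipal) (hJ : J.IsPrincipal) : (I ⊓ J).IsPrincipal := by
  classical
  obtain ⟨a, rfl⟩ := hI
  obtain ⟨b, rfl⟩ := hJ
  let := UniqueFactorizationMonoid.toGCDMonoid R
  refine ⟨lcm a b, Ideal.ext fun x ↦ ?_⟩
  change x ∈ Ideal.span _ ⊓ Ideal.span _ ↔ x ∈ Ideal.span _
  rw [Ideal.mem_inf, Ideal.mem_span_singleton, Ideal.mem_span_singleton, Ideal.mem_span_singleton,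
    lcm_dvd_iff]

/-- The ideal is the intersection of finitely many height one primes. These are principal in a
factorial ring, and intersections of principal ideals are generated by least common multiples. -/
lemma isPrincipal_of_isRadical {R : Type*} [CommRing R] [IsDomain R] [IsNoetherianRing R]
    [UniqueFactorizationMonoid R] {I : Ideal R} (hI : I.IsRadical)
    (h : ∀ x ∈ I.minimalPrimes, x.height = 1) : I.IsPrincipal := by
  rw [← hI.radical, ← Ideal.sInf_minimalPrimes]
  have hfin := Ideal.finite_minimalPrimes_of_isNoetherianRing R I
  have key (s : Set (Ideal R)) (hs : s.Finite) (hs' : ∀ x ∈ s, x.IsPrincipal) :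
      (sInf s).IsPrincipal := by
    induction s, hs using Set.Finite.induction_on with
    | empty => rw [sInf_empty]; exact ⟨1, by simp⟩
    | insert _ _ ih =>
      rw [sInf_insert]
      exact isPrincipal_inf (hs' _ (Set.mem_insert _ _))
        (ih fun x hx ↦ hs' x (Set.mem_insert_of_mem _ hx))
  refine key _ hfin fun x hx ↦ ?_
  have : x.IsPrime := hx.1.1
  exact UniqueFactorizationMonoid.isPrincipal_of_height_eq_one (h x hx)

lemma exists_map_eq_span_of_localization [IsNoetherianRing B] (p : Ideal B) [p.IsPrime]
    {R : Type u} [CommRing R] [Algebra B R] [IsLocalization.AtPrime R p] [IsDomain R]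
    [UniqueFactorizationMonoid R] {I : Ideal B} (hI : I.IsRadical)
    (h : ∀ x ∈ I.minimalPrimes, x.height = 1) :
    ∃ b ∉ p, ∃ F : B, ∀ (B' : Type u) [CommRing B'] [Algebra B B'], IsUnit (algebraMap B B' b) →
      I.map (algebraMap B B') = Ideal.span {algebraMap B B' F} := by
  have : IsNoetherianRing R := IsLocalization.isNoetherianRing p.primeCompl R inferInstance
  have hI' : (I.map (algebraMap B R)).IsRadical := by
    rw [← Ideal.radical_eq_iff, ← IsLocalization.map_radical p.primeCompl, hI.radical]
  have hmin (x) (hx : x ∈ (I.map (algebraMap B R)).minimalPrimes) : x.height = 1 := by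
    rw [IsLocalization.minimalPrimes_map p.primeCompl R I] at hx
    rw [← IsLocalization.height_under p.primeCompl x]
    exact h _ hx
  obtain ⟨g, hg⟩ := isPrincipal_of_isRadical hI' hmin
  obtain ⟨⟨F, s⟩, hs⟩ := IsLocalization.surj p.primeCompl g
  have hspan : I.map (algebraMap B R) = (Ideal.span {F}).map (algebraMap B R) := by
    rw [hg, Ideal.map_span, Set.image_singleton, ← hs]
    exact (Ideal.span_singleton_mul_right_unit (IsLocalization.map_units R s) g).symm
  obtain ⟨b, hb, H⟩ := exists_map_eq_map_of_localization p hspan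
  refine ⟨b, hb, F, fun B' _ _ hu ↦ ?_⟩
  rw [H B' hu, Ideal.map_span, Set.image_singleton]

lemma exists_isPrime_map_of_localization [IsNoetherianRing B] (p : Ideal B) [p.IsPrime]
    {R : Type u} [CommRing R] [Algebra B R] [IsLocalization.AtPrime R p] {I : Ideal B}
    (hI : (I.map (algebraMap B R)).IsPrime) :
    ∃ b ∉ p, ∀ (c : B) (B' : Type u) [CommRing B'] [Algebra B B'], c ∉ p → b ∣ c →
      IsLocalization.Away c B' → (I.map (algebraMap B B')).IsPrime := by
  let P := (I.map (algebraMap B R)).comap (algebraMap B R)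
  have hP : P.map (algebraMap B R) = I.map (algebraMap B R) := IsLocalization.map_under p.primeCompl R _
  obtain ⟨b, hb, H⟩ := exists_map_eq_map_of_localization p hP
  refine ⟨b, hb, fun c B' _ _ hc hbc _ ↦ ?_⟩
  rw [← H B' (isUnit_of_dvd_unit (map_dvd _ hbc) (IsLocalization.Away.algebraMap_isUnit c))]
  refine IsLocalization.isPrime_of_isPrime_disjoint (.powers c) _ _ inferInstance ?_
  rw [Ideal.disjoint_powers_iff_notMem_of_isPrime]
  intro hcP
  exact hI.ne_top (Ideal.eq_top_of_isUnit_mem _ hcP (IsLocalization.map_units R (⟨c, hc⟩ : p.primeCompl)))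

end Spreading

end LagrangianSpecialization

namespace LagrangianSpecialization

/-! ### Smoothness of closed subschemes in terms of quotients of local rings. -/

section SmoothQuotient

theorem nonempty_localization_algEquiv_quotient {A B C : Type u} [CommRing A] [CommRing B] [CommRing C]
    [Algebra A B] [Algebra A C] [Algebra B C] [IsScalarTower A B C]
    (h : Function.Surjective (algebraMap B C)) (q : Ideal C) [q.IsPrime] (p : Ideal B) [p.IsPrime]
    (hp : p = q.comap (algebraMap B C)) :
    Nonempty (Localization.AtPrime q ≃ₐ[A] Localization.AtPrime p ⧸
      (RingHom.ker (algebraMap B C)).map (algebraMap B (Localization.AtPrime p))) := by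
  let R := Localization.AtPrime p
  let J := (RingHom.ker (algebraMap B C)).map (algebraMap B R)
  let ψ : C →+* R ⧸ J := RingHom.liftOfSurjective (algebraMap B C) h
    ⟨(Ideal.Quotient.mk J).comp (algebraMap B R), fun b hb ↦
      Ideal.Quotient.eq_zero_iff_mem.mpr (Ideal.mem_map_of_mem _ hb)⟩
  have hψ (b : B) : ψ (algebraMap B C b) = Ideal.Quotient.mk J (algebraMap B R b) :=
    RingHom.liftOfRightInverse_comp_apply _ _ _ _ b
  let : Algebra C (R ⧸ J) := ψ.toAlgebra
  have hloc := IsLocalization.of_surjective p.primeCompl R (R' := C) (S' := R ⧸ J) (algebraMap B C) h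
    (Ideal.Quotient.mk J) Ideal.Quotient.mk_surjective (RingHom.ext fun b ↦ (hψ b).symm)
    (by rw [Ideal.mk_ker])
  have hsub : p.primeCompl.map (algebraMap B C) = q.primeCompl := by
    ext c
    constructor
    · rintro ⟨b, hb, rfl⟩
      exact fun hc ↦ hb (hp ▸ hc)
    · intro hc
      obtain ⟨b, rfl⟩ := h c
      exact ⟨b, fun hb ↦ hc (by rw [hp] at hb; exact hb), rfl⟩
  rw [hsub] at hloc
  have : IsScalarTower A C (R ⧸ J) := .of_algebraMap_eq fun a ↦ by
    rw [IsScalarTower.algebraMap_apply A B C]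
    exact (hψ _).symm
  exact ⟨(IsLocalization.algEquiv q.primeCompl (Localization.AtPrime q) (R ⧸ J)).restrictScalars A⟩

/-- A surjective homomorphism `B → C` identifies smoothness of `C` over `A` at a prime with smoothness
of the corresponding quotient of a local ring of `B`. -/
theorem isSmoothAt_iff_formallySmooth_quotient {A B C : Type u} [CommRing A] [CommRing B] [CommRing C]
    [Algebra A B] [Algebra A C] [Algebra B C] [IsScalarTower A B C]
    (h : Function.Surjective (algebraMap B C)) (q : Ideal C) [q.IsPrime] (p : Ideal B) [p.IsPrime]
    (hp : p = q.comap (algebraMap B C)) :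
    Algebra.IsSmoothAt A q ↔ Algebra.FormallySmooth A
      (Localization.AtPrime p ⧸ (RingHom.ker (algebraMap B C)).map
        (algebraMap B (Localization.AtPrime p))) := by
  obtain ⟨e⟩ := nonempty_localization_algEquiv_quotient (A := A) h q p hp
  exact Algebra.FormallySmooth.iff_of_equiv e

theorem isRegularLocalRing_of_isSmoothAt {k C : Type u} [CommRing k] [IsRegularRing k] [CommRing C]
    [Algebra k C] [Algebra.FinitePresentation k C] (q : Ideal C) [q.IsPrime]
    [Algebra.IsSmoothAt k q] : IsRegularLocalRing (Localization.AtPrime q) := by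
  obtain ⟨g, hg, hsm⟩ := Algebra.IsSmoothAt.exists_notMem_smooth k q
  have : IsRegularRing (Localization.Away g) := isRegularRing_of_smooth k (Localization.Away g)
  have hd : Disjoint (Submonoid.powers g : Set C) (q : Set C) := by
    rw [Set.disjoint_left]
    rintro _ ⟨m, rfl⟩ hm
    exact hg (Ideal.IsPrime.mem_of_pow_mem inferInstance m hm)
  let Q := q.map (algebraMap C (Localization.Away g))
  have hQ : Q.IsPrime := IsLocalization.isPrime_of_isPrime_disjoint (.powers g) _ _ ‹_› hd
  have hQq : Q.comap (algebraMap C _) = q :=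
    IsLocalization.under_map_of_isPrime_disjoint (.powers g) _ ‹_› hd
  have := IsLocalization.isLocalization_isLocalization_atPrime_isLocalization (.powers g)
    (Localization.AtPrime Q) Q
  simp only [hQq] at this
  exact IsRegularLocalRing.of_ringEquiv
    (IsLocalization.algEquiv q.primeCompl (Localization.AtPrime Q)
      (Localization.AtPrime q)).toRingEquiv

/-- The local ring of V(I) at `p` is smooth over a field, hence regular, hence a domain: only one
branch of V(I) passes through `p`. -/
theorem isPrime_map_of_formallySmooth {k B : Type u} [Field k] [CommRing B] [Algebra k B]
    [Algebra.FinitePresentation k B] [IsNoetherianRing B] (p : Ideal B) [p.IsPrime] (I : Ideal B) (hI : I ≤ p)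
    (h : Algebra.FormallySmooth k
      (Localization.AtPrime p ⧸ I.map (algebraMap B (Localization.AtPrime p)))) :
    (I.map (algebraMap B (Localization.AtPrime p))).IsPrime := by
  let R := Localization.AtPrime p
  let q : Ideal (B ⧸ I) := p.map (Ideal.Quotient.mk I)
  have hq : q.IsPrime := Ideal.map_isPrime_of_surjective Ideal.Quotient.mk_surjective
    (by rwa [Ideal.mk_ker])
  have hp : p = q.comap (algebraMap B (B ⧸ I)) := by
    change p = (p.map (Ideal.Quotient.mk I)).comap (Ideal.Quotient.mk I)
    rw [Ideal.comap_map_of_surjective' _ Ideal.Quotient.mk_surjective, Ideal.mk_ker, sup_eq_left.mpr hI]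
  have hker : RingHom.ker (algebraMap B (B ⧸ I)) = I := Ideal.mk_ker
  obtain ⟨e⟩ := nonempty_localization_algEquiv_quotient (A := k) (B := B) (C := B ⧸ I)
    Ideal.Quotient.mk_surjective q p hp
  rw [hker] at e
  have : Algebra.FinitePresentation k (B ⧸ I) :=
    Algebra.FinitePresentation.quotient (IsNoetherian.noetherian I)
  have : Algebra.IsSmoothAt k q := Algebra.FormallySmooth.of_equiv e.symm
  have := isRegularLocalRing_of_isSmoothAt (k := k) q
  obtain ⟨m, hm⟩ : ∃ m : ℕ, ringKrullDim (Localization.AtPrime q) = m :=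
      ⟨_, (IsRegularLocalRing.spanFinrank_maximalIdeal (R := Localization.AtPrime q)).symm⟩
  have : IsDomain (Localization.AtPrime q) := isDomain_of_isRegularLocalRing m _ hm.le
  exact (Ideal.Quotient.isDomain_iff_prime _).mp (e.symm.toRingEquiv.toMulEquiv.isDomain _)

end SmoothQuotient

/-! ### Étale coordinates on a neighbourhood. -/

section EtaleSpreading

open MvPolynomial

variable {k B : Type u} [Field k] [CommRing B] [Algebra k B]

theorem exists_etale_aeval_of_basis [Algebra.Smooth k B] {n : Type} [Finite n] (x : n → B) (p : Ideal B) [p.IsPrime]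
    (hli : LinearIndependent (ResidueField (Localization.AtPrime p)) fun i ↦
      residueD k (Localization.AtPrime p) (algebraMap B (Localization.AtPrime p) (x i)))
    (hsp : Submodule.span (ResidueField (Localization.AtPrime p)) (Set.range fun i ↦
      residueD k (Localization.AtPrime p) (algebraMap B (Localization.AtPrime p) (x i))) = ⊤) :
    ∃ b ∉ p, ∀ (c : B) (B' : Type u) [CommRing B'] [Algebra B B'] [Algebra k B']
      [IsScalarTower k B B'], b ∣ c → IsLocalization.Away c B' →
      (aeval (fun i ↦ algebraMap B B' (x i)) : MvPolynomial n k →ₐ[k] B').toRingHom.Etale := by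
  let R := Localization.AtPrime p
  let P := MvPolynomial n k
  let : Algebra P B := (aeval x : P →ₐ[k] B).toRingHom.toAlgebra
  have hX (i : n) : algebraMap P B (X i) = x i := aeval_X _ _
  have : IsScalarTower k P B := .of_algebraMap_eq fun a ↦ ((aeval x : P →ₐ[k] B).commutes a).symm
  have : IsScalarTower k P R := .of_algebraMap_eq fun a ↦ by
    rw [IsScalarTower.algebraMap_apply k B R, IsScalarTower.algebraMap_apply k P B,
      ← IsScalarTower.algebraMap_apply P B R]
  have hXR (i : n) : algebraMap P R (X i) = algebraMap B R (x i) := by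
    rw [IsScalarTower.algebraMap_apply P B R, hX]
  have : Algebra.FormallySmooth k R := .comp k B R
  have : Algebra.EssFiniteType B R := .of_isLocalization _ p.primeCompl
  have : Algebra.EssFiniteType k R := .comp k B R
  have hx : (fun i ↦ residueD k R (algebraMap P R (X i))) =
    fun i ↦ residueD k R (algebraMap B R (x i)) := funext fun i ↦ congrArg (residueD k R) (hXR i)
  have : Algebra.FormallyEtale P R := formallyEtale_of_basis_residueD
    (by rw [hx]; exact hli) (by rw [hx]; exact hsp)
  have : Algebra.FinitePresentation P B := .of_restrict_scalars_finitePresentation k P B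
  obtain ⟨b, hb, hbe⟩ := Algebra.exists_etale_of_isEtaleAt (R := P) p
  refine ⟨b, hb, fun c B' _ _ _ _ hbc _ ↦ ?_⟩
  have hce : Algebra.Etale P (Localization.Away c) := by
    rw [← Algebra.basicOpen_subset_etaleLocus_iff_etale] at hbe ⊢
    obtain ⟨a, rfl⟩ := hbc
    exact .trans (PrimeSpectrum.basicOpen_mul_le_left _ _) hbe
  let : Algebra P B' := (aeval (fun i ↦ algebraMap B B' (x i)) : P →ₐ[k] B').toRingHom.toAlgebra
  have : IsScalarTower P B B' := .of_algebraMap_eq fun a ↦ by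
    have : (aeval (fun i ↦ algebraMap B B' (x i)) : P →ₐ[k] B') =
        (IsScalarTower.toAlgHom k B B').comp (aeval x) :=
      algHom_ext fun i ↦ by simp
    exact congr($this a)
  exact Algebra.Etale.of_equiv
    ((IsLocalization.algEquiv (.powers c) (Localization.Away c) B').restrictScalars P)

/-- Coordinates adapted to a flag `V(I) ⊆ V(J)` near a point `p` of `V(I)` at which `V(I)` is smooth,
where `J` defines a reduced divisor. -/
theorem exists_adapted_coordinates [Algebra.Smooth k B] [IsDomain B] (p : Ideal B) [p.IsPrime]
    (I J : Ideal B) (hI : I ≤ p) (t : B) (ht : t ∈ I)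
    (htD : residueD k (Localization.AtPrime p) (algebraMap B (Localization.AtPrime p) t) ≠ 0)
    (hsm : Algebra.FormallySmooth k
      (Localization.AtPrime p ⧸ I.map (algebraMap B (Localization.AtPrime p))))
    (hJ : J.IsRadical) (hJ' : ∀ x ∈ J.minimalPrimes, x.height = 1) :
    ∃ (d e : ℕ) (x : Option (Fin d ⊕ Fin e) → B) (F b : B), x none = t ∧ b ∉ p ∧
      ∀ (B' : Type u) [CommRing B'] [Algebra B B'] [Algebra k B'] [IsScalarTower k B B'],
      IsLocalization.Away b B' →
      (aeval (fun i ↦ algebraMap B B' (x i)) :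
        MvPolynomial (Option (Fin d ⊕ Fin e)) k →ₐ[k] B').toRingHom.Etale ∧
      I.map (algebraMap B B') = Ideal.span (Set.range fun i : Option (Fin d) ↦
        algebraMap B B' (x (i.map Sum.inl))) ∧
      (I.map (algebraMap B B')).IsPrime ∧ J.map (algebraMap B B') = Ideal.span {algebraMap B B' F} := by
  let R := Localization.AtPrime p
  have : IsNoetherianRing B := Algebra.FiniteType.isNoetherianRing k B
  have : IsNoetherianRing R := IsLocalization.isNoetherianRing p.primeCompl R inferInstance
  have : Algebra.FormallySmooth k R := .comp k B R
  have : Algebra.EssFiniteType B R := .of_isLocalization _ p.primeCompl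
  have : Algebra.EssFiniteType k R := .comp k B R
  have : IsDomain R := IsLocalization.isDomain_of_atPrime _ p
  have : UniqueFactorizationMonoid R := uniqueFactorizationMonoid_localization_of_smooth (k := k) p
  obtain ⟨d, e, x, hx, hspan, -, hli, hsp⟩ := exists_coordinates p I hI t ht htD hsm
  obtain ⟨b₁, hb₁, H₁⟩ := exists_etale_aeval_of_basis x p hli hsp
  obtain ⟨b₂, hb₂, H₂⟩ := exists_map_eq_map_of_localization p (R := R) (I := I)
    (J := Ideal.span (Set.range fun i : Option (Fin d) ↦ x (i.map Sum.inl))) (by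
      rw [hspan, Ideal.map_span, ← Set.range_comp]; rfl)
  obtain ⟨b₃, hb₃, H₃⟩ := exists_isPrime_map_of_localization p
    (isPrime_map_of_formallySmooth p I hI hsm)
  obtain ⟨b₄, hb₄, F, H₄⟩ := exists_map_eq_span_of_localization p (R := R) hJ hJ'
  have hb := ‹p.IsPrime›.mul_notMem (‹p.IsPrime›.mul_notMem hb₁ hb₂) (‹p.IsPrime›.mul_notMem hb₃ hb₄)
  refine ⟨d, e, x, F, _, hx, hb, fun B' _ _ _ _ h ↦ ?_⟩
  have hu := IsLocalization.Away.algebraMap_isUnit (S := B') (b₁ * b₂ * (b₃ * b₄))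
  refine ⟨H₁ _ B' ((dvd_mul_right _ _).mul_right _) h, ?_, H₃ _ B' hb
    ((dvd_mul_right _ _).mul_left _) h,
    H₄ B' (isUnit_of_dvd_unit (map_dvd _ ((dvd_mul_left _ _).mul_left _)) hu)⟩
  rw [H₂ B' (isUnit_of_dvd_unit (map_dvd _ ((dvd_mul_left _ _).mul_right _)) hu), Ideal.map_span,
    ← Set.range_comp]
  rfl

end EtaleSpreading

end LagrangianSpecialization

namespace LagrangianSpecialization

open TensorProduct

/-! ### Relative derivations over a one-dimensional base. -/

section Derivations

variable {k A B : Type u} [CommRing k] [CommRing A] [CommRing B] [Algebra k A] [Algebra k B]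
  [Algebra A B] [IsScalarTower k A B] {M : Type*} [AddCommGroup M] [Module k M] [Module A M]
  [Module B M] [IsScalarTower k B M] [IsScalarTower A B M] [IsScalarTower k A M]

/-- A derivation killing the image of `A` is `A`-linear. -/
def derivationOfKilling (D : Derivation k B M) (h : ∀ a : A, D (algebraMap A B a) = 0) :
    Derivation A B M :=
  Derivation.mk'
    { toFun := D
      map_add' := map_add D
      map_smul' a b := by
        rw [Algebra.smul_def, Derivation.leibniz, h, smul_zero, add_zero, algebraMap_smul,
          RingHom.id_apply] }
    D.leibniz

@[simp]
lemma derivationOfKilling_apply (D : Derivation k B M) (h : ∀ a : A, D (algebraMap A B a) = 0)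
    (b : B) : derivationOfKilling D h b = D b := rfl

lemma derivation_eq_zero_of_span {t : A}
    (ht : Submodule.span A {KaehlerDifferential.D k A t} = ⊤) (D : Derivation k A M) (hD : D t = 0) :
    D = 0 := by
  have h : D.liftKaehlerDifferential = 0 := by
    refine LinearMap.ext_on ht fun x hx ↦ ?_
    rw [Set.mem_singleton_iff.mp hx, Derivation.liftKaehlerDifferential_comp_D, hD]
    rfl
  rw [← D.liftKaehlerDifferential_comp, h]
  ext
  simp

lemma derivation_algebraMap_eq_zero_of_span {t : A}
    (ht : Submodule.span A {KaehlerDifferential.D k A t} = ⊤) (D : Derivation k B M)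
    (hD : D (algebraMap A B t) = 0) (a : A) : D (algebraMap A B a) = 0 :=
  congr($(derivation_eq_zero_of_span ht (D.compAlgebraMap A) hD) a)

end Derivations

section Base

variable {k A R : Type u} [CommRing k] [CommRing A] [CommRing R] [IsLocalRing R] [Algebra k A]
  [Algebra k R] [Algebra A R] [IsScalarTower k A R]

lemma residueD_ne_zero_of_linearMap {x : R} (φ : Ω[R⁄k] →ₗ[R] R)
    (h : IsUnit (φ (KaehlerDifferential.D k R x))) : residueD k R x ≠ 0 := by
  intro h0
  have h1 := congrArg (φ.lTensor (ResidueField R)) h0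
  rw [residueD_apply, LinearMap.lTensor_tmul, map_zero] at h1
  have h2 := congrArg (TensorProduct.rid R (ResidueField R)) h1
  rw [TensorProduct.rid_tmul, map_zero, Algebra.smul_def, mul_one] at h2
  exact (h.map (algebraMap R (ResidueField R))).ne_zero h2

/-- Formal smoothness of `R` over `A` splits the sequence of differentials, so the functional dual
to dt on `A` extends to differentials of `R`. -/
lemma residueD_algebraMap_ne_zero [Algebra.FormallySmooth A R] {t : A} (δ : Derivation k A A)
    (h : δ t = 1) : residueD k R (algebraMap A R t) ≠ 0 := by
  have hinj : Function.Injective (KaehlerDifferential.mapBaseChange k A R) := by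
    rw [injective_iff_map_eq_zero]
    intro x hx
    obtain ⟨y, rfl⟩ := (Algebra.H1Cotangent.exact_δ_mapBaseChange k A R x).mp hx
    rw [Subsingleton.elim y 0, map_zero]
  obtain ⟨s, hs⟩ := Module.projective_lifting_property (KaehlerDifferential.map k A R R)
    LinearMap.id (KaehlerDifferential.map_surjective k A R)
  obtain ⟨-, l, hl⟩ := ((Function.Exact.split_tfae'
    (KaehlerDifferential.exact_mapBaseChange_map k A R)).out 0 1 rfl rfl).mp ⟨hinj, s, hs⟩
  let φ : Ω[R⁄k] →ₗ[R] R := (AlgebraTensorModule.rid A R R).toLinearMap.comp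
    ((δ.liftKaehlerDifferential.baseChange R).comp l)
  have hφ : φ (KaehlerDifferential.D k R (algebraMap A R t)) = 1 := by
    have h1 : l (KaehlerDifferential.D k R (algebraMap A R t)) = 1 ⊗ₜ KaehlerDifferential.D k A t := by
      rw [← KaehlerDifferential.map_D k k A R, ← one_smul R (KaehlerDifferential.map k k A R _),
        ← KaehlerDifferential.mapBaseChange_tmul]
      exact congr($hl _)
    simp [φ, h1, h]
  exact residueD_ne_zero_of_linearMap φ (hφ ▸ isUnit_one)

end Base

section Jacobian

variable {k A B : Type u} [Field k] [CommRing A] [CommRing B] [Algebra k A] [Algebra k B]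
  [Algebra A B] [IsScalarTower k A B] {n : Type} [Fintype n] [DecidableEq n]
  [Algebra (MvPolynomial (Option n) k) B] [IsScalarTower k (MvPolynomial (Option n) k) B]
  [Algebra.Etale (MvPolynomial (Option n) k) B]

lemma partialDer_some_algebraMap {t : A} (ht : Submodule.span A {KaehlerDifferential.D k A t} = ⊤)
    (htB : algebraMap A B t = coord k B (none : Option n)) (i : n) (a : A) :
    partialDer k B (some i) (algebraMap A B a) = 0 :=
  derivation_algebraMap_eq_zero_of_span ht _ (by rw [htB, partialDer_coord]; simp) a

lemma relDerivation_apply_eq_sum {t : A} (htB : algebraMap A B t = coord k B (none : Option n))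
    {M : Type*} [AddCommGroup M] [Module k M] [Module A M] [Module B M] [IsScalarTower k B M]
    [IsScalarTower A B M] [IsScalarTower k A M] (D : Derivation A B M) (b : B) :
    D b = ∑ i : n, partialDer k B (some i) b • D (coord k B (some i)) := by
  have := derivation_apply_eq_sum (n := Option n) (D.restrictScalars k) b
  rw [Fintype.sum_option] at this
  simpa [← htB] using this

/-- By the chain rule dF is a combination of the relative coordinate differentials with the partial
derivatives as coefficients. If all of these vanished at `x`, so would dF at the residue field,
against the Jacobian criterion. -/
theorem exists_partialDer_notMem [Algebra.FormallySmooth A B] [Algebra.FiniteType A B]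
    [IsNoetherianRing B] [IsDomain B] {t : A} (htB : algebraMap A B t = coord k B (none : Option n))
    (x : Ideal B) [x.IsPrime] {F : B} (hF : F ≠ 0) (hFx : F ∈ x)
    (h : Algebra.FormallySmooth A (Localization.AtPrime x ⧸
      (Ideal.span {F}).map (algebraMap B (Localization.AtPrime x)))) :
    ∃ i : n, partialDer k B (some i) F ∉ x := by
  let R := Localization.AtPrime x
  have : IsNoetherianRing R := IsLocalization.isNoetherianRing x.primeCompl R inferInstance
  have : Algebra.FormallySmooth A R := .comp A B R
  have : Algebra.EssFiniteType B R := .of_isLocalization _ x.primeCompl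
  have : Algebra.EssFiniteType A R := .comp A B R
  rw [Ideal.map_span, Set.image_singleton] at h
  have hF0 : algebraMap B R F ≠ 0 := fun h0 ↦ hF
    ((injective_iff_map_eq_zero _).mp (IsLocalization.injective R x.primeCompl_le_nonZeroDivisors) F h0)
  have hne := residueD_ne_zero_of_formallySmooth (A := A) hF0
    ((IsLocalization.AtPrime.to_map_mem_maximal_iff R x F).mpr hFx) h
  by_contra! hall
  apply hne
  have h1 := relDerivation_apply_eq_sum htB ((KaehlerDifferential.D A R).compAlgebraMap B) F
  have h2 : KaehlerDifferential.D A R (algebraMap B R F) = _ := h1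
  rw [residueD_apply, h2, tmul_sum]
  refine Finset.sum_eq_zero fun i _ ↦ ?_
  have h3 : residue R (algebraMap B R (partialDer k B (some i) F)) = 0 := (residue_eq_zero_iff _).mpr
    ((IsLocalization.AtPrime.to_map_mem_maximal_iff R x _).mpr (hall i))
  rw [← algebraMap_smul R (partialDer k B (some i) F), ← smul_tmul, Algebra.smul_def, mul_one]
  erw [h3]
  rw [zero_tmul]

/-- A partial derivative along the fibers kills t and therefore all of `A`, because dt generates the
differentials of `A`. So it is an `A`-derivation, and its value on F is a unit at `x`. -/
theorem formallySmooth_of_partialDer_notMem [Algebra.Smooth A B]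
    [IsNoetherianRing B] {t : A} (ht : Submodule.span A {KaehlerDifferential.D k A t} = ⊤) (htB : algebraMap A B t = coord k B (none : Option n))
    (x : Ideal B) [x.IsPrime] {F : B} (hFx : F ∈ x) {i : n} (hi : partialDer k B (some i) F ∉ x) :
    Algebra.FormallySmooth A (Localization.AtPrime x ⧸
      (Ideal.span {F}).map (algebraMap B (Localization.AtPrime x))) := by
  let R := Localization.AtPrime x
  have : IsNoetherianRing R := IsLocalization.isNoetherianRing x.primeCompl R inferInstance
  have : Algebra.FormallySmooth A R := .comp A B R
  have : Algebra.EssFiniteType B R := .of_isLocalization _ x.primeCompl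
  have : Algebra.EssFiniteType A R := .comp A B R
  have : Algebra.FormallyEtale B R := .of_isLocalization x.primeCompl
  let D : Derivation A B B := derivationOfKilling (partialDer k B (some i)) 
    (partialDer_some_algebraMap ht htB i)
  rw [Ideal.map_span, Set.image_singleton]
  refine formallySmooth_of_isUnit_derivation
    ((IsLocalization.AtPrime.to_map_mem_maximal_iff R x F).mpr hFx) (extendDerivation A A B R D) ?_
  rw [extendDerivation_algebraMap]
  exact IsLocalization.map_units R (⟨_, hi⟩ : x.primeCompl)

end Jacobian

end LagrangianSpecialization

namespace LagrangianSpecialization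

/-! ### Generic smoothness of a flat reduced family in characteristic zero. -/

section GenericSmoothness

variable {A B : Type u} [CommRing A] [CommRing B] [Algebra A B]

lemma map_eq_maximalIdeal_of_mem_minimalPrimes {I : Ideal B} (hI : I.IsRadical) {x : Ideal B}
    [x.IsPrime] (hx : x ∈ I.minimalPrimes) :
    I.map (algebraMap B (Localization.AtPrime x)) = maximalIdeal (Localization.AtPrime x) := by
  let R := Localization.AtPrime x
  rw [← IsLocalization.AtPrime.map_eq_maximalIdeal x R]
  refine le_antisymm (Ideal.map_mono hx.1.2) ?_
  have hI' : (I.map (algebraMap B R)).IsRadical := by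
    rw [← Ideal.radical_eq_iff, ← IsLocalization.map_radical x.primeCompl, hI.radical]
  rw [← hI'.radical, ← Ideal.sInf_minimalPrimes, le_sInf_iff]
  intro Q hQ
  rw [IsLocalization.minimalPrimes_map x.primeCompl] at hQ
  have hQ' : Q.under B ∈ I.minimalPrimes := hQ
  have h1 : Q ≠ ⊤ := by
    rintro rfl
    exact hQ'.1.1.ne_top (by simp)
  have h2 : Q.under B ≤ x := by
    intro b hb
    exact (IsLocalization.AtPrime.to_map_mem_maximal_iff R x b).mp (le_maximalIdeal h1 hb)
  exact Ideal.map_le_iff_le_comap.mpr (hx.2 ⟨hQ'.1.1, hQ'.1.2⟩ h2)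

/-- At a minimal prime of a radical ideal, `I` localizes to the maximal ideal. If `a` were in `x`,
some s ∉ x would satisfy s a ∈ I; by flatness `a` is regular on `B/I`, so s ∈ I ⊆ x. -/
lemma algebraMap_notMem_of_mem_minimalPrimes [IsDomain A] {I : Ideal B} (hI : I.IsRadical)
    [Module.Flat A (B ⧸ I)] {x : Ideal B} (hx : x ∈ I.minimalPrimes) {a : A} (ha : a ≠ 0) :
    algebraMap A B a ∉ x := by
  have : x.IsPrime := hx.1.1
  intro hax
  have h1 : algebraMap B (Localization.AtPrime x) (algebraMap A B a) ∈ I.map (algebraMap B _) := by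
    rw [map_eq_maximalIdeal_of_mem_minimalPrimes hI hx]
    exact (IsLocalization.AtPrime.to_map_mem_maximal_iff _ x _).mpr hax
  obtain ⟨s, hs, hsa⟩ := (IsLocalization.algebraMap_mem_map_algebraMap_iff x.primeCompl _ I _).mp h1
  have h2 : a • (Ideal.Quotient.mk I s) = 0 := by
    rw [← Ideal.Quotient.eq_zero_iff_mem, mul_comm] at hsa
    rw [← hsa, map_mul, Algebra.smul_def]
    rfl
  have h3 : IsSMulRegular (B ⧸ I) a := Module.Flat.isSMulRegular_of_nonZeroDivisors (mem_nonZeroDivisors_of_ne_zero ha)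
  have h4 : Ideal.Quotient.mk I s = 0 := h3 (by simpa using h2)
  exact hs (hx.1.2 (Ideal.Quotient.eq_zero_iff_mem.mp h4))

/-- The localized quotient is a field that contains the fraction field of `A`, by flatness. Field
extensions in characteristic zero are formally smooth. -/
theorem formallySmooth_of_mem_minimalPrimes [IsDomain A] [CharZero A] [Algebra.FiniteType A B] {I : Ideal B} (hI : I.IsRadical)
    [Module.Flat A (B ⧸ I)] {x : Ideal B} [x.IsPrime] (hx : x ∈ I.minimalPrimes) :
    Algebra.FormallySmooth A (Localization.AtPrime x ⧸
      I.map (algebraMap B (Localization.AtPrime x))) := by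
  let R := Localization.AtPrime x
  have hmap := map_eq_maximalIdeal_of_mem_minimalPrimes hI hx
  let κ := R ⧸ I.map (algebraMap B R)
  have hmax : (I.map (algebraMap B R)).IsMaximal := hmap ▸ maximalIdeal.isMaximal R
  let : Field κ := Ideal.Quotient.field _
  have hinj : Function.Injective (algebraMap A κ) := by
    rw [injective_iff_map_eq_zero]
    intro a ha
    by_contra h0
    apply algebraMap_notMem_of_mem_minimalPrimes hI hx h0
    have h1 : Ideal.Quotient.mk (I.map (algebraMap B R)) (algebraMap B R (algebraMap A B a)) = 0 := ha
    rw [Ideal.Quotient.eq_zero_iff_mem, hmap] at h1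
    exact (IsLocalization.AtPrime.to_map_mem_maximal_iff R x _).mp h1
  have : FaithfulSMul A κ := (faithfulSMul_iff_algebraMap_injective A κ).mpr hinj
  let K := FractionRing A
  let : Algebra K κ := FractionRing.liftAlgebra A κ
  have : CharZero K := charZero_of_injective_algebraMap (FaithfulSMul.algebraMap_injective A K)
  have : Algebra.EssFiniteType B R := .of_isLocalization _ x.primeCompl
  have : Algebra.EssFiniteType A R := .comp A B R
  have : Algebra.EssFiniteType A κ := .comp A R κ
  have : Algebra.EssFiniteType K κ := .of_comp A K κ
  have : Algebra.FormallySmooth K κ := .of_perfectField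
  have : Algebra.FormallySmooth A K := .of_isLocalization (nonZeroDivisors A)
  exact .comp A K κ

end GenericSmoothness

/-! ### Parameters on a smooth curve. -/

section Base

open MvPolynomial

variable {k A : Type u} [Field k] [IsAlgClosed k] [CommRing A] [Algebra k A]

lemma exists_sub_algebraMap_mem [Algebra.FiniteType k A] (m : Ideal A) [m.IsMaximal] (a : A) :
    ∃ c : k, a - algebraMap k A c ∈ m := by
  let : Field (A ⧸ m) := Ideal.Quotient.field m
  have : Module.Finite k (A ⧸ m) := finite_of_finite_type_of_isJacobsonRing k (A ⧸ m)
  obtain ⟨c, hc⟩ := (IsAlgClosed.algebraMap_bijective_of_isIntegral (k := k) (K := A ⧸ m)).2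
    (Ideal.Quotient.mk m a)
  exact ⟨c, Ideal.Quotient.eq.mp hc.symm⟩

/-- The residue field at `m` is `k`, so every differential comes, up to coefficients, from functions
in `m`. Hence some t ∈ m has dt ≠ 0 at `m`. Then t is the first of a system of étale coordinates
adapted to the point, and rank one of the differentials excludes any further coordinate. -/
theorem exists_uniformizer [IsDomain A] [Algebra.Smooth k A] (ω : Module.Basis Unit A Ω[A⁄k])
    (m : Ideal A) [m.IsMaximal] :
    ∃ t ∈ m, ∃ b ∉ m, ∀ (A' : Type u) [CommRing A'] [Algebra A A'] [Algebra k A']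
      [IsScalarTower k A A'], IsLocalization.Away b A' →
      m.map (algebraMap A A') = Ideal.span {algebraMap A A' t} ∧
      Submodule.span A' {KaehlerDifferential.D k A' (algebraMap A A' t)} = ⊤ ∧
      ∃ δ : Derivation k A' A', δ (algebraMap A A' t) = 1 := by
  let φ : Ω[A⁄k] →ₗ[A] A := ω.coord ()
  let R := Localization.AtPrime m
  have : Algebra.EssFiniteType A R := .of_isLocalization _ m.primeCompl
  have : Algebra.EssFiniteType k R := .comp k A R
  have : Algebra.FormallyEtale A R := .of_isLocalization m.primeCompl
  obtain ⟨t, htm, ht⟩ : ∃ t ∈ m, φ (KaehlerDifferential.D k A t) ∉ m := by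
    by_contra! h
    have h1 (y : Ω[A⁄k]) : φ y ∈ m := by
      have hy : y ∈ Submodule.span A (Set.range (KaehlerDifferential.D k A)) := by
        rw [KaehlerDifferential.span_range_derivation]; trivial
      induction hy using Submodule.span_induction with
      | mem y hy =>
        obtain ⟨a, rfl⟩ := hy
        obtain ⟨c, hc⟩ := exists_sub_algebraMap_mem (k := k) m a
        have := h _ hc
        rwa [map_sub, Derivation.map_algebraMap, sub_zero] at this
      | zero => rw [map_zero]; exact m.zero_mem
      | add y z _ _ hy hz => rw [map_add]; exact m.add_mem hy hz
      | smul a y _ hy => rw [map_smul]; exact m.mul_mem_left _ hy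
    refine (Ideal.ne_top_iff_one m).mp (Ideal.IsMaximal.ne_top ‹_›) ?_
    have := h1 (ω ())
    simpa [φ] using this
  have htD : residueD k R (algebraMap A R t) ≠ 0 := by
    let δ := extendDerivation k k A R (φ.compDer (KaehlerDifferential.D k A))
    refine residueD_ne_zero_of_linearMap δ.liftKaehlerDifferential ?_
    rw [Derivation.liftKaehlerDifferential_comp_D, extendDerivation_algebraMap]
    exact IsLocalization.map_units R (⟨_, ht⟩ : m.primeCompl)
  have hsm : Algebra.FormallySmooth k (R ⧸ m.map (algebraMap A R)) := by
    have hmax : (m.map (algebraMap A R)).IsMaximal :=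
      (IsLocalization.AtPrime.map_eq_maximalIdeal m R).symm ▸ maximalIdeal.isMaximal R
    let : Field (R ⧸ m.map (algebraMap A R)) := Ideal.Quotient.field _
    have : Algebra.EssFiniteType k (R ⧸ m.map (algebraMap A R)) := .comp k R _
    exact .of_perfectField
  -- No divisor is needed here: the unit ideal has no minimal primes.
  obtain ⟨d, e, x, F, b, hx, hb, H⟩ := exists_adapted_coordinates m m ⊤ le_rfl t htm htD hsm
    (fun _ _ ↦ trivial) (fun x hx ↦ (hx.1.1.ne_top (top_le_iff.mp hx.1.2)).elim)
  refine ⟨t, htm, b, hb, fun A' _ _ _ _ hA' ↦ ?_⟩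
  obtain ⟨het, hspan, -, -⟩ := H A' hA'
  let P := MvPolynomial (Option (Fin d ⊕ Fin e)) k
  let alg : Algebra P A' := (aeval (fun i ↦ algebraMap A A' (x i)) : P →ₐ[k] A').toRingHom.toAlgebra
  have : Algebra.Etale P A' := het
  have : IsScalarTower k P A' := .of_algebraMap_eq fun a ↦
    ((aeval (fun i ↦ algebraMap A A' (x i)) : P →ₐ[k] A').commutes a).symm
  have hcoord (i) : coord k A' i = algebraMap A A' (x i) := aeval_X _ _
  have hb0 : b ≠ 0 := fun h ↦ hb (h ▸ m.zero_mem)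
  have : IsDomain A' := IsLocalization.isDomain_of_le_nonZeroDivisors (M := .powers b) _
    (powers_le_nonZeroDivisors_of_noZeroDivisors hb0)
  -- When the differentials have rank one, the values of a derivation are those of ω's coordinate
  -- times a constant factor. A derivation killing t, on which this coordinate is nonzero, has
  -- factor zero and cannot be 1 on a second coordinate.
  have hempty : IsEmpty (Fin d ⊕ Fin e) := by
    refine ⟨fun i ↦ ?_⟩
    let δ₀ := (partialDer k A' (none : Option (Fin d ⊕ Fin e))).compAlgebraMap A
    let δ₁ := (partialDer k A' (some i)).compAlgebraMap A
    have hδ₀ (j) : δ₀ (x j) = if j = none then 1 else 0 := by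
      rw [← partialDer_coord (k := k) (B := A') (n := Option (Fin d ⊕ Fin e)), hcoord]; rfl
    have hδ₁ (j) : δ₁ (x j) = if j = some i then 1 else 0 := by
      rw [← partialDer_coord (k := k) (B := A') (n := Option (Fin d ⊕ Fin e)), hcoord]; rfl
    have hω (D : Derivation k A A') (a : A) :
        D a = algebraMap A A' (φ (KaehlerDifferential.D k A a)) * D.liftKaehlerDifferential (ω ()) := by
      have : D.liftKaehlerDifferential =
          (LinearMap.toSpanSingleton A A' (D.liftKaehlerDifferential (ω ()))).comp φ :=
        ω.ext fun _ ↦ by simp [φ]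
      rw [← Algebra.smul_def]
      exact (Derivation.liftKaehlerDifferential_comp_D D a).symm.trans congr($this _)
    have h1 := (hω δ₀ (x none)).symm.trans (hδ₀ none)
    have h2 := (hω δ₁ (x none)).symm.trans (hδ₁ none)
    have h3 := (hω δ₁ (x (some i))).symm.trans (hδ₁ (some i))
    rw [if_pos rfl] at h1 h3
    rw [if_neg (Option.some_ne_none i).symm] at h2
    rw [(mul_eq_zero.mp h2).resolve_left (left_ne_zero_of_mul_eq_one h1), mul_zero] at h3
    exact zero_ne_one h3
  refine ⟨?_, ?_, partialDer k A' (none : Option (Fin d ⊕ Fin e)), ?_⟩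
  · have : IsEmpty (Fin d) := ⟨fun i ↦ hempty.elim (Sum.inl i)⟩
    rw [hspan, ← hx]
    congr 1
    rw [Set.range_unique]
    rfl
  · let N := Ω[A'⁄k] ⧸ Submodule.span A' {KaehlerDifferential.D k A' (algebraMap A A' t)}
    let q := Submodule.mkQ (Submodule.span A' {KaehlerDifferential.D k A' (algebraMap A A' t)})
    have h1 : q.compDer (KaehlerDifferential.D k A') = 0 := by
      refine derivation_ext_of_coord (n := Option (Fin d ⊕ Fin e)) fun i ↦ ?_
      rcases i with _ | i
      · rw [hcoord, hx]
        exact (Submodule.Quotient.mk_eq_zero _).mpr (Submodule.mem_span_singleton_self _)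
      · exact hempty.elim i
    rw [eq_top_iff, ← KaehlerDifferential.span_range_derivation, Submodule.span_le]
    rintro _ ⟨a, rfl⟩
    exact (Submodule.Quotient.mk_eq_zero _).mp congr($h1 a)
  · rw [← hx, ← hcoord, partialDer_coord (n := Option (Fin d ⊕ Fin e)), if_pos rfl]

end Base

end LagrangianSpecialization

namespace LagrangianSpecialization

open CategoryTheory Limits AlgebraicGeometry TopologicalSpace

variable {W S : Scheme.{u}} {f : W ⟶ S}

/-! ### Charts of the relative cotangent bundle. -/

namespace Chart

/-- The inclusion of the total space of a chart. -/
noncomputable def toTotal (c : Chart f) : Spec (.of c.B) ⟶ W := c.isoSpec.inv ≫ c.total.1.ι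

instance (c : Chart f) : IsOpenImmersion c.toTotal := by unfold toTotal; infer_instance

lemma range_toTotal (c : Chart f) : Set.range c.toTotal = c.total.1 := c.total.2.range_fromSpec

lemma toTotal_mem (c : Chart f) (x : Spec (.of c.B)) : c.toTotal x ∈ c.total.1 :=
  c.range_toTotal.subset ⟨x, rfl⟩

lemma exists_toTotal_eq (c : Chart f) {x : W} (hx : x ∈ c.total.1) :
    ∃ P : Spec (.of c.B), c.toTotal P = x := c.range_toTotal.superset hx

lemma toTotal_specializes_iff (c : Chart f) {P Q : Spec (.of c.B)} :
    c.toTotal P ⤳ c.toTotal Q ↔ P.asIdeal ≤ Q.asIdeal := by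
  rw [c.toTotal.isOpenEmbedding.isInducing.specializes_iff]
  exact (PrimeSpectrum.le_iff_specializes P Q).symm

/-- The ideal of a closed subset in a chart. -/
noncomputable def ideal (c : Chart f) (Y : Closeds W) : Ideal c.B :=
  (Scheme.IdealSheafData.vanishingIdeal Y).ideal c.total

lemma ideal_eq (c : Chart f) (Y : Closeds W) :
    c.ideal Y = PrimeSpectrum.vanishingIdeal (c.toTotal ⁻¹' Y) := rfl

lemma isRadical_ideal (c : Chart f) (Y : Closeds W) : (c.ideal Y).IsRadical :=
  PrimeSpectrum.isRadical_vanishingIdeal _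

lemma toTotal_mem_iff (c : Chart f) (Y : Closeds W) (P : Spec (.of c.B)) :
    c.toTotal P ∈ Y ↔ c.ideal Y ≤ P.asIdeal := by
  have h1 : IsClosed (c.toTotal ⁻¹' Y) := Y.isClosed.preimage c.toTotal.continuous
  have h2 := (PrimeSpectrum.zeroLocus_vanishingIdeal_eq_closure (R := c.B) (c.toTotal ⁻¹' Y)).trans
    h1.closure_eq
  exact ⟨fun h ↦ h2.ge h, fun h ↦ h2.le h⟩

lemma map_ideal {c d : Chart f} (h : c ≤ d) (Y : Closeds W) :
    (d.ideal Y).map (resB h) = c.ideal Y :=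
  (Scheme.IdealSheafData.vanishingIdeal Y).map_ideal h.2

lemma isLocalization_resB {c d : Chart f} (h : c ≤ d) (b : d.B)
    (hb : c.total.1 = W.basicOpen (U := d.total.1) b) :
    letI := (resB h).toAlgebra
    IsLocalization.Away b c.B :=
  d.total.2.isLocalization_of_eq_basicOpen b (homOfLE h.2) hb

lemma cotangentProj_cotangentChart [Smooth f] (c : Chart f) (q : Spec (.of c.Sym)) :
    cotangentProj f (cotangentChart f c q) =
      c.toTotal (Spec.map (CommRingCat.ofHom (algebraMap c.B c.Sym)) q) := by
  rw [← Scheme.Hom.comp_apply, cotangentChart_proj]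
  rfl

instance [Smooth f] (c : Chart f) : IsOpenImmersion (cotangentChart f c) :=
  (Chart.gluingData f).cover.map_prop c

lemma exists_cotangentChart_eq [Smooth f] (c : Chart f) {ξ : cotangentBundle f}
    (h : cotangentProj f ξ ∈ c.total.1) : ∃ q, cotangentChart f c q = ξ := by
  have h1 := (Chart.gluingData f).preimage_toBase_eq_range_ι c
  have h2 : ξ ∈ (Chart.gluingData f).toBase ⁻¹' Set.range ((cover f).f c) := by
    refine ⟨⟨_, h⟩, rfl⟩
  rw [h1] at h2
  exact h2

lemma resSym_cotangentChart [Smooth f] {c d : Chart f} (h : c ≤ d) :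
    Spec.map (CommRingCat.ofHom (resSym h)) ≫ cotangentChart f d = cotangentChart f c :=
  by
  let φ : c ⟶ d := homOfLE h
  exact (Chart.gluingData f).cover.trans_map (i := c) (j := d) φ

/-- A basic open subset of a chart, in a given neighbourhood. -/
lemma exists_basicOpen_le (x : W) (c d : Chart f) (hc : x ∈ c.total.1) (hd : x ∈ d.total.1) :
    ∃ (e : Chart f) (b : d.B), e ≤ c ∧ e ≤ d ∧ x ∈ e.total.1 ∧
      e.total.1 = W.basicOpen (U := d.total.1) b := by
  obtain ⟨V, hV, hxV, hVle⟩ := Opens.isBasis_iff_nbhd.mp S.isBasis_affineOpens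
    (show f x ∈ c.base.1 ⊓ d.base.1 from ⟨c.le hc, d.le hd⟩)
  obtain ⟨b, hb, hxb⟩ := d.total.2.exists_basicOpen_le (V := c.total.1 ⊓ f ⁻¹ᵁ V) ⟨x, ⟨hc, hxV⟩⟩ hd
  refine ⟨⟨⟨V, hV⟩, ⟨_, d.total.2.basicOpen b⟩, hb.trans inf_le_right⟩, b,
    ⟨hVle.trans inf_le_left, hb.trans inf_le_left⟩,
    ⟨hVle.trans inf_le_right, W.basicOpen_le _⟩, hxb, rfl⟩

end Chart

end LagrangianSpecialization

namespace LagrangianSpecialization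

open CategoryTheory Limits AlgebraicGeometry TopologicalSpace

/-! ### Independence of the conormality condition from the chart. -/

variable {W S : Scheme.{u}} {f : W ⟶ S}

lemma exists_pow_smul_eq_extendDerivation {A A' B B' : Type u} [CommRing A] [CommRing A'] [CommRing B]
    [CommRing B'] [Algebra A B] [Algebra A' B'] [Algebra A A'] [Algebra B B'] [Algebra A B']
    [IsScalarTower A B B'] [IsScalarTower A A' B'] [Algebra.FormallyUnramified A A'] 
    [Algebra.FormallyEtale B B'] [Module.FinitePresentation B Ω[B⁄A]] (b : B) [IsLocalization.Away b B']
    (E : Derivation A' B' B') :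
    ∃ (n : ℕ) (D : Derivation A B B), b ^ n • E = extendDerivation A A' B B' D := by
  have : Module.Flat B B' := IsLocalization.flat B' (.powers b)
  induction E using (extendDerivation_isBaseChange A A' B B').inductionOn with
  | zero => exact ⟨0, 0, by simp⟩
  | tmul D => exact ⟨0, D, by simp⟩
  | smul a E hE =>
    obtain ⟨n, D, hD⟩ := hE
    obtain ⟨⟨x, ⟨_, m, rfl⟩⟩, hx⟩ := IsLocalization.surj (.powers b) a
    refine ⟨m + n, x • D, ?_⟩
    rw [map_smul, ← hD, pow_add, mul_smul, smul_comm (b ^ n) a E, ← smul_assoc, Algebra.smul_def (b ^ m) a, mul_comm]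
    simp only at hx
    rw [hx, algebraMap_smul]
  | add E₁ E₂ h₁ h₂ =>
    obtain ⟨n₁, D₁, hD₁⟩ := h₁
    obtain ⟨n₂, D₂, hD₂⟩ := h₂
    refine ⟨n₁ + n₂, b ^ n₂ • D₁ + b ^ n₁ • D₂, ?_⟩
    rw [map_add, map_smul, map_smul, ← hD₁, ← hD₂, smul_add, pow_add, mul_smul, mul_smul,
      smul_comm (b ^ n₁) (b ^ n₂) E₁]

namespace Chart

lemma exists_pow_smul_eq [LocallyOfFinitePresentation f] {c d : Chart f} (h : c ≤ d) (b : d.B)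
    (hb : c.total.1 = W.basicOpen (U := d.total.1) b) (E : c.Der) :
    IsUnit (resB h b) ∧
    ∃ (n : ℕ) (D : d.Der), ∀ x, (resB h b ^ n • E) (resB h x) = resB h (D x) := by
  let : Algebra d.A c.A := (resA h).toAlgebra
  let : Algebra d.B c.B := (resB h).toAlgebra
  let : Algebra d.A c.B := ((resB h).comp (algebraMap d.A d.B)).toAlgebra
  have : IsScalarTower d.A d.B c.B := .of_algebraMap_eq fun _ ↦ rfl
  have : IsScalarTower d.A c.A c.B := .of_algebraMap_eq fun x ↦ congr($(resB_comp h) x)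
  have : Algebra.Etale d.A c.A := etale_resA h
  have : Algebra.Etale d.B c.B := etale_resB h
  have : Algebra.FinitePresentation d.A d.B :=
    f.finitePresentation_appLE d.base.2 d.total.2 d.le
  have : IsLocalization.Away b c.B := isLocalization_resB h b hb
  refine ⟨IsLocalization.Away.algebraMap_isUnit (S := c.B) b, ?_⟩
  obtain ⟨n, D, hD⟩ := exists_pow_smul_eq_extendDerivation (A := d.A) b E
  refine ⟨n, D, fun x ↦ ?_⟩
  have h1 := congr($hD (algebraMap d.B c.B x))
  rw [extendDerivation_algebraMap, Derivation.smul_apply, Algebra.smul_def, map_pow] at h1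
  exact h1

end Chart

lemma algebraMap_derivation_mem_of_mem_map {A B B' C : Type u} [CommRing A] [CommRing B] [CommRing B']
    [CommRing C] [Algebra A B'] [Algebra B' C] {φ : B →+* B'} {I : Ideal B} {Q : Ideal C}
    (hI : ∀ g ∈ I.map φ, algebraMap B' C g ∈ Q) (E : Derivation A B' B')
    (hE : ∀ x ∈ I, algebraMap B' C (E (φ x)) ∈ Q) {g : B'} (hg : g ∈ I.map φ) :
    algebraMap B' C (E g) ∈ Q := by
  change g ∈ Submodule.span B' _ at hg
  induction hg using Submodule.span_induction with
  | mem g hg =>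
    obtain ⟨x, hx, rfl⟩ := hg
    exact hE x hx
  | zero => rw [map_zero, map_zero]; exact Q.zero_mem
  | add x y hx hy ihx ihy => rw [map_add, map_add]; exact Q.add_mem ihx ihy
  | smul a x hx ihx =>
    rw [smul_eq_mul, Derivation.leibniz, map_add, smul_eq_mul, smul_eq_mul, map_mul, map_mul]
    exact Q.add_mem (Q.mul_mem_left _ ihx) (Q.mul_mem_right _ (hI x hx))

/-- The description of conormal vectors does not depend on the chart. -/
theorem cotangentChart_mem_conormalPoints_iff [Smooth f] (c : Chart f) (q : Spec (.of c.Sym))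
    {Y : Closeds W} {A : Set W} (hA : A ⊆ Y) :
    cotangentChart f c q ∈ conormalPoints f Y A ↔
      cotangentProj f (cotangentChart f c q) ∈ A ∧ ∀ D : c.Der,
        (∀ g ∈ c.ideal Y, algebraMap c.B c.Sym (D g) ∈ q.asIdeal) →
          SymmetricAlgebra.ι c.B c.Der D ∈ q.asIdeal := by
  refine ⟨fun ⟨hqA, d, q', hq', H⟩ ↦ ⟨hqA, fun D hD ↦ ?_⟩, fun ⟨h1, h2⟩ ↦ ⟨h1, c, q, rfl, h2⟩⟩
  have hxc : cotangentProj f (cotangentChart f c q) ∈ c.total.1 := by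
    rw [c.cotangentProj_cotangentChart]; exact c.toTotal_mem _
  have hxd : cotangentProj f (cotangentChart f c q) ∈ d.total.1 := by
    rw [← hq', d.cotangentProj_cotangentChart]; exact d.toTotal_mem _
  -- The charts are compared on a third one that is a basic open set in `d`. A vector field on `c`
  -- restricts to it, and a multiple of the restriction by a power of the unit `b` extends to `d`.
  obtain ⟨e, b, hec, hed, hxe, hb⟩ := Chart.exists_basicOpen_le _ c d hxc hxd
  obtain ⟨r, hr⟩ := e.exists_cotangentChart_eq hxe
  have hrc : Spec.map (CommRingCat.ofHom (Chart.resSym hec)) r = q := by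
    apply (cotangentChart f c).isOpenEmbedding.injective
    rw [← hr, ← Chart.resSym_cotangentChart hec]
    rfl
  have hrd : Spec.map (CommRingCat.ofHom (Chart.resSym hed)) r = q' := by
    apply (cotangentChart f d).isOpenEmbedding.injective
    rw [hq', ← hr, ← Chart.resSym_cotangentChart hed]
    rfl
  have hc (x) : x ∈ q.asIdeal ↔ Chart.resSym hec x ∈ r.asIdeal := by rw [← hrc]; rfl
  have hd (x) : x ∈ q'.asIdeal ↔ Chart.resSym hed x ∈ r.asIdeal := by rw [← hrd]; rfl
  have hY (g) (hg : g ∈ e.ideal Y) : algebraMap e.B e.Sym g ∈ r.asIdeal := by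
    have h1 := hA hqA
    rw [← hr, e.cotangentProj_cotangentChart] at h1
    exact (e.toTotal_mem_iff Y _).mp h1 hg
  obtain ⟨E, hE⟩ := Chart.exists_der_extend hec D
  rw [hc, Chart.resSym_ι hec D E hE]
  have hEY (g) (hg : g ∈ e.ideal Y) : algebraMap e.B e.Sym (E g) ∈ r.asIdeal :=
    algebraMap_derivation_mem_of_mem_map (fun g hg ↦ hY g (Chart.map_ideal hec Y ▸ hg)) E
      (fun x hx ↦ by rw [hE, ← Chart.resSym_algebraMap hec, ← hc]; exact hD x hx)
      ((Chart.map_ideal hec Y).symm ▸ hg)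
  obtain ⟨hbu, n, D', hD'⟩ := Chart.exists_pow_smul_eq hed b hb E
  have h1 : SymmetricAlgebra.ι d.B d.Der D' ∈ q'.asIdeal := by
    refine H D' fun g hg ↦ ?_
    rw [hd, Chart.resSym_algebraMap, ← hD', Derivation.smul_apply, smul_eq_mul, map_mul]
    refine r.asIdeal.mul_mem_left _ (hEY _ ?_)
    rw [← Chart.map_ideal hed]
    exact Ideal.mem_map_of_mem _ hg
  rw [hd, Chart.resSym_ι hed D' _ hD', map_smul, Algebra.smul_def] at h1
  exact (Ideal.unit_mul_mem_iff_mem _ ((hbu.pow n).map (algebraMap e.B e.Sym))).mp h1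

end LagrangianSpecialization

namespace LagrangianSpecialization

open CategoryTheory Limits AlgebraicGeometry TopologicalSpace

/-! ### Smooth points of closed subsets in terms of local rings. -/

variable {W T : Scheme.{u}}

lemma smoothPoints_subset (Y : Closeds W) (g : W ⟶ T) : smoothPoints Y g ⊆ Y := by
  rintro _ ⟨y, rfl, -⟩
  have := (Scheme.IdealSheafData.range_subschemeι (Scheme.IdealSheafData.vanishingIdeal Y)).subset
    ⟨y, rfl⟩
  simpa using this

lemma exists_subschemeι_eq {Y : Closeds W} {x : W} (hx : x ∈ Y) :
    ∃ y, (Scheme.IdealSheafData.vanishingIdeal Y).subschemeι y = x := by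
  have h1 : x ∈ ((Scheme.IdealSheafData.vanishingIdeal Y).support : Set W) := by simpa using hx
  rw [← Scheme.IdealSheafData.range_subschemeι] at h1
  exact h1

lemma mem_smoothPoints_of_specializes {Y : Closeds W} {g : W ⟶ T} {x x' : W} (h : x' ⤳ x)
    (hx : x ∈ smoothPoints Y g) (hx' : x' ∈ Y) : x' ∈ smoothPoints Y g := by
  obtain ⟨y, rfl, U, hyU, hU⟩ := hx
  obtain ⟨y', rfl⟩ := exists_subschemeι_eq hx'
  refine ⟨y', rfl, U, ?_, hU⟩
  rw [(Scheme.Hom.isEmbedding _).isInducing.specializes_iff] at h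
  exact h.mem_open U.2 hyU

lemma smoothPoints_comp {V : Scheme.{u}} (Y : Closeds W) (g : W ⟶ T) (h : T ⟶ V) [Smooth h] :
    smoothPoints Y g ⊆ smoothPoints Y (g ≫ h) := by
  rintro _ ⟨y, rfl, U, hyU, hU⟩
  refine ⟨y, rfl, U, hyU, ?_⟩
  have : U.ι ≫ (Scheme.IdealSheafData.vanishingIdeal Y).subschemeι ≫ g ≫ h =
    (U.ι ≫ (Scheme.IdealSheafData.vanishingIdeal Y).subschemeι ≫ g) ≫ h := by simp
  rw [this]
  infer_instance

lemma relSmoothLocus_eq {S K : Scheme.{u}} (p : S ⟶ K) (f : W ⟶ S) (X : Closeds W) [Smooth p] :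
    relSmoothLocus p f X = smoothPoints X f :=
  Set.inter_eq_right.mpr (smoothPoints_comp X f p)

lemma mem_smoothLocus_iff_exists {g : W ⟶ T} [LocallyOfFinitePresentation g] (x : W) :
    x ∈ g.smoothLocus ↔ ∃ U : W.Opens, x ∈ U ∧ Smooth (U.ι ≫ g) := by
  constructor
  · intro h
    refine ⟨_, h, ?_⟩
    rw [← Scheme.Hom.smoothLocus_eq_top_iff, ← Scheme.Hom.preimage_smoothLocus_eq]
    simp
  · rintro ⟨U, hxU, hU⟩
    have h1 := U.ι.preimage_smoothLocus_eq g
    rw [(U.ι ≫ g).smoothLocus_eq_top] at h1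
    exact h1.ge (x := ⟨x, hxU⟩) trivial

lemma mem_smoothPoints_iff [IsLocallyNoetherian W] [IsLocallyNoetherian T] (Y : Closeds W) (g : W ⟶ T)
    [LocallyOfFiniteType g] (V : T.affineOpens) (U : W.affineOpens) (h : U.1 ≤ g ⁻¹ᵁ V.1)
    (P : PrimeSpectrum Γ(W, U.1)) :
    letI := (g.appLE V.1 U.1 h).hom.toAlgebra
    U.2.fromSpec P ∈ smoothPoints Y g ↔ U.2.fromSpec P ∈ Y ∧
      Algebra.FormallySmooth Γ(T, V.1) (Localization.AtPrime P.asIdeal ⧸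
        ((Scheme.IdealSheafData.vanishingIdeal Y).ideal U).map
          (algebraMap _ (Localization.AtPrime P.asIdeal))) := by
  let I := Scheme.IdealSheafData.vanishingIdeal Y
  let : Algebra Γ(T, V.1) Γ(W, U.1) := (g.appLE V.1 U.1 h).hom.toAlgebra
  by_cases hY : U.2.fromSpec P ∈ Y
  swap
  · exact ⟨fun h ↦ (hY (smoothPoints_subset Y g h)).elim, fun h ↦ (hY h.1).elim⟩
  obtain ⟨y, hy⟩ := exists_subschemeι_eq hY
  have hU' : IsAffineOpen (I.subschemeι ⁻¹ᵁ U.1) := U.2.preimage I.subschemeι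
  have hyU : y ∈ I.subschemeι ⁻¹ᵁ U.1 := by
    change I.subschemeι y ∈ U.1
    rw [hy]
    exact U.2.range_fromSpec.subset ⟨P, rfl⟩
  have hle : I.subschemeι ⁻¹ᵁ U.1 ≤ (I.subschemeι ≫ g) ⁻¹ᵁ V.1 := fun z hz ↦ h hz
  let : Algebra Γ(T, V.1) Γ(I.subscheme, I.subschemeι ⁻¹ᵁ U.1) :=
    ((I.subschemeι ≫ g).appLE V.1 _ hle).hom.toAlgebra
  let : Algebra Γ(W, U.1) Γ(I.subscheme, I.subschemeι ⁻¹ᵁ U.1) := (I.subschemeι.app U.1).hom.toAlgebra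
  have htower : IsScalarTower Γ(T, V.1) Γ(W, U.1) Γ(I.subscheme, I.subschemeι ⁻¹ᵁ U.1) := by
    refine .of_algebraMap_eq fun a ↦ ?_
    have : (I.subschemeι ≫ g).appLE V.1 _ hle = g.appLE V.1 U.1 h ≫ I.subschemeι.app U.1 := by
      rw [Scheme.Hom.app_eq_appLE, Scheme.Hom.appLE_comp_appLE]
    exact congr($(this).hom a)
  let q := hU'.primeIdealOf ⟨y, hyU⟩
  have hq : P.asIdeal = q.asIdeal.comap
      (algebraMap Γ(W, U.1) Γ(I.subscheme, I.subschemeι ⁻¹ᵁ U.1)) := by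
    have h1 := IsAffineOpen.comap_primeIdealOf_appLE (f := I.subschemeι) U.1 U.2 _ hU' le_rfl hyU
    have h2 : U.2.primeIdealOf ⟨I.subschemeι y, hyU⟩ = P := by
      have : IsOpenImmersion U.2.fromSpec := U.2.isOpenImmersion_fromSpec
      apply U.2.fromSpec.isOpenEmbedding.injective
      exact (IsAffineOpen.fromSpec_primeIdealOf U.2 ⟨I.subschemeι y, hyU⟩).trans hy
    rw [h2, ← Scheme.Hom.app_eq_appLE] at h1
    exact congr($(h1).asIdeal).symm
  have hker : RingHom.ker (algebraMap Γ(W, U.1) Γ(I.subscheme, I.subschemeι ⁻¹ᵁ U.1)) =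
    I.ideal U := I.ker_subschemeι_app U
  have h1 := isSmoothAt_iff_formallySmooth_quotient (A := Γ(T, V.1)) (B := Γ(W, U.1))
    (C := Γ(I.subscheme, I.subschemeι ⁻¹ᵁ U.1)) (I.subschemeι_app_surjective U) q.asIdeal P.asIdeal hq
  rw [hker] at h1
  have h2 : y ∈ (I.subschemeι ≫ g).smoothLocus ↔ Algebra.IsSmoothAt Γ(T, V.1) q.asIdeal :=
    Scheme.Hom.mem_smoothLocus.trans (formallySmooth_stalkMap_iff V.1 V.2 _ hU' hle hyU)
  rw [← h1, ← h2, mem_smoothLocus_iff_exists]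
  refine ⟨fun ⟨y', hy', H⟩ ↦ ⟨hY, ?_⟩, fun ⟨_, H⟩ ↦ ⟨y, hy, H⟩⟩
  obtain rfl : y' = y := (Scheme.Hom.isEmbedding _).injective (hy'.trans hy.symm)
  exact H

end LagrangianSpecialization

namespace LagrangianSpecialization

open CategoryTheory Limits AlgebraicGeometry TopologicalSpace

/-! ### Charts of the base curve. -/

section Base

variable {k : Type u} [Field k] {S : Scheme.{u}}

/-- The constant functions on an open subset of a scheme over a field. -/
noncomputable def constantsHom (p : S ⟶ Spec (.of k)) (V : S.Opens) : k →+* Γ(S, V) :=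
  ((Scheme.ΓSpecIso (.of k)).inv ≫ p.appLE ⊤ V (show V ≤ p ⁻¹ᵁ ⊤ from le_top)).hom

lemma map_constantsHom (p : S ⟶ Spec (.of k)) {V V' : S.Opens} (h : V' ≤ V) (a : k) :
    S.presheaf.map (homOfLE h).op (constantsHom p V a) = constantsHom p V' a := by
  have : constantsHom p V' =
      ((Scheme.ΓSpecIso (.of k)).inv ≫ p.appLE ⊤ V (show V ≤ p ⁻¹ᵁ ⊤ from le_top) ≫ S.presheaf.map (homOfLE h).op).hom := by
    rw [Scheme.Hom.appLE_map]; rfl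
  rw [this]; rfl

lemma appLE_constantsHom {W : Scheme.{u}} (f : W ⟶ S) (p : S ⟶ Spec (.of k)) {V : S.Opens}
    {U : W.Opens} (h : U ≤ f ⁻¹ᵁ V) (a : k) :
    f.appLE V U h (constantsHom p V a) = constantsHom (f ≫ p) U a := by
  have : constantsHom (f ≫ p) U =
      ((Scheme.ΓSpecIso (.of k)).inv ≫ p.appLE ⊤ V (show V ≤ p ⁻¹ᵁ ⊤ from le_top) ≫ f.appLE V U h).hom := by
    rw [Scheme.Hom.appLE_comp_appLE]; rfl
  rw [this]; rfl

lemma opens_Spec_field_eq_top (U : (Spec (CommRingCat.of k)).Opens) {x} (hx : x ∈ U) : U = ⊤ := by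
  rw [eq_top_iff]
  intro y _
  have : y = x := Subsingleton.elim (α := PrimeSpectrum k) y x
  rwa [this]

theorem exists_standardSmooth_constantsHom (p : S ⟶ Spec (.of k)) (n : ℕ)
    [SmoothOfRelativeDimension n p] (s : S) :
    ∃ V : S.affineOpens, s ∈ V.1 ∧
      (constantsHom p V.1).IsStandardSmoothOfRelativeDimension n := by
  obtain ⟨U, hU, V, hV, hs, e, H⟩ :=
    SmoothOfRelativeDimension.exists_isStandardSmoothOfRelativeDimension (n := n) (f := p) s
  obtain rfl := opens_Spec_field_eq_top U (e hs)
  exact ⟨⟨V, hV⟩, hs, (RingHom.isStandardSmoothOfRelativeDimension_respectsIso.2 _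
    (Scheme.ΓSpecIso (.of k)).symm.commRingCatIsoToRingEquiv H)⟩

lemma primeIdealOf_basicOpen {V : S.affineOpens} (b : Γ(S, V.1)) (s : S) (hs : s ∈ V.1)
    (hb : s ∈ S.basicOpen b) :
    (V.2.primeIdealOf ⟨s, hs⟩).asIdeal.map
      (S.presheaf.map (homOfLE (S.basicOpen_le b)).op).hom =
      ((V.2.basicOpen b).primeIdealOf ⟨s, hb⟩).asIdeal := by
  let := (S.presheaf.map (homOfLE (S.basicOpen_le b)).op).hom.toAlgebra
  have : IsLocalization.Away b Γ(S, S.basicOpen b) := V.2.isLocalization_basicOpen b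
  rw [← IsLocalization.map_under (.powers b) Γ(S, S.basicOpen b)
    ((V.2.basicOpen b).primeIdealOf ⟨s, hb⟩).asIdeal]
  have h1 := IsAffineOpen.comap_primeIdealOf_appLE (f := 𝟙 S) V.1 V.2 _ (V.2.basicOpen b)
    (S.basicOpen_le b) hb
  have h2 : (𝟙 S : S ⟶ S).appLE V.1 (S.basicOpen b) (S.basicOpen_le b) =
    S.presheaf.map (homOfLE (S.basicOpen_le b)).op := Category.id_comp _
  rw [h2] at h1
  exact congrArg (Ideal.map _) congr($(h1).asIdeal).symm

theorem exists_base_chart [IsAlgClosed k] [IsIntegral S] (p : S ⟶ Spec (.of k))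
    [SmoothOfRelativeDimension 1 p] (s : S) (hs : IsClosed {s}) :
    ∃ (V : S.affineOpens) (hV : s ∈ V.1) (t : Γ(S, V.1)),
      (V.2.primeIdealOf ⟨s, hV⟩).asIdeal = Ideal.span {t} ∧
      letI := (constantsHom p V.1).toAlgebra
      Submodule.span Γ(S, V.1) {KaehlerDifferential.D k Γ(S, V.1) t} = ⊤ ∧
      ∃ δ : Derivation k Γ(S, V.1) Γ(S, V.1), δ t = 1 := by
  obtain ⟨V, hV, H⟩ := exists_standardSmooth_constantsHom p 1 s
  let := (constantsHom p V.1).toAlgebra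
  have : Nonempty V.1 := ⟨⟨s, hV⟩⟩
  have hst : Algebra.IsStandardSmoothOfRelativeDimension 1 k Γ(S, V.1) := H
  have := hst.isStandardSmooth
  have hrank := Algebra.IsStandardSmoothOfRelativeDimension.rank_kaehlerDifferential
    (R := k) (S := Γ(S, V.1)) 1
  have hfin : Module.finrank Γ(S, V.1) Ω[Γ(S, V.1)⁄k] = 1 := by
    rw [Module.finrank, hrank]; simp
  let ω := Module.basisUnique Unit hfin
  have hmax := V.2.primeIdealOf_isMaximal_of_isClosed ⟨s, hV⟩ hs
  obtain ⟨t, -, b, hb, H⟩ := exists_uniformizer (k := k) ω (V.2.primeIdealOf ⟨s, hV⟩).asIdeal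
  have hsb : s ∈ S.basicOpen b := by
    have h1 : V.2.primeIdealOf ⟨s, hV⟩ ∈ V.2.fromSpec ⁻¹ᵁ S.basicOpen b := by
      rw [V.2.fromSpec_preimage_basicOpen]
      exact hb
    have h2 := V.2.fromSpec_primeIdealOf ⟨s, hV⟩
    exact Set.mem_of_eq_of_mem h2.symm h1
  let : Algebra k Γ(S, S.basicOpen b) := (constantsHom p (S.basicOpen b)).toAlgebra
  let : Algebra Γ(S, V.1) Γ(S, S.basicOpen b) :=
    (S.presheaf.map (homOfLE (S.basicOpen_le b)).op).hom.toAlgebra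
  have : IsScalarTower k Γ(S, V.1) Γ(S, S.basicOpen b) :=
    .of_algebraMap_eq fun a ↦ (map_constantsHom p (S.basicOpen_le b) a).symm
  obtain ⟨h1, h2, h3⟩ := H Γ(S, S.basicOpen b) (V.2.isLocalization_basicOpen b)
  exact ⟨⟨_, V.2.basicOpen b⟩, hsb, _, (primeIdealOf_basicOpen b s hV hsb).symm.trans h1, h2, h3⟩

end Base

end LagrangianSpecialization

namespace LagrangianSpecialization

open CategoryTheory Limits AlgebraicGeometry TopologicalSpace

/-! ### Existence of adapted charts. -/

variable {W S : Scheme.{u}} {f : W ⟶ S}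

lemma formallySmooth_of_bijective {k R M : Type u} [CommRing k] [CommRing R] [CommRing M]
    [Algebra k R] [Algebra R M] [Algebra k M] [IsScalarTower k R M]
    (h : Function.Bijective (algebraMap k R)) [Algebra.FormallySmooth R M] :
    Algebra.FormallySmooth k M := by
  have : Algebra.FormallySmooth k R :=
    .of_equiv (AlgEquiv.ofBijective (Algebra.ofId k R) h)
  exact .comp k R M

lemma formallySmooth_of_mem_smoothPoints {k : Type u} [Field k] [IsLocallyNoetherian W]
    (Y : Closeds W) (g : W ⟶ Spec (.of k)) [LocallyOfFiniteType g] (U : W.affineOpens)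
    (P : PrimeSpectrum Γ(W, U.1)) (h : U.2.fromSpec P ∈ smoothPoints Y g) :
    letI := (constantsHom g U.1).toAlgebra
    Algebra.FormallySmooth k (Localization.AtPrime P.asIdeal ⧸
        ((Scheme.IdealSheafData.vanishingIdeal Y).ideal U).map
          (algebraMap _ (Localization.AtPrime P.asIdeal))) := by
  have h1 := ((mem_smoothPoints_iff Y g ⟨⊤, isAffineOpen_top _⟩ U
    (show U.1 ≤ g ⁻¹ᵁ ⊤ from le_top) P).mp h).2
  let : Algebra Γ(Spec (.of k), ⊤) Γ(W, U.1) :=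
    (g.appLE ⊤ U.1 (show U.1 ≤ g ⁻¹ᵁ ⊤ from le_top)).hom.toAlgebra
  let : Algebra k Γ(W, U.1) := (constantsHom g U.1).toAlgebra
  let : Algebra k Γ(Spec (.of k), ⊤) := (Scheme.ΓSpecIso (.of k)).inv.hom.toAlgebra
  have : IsScalarTower k Γ(Spec (.of k), ⊤) Γ(W, U.1) := .of_algebraMap_eq fun _ ↦ rfl
  have : IsScalarTower k Γ(Spec (.of k), ⊤) (Localization.AtPrime P.asIdeal) :=
    .of_algebraMap_eq fun _ ↦ rfl
  exact formallySmooth_of_bijective (R := Γ(Spec (.of k), ⊤))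
    (Scheme.ΓSpecIso (.of k)).symm.commRingCatIsoToRingEquiv.bijective

namespace Chart

lemma eq_iff_comap_eq (c : Chart f) {s : S} (hs : s ∈ c.base.1) (P : Spec (.of c.B)) :
    f (c.toTotal P) = s ↔
      P.asIdeal.comap (algebraMap c.A c.B) = (c.base.2.primeIdealOf ⟨s, hs⟩).asIdeal := by
  have h1 : c.toTotal ≫ f = Spec.map (CommRingCat.ofHom (algebraMap c.A c.B)) ≫ c.base.2.fromSpec :=
    (IsAffineOpen.SpecMap_appLE_fromSpec f c.base.2 c.total.2 c.le).symm
  have h2 : f (c.toTotal P) =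
      c.base.2.fromSpec (Spec.map (CommRingCat.ofHom (algebraMap c.A c.B)) P) := congr($h1 P)
  have h3 := c.base.2.fromSpec_primeIdealOf ⟨s, hs⟩
  have : IsOpenImmersion c.base.2.fromSpec := c.base.2.isOpenImmersion_fromSpec
  constructor
  · intro h
    have := c.base.2.fromSpec.isOpenEmbedding.injective ((h2.symm.trans h).trans h3.symm)
    exact congr($(this).asIdeal)
  · intro h
    rw [h2]
    refine Eq.trans (congrArg _ (PrimeSpectrum.ext h)) h3

/-- A minimal prime of the ideal of X in a chart is the generic point of a component of X: a larger
irreducible subset would have its generic point in the chart, at a smaller prime containing the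
ideal. -/
lemma height_eq_one (c : Chart f) {X : Closeds W} (hX : IsReducedDivisor X) {x : Ideal c.B}
    (hx : x ∈ (c.ideal X).minimalPrimes) : x.height = 1 := by
  have hxp : x.IsPrime := hx.1.1
  let P : Spec (.of c.B) := ⟨x, hxp⟩
  have h1 : ringKrullDim (W.presheaf.stalk (c.toTotal P)) = 1 := by
    refine hX _ ⟨⟨?_, ?_⟩, ?_⟩
    · exact isIrreducible_singleton.closure
    · exact closure_minimal (Set.singleton_subset_iff.mpr ((c.toTotal_mem_iff X P).mpr hx.1.2))
        X.isClosed
    · rintro B ⟨hB, hBX⟩ hle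
      have hg : closure {hB.genericPoint} = (B : Set W) := hB.closure_genericPoint B.isClosed
      have h2 : hB.genericPoint ⤳ c.toTotal P := by
        rw [specializes_iff_mem_closure, hg]
        exact hle (subset_closure rfl)
      obtain ⟨Q, hQ⟩ := c.exists_toTotal_eq (h2.mem_open c.total.1.2 (c.toTotal_mem P))
      rw [← hQ] at h2 hg
      have h3 : Q.asIdeal ≤ x := c.toTotal_specializes_iff.mp h2
      have h4 : c.ideal X ≤ Q.asIdeal :=
        (c.toTotal_mem_iff X Q).mp (hBX (hg.subset (subset_closure rfl)))
      have h5 : Q = P := PrimeSpectrum.ext (le_antisymm h3 (hx.2 ⟨Q.isPrime, h4⟩ h3))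
      rw [h5] at hg
      exact hg.ge
  have h6 : c.toTotal P ∈ c.total.1 := c.toTotal_mem P
  let := W.presheaf.algebra_section_stalk ⟨c.toTotal P, h6⟩
  have h7 := c.total.2.isLocalization_stalk ⟨c.toTotal P, h6⟩
  have h8 : c.total.2.primeIdealOf ⟨c.toTotal P, h6⟩ = P := by
    apply c.toTotal.isOpenEmbedding.injective
    exact c.total.2.fromSpec_primeIdealOf ⟨c.toTotal P, h6⟩
  have h9 := IsLocalization.AtPrime.ringKrullDim_eq_height
    (c.total.2.primeIdealOf ⟨c.toTotal P, h6⟩).asIdeal (W.presheaf.stalk (c.toTotal P))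
  rw [h1] at h9
  have h10 : ((c.total.2.primeIdealOf ⟨c.toTotal P, h6⟩).asIdeal.height : WithBot ℕ∞) = x.height :=
    congrArg (fun I : Ideal c.B ↦ (I.height : WithBot ℕ∞)) congr($(h8).asIdeal)
  exact (WithBot.coe_injective (h9.trans h10)).symm

lemma flat_quotient (c : Chart f) (X : Closeds W)
    [Flat ((Scheme.IdealSheafData.vanishingIdeal X).subschemeι ≫ f)] :
    Module.Flat c.A (c.B ⧸ c.ideal X) := by
  let I := Scheme.IdealSheafData.vanishingIdeal X
  have hU' : IsAffineOpen (I.subschemeι ⁻¹ᵁ c.total.1) := c.total.2.preimage I.subschemeι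
  have hle : I.subschemeι ⁻¹ᵁ c.total.1 ≤ (I.subschemeι ≫ f) ⁻¹ᵁ c.base.1 := fun z hz ↦ c.le hz
  have h1 : ((I.subschemeι ≫ f).appLE c.base.1 _ hle).hom.Flat :=
    (I.subschemeι ≫ f).flat_appLE c.base.2 hU' hle
  let : Algebra c.A Γ(I.subscheme, I.subschemeι ⁻¹ᵁ c.total.1) :=
    ((I.subschemeι ≫ f).appLE c.base.1 _ hle).hom.toAlgebra
  let : Algebra c.B Γ(I.subscheme, I.subschemeι ⁻¹ᵁ c.total.1) :=
    (I.subschemeι.app c.total.1).hom.toAlgebra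
  have htower : IsScalarTower c.A c.B Γ(I.subscheme, I.subschemeι ⁻¹ᵁ c.total.1) := by
    refine .of_algebraMap_eq fun a ↦ ?_
    have : (I.subschemeι ≫ f).appLE c.base.1 _ hle =
        f.appLE c.base.1 c.total.1 c.le ≫ I.subschemeι.app c.total.1 := by
      rw [Scheme.Hom.app_eq_appLE, Scheme.Hom.appLE_comp_appLE]
    exact congr($(this).hom a)
  have : Module.Flat c.A Γ(I.subscheme, I.subschemeι ⁻¹ᵁ c.total.1) := h1
  have hker : RingHom.ker (algebraMap c.B Γ(I.subscheme, I.subschemeι ⁻¹ᵁ c.total.1)) =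
    c.ideal X := I.ker_subschemeι_app c.total
  have e := (Ideal.quotientKerAlgEquivOfSurjective
    (f := IsScalarTower.toAlgHom c.A c.B Γ(I.subscheme, I.subschemeι ⁻¹ᵁ c.total.1))
    (I.subschemeι_app_surjective c.total))
  rw [← hker]
  exact .of_linearEquiv e.toLinearEquiv

end Chart

/-- A chart of a smooth morphism `f` to a curve with coordinates adapted to a reduced divisor `X`
and a closed subset `Y` of the fiber over `s`: the coordinate `none` is a parameter of the base at
`s`, and `Y` is irreducible and given by the vanishing of the coordinates `none` and `inl i`. -/
structure AdaptedChart (k : Type u) [Field k] (f : W ⟶ S) (s : S) (X Y : Closeds W)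
    extends Chart f where
  mem_base : s ∈ base.1
  [algebraA : Algebra k toChart.A]
  [algebraB : Algebra k toChart.B]
  [isScalarTower : IsScalarTower k toChart.A toChart.B]
  [isDomainA : IsDomain toChart.A]
  [isDomainB : IsDomain toChart.B]
  /-- The parameter of the base. -/
  t : toChart.A
  primeIdealOf_eq : (base.2.primeIdealOf ⟨s, mem_base⟩).asIdeal = Ideal.span {t}
  span_eq_top : Submodule.span toChart.A {KaehlerDifferential.D k toChart.A t} = ⊤
  /-- The codimension of `Y` in the fiber. -/
  codim : ℕ
  /-- The dimension of `Y`. -/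
  dim : ℕ
  [algebraPoly : Algebra (MvPolynomial (Option (Fin codim ⊕ Fin dim)) k) toChart.B]
  [isScalarTowerPoly : IsScalarTower k (MvPolynomial (Option (Fin codim ⊕ Fin dim)) k) toChart.B]
  [etale : Algebra.Etale (MvPolynomial (Option (Fin codim ⊕ Fin dim)) k) toChart.B]
  algebraMap_t : algebraMap toChart.A toChart.B t =
    coord k toChart.B (none : Option (Fin codim ⊕ Fin dim))
  ideal_eq_map : toChart.ideal Y = (RingHom.ker (killHom k (Fin codim) (Fin dim))).map
    (algebraMap (MvPolynomial (Option (Fin codim ⊕ Fin dim)) k) toChart.B)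
  [isPrime : (toChart.ideal Y).IsPrime]
  /-- The equation of `X`. -/
  F : toChart.B
  F_ne_zero : F ≠ 0
  ideal_eq_span : toChart.ideal X = Ideal.span {F}

namespace AdaptedChart

attribute [instance] algebraA algebraB isScalarTower isDomainA isDomainB algebraPoly
  isScalarTowerPoly etale isPrime

-- The parameter t vanishes on Y because Y lies over `s`, and dt is nonzero on W because `f` is
-- smooth; so t can be the first adapted coordinate. The coordinates are étale, Y is irreducible and
-- X is principal on a common basic open set, which becomes the chart.
set_option maxHeartbeats 1000000 in
theorem exists_mem {k : Type u} [Field k] [IsAlgClosed k] [IsIntegral S] [IsIntegral W]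
    (p : S ⟶ Spec (.of k)) [SmoothOfRelativeDimension 1 p] (f : W ⟶ S) [Smooth f]
    {s : S} (hs : IsClosed {s}) {X Y : Closeds W} (hX : IsReducedDivisor X)
    (hY : (Y : Set W) ⊆ f ⁻¹' {s}) {x : W} (hx : x ∈ smoothPoints Y (f ≫ p)) :
    ∃ c : AdaptedChart k f s X Y, x ∈ c.total.1 := by
  have : Smooth p := SmoothOfRelativeDimension.smooth 1 p
  have hWn : IsLocallyNoetherian W := LocallyOfFiniteType.isLocallyNoetherian (f ≫ p)
  have hxY := smoothPoints_subset _ _ hx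
  have hfx : f x = s := hY hxY
  obtain ⟨V, hV, t, ht, htD, δ, hδ⟩ := exists_base_chart p s hs
  obtain ⟨U, hU, hxU, hUle⟩ := Opens.isBasis_iff_nbhd.mp W.isBasis_affineOpens
    (show x ∈ f ⁻¹ᵁ V.1 by rw [Scheme.Hom.mem_preimage, hfx]; exact hV)
  let c : Chart f := ⟨V, ⟨U, hU⟩, hUle⟩
  let algA : Algebra k c.A := (constantsHom p V.1).toAlgebra
  let algB : Algebra k c.B := (constantsHom (f ≫ p) U).toAlgebra
  have htower : IsScalarTower k c.A c.B :=
    .of_algebraMap_eq fun a ↦ (appLE_constantsHom f p hUle a).symm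
  have : Nonempty V.1 := ⟨⟨s, hV⟩⟩
  have : Nonempty U := ⟨⟨x, hxU⟩⟩
  have hdA : IsDomain c.A := inferInstanceAs (IsDomain Γ(S, V.1))
  have hdB : IsDomain c.B := inferInstanceAs (IsDomain Γ(W, U))
  obtain ⟨P, rfl⟩ := c.exists_toTotal_eq hxU
  have hsm := formallySmooth_of_mem_smoothPoints Y (f ≫ p) ⟨U, hU⟩ P hx
  have : Algebra.Smooth c.A c.B := f.smooth_appLE V.2 hU hUle
  have hkB : Algebra.Smooth k c.B := RingHom.Smooth.respectsIso.2 _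
    (Scheme.ΓSpecIso (.of k)).symm.commRingCatIsoToRingEquiv
    ((f ≫ p).smooth_appLE (isAffineOpen_top _) hU (show U ≤ (f ≫ p) ⁻¹ᵁ ⊤ from le_top))
  have : P.asIdeal.IsPrime := P.2
  have htmem (Q : Spec (.of c.B)) (hQ : c.toTotal Q ∈ Y) : algebraMap c.A c.B t ∈ Q.asIdeal := by
    have h1 := (c.eq_iff_comap_eq hV Q).mp (hY hQ)
    have h2 : t ∈ Q.asIdeal.comap (algebraMap c.A c.B) := by
      rw [h1]; exact ht.ge (Ideal.mem_span_singleton_self t)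
    exact h2
  have htY : algebraMap c.A c.B t ∈ c.ideal Y := by
    rw [Chart.ideal_eq, PrimeSpectrum.mem_vanishingIdeal]
    exact htmem
  have : Algebra.FormallySmooth c.A (Localization.AtPrime P.asIdeal) := .comp c.A c.B _
  have htD' : residueD k (Localization.AtPrime P.asIdeal)
      (algebraMap c.B (Localization.AtPrime P.asIdeal) (algebraMap c.A c.B t)) ≠ 0 := by
    exact residueD_algebraMap_ne_zero (k := k) (A := c.A) (R := Localization.AtPrime P.asIdeal) δ hδ
  obtain ⟨d, e, y, F, b, hy, hb, H⟩ := exists_adapted_coordinates (k := k) P.asIdeal (c.ideal Y) (c.ideal X)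
    ((c.toTotal_mem_iff Y P).mp hxY) _ htY htD' hsm (c.isRadical_ideal X) fun _ ↦ c.height_eq_one hX
  let c' : Chart f := ⟨V, ⟨W.basicOpen b, hU.basicOpen b⟩, (W.basicOpen_le b).trans hUle⟩
  have hle : c' ≤ c := ⟨le_rfl, W.basicOpen_le b⟩
  let algA' : Algebra k c'.A := algA
  let algB' : Algebra k c'.B := (constantsHom (f ≫ p) (W.basicOpen b)).toAlgebra
  let algBB' : Algebra c.B c'.B := (Chart.resB hle).toAlgebra
  have htower' : IsScalarTower k c.B c'.B :=
    .of_algebraMap_eq fun a ↦ (map_constantsHom (f ≫ p) (W.basicOpen_le b) a).symm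
  have hloc : IsLocalization.Away b c'.B := Chart.isLocalization_resB hle b rfl
  let algP : Algebra (MvPolynomial (Option (Fin d ⊕ Fin e)) k) c'.B :=
    (MvPolynomial.aeval (fun i ↦ algebraMap c.B c'.B (y i))).toAlgebra
  have towP : IsScalarTower k (MvPolynomial (Option (Fin d ⊕ Fin e)) k) c'.B :=
    .of_algebraMap_eq fun a ↦ (AlgHom.commutes _ a).symm
  obtain ⟨h1, h2, h3, h4⟩ := H c'.B hloc
  have hcoord (i) : coord k c'.B i = algebraMap c.B c'.B (y i) := MvPolynomial.aeval_X _ _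
  have hYm := Chart.map_ideal hle Y
  have hxb : c.toTotal P ∈ W.basicOpen b := by
    have h5 : hU.fromSpec ⁻¹ᵁ W.basicOpen b = PrimeSpectrum.basicOpen b :=
      hU.fromSpec_preimage_basicOpen b
    exact h5.ge (x := P) hb
  have : Nonempty (W.basicOpen b) := ⟨⟨_, hxb⟩⟩
  have hdB' : IsDomain c'.B := inferInstanceAs (IsDomain Γ(W, W.basicOpen b))
  refine ⟨{ toChart := c'
            mem_base := hV
            algebraA := algA'
            algebraB := algB'
            isScalarTower := .of_algebraMap_eq fun a ↦ (appLE_constantsHom f p _ a).symm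
            isDomainA := hdA
            isDomainB := hdB'
            t := t
            primeIdealOf_eq := ht
            span_eq_top := htD
            codim := d
            dim := e
            algebraPoly := algP
            isScalarTowerPoly := towP
            etale := h1
            algebraMap_t := ?_
            ideal_eq_map := ?_
            isPrime := hYm ▸ h3
            F := algebraMap c.B c'.B F
            F_ne_zero := ?_
            ideal_eq_span := (Chart.map_ideal hle X).symm.trans h4 }, hxb⟩
  · rw [hcoord, hy]
    exact congr($(Scheme.Hom.appLE_map f hUle (homOfLE (W.basicOpen_le b)).op).hom t).symm
  · rw [map_ker_killHom]
    simp only [hcoord]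
    exact hYm.symm.trans h2
  -- If the equation were zero, the zero ideal would be a minimal prime of the ideal of X, but its
  -- height is not one.
  · intro h0
    have h5 : c'.ideal X = ⊥ := by
      rw [← Chart.map_ideal hle X]
      exact h4.trans (by rw [h0, Ideal.span_singleton_eq_bot])
    have h6 : (⊥ : Ideal c'.B) ∈ (c'.ideal X).minimalPrimes := by
      rw [h5]; exact ⟨⟨Ideal.isPrime_bot, le_rfl⟩, fun _ _ _ ↦ bot_le⟩
    have h7 := c'.height_eq_one hX h6
    simp at h7

end AdaptedChart

end LagrangianSpecialization

namespace LagrangianSpecialization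

/-! ### Conormal vectors in coordinates. -/

section

open MvPolynomial

variable {k A B : Type u} [Field k] [CommRing A] [CommRing B] [Algebra k A] [Algebra k B]
  [Algebra A B] [IsScalarTower k A B] {n : Type} [Fintype n] [DecidableEq n]
  [Algebra (MvPolynomial (Option n) k) B] [IsScalarTower k (MvPolynomial (Option n) k) B]
  [Algebra.Etale (MvPolynomial (Option n) k) B]

lemma derivation_sum_apply {α A B : Type*} [CommRing A] [CommRing B] [Algebra A B] (s : Finset α)
    (D : α → Derivation A B B) (b : B) : (∑ i ∈ s, D i) b = ∑ i ∈ s, D i b :=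
  (congrFun (map_sum (Derivation.coeFnAddMonoidHom (R := A) (A := B) (M := B)) D s) b).trans
    (Finset.sum_apply _ _ _)

/-- The coordinate basis of the relative vector fields over a curve with parameter `t`. -/
noncomputable def derivationBasis {t : A} (ht : Submodule.span A {KaehlerDifferential.D k A t} = ⊤)
    (htB : algebraMap A B t = coord k B (none : Option n)) : Module.Basis n B (Derivation A B B) :=
  .ofEquivFun
    { toFun D i := D (coord k B (some i))
      map_add' _ _ := rfl
      map_smul' _ _ := rfl
      invFun a := ∑ i, a i • derivationOfKilling (partialDer k B (some i))
        (partialDer_some_algebraMap ht htB i)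
      left_inv D := by
        ext b
        rw [relDerivation_apply_eq_sum htB D b]
        refine (derivation_sum_apply _ _ _).trans ?_
        refine Finset.sum_congr rfl fun i _ ↦ ?_
        rw [Derivation.smul_apply, derivationOfKilling_apply, smul_eq_mul, smul_eq_mul, mul_comm]
      right_inv a := by
        ext j
        refine (derivation_sum_apply _ _ _).trans ?_
        rw [Finset.sum_eq_single j]
        · rw [Derivation.smul_apply, derivationOfKilling_apply, partialDer_coord, if_pos rfl,
            smul_eq_mul, mul_one]
        · intro i _ hi
          rw [Derivation.smul_apply, derivationOfKilling_apply, partialDer_coord, if_neg, smul_zero]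
          exact fun h ↦ hi (Option.some_injective _ h).symm
        · intro h
          exact (h (Finset.mem_univ j)).elim }

lemma derivationBasis_repr {t : A} (ht : Submodule.span A {KaehlerDifferential.D k A t} = ⊤)
    (htB : algebraMap A B t = coord k B (none : Option n)) (D : Derivation A B B) (i : n) :
    (derivationBasis ht htB).repr D i = D (coord k B (some i)) := by
  rw [← Module.Basis.equivFun_apply, derivationBasis, Module.Basis.equivFun_ofEquivFun]
  rfl

/-- The functions on the relative cotangent space in coordinates. -/
noncomputable def symEquiv {t : A} (ht : Submodule.span A {KaehlerDifferential.D k A t} = ⊤)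
    (htB : algebraMap A B t = coord k B (none : Option n)) :
    SymmetricAlgebra B (Derivation A B B) ≃ₐ[B] MvPolynomial n B :=
  SymmetricAlgebra.equivMvPolynomial (derivationBasis ht htB)

lemma symEquiv_ι {t : A} (ht : Submodule.span A {KaehlerDifferential.D k A t} = ⊤)
    (htB : algebraMap A B t = coord k B (none : Option n)) (D : Derivation A B B) :
    symEquiv ht htB (SymmetricAlgebra.ι B _ D) = ∑ i, C (D (coord k B (some i))) * X i := by
  conv_lhs => rw [← (derivationBasis ht htB).sum_repr D]
  simp only [map_sum, map_smul]
  refine Finset.sum_congr rfl fun i _ ↦ ?_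
  rw [derivationBasis_repr, symEquiv, SymmetricAlgebra.equivMvPolynomial_ι_apply, smul_eq_C_mul]

/-- The condition on a prime ideal of functions on the cotangent space that a covector is conormal
to a closed subset, in coordinates. -/
lemma forall_derivation_iff {t : A} (ht : Submodule.span A {KaehlerDifferential.D k A t} = ⊤)
    (htB : algebraMap A B t = coord k B (none : Option n)) (I : Ideal B)
    (Q : Ideal (MvPolynomial n B)) :
    (∀ D : Derivation A B B, (∀ g ∈ I, C (D g) ∈ Q) → symEquiv ht htB (SymmetricAlgebra.ι B _ D) ∈ Q) ↔
      ∀ a : n → B, (∀ g ∈ I, C (∑ i, a i * partialDer k B (some i) g) ∈ Q) →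
        ∑ i, C (a i) * X i ∈ Q := by
  constructor
  · intro h a ha
    have h1 (i) : (derivationBasis ht htB).equivFun.symm a (coord k B (some i)) = a i :=
      (derivationBasis_repr ht htB _ i).symm.trans
        (congrFun ((derivationBasis ht htB).equivFun.apply_symm_apply a) i)
    have h2 := h ((derivationBasis ht htB).equivFun.symm a) fun g hg ↦ by
      rw [relDerivation_apply_eq_sum htB]
      simp only [h1, smul_eq_mul, mul_comm (partialDer _ _ _ _)]
      exact ha g hg
    rw [symEquiv_ι] at h2
    simpa only [h1] using h2
  · intro h D hD
    rw [symEquiv_ι]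
    refine h _ fun g hg ↦ ?_
    have := hD g hg
    rw [relDerivation_apply_eq_sum htB] at this
    simpa only [smul_eq_mul, mul_comm (partialDer _ _ _ _)] using this

end

section

open MvPolynomial

variable {B : Type*} [CommRing B] {n : Type*}

/-- Testing with the vectors G_{i₀} e_i - G_i e_{i₀}, which are annihilated by G, shows that the X_i
are proportional to the G_i modulo `Q`. So the generic point of V(Q) is a scaled gradient with
factor X_{i₀}/G_{i₀}. -/
lemma conormalIdeal_le_of_forall [Fintype n] [DecidableEq n] (G : n → B) (I : Ideal B) (Q : Ideal (MvPolynomial n B)) [Q.IsPrime]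
    (hI : ∀ b ∈ I, C b ∈ Q) {i₀ : n} (hi₀ : C (G i₀) ∉ Q)
    (h : ∀ a : n → B, C (∑ i, a i * G i) ∈ Q → ∑ i, C (a i) * X i ∈ Q) : conormalIdeal G I ≤ Q := by
  intro g hg
  let K := FractionRing (MvPolynomial n B ⧸ Q)
  let ψ : MvPolynomial n B →+* K := (algebraMap _ K).comp (Ideal.Quotient.mk Q)
  have hψ (x) : ψ x = 0 ↔ x ∈ Q := by
    rw [← Ideal.Quotient.eq_zero_iff_mem]
    exact map_eq_zero_iff (algebraMap (MvPolynomial n B ⧸ Q) K) (IsFractionRing.injective _ K)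
  have h1 (i : n) : C (G i₀) * X i - C (G i) * X i₀ ∈ Q := by
    have := h (Pi.single i (G i₀) - Pi.single i₀ (G i)) (by
      have h2 : ∑ j, (Pi.single i (G i₀) - Pi.single i₀ (G i) : n → B) j * G j = 0 := by
        simp [sub_mul, Finset.sum_sub_distrib, Pi.single_apply, mul_comm (G i₀)]
      rw [h2, map_zero]
      exact Q.zero_mem)
    have h2 : ∑ j, C ((Pi.single i (G i₀) - Pi.single i₀ (G i) : n → B) j) * X j =
        C (G i₀) * X i - C (G i) * X i₀ := by
      simp [sub_mul, Finset.sum_sub_distrib, Pi.single_apply, apply_ite C]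
    rwa [h2] at this
  have hne : ψ (C (G i₀)) ≠ 0 := fun h ↦ hi₀ ((hψ _).mp h)
  have h2 (i : n) : ψ (X i) = ψ (X i₀) / ψ (C (G i₀)) * ψ (C (G i)) := by
    have := (hψ _).mpr (h1 i)
    rw [map_sub, map_mul, map_mul, sub_eq_zero] at this
    rw [div_mul_eq_mul_div, eq_div_iff hne, mul_comm, this, mul_comm]
  have h3 := eval_eq_zero_of_mem_conormalIdeal G hg (ψ.comp C) (fun b hb ↦ (hψ _).mpr (hI b hb))
    (ψ (X i₀) / ψ (C (G i₀)))
  have h4 : ψ g = eval₂ (ψ.comp C) (fun i ↦ ψ (X i)) g := by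
    conv_lhs => rw [← eval₂_eta g, hom_eval₂]
  rw [← hψ, h4, funext h2]
  exact h3

lemma sum_mem_conormalIdeal [Fintype n] (G : n → B) (I : Ideal B) (a : n → B) (h : ∑ i, a i * G i ∈ I) :
    ∑ i, C (a i) * X i ∈ conormalIdeal G I := by
  rw [conormalIdeal, Ideal.mem_comap]
  have : (aeval fun i ↦ Polynomial.C (G i) * Polynomial.X) (∑ i, C (a i) * X i) =
      Polynomial.C (∑ i, a i * G i) * Polynomial.X := by
    simp [Finset.sum_mul, mul_assoc]
  rw [this]
  exact Ideal.mul_mem_right _ _ (Ideal.mem_map_of_mem _ h)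

lemma isRadical_conormalIdeal (G : n → B) {I : Ideal B} (hI : I.IsRadical) :
    (conormalIdeal G I).IsRadical := by
  intro g ⟨m, hg⟩
  rw [← hI.radical, ← Ideal.sInf_minimalPrimes]
  refine mem_conormalIdeal_sInf G fun x hx ↦ ?_
  have : x.IsPrime := hx.1.1
  exact (inferInstance : (conormalIdeal G x).IsPrime).mem_of_pow_mem _ (conormalIdeal_mono G hx.1.2 hg)

end

section

open MvPolynomial

variable {k : Type u} [Field k] {ι σ : Type} [Fintype ι] [Fintype σ] [DecidableEq ι] [DecidableEq σ]
  {B : Type u} [CommRing B] [Algebra k B]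
  [Algebra (MvPolynomial (Option (ι ⊕ σ)) k) B] [IsScalarTower k (MvPolynomial (Option (ι ⊕ σ)) k) B]
  [Algebra.Etale (MvPolynomial (Option (ι ⊕ σ)) k) B]

/-- The derivations along `inr j` preserve `p`, so they are tangent to V(p) and conormality forces
the covector coordinates `inr j` to vanish. Conversely, testing a tangent vector on the equations
`inl i` shows that its components in these directions vanish on V(p). -/
lemma genericConormal_le_iff (p : Ideal B)
    (hp : p = (RingHom.ker (killHom k ι σ)).map (algebraMap _ B)) (Q : Ideal (MvPolynomial (ι ⊕ σ) B))
    (hQ : ∀ b ∈ p, C b ∈ Q) :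
    (∀ a : ι ⊕ σ → B, (∀ g ∈ p, C (∑ i, a i * partialDer k B (some i) g) ∈ Q) →
        ∑ i, C (a i) * X i ∈ Q) ↔ genericConormal ι σ p ≤ Q := by
  have hpc (i : ι) : coord k B (some (Sum.inl (β := σ) i)) ∈ p := by
    rw [hp, map_ker_killHom]; exact Ideal.subset_span ⟨some i, rfl⟩
  have hD (j : σ) (g : B) (hg : g ∈ p) : partialDer k B (some (Sum.inr (α := ι) j)) g ∈ p := by
    have hspan : Ideal.span (Set.range fun i : Option ι ↦ coord k B (i.map (Sum.inl (β := σ)))) = p :=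
      map_ker_killHom.symm.trans hp.symm
    have h1 := hspan.ge hg
    clear hg
    induction h1 using Submodule.span_induction with
    | mem x hx =>
      obtain ⟨_ | i, rfl⟩ := hx <;> simp [partialDer_coord]
    | zero => simp
    | add x y hx hy ihx ihy =>
      rw [map_add]
      exact add_mem ihx ihy
    | smul b x hx ih =>
      rw [smul_eq_mul, Derivation.leibniz]
      exact add_mem (p.mul_mem_left _ ih) (p.mul_mem_right _ (hspan.le hx))
  constructor
  · intro h
    rw [genericConormal_eq]
    refine sup_le (Ideal.map_le_iff_le_comap.mpr hQ) (Ideal.span_le.mpr ?_)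
    rintro _ ⟨j, rfl⟩
    have := h (Pi.single (Sum.inr j) 1) fun g hg ↦ by
      simpa [Pi.single_apply] using hQ _ (hD j g hg)
    simpa [Pi.single_apply, apply_ite C] using this
  · intro h a ha
    rw [Fintype.sum_sum_type]
    refine add_mem (sum_mem fun i _ ↦ Ideal.mul_mem_right _ _ ?_)
      (sum_mem fun j _ ↦ Ideal.mul_mem_left _ _ (h (X_inr_mem_genericConormal p j)))
    simpa [partialDer_coord] using ha _ (hpc i)

end

end LagrangianSpecialization

namespace LagrangianSpecialization

open CategoryTheory Limits AlgebraicGeometry TopologicalSpace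

/-! ### The relative conormal variety in an adapted chart. -/

variable {W S : Scheme.{u}} {f : W ⟶ S}

/-- The point of an affine scheme given by a prime ideal. -/
def specPoint {R : Type u} [CommRing R] (I : Ideal R) [hI : I.IsPrime] : Spec (.of R) :=
  (⟨I, hI⟩ : PrimeSpectrum R)

namespace AdaptedChart

variable {k : Type u} [Field k] {s : S} {X Y : Closeds W} (c : AdaptedChart k f s X Y)

/-- The functions on the relative cotangent bundle of an adapted chart, as polynomials. -/
abbrev Poly : Type u := MvPolynomial (Fin c.codim ⊕ Fin c.dim) c.B

/-- The partial derivatives of the equation of `X` along the fibers. -/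
noncomputable def grad (i : Fin c.codim ⊕ Fin c.dim) : c.B := partialDer k c.B (some i) c.F

/-- The ideal of the relative conormal variety of `X`. -/
noncomputable abbrev conormal : Ideal c.Poly := conormalIdeal c.grad (Ideal.span {c.F})

/-- The ideal of the conormal variety of `Y`. -/
noncomputable abbrev generic : Ideal c.Poly := genericConormal (Fin c.codim) (Fin c.dim) (c.ideal Y)

/-- The equation of the fiber over `s`. -/
noncomputable abbrev param : c.B := coord k c.B (none : Option (Fin c.codim ⊕ Fin c.dim))

instance : c.generic.IsPrime := by
  unfold generic genericConormal
  exact RingHom.ker_isPrime _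

lemma isNoetherianRing : IsNoetherianRing c.B := by
  have : Algebra.FiniteType k c.B :=
    .trans (S := MvPolynomial (Option (Fin c.codim ⊕ Fin c.dim)) k) inferInstance inferInstance
  exact Algebra.FiniteType.isNoetherianRing k c.B

lemma isRadical_span : (Ideal.span {c.F}).IsRadical := c.ideal_eq_span ▸ c.isRadical_ideal X

lemma param_mem_iff (hs : IsClosed {s}) (P : Spec (.of c.B)) :
    c.param ∈ P.asIdeal ↔ f (c.toTotal P) = s := by
  have : (P.asIdeal.comap (algebraMap c.A c.B)).IsPrime := Ideal.IsPrime.comap (hK := P.2) _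
  have hm := c.base.2.primeIdealOf_isMaximal_of_isClosed ⟨s, c.mem_base⟩ hs
  rw [c.eq_iff_comap_eq c.mem_base]
  have h1 : c.param ∈ P.asIdeal ↔ c.t ∈ P.asIdeal.comap (algebraMap c.A c.B) :=
    (congrArg (· ∈ P.asIdeal) c.algebraMap_t).symm.to_iff
  rw [h1]
  constructor
  · intro h
    refine (hm.eq_of_le (Ideal.IsPrime.ne_top ‹_›) ?_).symm
    rw [c.primeIdealOf_eq]
    exact (Ideal.span_singleton_le_iff_mem (P.asIdeal.comap (algebraMap c.A c.B))).mpr h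
  · intro h
    rw [h, c.primeIdealOf_eq]; exact Ideal.mem_span_singleton_self _

lemma comap_C_generic :
    Spec.map (CommRingCat.ofHom MvPolynomial.C) (specPoint c.generic) = specPoint (c.ideal Y) :=
  PrimeSpectrum.ext (Ideal.ext fun _ ↦ C_mem_genericConormal)

lemma param_notMem [Flat ((Scheme.IdealSheafData.vanishingIdeal X).subschemeι ≫ f)]
    (x : Ideal c.B) (hx : x ∈ (Ideal.span {c.F}).minimalPrimes) : c.param ∉ x := by
  have : Module.Flat c.A (c.B ⧸ Ideal.span {c.F}) := c.ideal_eq_span ▸ c.flat_quotient X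
  have h := algebraMap_notMem_of_mem_minimalPrimes (A := c.A) c.isRadical_span hx (a := c.t) ?_
  · rwa [c.algebraMap_t] at h
  · intro h0
    have h1 := c.algebraMap_t
    have h2 := partialDer_coord (k := k) (B := c.B) (none : Option (Fin c.codim ⊕ Fin c.dim)) none
    rw [← h1, h0, map_zero, map_zero, if_pos rfl] at h2
    exact zero_ne_one h2

variable [Smooth f]

/-- The relative cotangent bundle of an adapted chart, as an affine space. -/
noncomputable def polyChart : Spec (.of c.Poly) ⟶ cotangentBundle f :=
  Spec.map (CommRingCat.ofHom (symEquiv c.span_eq_top c.algebraMap_t).toRingHom) ≫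
    cotangentChart f c.toChart

instance : IsOpenImmersion c.polyChart := by
  have : IsIso (CommRingCat.ofHom (symEquiv c.span_eq_top c.algebraMap_t).toRingHom) :=
    ((symEquiv c.span_eq_top c.algebraMap_t).toRingEquiv.toCommRingCatIso).isIso_hom
  unfold polyChart
  infer_instance

lemma cotangentProj_polyChart (Q : Spec (.of c.Poly)) : cotangentProj f (c.polyChart Q) =
    c.toTotal (Spec.map (CommRingCat.ofHom MvPolynomial.C) Q) := by
  rw [polyChart, Scheme.Hom.comp_apply, Chart.cotangentProj_cotangentChart]
  refine congrArg _ (PrimeSpectrum.ext (Ideal.ext fun b ↦ ?_))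
  change symEquiv c.span_eq_top c.algebraMap_t (algebraMap _ _ b) ∈ Q.asIdeal ↔ _
  rw [AlgEquiv.commutes]
  rfl

lemma exists_polyChart_eq {ξ : cotangentBundle f} (h : cotangentProj f ξ ∈ c.total.1) :
    ∃ Q, c.polyChart Q = ξ := by
  obtain ⟨q, rfl⟩ := c.exists_cotangentChart_eq h
  refine ⟨Spec.map (CommRingCat.ofHom (symEquiv c.span_eq_top c.algebraMap_t).symm.toRingHom) q, ?_⟩
  rw [polyChart, ← Scheme.Hom.comp_apply, ← Spec.map_comp_assoc]
  have : CommRingCat.ofHom (symEquiv c.span_eq_top c.algebraMap_t).toRingHom ≫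
      CommRingCat.ofHom (symEquiv c.span_eq_top c.algebraMap_t).symm.toRingHom = 𝟙 _ := by
    ext x
    exact (symEquiv c.span_eq_top c.algebraMap_t).symm_apply_apply x
  rw [this, Spec.map_id, Category.id_comp]

lemma polyChart_specializes_iff {P Q : Spec (.of c.Poly)} :
    c.polyChart P ⤳ c.polyChart Q ↔ P.asIdeal ≤ Q.asIdeal := by
  rw [c.polyChart.isOpenEmbedding.isInducing.specializes_iff]
  exact (PrimeSpectrum.le_iff_specializes P Q).symm

/-- Conormality in the coordinates of an adapted chart. -/
lemma polyChart_mem_conormalPoints_iff (Q : Spec (.of c.Poly)) {V : Closeds W} {A : Set W} (hA : A ⊆ V) :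
    c.polyChart Q ∈ conormalPoints f V A ↔
      c.toTotal (Spec.map (CommRingCat.ofHom MvPolynomial.C) Q) ∈ A ∧
      ∀ a : Fin c.codim ⊕ Fin c.dim → c.B,
        (∀ g ∈ c.ideal V, MvPolynomial.C (∑ i, a i * partialDer k c.B (some i) g) ∈ Q.asIdeal) →
        ∑ i, MvPolynomial.C (a i) * MvPolynomial.X i ∈ Q.asIdeal := by
  have e : c.polyChart Q = cotangentChart f c.toChart
      (Spec.map (CommRingCat.ofHom (symEquiv c.span_eq_top c.algebraMap_t).toRingHom) Q) :=
    Scheme.Hom.comp_apply _ _ _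
  rw [e, cotangentChart_mem_conormalPoints_iff _ _ hA, ← e, cotangentProj_polyChart,
    ← forall_derivation_iff c.span_eq_top c.algebraMap_t]
  refine and_congr_right fun _ ↦ forall_congr' fun D ↦ imp_congr_left (forall₂_congr fun g _ ↦ ?_)
  change symEquiv c.span_eq_top c.algebraMap_t (algebraMap _ _ (D g)) ∈ Q.asIdeal ↔ _
  rw [AlgEquiv.commutes]
  rfl

lemma polyChart_mem_conormalPoints_Y_iff (Q : Spec (.of c.Poly)) {A : Set W} (hA : A ⊆ Y) :
    c.polyChart Q ∈ conormalPoints f Y A ↔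
      c.toTotal (Spec.map (CommRingCat.ofHom MvPolynomial.C) Q) ∈ A ∧ c.generic ≤ Q.asIdeal := by
  rw [c.polyChart_mem_conormalPoints_iff Q hA]
  refine and_congr_right fun h ↦ ?_
  exact genericConormal_le_iff _ c.ideal_eq_map _ fun b hb ↦
    (c.toTotal_mem_iff Y _).mp (hA h) hb

lemma exists_grad_notMem [CharZero k]
    [Flat ((Scheme.IdealSheafData.vanishingIdeal X).subschemeι ≫ f)]
    (x : Ideal c.B) (hx : x ∈ (Ideal.span {c.F}).minimalPrimes) :
    ∃ i, c.grad i ∉ x := by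
  have := c.isNoetherianRing
  have hsm : Algebra.Smooth c.A c.B := f.smooth_appLE c.base.2 c.total.2 c.le
  have : CharZero c.A := charZero_of_injective_algebraMap (algebraMap k c.A).injective
  have : x.IsPrime := hx.1.1
  have : Module.Flat c.A (c.B ⧸ Ideal.span {c.F}) := c.ideal_eq_span ▸ c.flat_quotient X
  exact exists_partialDer_notMem c.algebraMap_t x c.F_ne_zero
    (hx.1.2 (Ideal.mem_span_singleton_self _)) (formallySmooth_of_mem_minimalPrimes c.isRadical_span hx)

variable [IsLocallyNoetherian W] [IsLocallyNoetherian S]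

lemma toTotal_mem_smoothPoints_iff (P : Spec (.of c.B)) :
    c.toTotal P ∈ smoothPoints X f ↔ c.F ∈ P.asIdeal ∧ ∃ i, c.grad i ∉ P.asIdeal := by
  have := c.isNoetherianRing
  have hsm : Algebra.Smooth c.A c.B := f.smooth_appLE c.base.2 c.total.2 c.le
  have : P.asIdeal.IsPrime := P.2
  have hmem : c.toTotal P ∈ X ↔ c.F ∈ P.asIdeal := by
    rw [c.toTotal_mem_iff, c.ideal_eq_span, Ideal.span_singleton_le_iff_mem]
  have h1 := mem_smoothPoints_iff X f c.base c.total c.le P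
  have h2 : c.toTotal P ∈ smoothPoints X f ↔ c.toTotal P ∈ X ∧
      Algebra.FormallySmooth c.A (Localization.AtPrime P.asIdeal ⧸
        (c.ideal X).map (algebraMap c.B (Localization.AtPrime P.asIdeal))) := h1
  rw [h2, hmem, c.ideal_eq_span]
  refine and_congr_right fun hF ↦ ⟨fun h ↦ ?_, fun ⟨i, hi⟩ ↦ ?_⟩
  · exact exists_partialDer_notMem c.algebraMap_t P.asIdeal c.F_ne_zero hF h
  · exact formallySmooth_of_partialDer_notMem c.span_eq_top c.algebraMap_t P.asIdeal hF hi

/-- On V(F), tangency to X need only be tested on the generator F, by the Leibniz rule; then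
`conormalIdeal_le_of_forall` applies at a point where the gradient is nonzero. -/
lemma conormal_le_of_mem (Q : Spec (.of c.Poly))
    (h : c.polyChart Q ∈ conormalPoints f X (smoothPoints X f)) : c.conormal ≤ Q.asIdeal := by
  have : Q.asIdeal.IsPrime := Q.2
  rw [c.polyChart_mem_conormalPoints_iff Q (smoothPoints_subset X f),
    toTotal_mem_smoothPoints_iff] at h
  obtain ⟨⟨hF, i₀, hi₀⟩, h⟩ := h
  have hF' (b) (hb : b ∈ Ideal.span {c.F}) : MvPolynomial.C b ∈ Q.asIdeal :=
    (Ideal.span_singleton_le_iff_mem _).mpr hF hb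
  refine conormalIdeal_le_of_forall c.grad _ Q.asIdeal hF' hi₀ fun a ha ↦ h a fun g hg ↦ ?_
  rw [c.ideal_eq_span] at hg
  obtain ⟨b, rfl⟩ := Ideal.mem_span_singleton.mp hg
  have h1 : ∑ i, a i * partialDer k c.B (some i) (c.F * b) =
      c.F * (∑ i, a i * partialDer k c.B (some i) b) + b * ∑ i, a i * c.grad i := by
    rw [Finset.mul_sum, Finset.mul_sum, ← Finset.sum_add_distrib]
    refine Finset.sum_congr rfl fun i _ ↦ ?_
    rw [Derivation.leibniz, smul_eq_mul, smul_eq_mul, grad]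
    ring
  rw [h1, map_add, map_mul, map_mul]
  exact add_mem (Ideal.mul_mem_right _ _ hF) (Ideal.mul_mem_left _ _ ha)

lemma polyChart_conormal_mem [CharZero k]
    [Flat ((Scheme.IdealSheafData.vanishingIdeal X).subschemeι ≫ f)] (x : Ideal c.B)
    (hx : x ∈ (Ideal.span {c.F}).minimalPrimes) [x.IsPrime] :
    c.polyChart (specPoint (conormalIdeal c.grad x)) ∈
      conormalPoints f X (smoothPoints X f) := by
  rw [c.polyChart_mem_conormalPoints_iff _ (smoothPoints_subset X f),
    toTotal_mem_smoothPoints_iff]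
  have hF := hx.1.2 (Ideal.mem_span_singleton_self c.F)
  refine ⟨⟨(C_mem_conormalIdeal c.grad).mpr hF, ?_⟩, fun a ha ↦ ?_⟩
  · obtain ⟨i, hi⟩ := c.exists_grad_notMem x hx
    exact ⟨i, fun h ↦ hi ((C_mem_conormalIdeal c.grad).mp h)⟩
  · refine sum_mem_conormalIdeal _ _ _ ((C_mem_conormalIdeal c.grad).mp ?_)
    exact ha c.F (c.ideal_eq_span.ge (Ideal.mem_span_singleton_self _))

/-- Conormal vectors lie in the closed zero locus of the conormal ideal. Conversely, each point of
this locus specializes from the conormal ideal of some component `x` of F = 0, and generic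
smoothness makes that prime itself a conormal vector of X at a smooth point. -/
theorem polyChart_mem_relConormal_iff [CharZero k]
    [Flat ((Scheme.IdealSheafData.vanishingIdeal X).subschemeι ≫ f)] {K : Scheme.{u}} (p : S ⟶ K) [Smooth p]
    (Q : Spec (.of c.Poly)) :
    c.polyChart Q ∈ relConormal f p X ↔ c.conormal ≤ Q.asIdeal := by
  have := c.isNoetherianRing
  have h0 : c.polyChart Q ∈ relConormal f p X ↔
      Q ∈ closure (c.polyChart ⁻¹' conormalPoints f X (smoothPoints X f)) := by
    rw [← c.polyChart.isOpenEmbedding.isOpenMap.preimage_closure_eq_closure_preimage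
      c.polyChart.continuous, ← relSmoothLocus_eq p f X]
    rfl
  rw [h0]
  constructor
  · intro h
    have h1 : IsClosed (PrimeSpectrum.zeroLocus (c.conormal : Set c.Poly)) :=
      PrimeSpectrum.isClosed_zeroLocus _
    exact closure_minimal (s := c.polyChart ⁻¹' conormalPoints f X (smoothPoints X f))
      (fun Q hQ ↦ c.conormal_le_of_mem Q hQ) h1 h
  · intro h
    have : Q.asIdeal.IsPrime := Q.2
    obtain ⟨x, hx, hxQ⟩ := exists_conormalIdeal_le _ _ c.isRadical_span Q.asIdeal h
    have : x.IsPrime := hx.1.1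
    have h1 : specPoint (conormalIdeal c.grad x) ⤳ Q := (PrimeSpectrum.le_iff_specializes _ _).mp hxQ
    refine closure_mono ?_ h1.mem_closure
    exact Set.singleton_subset_iff.mpr (c.polyChart_conormal_mem x hx)

end AdaptedChart

end LagrangianSpecialization

namespace LagrangianSpecialization

open CategoryTheory Limits AlgebraicGeometry TopologicalSpace

/-! ### Multiplicities of cycles at generic points. -/

lemma closure_mem_irreducibleComponents_iff {T : Scheme.{u}} (y : T) :
    closure {y} ∈ irreducibleComponents T ↔ ∀ z, z ⤳ y → z = y := by
  constructor
  · intro h z hz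
    have h1 : closure {y} ⊆ closure {z} :=
      closure_minimal (Set.singleton_subset_iff.mpr hz.mem_closure) isClosed_closure
    have h2 := h.2 isIrreducible_singleton.closure h1
    exact (hz.antisymm (specializes_iff_mem_closure.mpr (h2 (subset_closure rfl)))).eq
  · refine fun h ↦ ⟨isIrreducible_singleton.closure, fun Z hZ hle ↦ ?_⟩
    have h1 : closure {hZ.closure.genericPoint} = closure Z :=
      hZ.closure.closure_genericPoint isClosed_closure
    have h2 : hZ.closure.genericPoint ⤳ y := by
      rw [specializes_iff_mem_closure, h1]
      exact subset_closure (hle (subset_closure rfl))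
    rw [h _ h2] at h1
    exact subset_closure.trans h1.ge

lemma eq_maximalIdeal_stalk {T : Scheme.{u}} {y : T} (h : ∀ z, z ⤳ y → z = y)
    (p : Ideal (T.presheaf.stalk y)) [p.IsPrime] : p = maximalIdeal _ := by
  let P : Spec (T.presheaf.stalk y) := (⟨p, inferInstance⟩ : PrimeSpectrum _)
  have h1 : T.fromSpecStalk y P ⤳ y := by
    have : T.fromSpecStalk y P ∈ Set.range (T.fromSpecStalk y) := ⟨P, rfl⟩
    rwa [Scheme.range_fromSpecStalk] at this
  have h2 := (T.fromSpecStalk y).isEmbedding.injective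
    ((h _ h1).trans Scheme.fromSpecStalk_closedPoint.symm)
  exact congr($(h2).asIdeal)

lemma length_ne_top {T : Scheme.{u}} [IsLocallyNoetherian T] {y : T} (h : ∀ z, z ⤳ y → z = y) :
    Module.length (T.presheaf.stalk y) (T.presheaf.stalk y) ≠ ⊤ := by
  have : Ring.KrullDimLE 0 (T.presheaf.stalk y) := by
    rw [Ring.krullDimLE_zero_iff]
    intro I hI
    rw [eq_maximalIdeal_stalk h I]
    infer_instance
  have : IsArtinianRing (T.presheaf.stalk y) := isArtinianRing_iff_krullDimLE_zero.mpr this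
  exact Module.length_ne_top

lemma one_le_componentMultiplicity {T : Scheme.{u}} [IsLocallyNoetherian T] {y : T}
    (h : ∀ z, z ⤳ y → z = y) : 1 ≤ componentMultiplicity T y := by
  rw [componentMultiplicity, if_pos ((closure_mem_irreducibleComponents_iff y).mpr h)]
  have h1 := length_ne_top h
  have h2 : 0 < Module.length (T.presheaf.stalk y) (T.presheaf.stalk y) := Module.length_pos_iff.mpr
    inferInstance
  have h3 : (Module.length (T.presheaf.stalk y) (T.presheaf.stalk y)).toNat ≠ 0 := fun h ↦
    (ENat.toNat_eq_zero.mp h).elim h2.ne' h1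
  omega

/-- Length one means that the local ring is simple over itself, that is, a field. -/
lemma isUnit_of_componentMultiplicity_eq_one {T : Scheme.{u}} {y : T}
    (h : componentMultiplicity T y = 1) (a : T.presheaf.stalk y) (ha : a ≠ 0) : IsUnit a := by
  rw [componentMultiplicity] at h
  split_ifs at h
  swap
  · exact (zero_ne_one h).elim
  have h1 : Module.length (T.presheaf.stalk y) (T.presheaf.stalk y) = 1 := by
    have h2 : (Module.length (T.presheaf.stalk y) (T.presheaf.stalk y)).toNat = 1 := by exact_mod_cast h
    have h3 : Module.length (T.presheaf.stalk y) (T.presheaf.stalk y) ≠ ⊤ := by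
      intro h3; simp [h3] at h2
    rw [← ENat.natCast_toNat h3, h2]; rfl
  exact (isSimpleModule_self_iff_isUnit.mp (Module.length_eq_one_iff.mp h1)).2 a ha

lemma isReduced_stalk_subscheme {T : Scheme.{u}} (Z : Closeds T)
    (y : (Scheme.IdealSheafData.vanishingIdeal Z).subscheme) :
    _root_.IsReduced ((Scheme.IdealSheafData.vanishingIdeal Z).subscheme.presheaf.stalk y) := by
  let I := Scheme.IdealSheafData.vanishingIdeal Z
  obtain ⟨U, hU, hyU, -⟩ := Opens.isBasis_iff_nbhd.mp T.isBasis_affineOpens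
    (show I.subschemeι y ∈ (⊤ : T.Opens) from trivial)
  have hU' : IsAffineOpen (I.subschemeι ⁻¹ᵁ U) := IsAffineOpen.preimage hU I.subschemeι
  have h1 : (I.ideal ⟨U, hU⟩).IsRadical := PrimeSpectrum.isRadical_vanishingIdeal _
  have h2 : _root_.IsReduced (Γ(T, U) ⧸ I.ideal ⟨U, hU⟩) := (Ideal.isRadical_iff_quotient_reduced _).mp h1
  have h3 : _root_.IsReduced Γ(I.subscheme, I.subschemeι ⁻¹ᵁ U) :=
    isReduced_of_injective (I.subschemeObjIso ⟨U, hU⟩).commRingCatIsoToRingEquiv.toRingHom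
      (I.subschemeObjIso ⟨U, hU⟩).commRingCatIsoToRingEquiv.injective
  let y' : (I.subschemeι ⁻¹ᵁ U : I.subscheme.Opens) := ⟨y, hyU⟩
  let := I.subscheme.presheaf.algebra_section_stalk y'
  have h4 := hU'.isLocalization_stalk y'
  exact isReduced_localizationPreserves (hU'.primeIdealOf y').asIdeal.primeCompl
    (I.subscheme.presheaf.stalk y) h3

lemma componentMultiplicity_vanishingIdeal {T : Scheme.{u}} (Z : Closeds T)
    {y : (Scheme.IdealSheafData.vanishingIdeal Z).subscheme} (h : ∀ z, z ⤳ y → z = y) :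
    componentMultiplicity (Scheme.IdealSheafData.vanishingIdeal Z).subscheme y = 1 := by
  have := isReduced_stalk_subscheme Z y
  rw [componentMultiplicity, if_pos ((closure_mem_irreducibleComponents_iff y).mpr h)]
  have h1 : IsSimpleModule ((Scheme.IdealSheafData.vanishingIdeal Z).subscheme.presheaf.stalk y)
      ((Scheme.IdealSheafData.vanishingIdeal Z).subscheme.presheaf.stalk y) := by
    rw [isSimpleModule_self_iff_isUnit]
    refine ⟨inferInstance, fun a ha ↦ ?_⟩
    by_contra hu
    refine ha (IsNilpotent.eq_zero ?_)
    rw [← mem_nilradical, nilradical_eq_sInf, Ideal.mem_sInf]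
    intro p hp
    have : p.IsPrime := hp
    rw [eq_maximalIdeal_stalk h p]
    exact hu
  rw [Module.length_eq_one_iff.mpr h1]
  rfl

section

variable {T : Scheme.{u}} [IsLocallyNoetherian T]

lemma closedSubschemeCycle_subschemeι (I : T.IdealSheafData) (y : I.subscheme) :
    closedSubschemeCycle I (I.subschemeι y) = componentMultiplicity I.subscheme y :=
  I.subschemeι.isEmbedding.injective.extend_apply _ _ _

lemma componentMultiplicity_nonneg (T : Scheme.{u}) (y : T) : 0 ≤ componentMultiplicity T y := by
  rw [componentMultiplicity]
  split_ifs
  · exact Int.natCast_nonneg _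
  · exact le_rfl

lemma closedSubschemeCycle_nonneg (I : T.IdealSheafData) (e : T) : 0 ≤ closedSubschemeCycle I e := by
  by_cases h : ∃ y, I.subschemeι y = e
  · obtain ⟨y, rfl⟩ := h
    rw [closedSubschemeCycle_subschemeι]
    exact componentMultiplicity_nonneg _ _
  · exact (show closedSubschemeCycle I e = 0 from Function.extend_apply' _ _ _ h).ge

lemma closedSubschemeCycle_vanishingIdeal_cases (Z : Closeds T) (e : T) :
    closedSubschemeCycle (Scheme.IdealSheafData.vanishingIdeal Z) e = 0 ∨
    closedSubschemeCycle (Scheme.IdealSheafData.vanishingIdeal Z) e = 1 ∧ e ∈ Z ∧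
      ∀ z ∈ Z, z ⤳ e → z = e := by
  by_cases h : ∃ y, (Scheme.IdealSheafData.vanishingIdeal Z).subschemeι y = e
  · obtain ⟨y, rfl⟩ := h
    rw [closedSubschemeCycle_subschemeι]
    by_cases hy : ∀ z, z ⤳ y → z = y
    · refine .inr ⟨componentMultiplicity_vanishingIdeal Z hy, ?_, fun z hz hzy ↦ ?_⟩
      · have := (Scheme.IdealSheafData.range_subschemeι (Scheme.IdealSheafData.vanishingIdeal Z)).subset
          ⟨y, rfl⟩
        simpa using this
      · obtain ⟨z, rfl⟩ := exists_subschemeι_eq hz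
        rw [(Scheme.Hom.isEmbedding _).isInducing.specializes_iff] at hzy
        rw [hy z hzy]
    · exact .inl (if_neg fun h ↦ hy ((closure_mem_irreducibleComponents_iff y).mp h))
  · exact .inl (Function.extend_apply' _ _ _ h)

/-- Near `e` the closure of `C` has finitely many components. Remove those that avoid `e`; what is
left of a neighbourhood of `e` still meets `C`, at a point on a component through `e`. By minimality
`e` is the generic point of that component. -/
lemma exists_specializes_of_mem_closure (C : Set T) {e : T} (he : e ∈ closure C)
    (h : ∀ z ∈ closure C, z ⤳ e → z = e) : ∃ c ∈ C, e ⤳ c := by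
  obtain ⟨U, hU, heU, -⟩ := Opens.isBasis_iff_nbhd.mp T.isBasis_affineOpens
    (show e ∈ (⊤ : T.Opens) from trivial)
  have : IsNoetherianRing Γ(T, U) := IsLocallyNoetherian.component_noetherian ⟨U, hU⟩
  have : NoetherianSpace U := noetherianSpace_of_isAffineOpen U hU
  let K : Closeds U := ⟨(Subtype.val : U → T) ⁻¹' closure C, isClosed_closure.preimage continuous_subtype_val⟩
  obtain ⟨F, hF, hFi, hFs⟩ := NoetherianSpace.exists_finite_set_isClosed_irreducible K.isClosed
  by_contra! hC
  let K' : Set U := ⋃₀ {t ∈ F | ⟨e, heU⟩ ∉ t}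
  have hK' : IsClosed K' := by
    rw [show K' = _ from Set.sUnion_eq_biUnion]
    exact (hF.subset (Set.sep_subset _ _)).isClosed_biUnion fun t ht ↦ hFi t ht.1
  obtain ⟨V, hV, hVK⟩ := isOpen_induced_iff.mp hK'.isOpen_compl
  have heV : e ∈ V := by
    have : (⟨e, heU⟩ : U) ∈ K'ᶜ := fun ⟨t, ht, het⟩ ↦ ht.2 het
    exact hVK.ge this
  obtain ⟨c, ⟨hcV, hcU⟩, hc⟩ := mem_closure_iff.mp he (V ∩ U) (hV.inter U.2) ⟨heV, heU⟩
  have hcK : (⟨c, hcU⟩ : U) ∈ (K : Set U) := subset_closure hc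
  have hcK' : (⟨c, hcU⟩ : U) ∉ K' := by
    have : (⟨c, hcU⟩ : U) ∈ (Subtype.val : U → T) ⁻¹' V := hcV
    exact hVK.le this
  rw [hFs.2] at hcK
  obtain ⟨t, ht, hct⟩ := hcK
  have het : ⟨e, heU⟩ ∈ t := by
    by_contra het
    exact hcK' ⟨t, ⟨ht, het⟩, hct⟩
  have hirr : IsIrreducible (closure ((Subtype.val : U → T) '' t)) :=
    ((hFs.1 t ht).image _ continuous_subtype_val.continuousOn).closure
  have hg : closure {hirr.genericPoint} = closure ((Subtype.val : U → T) '' t) :=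
    hirr.closure_genericPoint isClosed_closure
  have hgC : hirr.genericPoint ∈ closure C := by
    have h1 : closure ((Subtype.val : U → T) '' t) ⊆ closure C := by
      refine closure_minimal ?_ isClosed_closure
      rintro _ ⟨x, hx, rfl⟩
      have : x ∈ (K : Set U) := by rw [hFs.2]; exact ⟨t, ht, hx⟩
      exact this
    exact h1 (hg.subset (subset_closure rfl))
  have h2 (x : U) (hx : x ∈ t) : hirr.genericPoint ⤳ x.1 := by
    rw [specializes_iff_mem_closure, hg]
    exact subset_closure ⟨x, hx, rfl⟩
  refine hC c hc ?_
  rw [← h _ hgC (h2 _ het)]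
  exact h2 _ hct

end

end LagrangianSpecialization

namespace LagrangianSpecialization

open CategoryTheory Limits AlgebraicGeometry TopologicalSpace

/-! ### Coefficients of conormal cycles and lower bounds for the specialization. -/

variable {W S : Scheme.{u}} {f : W ⟶ S} [Smooth f]

lemma exists_fiberι_eq {s : S} {ξ : cotangentBundle f} (h : f (cotangentProj f ξ) = s) :
    ∃ e, (cotangentProj f ≫ f).fiberι s e = ξ := by
  have : ξ ∈ Set.range ((cotangentProj f ≫ f).fiberι s) := by
    rw [Scheme.Hom.range_fiberι]; exact h
  exact this

lemma fiberι_specializes_iff {s : S} {e e' : cotangentFiber f s} :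
    (cotangentProj f ≫ f).fiberι s e ⤳ (cotangentProj f ≫ f).fiberι s e' ↔ e ⤳ e' :=
  ((cotangentProj f ≫ f).fiberι s).isEmbedding.isInducing.specializes_iff

namespace AdaptedChart

variable {k : Type u} [Field k] {s : S} {X Y : Closeds W} (c : AdaptedChart k f s X Y)

lemma param_mem_polyChart_iff (hs : IsClosed {s}) (Q : Spec (.of c.Poly)) :
    MvPolynomial.C c.param ∈ Q.asIdeal ↔ f (cotangentProj f (c.polyChart Q)) = s := by
  rw [c.cotangentProj_polyChart, ← c.param_mem_iff hs]
  rfl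

lemma generic_le_of_mem_closure {A : Set W} (hA : A ⊆ Y) (Q : Spec (.of c.Poly))
    (h : c.polyChart Q ∈ closure (conormalPoints f Y A)) : c.generic ≤ Q.asIdeal := by
  have h0 : Q ∈ closure (c.polyChart ⁻¹' conormalPoints f Y A) := by
    rw [← c.polyChart.isOpenEmbedding.isOpenMap.preimage_closure_eq_closure_preimage
      c.polyChart.continuous]
    exact h
  exact closure_minimal (s := c.polyChart ⁻¹' conormalPoints f Y A)
    (fun Q hQ ↦ ((c.polyChart_mem_conormalPoints_Y_iff Q hA).mp hQ).2)
    (PrimeSpectrum.isClosed_zeroLocus (c.generic : Set c.Poly)) h0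

end AdaptedChart

/-- Where the coefficient is not zero, `e` is the generic point of a component and specializes to an
honest conormal vector over a smooth point of Y. An adapted chart exists there. In it the conormal
vectors have the prime `c.generic` as generic point, and minimality of `e` identifies the two. -/
theorem conormalCycle_cases {k : Type u} [Field k] [IsAlgClosed k] [IsIntegral S] [IsIntegral W]
    (p : S ⟶ Spec (.of k)) [SmoothOfRelativeDimension 1 p]
    {s : S} (hs : IsClosed {s}) {X Y : Closeds W} (hX : IsReducedDivisor X)
    (hY : (Y : Set W) ⊆ f ⁻¹' {s}) (e : cotangentFiber f s) :
    conormalCycle f p s Y e = 0 ∨ conormalCycle f p s Y e = 1 ∧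
      ∃ c : AdaptedChart k f s X Y,
        (cotangentProj f ≫ f).fiberι s e = c.polyChart (specPoint c.generic) := by
  refine (closedSubschemeCycle_vanishingIdeal_cases _ e).imp_right fun ⟨h1, he, hmin⟩ ↦ ⟨h1, ?_⟩
  obtain ⟨z, hz, hez⟩ := exists_specializes_of_mem_closure _ he hmin
  obtain ⟨c, hc⟩ := AdaptedChart.exists_mem p f hs hX hY hz.1
  have hez' := fiberι_specializes_iff.mpr hez
  obtain ⟨Qz, hQz⟩ := c.exists_polyChart_eq hc
  obtain ⟨Qe, hQe⟩ := c.exists_polyChart_eq (ξ := (cotangentProj f ≫ f).fiberι s e)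
    ((hez'.map (cotangentProj f).continuous).mem_open c.total.1.2 hc)
  have hA := smoothPoints_subset Y (f ≫ p)
  have hQ : c.polyChart Qe ∈ closure (conormalPoints f Y (smoothPoints Y (f ≫ p))) := by
    rw [hQe]
    exact closure_mono (Set.image_preimage_subset _ _)
      (image_closure_subset_closure_image ((cotangentProj f ≫ f).fiberι s).continuous ⟨e, he, rfl⟩)
  have hgen : c.polyChart (specPoint c.generic) ∈ conormalPoints f Y (smoothPoints Y (f ≫ p)) := by
    rw [c.polyChart_mem_conormalPoints_Y_iff _ hA]
    refine ⟨?_, le_rfl⟩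
    rw [c.comap_C_generic]
    have hzY := hA hz.1
    have h3 : c.toTotal (specPoint (c.ideal Y)) ∈ Y := (c.toTotal_mem_iff _ _).mpr le_rfl
    refine mem_smoothPoints_of_specializes ?_ hz.1 h3
    obtain ⟨P, hP⟩ := c.exists_toTotal_eq hc
    rw [← hP] at hzY ⊢
    exact c.toTotal_specializes_iff.mpr ((c.toTotal_mem_iff _ _).mp hzY)
  obtain ⟨e₀, he₀⟩ := exists_fiberι_eq (hY (hA hgen.1))
  refine ⟨c, ?_⟩
  rw [← he₀, hmin e₀ (subset_closure (by rw [Set.mem_preimage, he₀]; exact hgen)) ?_]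
  rw [← fiberι_specializes_iff, he₀, ← hQe, c.polyChart_specializes_iff]
  exact c.generic_le_of_mem_closure hA Qe hQ

section Specialization

variable {k : Type u} [Field k] {s : S} {X Y : Closeds W} (c : AdaptedChart k f s X Y)
  {K : Scheme.{u}} (p : S ⟶ K)

variable (f) in
/-- The ideal of the fiber over `s` of a closed subset of the relative cotangent bundle. -/
noncomputable abbrev fiberIdeal (s : S) (Λ : Closeds (cotangentBundle f)) :
    (cotangentFiber f s).IdealSheafData :=
  (Scheme.IdealSheafData.vanishingIdeal Λ).comap ((cotangentProj f ≫ f).fiberι s)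

lemma exists_comap_subschemeι_eq {s : S} {Λ : Closeds (cotangentBundle f)} {e : cotangentFiber f s}
    (h : (cotangentProj f ≫ f).fiberι s e ∈ Λ) :
    ∃ y, (fiberIdeal f s Λ).subschemeι y = e := by
  have : e ∈ Set.range (fiberIdeal f s Λ).subschemeι := by
    rw [Scheme.IdealSheafData.range_subschemeι, Scheme.IdealSheafData.support_comap]
    simpa using h
  exact this

lemma fiberι_subschemeι_mem {s : S} {Λ : Closeds (cotangentBundle f)}
    (y : (fiberIdeal f s Λ).subscheme) : (cotangentProj f ≫ f).fiberι s
        ((fiberIdeal f s Λ).subschemeι y) ∈ Λ := by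
  have : (fiberIdeal f s Λ).subschemeι y ∈
      Set.range (fiberIdeal f s Λ).subschemeι := ⟨y, rfl⟩
  rw [Scheme.IdealSheafData.range_subschemeι, Scheme.IdealSheafData.support_comap] at this
  simpa using this

variable [CharZero k] [Flat ((Scheme.IdealSheafData.vanishingIdeal X).subschemeι ≫ f)] 
  [IsLocallyNoetherian W] [IsLocallyNoetherian S] [Smooth p]

/-- A generization of `e` inside the fiber of Λ_{X/S} stays in the chart. It is a prime below `Q`
containing the conormal ideal and t, so `hmin` makes `e` the generic point of a component. -/
theorem one_le_specialization (hs : IsClosed {s}) {e : cotangentFiber f s} {Q : Spec (.of c.Poly)}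
    (he : (cotangentProj f ≫ f).fiberι s e = c.polyChart Q) (hQ : c.conormal ≤ Q.asIdeal)
    (hmin : ∀ Q' : Ideal c.Poly, Q'.IsPrime → Q' ≤ Q.asIdeal → c.conormal ≤ Q' →
      MvPolynomial.C c.param ∈ Q' → Q' = Q.asIdeal) :
    ∃ y, (fiberIdeal f s (relConormal f p X)).subschemeι y = e ∧ 
      specialization f s (relConormal f p X) e = componentMultiplicity _ y ∧
      1 ≤ specialization f s (relConormal f p X) e := by
  obtain ⟨y, rfl⟩ := exists_comap_subschemeι_eq (Λ := relConormal f p X) (e := e) (by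
    rw [he, c.polyChart_mem_relConormal_iff]; exact hQ)
  refine ⟨y, rfl, closedSubschemeCycle_subschemeι _ y, ?_⟩
  rw [specialization, closedSubschemeCycle_subschemeι]
  have : IsLocallyNoetherian (fiberIdeal f s (relConormal f p X)).subscheme :=
    LocallyOfFiniteType.isLocallyNoetherian (fiberIdeal f s (relConormal f p X)).subschemeι
  refine one_le_componentMultiplicity fun z hz ↦ ?_
  have hz' := hz.map (Scheme.Hom.continuous (fiberIdeal f s (relConormal f p X)).subschemeι)
  rw [← fiberι_specializes_iff, he] at hz'
  obtain ⟨Qz, hQz⟩ := c.exists_polyChart_eq ((hz'.map (cotangentProj f).continuous).mem_open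
    c.total.1.2 (by rw [c.cotangentProj_polyChart]; exact c.toTotal_mem _))
  have hzΛ := fiberι_subschemeι_mem z
  have hzs : f (cotangentProj f ((cotangentProj f ≫ f).fiberι s
        ((fiberIdeal f s (relConormal f p X)).subschemeι z))) = s :=
    ((cotangentProj f ≫ f).range_fiberι s).subset ⟨_, rfl⟩
  rw [← hQz] at hz' hzΛ hzs
  rw [c.polyChart_mem_relConormal_iff] at hzΛ
  rw [← c.param_mem_polyChart_iff hs] at hzs
  have h1 : Qz = Q := PrimeSpectrum.ext
    (hmin _ Qz.2 (c.polyChart_specializes_iff.mp hz') hzΛ hzs)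
  apply (fiberIdeal f s (relConormal f p X)).subschemeι.isEmbedding.injective
  apply ((cotangentProj f ≫ f).fiberι s).isEmbedding.injective
  rw [he, ← hQz, h1]

end Specialization

end LagrangianSpecialization

namespace LagrangianSpecialization

open CategoryTheory Limits AlgebraicGeometry TopologicalSpace

/-! ### From multiplicity one to local equations. -/

lemma vanishingIdeal_le_ker_SpecMap {R R' : Type u} [CommRing R] [CommRing R'] (φ : R →+* R')
    (Z : Closeds (Spec (.of R))) (h : ∀ r, (∀ P ∈ Z, r ∈ P.asIdeal) → φ r = 0) :
    Scheme.IdealSheafData.vanishingIdeal Z ≤ (Spec.map (CommRingCat.ofHom φ)).ker := by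
  refine Scheme.IdealSheafData.le_of_isAffine fun x hx ↦ ?_
  have hx' : ∀ P ∈ (isAffineOpen_top (Spec (.of R))).fromSpec ⁻¹' Z, x ∈ P.asIdeal :=
    (PrimeSpectrum.mem_vanishingIdeal _ _).mp hx
  rw [Scheme.Hom.ker_apply, RingHom.mem_ker]
  have h1 := h ((Scheme.ΓSpecIso (.of R)).hom x) fun P hP ↦ by
    let q : Spec Γ(Spec (.of R), ⊤) := Spec.map (Scheme.ΓSpecIso (.of R)).hom P
    have hq : (isAffineOpen_top (Spec (.of R))).fromSpec q = P := by
      rw [IsAffineOpen.fromSpec_top, Scheme.isoSpec_Spec_inv]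
      change (Spec.map _ ≫ Spec.map _) P = P
      rw [← Spec.map_comp, Iso.inv_hom_id, Spec.map_id]
      rfl
    exact hx' q (by rw [Set.mem_preimage, hq]; exact hP)
  have h2 := congr($(Scheme.ΓSpecIso_naturality (CommRingCat.ofHom φ)).hom x)
  apply (Scheme.ΓSpecIso (.of R')).commRingCatIsoToRingEquiv.injective
  exact (h2.trans h1).trans (map_zero _).symm

lemma vanishingIdeal_le_ker {T : Scheme.{u}} {R R' : Type u} [CommRing R] [CommRing R'] (φ : R →+* R')
    (j : Spec (.of R) ⟶ T) (Z : Closeds T) (h : ∀ r, (∀ P, j P ∈ Z → r ∈ P.asIdeal) → φ r = 0) :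
    Scheme.IdealSheafData.vanishingIdeal Z ≤ (Spec.map (CommRingCat.ofHom φ) ≫ j).ker := by
  rw [Scheme.Hom.ker_comp]
  refine le_trans ?_ (Scheme.IdealSheafData.map_mono j
    (vanishingIdeal_le_ker_SpecMap φ (Z.preimage j.continuous) h))
  refine le_of_le_of_eq ?_ (Scheme.IdealSheafData.map_vanishingIdeal j _).symm
  refine Scheme.IdealSheafData.vanishingIdeal_antimono ?_
  exact closure_minimal (Set.image_preimage_subset _ _) Z.isClosed

lemma appLE_congr_hom {T C : Scheme.{u}} {a b : T ⟶ C} (h : a = b) (U : C.Opens) (V : T.Opens)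
    (e : V ≤ a ⁻¹ᵁ U) : a.appLE U V e = b.appLE U V (h ▸ e) := by
  subst h; rfl

section Germ

variable {R : Type u} [CommRing R] (q : PrimeSpectrum.Top R) (r : R)

lemma exists_mul_eq_zero_of_germ_eq_zero
    (h : (Spec (.of R)).presheaf.germ ⊤ q trivial ((Scheme.ΓSpecIso (.of R)).inv r) = 0) :
    ∃ m ∉ q.asIdeal, m * r = 0 := by
  have h1 : algebraMap R ((structurePresheafInCommRingCat R).stalk q) r = 0 := h
  have : q.asIdeal.IsPrime := q.2
  obtain ⟨⟨m, hm⟩, hmr⟩ := (IsLocalization.map_eq_zero_iff q.asIdeal.primeCompl _ _).mp h1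
  exact ⟨m, hm, hmr⟩

lemma notMem_of_isUnit_germ
    (h : IsUnit ((Spec (.of R)).presheaf.germ ⊤ q trivial ((Scheme.ΓSpecIso (.of R)).inv r))) :
    r ∉ q.asIdeal := by
  have h1 : IsUnit (algebraMap R ((structurePresheafInCommRingCat R).stalk q) r) := h
  have : q.asIdeal.IsPrime := q.2
  exact (IsLocalization.AtPrime.isUnit_to_map_iff _ q.asIdeal r).mp h1

end Germ

/-- Extend `g` to a section on the open image of `u`. Its germ on `T` pulls back to the class of `g`
at q', a nonunit, so the germ itself is not a unit and vanishes by `h`. Therefore `g` dies in the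
local ring of R/I at q'. -/
lemma exists_mul_mem_of_isUnit_stalk {R : Type u} [CommRing R] {I q : Ideal R}
    {T C : Scheme.{u}} (u : Spec (.of R) ⟶ C) [IsOpenImmersion u] (j : T ⟶ C)
    (φ : Spec (.of (R ⧸ I)) ⟶ T)
    (hφ : φ ≫ j = Spec.map (CommRingCat.ofHom (Ideal.Quotient.mk I)) ≫ u) (q' : Spec (.of (R ⧸ I)))
    (hq' : q = q'.asIdeal.comap (Ideal.Quotient.mk I))
    (h : ∀ a : T.presheaf.stalk (φ q'), a ≠ 0 → IsUnit a) (g : R) (hg : g ∈ q) :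
    ∃ s ∉ q, s * g ∈ I := by
  have hq'p : q'.asIdeal.IsPrime := q'.2
  let U : C.Opens := u ''ᵁ ⊤
  let σ : Γ(C, U) := (u.appIso ⊤).inv ((Scheme.ΓSpecIso (.of R)).inv g)
  have h1 : u.appLE U ⊤ (u.preimage_image_eq ⊤).ge σ = (Scheme.ΓSpecIso (.of R)).inv g := by
    have := congr($((u.appIso ⊤).inv_hom_id).hom ((Scheme.ΓSpecIso (.of R)).inv g))
    rw [u.appIso_hom' ⊤] at this
    exact this
  have hle : (⊤ : (Spec (.of (R ⧸ I))).Opens) ≤ φ ⁻¹ᵁ j ⁻¹ᵁ U := by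
    intro x _
    change (φ ≫ j) x ∈ U
    rw [hφ]
    exact ⟨Spec.map (CommRingCat.ofHom (Ideal.Quotient.mk I)) x, trivial, rfl⟩
  have h2 : φ.appLE (j ⁻¹ᵁ U) ⊤ hle (j.app U σ) =
      (Scheme.ΓSpecIso (.of (R ⧸ I))).inv (Ideal.Quotient.mk I g) := by
    have e1 : j.app U ≫ φ.appLE (j ⁻¹ᵁ U) ⊤ hle = (φ ≫ j).appLE U ⊤ hle := by
      rw [Scheme.Hom.app_eq_appLE, Scheme.Hom.appLE_comp_appLE]
    have e2 : (φ ≫ j).appLE U ⊤ hle = u.appLE U ⊤ (u.preimage_image_eq ⊤).ge ≫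
        (Spec.map (CommRingCat.ofHom (Ideal.Quotient.mk I))).appLE ⊤ ⊤ le_top := by
      exact (appLE_congr_hom hφ U ⊤ hle).trans (Scheme.Hom.appLE_comp_appLE ..).symm
    have e3 : (Spec.map (CommRingCat.ofHom (Ideal.Quotient.mk I))).appLE ⊤ ⊤ le_top =
        (Spec.map (CommRingCat.ofHom (Ideal.Quotient.mk I))).appTop := (Scheme.Hom.app_eq_appLE _).symm
    have e4 := congr($(Scheme.ΓSpecIso_inv_naturality (CommRingCat.ofHom (Ideal.Quotient.mk I))).hom g)
    refine congr($(e1.trans e2).hom σ).trans (Eq.trans ?_ e4.symm)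
    rw [e3]
    exact congrArg (Spec.map (CommRingCat.ofHom (Ideal.Quotient.mk I))).appTop.hom h1
  have hmem : φ q' ∈ j ⁻¹ᵁ U := hle (x := q') trivial
  have h3 : φ.stalkMap q' (T.presheaf.germ (j ⁻¹ᵁ U) (φ q') hmem (j.app U σ)) =
      (Spec (.of (R ⧸ I))).presheaf.germ ⊤ q' trivial
        ((Scheme.ΓSpecIso (.of (R ⧸ I))).inv (Ideal.Quotient.mk I g)) := by
    rw [Scheme.Hom.germ_stalkMap_apply]
    refine Eq.trans ?_ (congrArg ((Spec (.of (R ⧸ I))).presheaf.germ ⊤ q' trivial).hom h2)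
    exact ((Spec (.of (R ⧸ I))).presheaf.germ_res_apply (homOfLE hle) q' trivial _).symm
  have h4 : T.presheaf.germ (j ⁻¹ᵁ U) (φ q') hmem (j.app U σ) = 0 := by
    by_contra h5
    have h6 := (h _ h5).map (φ.stalkMap q').hom
    have h7 : Ideal.Quotient.mk I g ∉ q'.asIdeal :=
      notMem_of_isUnit_germ q' _ (by rw [← h3]; exact h6)
    rw [hq'] at hg
    exact h7 hg
  rw [h4, map_zero] at h3
  obtain ⟨m, hm, hmg⟩ := exists_mul_eq_zero_of_germ_eq_zero q' _ h3.symm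
  obtain ⟨s, rfl⟩ := Ideal.Quotient.mk_surjective m
  refine ⟨s, fun hs ↦ hm ?_, ?_⟩
  · rw [hq'] at hs; exact hs
  · rw [← Ideal.Quotient.eq_zero_iff_mem, map_mul]
    exact hmg

end LagrangianSpecialization

namespace LagrangianSpecialization

open CategoryTheory Limits AlgebraicGeometry TopologicalSpace

/-! ### The scheme-theoretic fiber of the conormal variety and coefficient two. -/

variable {W S : Scheme.{u}} {f : W ⟶ S} [Smooth f]

/-- A morphism into the scheme-theoretic fiber suffices for the multiplicity argument. The two ideal
conditions factor ψ through the reduced Λ and through the residue field of `s`. -/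
lemma exists_lift_fiberIdeal {s : S} (hs : IsClosed {s}) (Λ : Closeds (cotangentBundle f))
    {N : Scheme.{u}} (ψ : N ⟶ cotangentBundle f)
    (h1 : Scheme.IdealSheafData.vanishingIdeal Λ ≤ ψ.ker)
    (h2 : Scheme.IdealSheafData.vanishingIdeal ⟨{s}, hs⟩ ≤ (ψ ≫ cotangentProj f ≫ f).ker) :
    ∃ φ : N ⟶ (fiberIdeal f s Λ).subscheme,
      φ ≫ (fiberIdeal f s Λ).subschemeι ≫ (cotangentProj f ≫ f).fiberι s = ψ := by
  have hcl : IsClosedImmersion (S.fromSpecResidueField s) :=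
    isClosed_singleton_iff_isClosedImmersion.mp hs
  have h3 : (S.fromSpecResidueField s).ker ≤ (ψ ≫ cotangentProj f ≫ f).ker := by
    refine le_trans ?_ h2
    rw [← Scheme.IdealSheafData.le_support_iff_le_vanishingIdeal]
    rintro x (hx : x = s)
    rw [hx]
    exact (S.fromSpecResidueField s).range_subset_ker_support
      ((Scheme.range_fromSpecResidueField s).ge rfl)
  let α : N ⟶ cotangentFiber f s := pullback.lift ψ (IsClosedImmersion.lift _ _ h3)
    (IsClosedImmersion.lift_fac _ _ h3).symm
  have hα : α ≫ (cotangentProj f ≫ f).fiberι s = ψ := pullback.lift_fst _ _ _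
  have h4 : (Scheme.IdealSheafData.vanishingIdeal Λ).subschemeι.ker ≤ ψ.ker := by
    rwa [Scheme.IdealSheafData.ker_subschemeι]
  let β : N ⟶ (Scheme.IdealSheafData.vanishingIdeal Λ).subscheme := IsClosedImmersion.lift _ _ h4
  have hβ : β ≫ (Scheme.IdealSheafData.vanishingIdeal Λ).subschemeι = ψ :=
    IsClosedImmersion.lift_fac _ _ h4
  refine ⟨pullback.lift α β (hα.trans hβ.symm) ≫ ((Scheme.IdealSheafData.vanishingIdeal Λ).comapIso
    ((cotangentProj f ≫ f).fiberι s)).inv, ?_⟩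
  rw [Category.assoc, Scheme.IdealSheafData.comapIso_inv_subschemeι_assoc, pullback.lift_fst_assoc,
    hα]

namespace AdaptedChart

variable {k : Type u} [Field k] {s : S} {X Y : Closeds W} (c : AdaptedChart k f s X Y)

lemma polyChart_cotangentProj : c.polyChart ≫ cotangentProj f =
    Spec.map (CommRingCat.ofHom MvPolynomial.C) ≫ c.toTotal := by
  rw [polyChart, Category.assoc, cotangentChart_proj, ← Spec.map_comp_assoc]
  refine congrArg (Spec.map · ≫ c.toTotal) (CommRingCat.hom_ext (RingHom.ext fun b ↦ ?_))
  exact (symEquiv c.span_eq_top c.algebraMap_t).commutes b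

lemma toTotal_comp : c.toTotal ≫ f =
    Spec.map (CommRingCat.ofHom (algebraMap c.A c.B)) ≫ c.base.2.fromSpec :=
  (IsAffineOpen.SpecMap_appLE_fromSpec f c.base.2 c.total.2 c.le).symm

lemma vanishingIdeal_singleton_le_ker (hs : IsClosed {s}) {I : Ideal c.Poly}
    (hI : MvPolynomial.C c.param ∈ I) :
    Scheme.IdealSheafData.vanishingIdeal ⟨{s}, hs⟩ ≤
      ((Spec.map (CommRingCat.ofHom (Ideal.Quotient.mk I)) ≫ c.polyChart) ≫
        cotangentProj f ≫ f).ker := by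
  have h : (Spec.map (CommRingCat.ofHom (Ideal.Quotient.mk I)) ≫ c.polyChart) ≫
      cotangentProj f ≫ f = Spec.map (CommRingCat.ofHom ((Ideal.Quotient.mk I).comp
        ((MvPolynomial.C : c.B →+* c.Poly).comp (algebraMap c.A c.B)))) ≫ c.base.2.fromSpec := by
    rw [Category.assoc, reassoc_of% c.polyChart_cotangentProj, c.toTotal_comp]
    rw [CommRingCat.ofHom_comp, CommRingCat.ofHom_comp, Spec.map_comp, Spec.map_comp]
    rfl
  refine le_of_le_of_eq (vanishingIdeal_le_ker _ _ _ fun r hr ↦ ?_) congr(($h).ker).symm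
  have h1 := hr (c.base.2.primeIdealOf ⟨s, c.mem_base⟩)
    (c.base.2.fromSpec_primeIdealOf ⟨s, c.mem_base⟩)
  rw [c.primeIdealOf_eq] at h1
  obtain ⟨a, rfl⟩ := Ideal.mem_span_singleton'.mp h1
  refine Ideal.Quotient.eq_zero_iff_mem.mpr ?_
  change MvPolynomial.C (algebraMap c.A c.B (a * c.t)) ∈ I
  rw [map_mul, map_mul, c.algebraMap_t]
  exact I.mul_mem_left _ hI

variable {K : Scheme.{u}} (p : S ⟶ K) [CharZero k]
  [Flat ((Scheme.IdealSheafData.vanishingIdeal X).subschemeι ≫ f)]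
  [IsLocallyNoetherian W] [IsLocallyNoetherian S] [Smooth p]

lemma vanishingIdeal_relConormal_le_ker {I : Ideal c.Poly} (hI : c.conormal ≤ I) :
    Scheme.IdealSheafData.vanishingIdeal (relConormal f p X) ≤
      (Spec.map (CommRingCat.ofHom (Ideal.Quotient.mk I)) ≫ c.polyChart).ker := by
  refine vanishingIdeal_le_ker _ _ _ fun r hr ↦ Ideal.Quotient.eq_zero_iff_mem.mpr (hI ?_)
  refine isRadical_conormalIdeal c.grad c.isRadical_span ?_
  rw [Ideal.radical_eq_sInf, Submodule.mem_sInf]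
  rintro Q ⟨hQ, hQp⟩
  exact hr (specPoint Q) ((c.polyChart_mem_relConormal_iff p _).mpr hQ)

end AdaptedChart

section Specialization

variable {k : Type u} [Field k] {s : S} {X Y : Closeds W} (c : AdaptedChart k f s X Y)
  {K : Scheme.{u}} (p : S ⟶ K) [CharZero k]
  [Flat ((Scheme.IdealSheafData.vanishingIdeal X).subschemeι ≫ f)]
  [IsLocallyNoetherian W] [IsLocallyNoetherian S] [Smooth p]

/-- If the coefficient were 1, the local ring of the fiber at `e` would be a field. Pulling back to
the spectrum of the polynomial ring modulo the conormal ideal and t, every `g ∈ Q` would locally lie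
in that ideal, against `h`. -/
theorem two_le_specialization (hs : IsClosed {s}) {e : cotangentFiber f s} {Q : Spec (.of c.Poly)}
    (he : (cotangentProj f ≫ f).fiberι s e = c.polyChart Q) (hQ : c.conormal ≤ Q.asIdeal)
    (hmin : ∀ Q' : Ideal c.Poly, Q'.IsPrime → Q' ≤ Q.asIdeal → c.conormal ≤ Q' →
      MvPolynomial.C c.param ∈ Q' → Q' = Q.asIdeal)
    (h : ¬ ∀ g ∈ Q.asIdeal, ∃ m ∉ Q.asIdeal,
      m * g ∈ c.conormal ⊔ Ideal.span {MvPolynomial.C c.param}) :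
    2 ≤ specialization f s (relConormal f p X) e := by
  obtain ⟨y, rfl, hy, h1⟩ := one_le_specialization c p hs he hQ hmin
  by_contra h2
  rw [hy] at h1 h2
  have hunit := isUnit_of_componentMultiplicity_eq_one (by omega :
    componentMultiplicity (fiberIdeal f s (relConormal f p X)).subscheme y = 1)
  have hparam : MvPolynomial.C c.param ∈ Q.asIdeal := by
    rw [c.param_mem_polyChart_iff hs, ← he]
    exact ((cotangentProj f ≫ f).range_fiberι s).subset ⟨_, rfl⟩
  have hIQ : c.conormal ⊔ Ideal.span {MvPolynomial.C c.param} ≤ Q.asIdeal :=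
    sup_le hQ ((Ideal.span_singleton_le_iff_mem _).mpr hparam)
  obtain ⟨φ, hφ⟩ := exists_lift_fiberIdeal hs (relConormal f p X) _
    (c.vanishingIdeal_relConormal_le_ker p le_sup_left)
    (c.vanishingIdeal_singleton_le_ker hs (Ideal.mem_sup_right (Ideal.mem_span_singleton_self _)))
  have hQp : Q.asIdeal.IsPrime := Q.2
  obtain ⟨q', hq'⟩ : ∃ q' : Spec (.of (c.Poly ⧸ (c.conormal ⊔ Ideal.span {MvPolynomial.C c.param}))),
      Spec.map (CommRingCat.ofHom (Ideal.Quotient.mk _)) q' = Q := by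
    have hp := Ideal.map_isPrime_of_surjective (I := Q.asIdeal)
      (Ideal.Quotient.mk_surjective (I := c.conormal ⊔ Ideal.span {MvPolynomial.C c.param}))
      (by rwa [Ideal.mk_ker])
    refine ⟨specPoint (Q.asIdeal.map (Ideal.Quotient.mk _)), PrimeSpectrum.ext ?_⟩
    exact (Ideal.comap_map_mk hIQ :)
  have hy' : φ q' = y := by
    apply (fiberIdeal f s (relConormal f p X)).subschemeι.isEmbedding.injective
    apply ((cotangentProj f ≫ f).fiberι s).isEmbedding.injective
    rw [he, ← hq']
    exact congr($hφ q')
  subst hy'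
  exact h fun g hg ↦ exists_mul_mem_of_isUnit_stalk c.polyChart _ φ hφ q'
    congr(($hq').asIdeal).symm hunit g hg

end Specialization

end LagrangianSpecialization

namespace LagrangianSpecialization

open CategoryTheory Limits AlgebraicGeometry TopologicalSpace

/-! ### The local hypotheses for Z and for the special fiber. -/

lemma map_ker_killHom_of_isEmpty {k : Type u} [Field k] {ι σ : Type} [IsEmpty ι] {B : Type u}
    [CommRing B] [Algebra (MvPolynomial (Option (ι ⊕ σ)) k) B] :
    (RingHom.ker (killHom k ι σ)).map (algebraMap _ B) ≤
      Ideal.span {coord k B (none : Option (ι ⊕ σ))} := by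
  let J : Ideal (MvPolynomial (Option (ι ⊕ σ)) k) := Ideal.span {MvPolynomial.X none}
  have h1 : (Ideal.Quotient.mkₐ k J).comp
      ((MvPolynomial.rename fun j ↦ some (Sum.inr j)).comp (killHom k ι σ)) =
      Ideal.Quotient.mkₐ k J := by
    refine MvPolynomial.algHom_ext fun i ↦ ?_
    match i with
    | none =>
      have : Ideal.Quotient.mk J (MvPolynomial.X none) = 0 :=
        Ideal.Quotient.eq_zero_iff_mem.mpr (Ideal.mem_span_singleton_self _)
      simp [killHom, this]
    | some (Sum.inl i) => exact isEmptyElim i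
    | some (Sum.inr j) => simp [killHom]
  rw [Ideal.map_le_iff_le_comap]
  intro P hP
  have h2 : P ∈ J := by
    rw [← Ideal.Quotient.eq_zero_iff_mem]
    have := congr($h1 P)
    rw [AlgHom.comp_apply, AlgHom.comp_apply, (RingHom.mem_ker).mp hP, map_zero, map_zero] at this
    exact this.symm
  obtain ⟨R, rfl⟩ := Ideal.mem_span_singleton'.mp h2
  rw [Ideal.mem_comap, map_mul]
  exact Ideal.mul_mem_left _ _ (Ideal.mem_span_singleton_self _)

lemma eq_bot_of_lt_of_le_span_singleton {B : Type*} [CommRing B] [IsDomain B] [IsNoetherianRing B]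
    {p : Ideal B} [hp : p.IsPrime] {t : B} (hpt : p ≤ Ideal.span {t}) (ht : t ∈ p) {x : Ideal B}
    [x.IsPrime] (hx : x < p) : x = ⊥ := by
  have h1 : p = Ideal.span {t} := le_antisymm hpt ((Ideal.span_singleton_le_iff_mem _).mpr ht)
  have h2 : p.height ≤ 1 := Ideal.height_le_one_of_isPrincipal_of_mem_minimalPrimes (Ideal.span {t}) p
    ⟨⟨hp, h1.ge⟩, fun Q hQ _ ↦ h1.le.trans hQ.2⟩
  have h3 := (Ideal.height_add_one_le_of_lt_of_isPrime hx).trans h2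
  rw [← Ideal.height_eq_zero_iff_eq_bot]
  by_contra h4
  have h5 : (1 : ℕ∞) ≤ x.height := Order.one_le_iff_ne_zero.mpr h4
  have h6 : ((1 + 1 : ℕ) : ℕ∞) ≤ ((1 : ℕ) : ℕ∞) := by
    push_cast
    exact (add_le_add_left h5 1).trans h3
  have := Nat.cast_le.mp h6
  omega

variable {W S : Scheme.{u}} {f : W ⟶ S} [Smooth f]

namespace AdaptedChart

variable {k : Type u} [Field k] {s : S} {X Y : Closeds W} (c : AdaptedChart k f s X Y)

lemma toTotal_mem_X_iff (P : Spec (.of c.B)) : c.toTotal P ∈ X ↔ c.F ∈ P.asIdeal := by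
  rw [c.toTotal_mem_iff, c.ideal_eq_span, Ideal.span_singleton_le_iff_mem]

lemma toTotal_specPoint_mem : c.toTotal (specPoint (c.ideal Y)) ∈ Y :=
  (c.toTotal_mem_iff _ _).mpr le_rfl

lemma F_mem (h : Y ≤ X) : c.F ∈ c.ideal Y :=
  (c.toTotal_mem_X_iff _).mp (h c.toTotal_specPoint_mem)

lemma param_mem (hs : IsClosed {s}) (h : (Y : Set W) ⊆ f ⁻¹' {s}) : c.param ∈ c.ideal Y :=
  (c.param_mem_iff hs (specPoint (c.ideal Y))).mpr (h c.toTotal_specPoint_mem)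

variable [Flat ((Scheme.IdealSheafData.vanishingIdeal X).subschemeι ≫ f)]

/-- Without z-coordinates the ideal of Y would be generated by t. It strictly contains a component
of F = 0, because t lies in no such component by flatness; that component would be the zero ideal
and F would vanish. -/
lemma codim_nonempty (hs : IsClosed {s}) (h : (Y : Set W) ⊆ f ⁻¹' {s}) (hYX : Y ≤ X) :
    Nonempty (Fin c.codim) := by
  have := c.isNoetherianRing
  by_contra hι
  rw [not_nonempty_iff] at hι
  obtain ⟨x, hx, hxp⟩ := Ideal.exists_minimalPrimes_le
    ((Ideal.span_singleton_le_iff_mem (c.ideal Y)).mpr (c.F_mem hYX))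
  have : x.IsPrime := hx.1.1
  have hlt : x < c.ideal Y :=
    lt_of_le_of_ne hxp fun h1 ↦ c.param_notMem x hx (h1 ▸ c.param_mem hs h)
  have h0 := eq_bot_of_lt_of_le_span_singleton
    (c.ideal_eq_map.le.trans map_ker_killHom_of_isEmpty) (c.param_mem hs h) hlt
  exact c.F_ne_zero (by simpa [h0] using hx.1.2 (Ideal.mem_span_singleton_self c.F))

variable [CharZero k]

lemma conormal_le_generic (hs : IsClosed {s}) (h : (Y : Set W) ⊆ f ⁻¹' {s}) (hYX : Y ≤ X)
    (hD : (∀ i, c.grad (Sum.inl i) ∈ c.ideal Y) ∨ Subsingleton (Fin c.codim))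
    (hsm : ∀ x : Ideal c.B, x.IsPrime → c.F ∈ x → x < c.ideal Y → ∃ i, c.grad i ∉ x) :
    c.conormal ≤ c.generic :=
  have := c.codim_nonempty hs h hYX
  conormalIdeal_le_genericConormal _ c.ideal_eq_map c.F (c.F_mem hYX) hD hsm

lemma eq_generic (hsm : ∀ x : Ideal c.B, x.IsPrime → c.F ∈ x → x < c.ideal Y → ∃ i, c.grad i ∉ x)
    (Q : Ideal c.Poly) (hQ : Q.IsPrime) (hQg : Q ≤ c.generic) (hLQ : c.conormal ≤ Q)
    (htQ : MvPolynomial.C c.param ∈ Q) : Q = c.generic :=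
  eq_genericConormal _ c.ideal_eq_map c.F c.F_ne_zero hsm c.isRadical_span c.param_notMem Q hQg hLQ
    htQ

lemma not_forall_generic (hs : IsClosed {s}) (h : (Y : Set W) ⊆ f ⁻¹' {s}) (hYX : Y ≤ X)
    (hD : ∀ i, c.grad i ∈ c.ideal Y)
    (hmin : c.ideal Y ∈ (Ideal.span {c.F, c.param}).minimalPrimes)
    (hsm : ∀ x : Ideal c.B, x.IsPrime → c.F ∈ x → x < c.ideal Y → ∃ i, c.grad i ∉ x) :
    ¬ ∀ g ∈ c.generic, ∃ m ∉ c.generic,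
      m * g ∈ c.conormal ⊔ Ideal.span {MvPolynomial.C c.param} :=
  have := c.codim_nonempty hs h hYX
  not_forall_exists_mul_mem _ c.ideal_eq_map c.F c.F_ne_zero hD hmin hsm c.isRadical_span
    c.param_notMem

end AdaptedChart

section SpecialFiber

variable {k : Type u} [Field k] {s : S} {X : Closeds W} {hs : IsClosed {s}}
  (c : AdaptedChart k f s X (closedFiber f X hs))

lemma closedFiber_le : closedFiber f X hs ≤ X := inf_le_left

lemma closedFiber_subset : (closedFiber f X hs : Set W) ⊆ f ⁻¹' {s} := Set.inter_subset_right

lemma AdaptedChart.ideal_closedFiber_mem_minimalPrimes :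
    c.ideal (closedFiber f X hs) ∈ (Ideal.span {c.F, c.param}).minimalPrimes := by
  refine ⟨⟨inferInstance, ?_⟩, fun Q hQ _ ↦ ?_⟩
  · rw [Ideal.span_le]
    rintro _ (rfl | rfl)
    · exact c.F_mem closedFiber_le
    · exact c.param_mem hs closedFiber_subset
  · have := hQ.1
    refine (c.toTotal_mem_iff _ (specPoint Q)).mp ⟨?_, ?_⟩
    · exact (c.toTotal_mem_X_iff _).mpr (hQ.2 (Ideal.subset_span (by simp)))
    · exact (c.param_mem_iff hs _).mp (hQ.2 (Ideal.subset_span (by simp)))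

lemma AdaptedChart.subsingleton_codim : Subsingleton (Fin c.codim) :=
  have := c.isNoetherianRing
  subsingleton_of_mem_minimalPrimes _ c.ideal_eq_map _ _ c.ideal_closedFiber_mem_minimalPrimes

/-- The ideal of X_s is minimal over F and t, hence of height at most 2. A smaller prime containing
F is therefore minimal over F, and X is generically smooth over S there. -/
lemma AdaptedChart.exists_grad_notMem_of_lt_closedFiber [CharZero k]
    [Flat ((Scheme.IdealSheafData.vanishingIdeal X).subschemeι ≫ f)]
    (x : Ideal c.B) (hx : x.IsPrime) (hF : c.F ∈ x) (hlt : x < c.ideal (closedFiber f X hs)) :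
    ∃ i, c.grad i ∉ x := by
  have := c.isNoetherianRing
  obtain ⟨Q, hQ, hQx⟩ := Ideal.exists_minimalPrimes_le
    ((Ideal.span_singleton_le_iff_mem x).mpr hF)
  have : Q.IsPrime := hQ.1.1
  have hQ0 : Q ≠ ⊥ := fun h0 ↦
    c.F_ne_zero (by simpa [h0] using hQ.1.2 (Ideal.mem_span_singleton_self c.F))
  have h1 := (eq_or_eq_of_mem_minimalPrimes _ _ _ c.ideal_closedFiber_mem_minimalPrimes Q hQ0 x hx
    hQx hlt.le).resolve_right hlt.ne
  exact c.exists_grad_notMem x (h1 ▸ hQ)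

end SpecialFiber

section Singular

variable {k : Type u} [Field k] {s : S} {X Z : Closeds W} {K : Scheme.{u}} (p : S ⟶ K)
  [IsLocallyNoetherian W] [IsLocallyNoetherian S] [Smooth p] (c : AdaptedChart k f s X Z)

lemma mem_relSingularLocus_of_specializes {x x' : W} (h : x ⤳ x') (hx : x ∈ relSingularLocus p f X) :
    x' ∈ relSingularLocus p f X := by
  rw [relSingularLocus, relSmoothLocus_eq] at hx ⊢
  exact ⟨h.mem_closed X.isClosed hx.1, fun h' ↦ hx.2 (mem_smoothPoints_of_specializes h h' hx.1)⟩

lemma AdaptedChart.toTotal_mem_relSingularLocus_iff (P : Spec (.of c.B)) :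
    c.toTotal P ∈ relSingularLocus p f X ↔ c.F ∈ P.asIdeal ∧ ∀ i, c.grad i ∈ P.asIdeal := by
  rw [relSingularLocus, relSmoothLocus_eq, Set.mem_sdiff, SetLike.mem_coe, c.toTotal_mem_X_iff,
    c.toTotal_mem_smoothPoints_iff]
  push Not
  exact and_congr_right fun h ↦ ⟨fun h' ↦ h' h, fun h' _ ↦ h'⟩

lemma AdaptedChart.subset_closure_specPoint (hZ : IsIrreducible (Z : Set W)) :
    (Z : Set W) ⊆ closure {c.toTotal (specPoint (c.ideal Z))} := by
  refine (subset_closure_inter_of_isPreirreducible_of_isOpen hZ.2 c.total.1.2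
    ⟨_, c.toTotal_specPoint_mem, c.toTotal_mem _⟩).trans (closure_minimal ?_ isClosed_closure)
  rintro z ⟨hzZ, hz⟩
  obtain ⟨P, rfl⟩ := c.exists_toTotal_eq hz
  rw [← specializes_iff_mem_closure, c.toTotal_specializes_iff]
  exact (c.toTotal_mem_iff _ _).mp hzZ

lemma le_of_maximal_relSingularLocus
    (hZ : Maximal (fun B : Closeds W ↦ IsIrreducible (B : Set W) ∧
      (B : Set W) ⊆ relSingularLocus p f X) Z) : Z ≤ X := fun _ hz ↦ (hZ.1.2 hz).1

lemma AdaptedChart.grad_mem_of_maximal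
    (hZ : Maximal (fun B : Closeds W ↦ IsIrreducible (B : Set W) ∧
      (B : Set W) ⊆ relSingularLocus p f X) Z) (i) : c.grad i ∈ c.ideal Z :=
  ((c.toTotal_mem_relSingularLocus_iff p _).mp (hZ.1.2 c.toTotal_specPoint_mem)).2 i

/-- If the gradient vanished at `x`, the closure of that point would be an irreducible closed subset
of Sing(X/S) strictly larger than Z. -/
lemma AdaptedChart.exists_grad_notMem_of_maximal
    (hZ : Maximal (fun B : Closeds W ↦ IsIrreducible (B : Set W) ∧
      (B : Set W) ⊆ relSingularLocus p f X) Z)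
    (x : Ideal c.B) (hx : x.IsPrime) (hF : c.F ∈ x) (hlt : x < c.ideal Z) :
    ∃ i, c.grad i ∉ x := by
  by_contra! h
  have h1 := (c.toTotal_mem_relSingularLocus_iff p (specPoint x)).mpr ⟨hF, h⟩
  have h2 : c.toTotal (specPoint x) ⤳ c.toTotal (specPoint (c.ideal Z)) :=
    c.toTotal_specializes_iff.mpr hlt.le
  have h3 := hZ.2 (y := Closeds.closure {c.toTotal (specPoint x)})
    ⟨isIrreducible_singleton.closure, fun z hz ↦ mem_relSingularLocus_of_specializes p
      (specializes_iff_mem_closure.mpr hz) h1⟩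
    ((c.subset_closure_specPoint hZ.1.1).trans (closure_minimal
      (Set.singleton_subset_iff.mpr h2.mem_closure) isClosed_closure))
  exact hlt.not_ge ((c.toTotal_mem_iff Z (specPoint x)).mp (h3 (subset_closure rfl)))

end Singular

end LagrangianSpecialization

namespace LagrangianSpecialization

open CategoryTheory Limits AlgebraicGeometry TopologicalSpace

/-! ### Comparison of the cycles. -/

variable {W S : Scheme.{u}} {f : W ⟶ S} [Smooth f] {k : Type u} [Field k]
  {s : S} {X Z : Closeds W} {K : Scheme.{u}} (p : S ⟶ K)
  [IsLocallyNoetherian W] [IsLocallyNoetherian S] [Smooth p] [CharZero k]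
  [Flat ((Scheme.IdealSheafData.vanishingIdeal X).subschemeι ≫ f)] {hs : IsClosed {s}}
  {e : cotangentFiber f s}

theorem one_le_specialization_of_closedFiber (d : AdaptedChart k f s X (closedFiber f X hs))
    (hd : (cotangentProj f ≫ f).fiberι s e = d.polyChart (specPoint d.generic)) :
    1 ≤ specialization f s (relConormal f p X) e := by
  obtain ⟨y, hy⟩ := one_le_specialization d p hs hd
    (d.conormal_le_generic hs closedFiber_subset closedFiber_le (.inr d.subsingleton_codim)
      d.exists_grad_notMem_of_lt_closedFiber)
    (d.eq_generic d.exists_grad_notMem_of_lt_closedFiber)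
  exact hy.2.2

theorem one_le_specialization_of_maximal (hZ : Maximal (fun B : Closeds W ↦
      IsIrreducible (B : Set W) ∧ (B : Set W) ⊆ relSingularLocus p f X) Z)
    (hs : IsClosed {s}) (hZs : (Z : Set W) ⊆ f ⁻¹' {s}) (c : AdaptedChart k f s X Z)
    (hc : (cotangentProj f ≫ f).fiberι s e = c.polyChart (specPoint c.generic)) :
    1 ≤ specialization f s (relConormal f p X) e := by
  obtain ⟨y, hy⟩ := one_le_specialization c p hs hc
    (c.conormal_le_generic hs hZs (le_of_maximal_relSingularLocus p hZ)
      (.inl fun _ ↦ c.grad_mem_of_maximal p hZ _) (c.exists_grad_notMem_of_maximal p hZ))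
    (c.eq_generic (c.exists_grad_notMem_of_maximal p hZ))
  exact hy.2.2

/-- Since the two generic points agree, Y is a component of X_s near that point. A smaller prime
containing F and t gives a point of X_s, which is compared with the generic point of X_s in the
chart `d`. -/
lemma AdaptedChart.mem_minimalPrimes_of_specPoint_eq {Y : Closeds W} (c : AdaptedChart k f s X Y)
    (d : AdaptedChart k f s X (closedFiber f X hs)) (hYX : Y ≤ X) (hYs : (Y : Set W) ⊆ f ⁻¹' {s})
    (h : c.toTotal (specPoint (c.ideal Y)) = d.toTotal (specPoint (d.ideal (closedFiber f X hs)))) :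
    c.ideal Y ∈ (Ideal.span {c.F, c.param}).minimalPrimes := by
  refine ⟨⟨inferInstance, ?_⟩, fun Q hQ hle ↦ ?_⟩
  · rw [Ideal.span_le]
    rintro _ (rfl | rfl)
    · exact c.F_mem hYX
    · exact c.param_mem hs hYs
  · have := hQ.1
    have h1 : c.toTotal (specPoint Q) ⤳ c.toTotal (specPoint (c.ideal Y)) :=
      c.toTotal_specializes_iff.mpr hle
    have h2 : c.toTotal (specPoint Q) ∈ closedFiber f X hs :=
      ⟨(c.toTotal_mem_X_iff _).mpr (hQ.2 (Ideal.subset_span (by simp))),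
        (c.param_mem_iff hs _).mp (hQ.2 (Ideal.subset_span (by simp)))⟩
    obtain ⟨P, hP⟩ := d.exists_toTotal_eq (x := c.toTotal (specPoint Q))
      (h1.mem_open d.total.1.2 (h ▸ d.toTotal_mem _))
    refine c.toTotal_specializes_iff (P := specPoint (c.ideal Y)) (Q := specPoint Q) |>.mp ?_
    rw [h, ← hP, d.toTotal_specializes_iff]
    exact (d.toTotal_mem_iff _ _).mp (hP ▸ h2)

theorem two_le_specialization_of_maximal (hZ : Maximal (fun B : Closeds W ↦
      IsIrreducible (B : Set W) ∧ (B : Set W) ⊆ relSingularLocus p f X) Z)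
    (hZs : (Z : Set W) ⊆ f ⁻¹' {s}) (c : AdaptedChart k f s X Z)
    (hc : (cotangentProj f ≫ f).fiberι s e = c.polyChart (specPoint c.generic))
    (d : AdaptedChart k f s X (closedFiber f X hs))
    (hd : (cotangentProj f ≫ f).fiberι s e = d.polyChart (specPoint d.generic)) :
    2 ≤ specialization f s (relConormal f p X) e := by
  have hZX := le_of_maximal_relSingularLocus p hZ
  have hsm := c.exists_grad_notMem_of_maximal p hZ
  have h := congr(cotangentProj f $(hc.symm.trans hd))
  rw [c.cotangentProj_polyChart, d.cotangentProj_polyChart, c.comap_C_generic,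
    d.comap_C_generic] at h
  exact two_le_specialization c p hs hc
    (c.conormal_le_generic hs hZs hZX (.inl fun _ ↦ c.grad_mem_of_maximal p hZ _) hsm)
    (c.eq_generic hsm)
    (c.not_forall_generic hs hZs hZX (c.grad_mem_of_maximal p hZ)
      (c.mem_minimalPrimes_of_specPoint_eq d hZX hZs h) hsm)

theorem conormalCycle_le [IsAlgClosed k] [IsIntegral S] [IsIntegral W]
    (p : S ⟶ Spec (.of k)) [SmoothOfRelativeDimension 1 p] (hX : IsReducedDivisor X)
    (hs : IsClosed {s}) (hZ : Maximal (fun B : Closeds W ↦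
      IsIrreducible (B : Set W) ∧ (B : Set W) ⊆ relSingularLocus p f X) Z)
    (hZs : (Z : Set W) ⊆ f ⁻¹' {s}) :
    conormalCycle f p s Z ≤ specialization f s (relConormal f p X) -
      conormalCycle f p s (closedFiber f X hs) := by
  have := SmoothOfRelativeDimension.smooth 1 p
  rw [Function.locallyFinsuppWithin.le_def]
  intro e
  change conormalCycle f p s Z e ≤ specialization f s (relConormal f p X) e -
    conormalCycle f p s (closedFiber f X hs) e
  -- The cycles of Z and of X_s each contribute 0 or 1, and the four combinations require the
  -- coefficient of the specialization to be at least their sum.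
  rcases conormalCycle_cases p hs hX hZs e with h1 | ⟨h1, c, hc⟩ <;>
  rcases conormalCycle_cases p hs hX (closedFiber_subset (hs := hs)) e with h2 | ⟨h2, d, hd⟩ <;>
  rw [h1, h2]
  · rw [sub_zero]
    exact closedSubschemeCycle_nonneg _ e
  · have := one_le_specialization_of_closedFiber p d hd
    omega
  · have := one_le_specialization_of_maximal p hZ hs hZs c hc
    omega
  · have := two_le_specialization_of_maximal p hZ hZs c hc d hd
    omega

end LagrangianSpecialization

end

theorem mainTheorem11 {k : Type u} [Field k] [IsAlgClosed k] [CharZero k]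
    {S W : Scheme.{u}}
    (p : S ⟶ Spec (CommRingCat.of k))
    [IsIntegral S] [IsSeparated p]
    [QuasiCompact p] [SmoothOfRelativeDimension 1 p]
    (f : W ⟶ S) [IsIntegral W] [IsSeparated (f ≫ p)]
    [QuasiCompact (f ≫ p)] [Smooth f]
    [IsDominant f]
    (X : Closeds W)
    (hX : IsReducedDivisor X)
    (hflat : Flat
      ((Scheme.IdealSheafData.vanishingIdeal X).subschemeι ≫ f))
    (s : S) (hs : IsClosed {s}) (Z : Closeds W)
    (hZ : Maximal (fun B : Closeds W ↦ IsIrreducible (B : Set W) ∧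
      (B : Set W) ⊆ relSingularLocus p f X) Z)
    (hZs : (Z : Set W) ⊆ f ⁻¹' {s}) :
    conormalCycle f p s Z ≤
      specialization f s (relConormal f p X) -
        conormalCycle f p s
          (closedFiber f X hs) := by
  have := SmoothOfRelativeDimension.smooth 1 p
  have : IsLocallyNoetherian S := LocallyOfFiniteType.isLocallyNoetherian p
  have : IsLocallyNoetherian W := LocallyOfFiniteType.isLocallyNoetherian (f ≫ p)
  exact conormalCycle_le p hX hs hZ hZs
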